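/- Let $V$ be a finite-dimensional $\mathbb{Q}$-vector space with a finite increasing filtration $W_\bullet$, non-degenerate $(-1)^k$-symmetric bilinear forms $Q_k$ on $\mathrm{Gr}^W_kV$ ($k\in\mathbb{Z}$) and a partition $\{h^{p,q}\}$ of $\dim V$ into non-negative integers. Let $\mathcal{M}$ be the classifying space of the $\mathbb{Q}$-mixed Hodge structures $(V,W_\bullet,F^\bullet)$ with Hodge numbers $h^{p,q}$ that are graded-polarized by the $Q_k$; it carries the complex structure induced from the Grassmannians (flag variety) containing the Hodge filtrations $F^\bullet$. A point $h\in\mathcal{M}$, with Deligne bigrading $V_{\mathbb{C}}=\bigoplus I^{p,q}$, is identified with the homomorphism $h\colon\mathbb{S}_{\mathbb{C}}\to\mathrm{GL}(V_{\mathbb{C}})$, where $\mathbb S=\mathrm{Res}_{\mathbb C/\mathbb R}\mathbb G_m$ is the Deligne torus and $h(z,w)$ acts on $I^{p,q}$ by $z^{-p}w^{-q}$. Its Mumford--Tate group $\mathrm{MT}(h)$ is the smallest algebraic $\mathbb{Q}$-subgroup of $\mathrm{GL}(V)$ whose complexification contains $h(\mathbb{S}_{\mathbb{C}})$. A subset $\mathcal{D}\subseteq\mathcal{M}$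 is a weak Mumford--Tate domain if there are $h\in\mathcal{D}$ and a normal algebraic $\mathbb{Q}$-subgroup $N$ of $P=\mathrm{MT}(h)$ with $\mathcal{D}=N(\mathbb{R})^+\mathcal{R}_u(N)(\mathbb{C})\,h$, where $N(\mathbb R)^+$ is the identity component of $N(\mathbb R)$ and $\mathcal{R}_u(N)$ is the unipotent radical; it is a Mumford--Tate domain if one can take $N=P$. Proposition. Every weak Mumford--Tate domain $\mathcal{D}$ in $\mathcal{M}$ is a complex analytic subspace of $\mathcal{M}$; more precisely, it is a closed (embedded) complex submanifold of $\mathcal{M}$. For all $h$ and $N$ as in the definition, the infinitesimal action of $\mathfrak{gl}(V_{\mathbb{C}})$ on filtrations at $h$ identifies $$\bigoplus_{r<0,\,s}(\operatorname{Lie}N_{\mathbb{C}})^{r,s}\;\cong\;T_h\mathcal{D},$$ where $(\operatorname{Lie}N_{\mathbb{C}})^{r,s}$ is the $(r,s)$-part of $\operatorname{Lie}N_{\mathbb{C}}$ for the adjoint Hodge structure $\mathrm{Ad}\circ h$. In particular, if $\mathcal{D}=P(\mathbb R)^+\mathcal R_u(P)(\mathbb C)h$ is the Mumford--Tate domain of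 $h$, with $P=\mathrm{MT}(h)$, then $T_h\mathcal{D}=\bigoplus_{r<0}(\operatorname{Lie}P_{\mathbb{C}})^{r,s}$. -/

import Mathlib

open scoped TensorProduct Manifold ContDiff

noncomputable section

namespace MHS

/-! ### Products of Grassmannians as complex manifolds -/

section Grassmannian

variable {ι : Type}

/-- The product over `i` of the Grassmannians of `k i`-dimensional subspaces of `W`. -/
def GrProd (W : Type*) [AddCommGroup W] [Module ℂ W] (k : ι → ℕ) : Type _ :=
  ∀ i, {L : Submodule ℂ W // Module.finrank ℂ L = k i}

/-- The local model `∏ Hom(ℂ^(k i), ℂ^(n - k i))` of the product of Grassmannians, `n = dim W`. -/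
abbrev GrModel (W : Type*) [AddCommGroup W] [Module ℂ W] (k : ι → ℕ) : Type :=
  ∀ i, (Fin (k i) → ℂ) →L[ℂ] (Fin (Module.finrank ℂ W - k i) → ℂ)

variable {W : Type*} [AddCommGroup W] [Module ℂ W] {k : ι → ℕ}

/-- A system of linear coordinates `W ≃ ℂ^(k i) × ℂ^(n - k i)`, one for each factor. -/
abbrev GrFrame (W : Type*) [AddCommGroup W] [Module ℂ W] (k : ι → ℕ) : Type _ :=
  ∀ i, W ≃ₗ[ℂ] (Fin (k i) → ℂ) × (Fin (Module.finrank ℂ W - k i) → ℂ)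

/-- The parametrization of an affine piece of the product of Grassmannians by graphs of linear
maps, in the linear coordinates `e`. -/
def graphParam (e : GrFrame W k) (T : GrModel W k) : GrProd W k := fun i =>
  ⟨((T i : (Fin (k i) → ℂ) →ₗ[ℂ] _).graph).map
      ((e i).symm : (Fin (k i) → ℂ) × (Fin (Module.finrank ℂ W - k i) → ℂ) →ₗ[ℂ] W), by
    rw [LinearEquiv.finrank_map_eq (e i).symm, LinearMap.graph_eq_range_prod,
      LinearMap.finrank_range_of_inj]
    · simp
    · intro x y hxy
      simpa using congrArg Prod.fst hxy⟩

theorem graph_le_graph_eq {A B : Type*} [AddCommGroup A] [Module ℂ A] [AddCommGroup B]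
    [Module ℂ B] {S T : A →ₗ[ℂ] B} (h : S.graph ≤ T.graph) : S = T := by
  ext x
  have : (x, S x) ∈ T.graph := h (by simp [LinearMap.mem_graph_iff])
  simpa [LinearMap.mem_graph_iff] using this

theorem graphParam_injective (e : GrFrame W k) : Function.Injective (graphParam e) := by
  intro S T h
  funext i
  have hi := congrArg Subtype.val (congrFun h i)
  have h2 := Submodule.map_injective_of_injective (f := ((e i).symm.toLinearMap))
    (e i).symm.injective hi
  exact ContinuousLinearMap.coe_injective (graph_le_graph_eq h2.le)

/-- The chart attached to the linear coordinates `e`: the inverse of `graphParam e`. -/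
def graphChart (e : GrFrame W k) : PartialEquiv (GrProd W k) (GrModel W k) where
  toFun := Function.invFun (graphParam e)
  invFun := graphParam e
  source := Set.range (graphParam e)
  target := Set.univ
  map_source' := fun _ _ => Set.mem_univ _
  map_target' := fun T _ => ⟨T, rfl⟩
  left_inv' := by
    rintro _ ⟨T, rfl⟩
    rw [Function.leftInverse_invFun (graphParam_injective e)]
  right_inv' := fun T _ => Function.leftInverse_invFun (graphParam_injective e) T

/-- The first component of the change of linear coordinates, restricted to the graph of `T i`. -/
def transA (e e' : GrFrame W k) (i : ι) (T : GrModel W k) :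
    (Fin (k i) → ℂ) →L[ℂ] (Fin (k i) → ℂ) :=
  ((ContinuousLinearMap.fst ℂ _ _).comp
    (LinearMap.toContinuousLinearMap ((e i).symm.trans (e' i)).toLinearMap)).comp
      (ContinuousLinearMap.inl ℂ _ _ + (ContinuousLinearMap.inr ℂ _ _).comp (T i))

/-- The second component of the change of linear coordinates, restricted to the graph of `T i`. -/
def transB (e e' : GrFrame W k) (i : ι) (T : GrModel W k) :
    (Fin (k i) → ℂ) →L[ℂ] (Fin (Module.finrank ℂ W - k i) → ℂ) :=
  ((ContinuousLinearMap.snd ℂ _ _).comp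
    (LinearMap.toContinuousLinearMap ((e i).symm.trans (e' i)).toLinearMap)).comp
      (ContinuousLinearMap.inl ℂ _ _ + (ContinuousLinearMap.inr ℂ _ _).comp (T i))

theorem trans_apply (e e' : GrFrame W k) (i : ι) (T : GrModel W k) (x : Fin (k i) → ℂ) :
    e' i ((e i).symm (x, T i x)) = (transA e e' i T x, transB e e' i T x) := by
  have h : (x, T i x) = (x, 0) + (0, T i x) := by simp
  rw [h, map_add, map_add]
  simp [transA, transB, Prod.ext_iff]

theorem mem_graphParam (e : GrFrame W k) (i : ι) (T : GrModel W k) (w : W) :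
    w ∈ (graphParam e T i).1 ↔ (e i w).2 = T i (e i w).1 := by
  simp only [graphParam, Submodule.mem_map_equiv, LinearMap.mem_graph_iff]
  simp

theorem graphParam_eq_of_isUnit (e e' : GrFrame W k) (T : GrModel W k)
    (h : ∀ i, IsUnit (transA e e' i T)) :
    graphParam e T =
      graphParam e' (fun i => (transB e e' i T).comp (Ring.inverse (transA e e' i T))) := by
  funext i
  apply Subtype.ext
  have hfd : Module.Finite ℂ W := Module.Finite.equiv (e i).symm
  apply Submodule.eq_of_le_of_finrank_eq
  · intro w hw
    rw [mem_graphParam] at hw ⊢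
    have h1 : w = (e i).symm ((e i w).1, T i (e i w).1) := by
      rw [← hw]; simp
    have h2 : e' i w = (transA e e' i T (e i w).1, transB e e' i T (e i w).1) := by
      rw [← trans_apply, ← h1]
    rw [h2]
    have h3 : (Ring.inverse (transA e e' i T)) (transA e e' i T (e i w).1) = (e i w).1 := by
      have := Ring.inverse_mul_cancel _ (h i)
      exact congrArg (fun f : (Fin (k i) → ℂ) →L[ℂ] (Fin (k i) → ℂ) => f (e i w).1) this
    simp [h3]
  · rw [(graphParam e T i).2, (graphParam _ _ i).2]

theorem mem_range_graphParam_iff (e e' : GrFrame W k) (T : GrModel W k) :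
    graphParam e T ∈ Set.range (graphParam e') ↔ ∀ i, IsUnit (transA e e' i T) := by
  constructor
  · rintro ⟨S, hS⟩ i
    have hinj : Function.Injective (transA e e' i T) := by
      rw [injective_iff_map_eq_zero]
      intro x hx
      have h1 : (e i).symm (x, T i x) ∈ (graphParam e' S i).1 := by
        rw [hS, mem_graphParam]; simp
      rw [mem_graphParam, trans_apply, hx] at h1
      have h2 : e' i ((e i).symm (x, T i x)) = 0 := by
        rw [trans_apply, hx]
        simpa using h1
      have h3 : (x, T i x) = 0 := by simpa using h2
      exact congrArg Prod.fst h3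
    have hbij : Function.Bijective (transA e e' i T) :=
      ⟨hinj, (LinearMap.injective_iff_surjective
        (f := (transA e e' i T : (Fin (k i) → ℂ) →ₗ[ℂ] (Fin (k i) → ℂ)))).1 hinj⟩
    exact ContinuousLinearMap.isUnit_iff_bijective.2 hbij
  · intro h
    exact ⟨_, (graphParam_eq_of_isUnit e e' T h).symm⟩

theorem trans_source (e e' : GrFrame W k) :
    ((graphChart e).symm.trans (graphChart e')).source =
      {T | ∀ i, IsUnit (transA e e' i T)} := by
  ext T
  rw [PartialEquiv.trans_source]
  simp only [graphChart, PartialEquiv.symm_source, Set.univ_inter]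
  exact mem_range_graphParam_iff e e' T

theorem exists_mem_range_graphParam [FiniteDimensional ℂ W] (x : GrProd W k) :
    ∃ e : GrFrame W k, x ∈ Set.range (graphParam e) := by
  have h : ∀ i, ∃ e : W ≃ₗ[ℂ] (Fin (k i) → ℂ) × (Fin (Module.finrank ℂ W - k i) → ℂ),
      ∀ w, w ∈ (x i).1 ↔ (e w).2 = 0 := by
    intro i
    obtain ⟨C, hC⟩ := Submodule.exists_isCompl (x i).1
    have hd := Submodule.finrank_add_eq_of_isCompl hC
    rw [(x i).2] at hd
    let f : (x i).1 ≃ₗ[ℂ] (Fin (k i) → ℂ) :=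
      LinearEquiv.ofFinrankEq _ _ (by rw [(x i).2]; simp)
    let g : C ≃ₗ[ℂ] (Fin (Module.finrank ℂ W - k i) → ℂ) :=
      LinearEquiv.ofFinrankEq _ _ (by simp; omega)
    refine ⟨(Submodule.prodEquivOfIsCompl _ _ hC).symm.trans (f.prodCongr g), fun w => ?_⟩
    simp only [LinearEquiv.trans_apply, LinearEquiv.prodCongr_apply, LinearEquiv.map_eq_zero_iff]
    rw [Submodule.prodEquivOfIsCompl_symm_apply_snd_eq_zero]
  choose e he using h
  refine ⟨e, 0, ?_⟩
  funext i
  apply Subtype.ext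
  ext w
  rw [mem_graphParam, he]
  simp

variable [Fintype ι]

theorem contDiff_transA (e e' : GrFrame W k) (i : ι) : ContDiff ℂ ω (transA e e' i) := by
  unfold transA
  have : ContDiff ℂ ω (fun T : GrModel W k =>
      ContinuousLinearMap.inl ℂ _ _ + (ContinuousLinearMap.inr ℂ _ _).comp (T i)) := by
    have h1 : ContDiff ℂ ω (fun T : GrModel W k => T i) :=
      (ContinuousLinearMap.proj (R := ℂ) (φ := fun i : ι =>
        (Fin (k i) → ℂ) →L[ℂ] (Fin (Module.finrank ℂ W - k i) → ℂ)) i).contDiff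
    exact contDiff_const.add (contDiff_const.clm_comp h1)
  exact contDiff_const.clm_comp this

theorem contDiff_transB (e e' : GrFrame W k) (i : ι) : ContDiff ℂ ω (transB e e' i) := by
  unfold transB
  have : ContDiff ℂ ω (fun T : GrModel W k =>
      ContinuousLinearMap.inl ℂ _ _ + (ContinuousLinearMap.inr ℂ _ _).comp (T i)) := by
    have h1 : ContDiff ℂ ω (fun T : GrModel W k => T i) :=
      (ContinuousLinearMap.proj (R := ℂ) (φ := fun i : ι =>
        (Fin (k i) → ℂ) →L[ℂ] (Fin (Module.finrank ℂ W - k i) → ℂ)) i).contDiff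
    exact contDiff_const.add (contDiff_const.clm_comp h1)
  exact contDiff_const.clm_comp this

theorem trans_isOpen (e e' : GrFrame W k) :
    IsOpen ((graphChart e).symm.trans (graphChart e')).source := by
  rw [trans_source, Set.ofPred_forall]
  exact isOpen_iInter_of_finite fun i =>
    Units.isOpen.preimage (contDiff_transA e e' i).continuous

theorem trans_contDiffOn (e e' : GrFrame W k) :
    ContDiffOn ℂ ω ((graphChart e).symm.trans (graphChart e'))
      ((graphChart e).symm.trans (graphChart e')).source := by
  rw [trans_source]
  have key : ContDiffOn ℂ ω
      (fun T : GrModel W k => fun i => (transB e e' i T).comp (Ring.inverse (transA e e' i T)))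
      {T | ∀ i, IsUnit (transA e e' i T)} := by
    rw [contDiffOn_pi]
    intro i T hT
    obtain ⟨u, hu⟩ := hT i
    have h1 : ContDiffAt ℂ ω (fun T => Ring.inverse (transA e e' i T)) T := by
      have h2 := contDiffAt_ringInverse ℂ u (n := ω)
      rw [hu] at h2
      exact h2.comp T (contDiff_transA e e' i).contDiffAt
    exact ((contDiff_transB e e' i).contDiffAt.clm_comp h1).contDiffWithinAt
  refine key.congr fun T hT => ?_
  change Function.invFun (graphParam e') (graphParam e T) = _
  rw [graphParam_eq_of_isUnit e e' T hT,
    Function.leftInverse_invFun (graphParam_injective e')]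

/-- The atlas of all graph charts. -/
def grCore (W : Type*) [AddCommGroup W] [Module ℂ W] [FiniteDimensional ℂ W] (k : ι → ℕ) :
    ChartedSpaceCore (GrModel W k) (GrProd W k) where
  atlas := Set.range graphChart
  chartAt := fun x => graphChart (exists_mem_range_graphParam x).choose
  mem_chart_source := fun x => (exists_mem_range_graphParam x).choose_spec
  chart_mem_atlas := fun x => ⟨_, rfl⟩
  open_source := by
    rintro _ _ ⟨e, rfl⟩ ⟨e', rfl⟩
    exact trans_isOpen e e'
  continuousOn_toFun := by
    rintro _ _ ⟨e, rfl⟩ ⟨e', rfl⟩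
    exact (trans_contDiffOn e e').continuousOn

variable [FiniteDimensional ℂ W]

instance grTopology : TopologicalSpace (GrProd W k) := (grCore W k).toTopologicalSpace

instance grChartedSpace : ChartedSpace (GrModel W k) (GrProd W k) := (grCore W k).toChartedSpace

/-- The product of Grassmannians is a complex manifold. -/
instance grIsManifold : IsManifold 𝓘(ℂ, GrModel W k) ω (GrProd W k) := by
  apply isManifold_of_contDiffOn
  intro f f' hf hf'
  obtain ⟨c, hc⟩ := Set.mem_iUnion.1 hf
  obtain ⟨⟨e, rfl⟩, rfl⟩ := Set.mem_iUnion.1 hc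
  obtain ⟨c', hc'⟩ := Set.mem_iUnion.1 hf'
  obtain ⟨⟨e', rfl⟩, rfl⟩ := Set.mem_iUnion.1 hc'
  simp only [modelWithCornersSelf_coe, modelWithCornersSelf_coe_symm, Set.range_id,
    Set.preimage_id, Set.inter_univ, Function.id_comp, Function.comp_id]
  exact trans_contDiffOn e e'

/-- `GL(W)` acts on the product of Grassmannians. -/
instance grSMul : SMul (LinearMap.GeneralLinearGroup ℂ W) (GrProd W k) where
  smul g x := fun i => ⟨(x i).1.map (g : Module.End ℂ W), by
    have := LinearEquiv.finrank_map_eq (LinearMap.GeneralLinearGroup.toLinearEquiv g) (x i).1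
    exact this.trans (x i).2⟩

open Classical in
/-- The infinitesimal action `𝔤𝔩(W) → T_x` at a point `x`: the derivative at `t = 0` of the
curve `t ↦ (1 + t A) • x` (`1 + t A` is invertible for small `t`). -/
def infAct (x : GrProd W k) (A : Module.End ℂ W) : TangentSpace 𝓘(ℂ, GrModel W k) x :=
  mfderiv 𝓘(ℂ, ℂ) 𝓘(ℂ, GrModel W k)
    (fun t : ℂ => if h : IsUnit (1 + t • A) then h.unit • x else x) 0 (1 : ℂ)

end Grassmannian

/-! ### Mixed Hodge structures -/

section Hodge

variable {U : Type*} [AddCommGroup U] [Module ℚ U]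

variable (U) in
/-- Complex conjugation on `U_ℂ = ℂ ⊗ U`. -/
def conj : (ℂ ⊗[ℚ] U) →ₛₗ[starRingEnd ℂ] (ℂ ⊗[ℚ] U) where
  toFun := LinearMap.rTensor U (starRingEnd ℂ).toAddMonoidHom.toRatLinearMap
  map_add' := map_add _
  map_smul' := by
    intro c x
    induction x with
    | zero => simp
    | tmul a u => simp [TensorProduct.smul_tmul']
    | add x y hx hy => rw [smul_add, map_add, map_add, hx, hy, smul_add]

variable {V : Type*} [AddCommGroup V] [Module ℚ V]

/-- The graded piece `Gr_k^W = W_k / W_{k-1}`. -/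
abbrev Gr (W : ℤ → Submodule ℚ V) (k : ℤ) : Type _ :=
  W k ⧸ (W (k - 1)).submoduleOf (W k)

/-- The filtration on `(Gr_k^W)_ℂ` deduced from a filtration `F` on `V_ℂ`. -/
def grFil (W : ℤ → Submodule ℚ V) (F : ℤ → Submodule ℂ (ℂ ⊗[ℚ] V)) (k p : ℤ) :
    Submodule ℂ (ℂ ⊗[ℚ] Gr W k) :=
  ((F p).comap ((W k).subtype.baseChange ℂ)).map
    (((W (k - 1)).submoduleOf (W k)).mkQ.baseChange ℂ)

/-- `(V, W, F)` is a mixed Hodge structure (`W` being an increasing filtration): `F` is a finite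
decreasing filtration, and it induces a pure Hodge structure of weight `k` on every `Gr_k^W`. -/
structure IsMHS (W : ℤ → Submodule ℚ V) (F : ℤ → Submodule ℂ (ℂ ⊗[ℚ] V)) : Prop where
  anti : Antitone F
  exists_top : ∃ a, F a = ⊤
  exists_bot : ∃ b, F b = ⊥
  pure : ∀ k p, IsCompl (grFil W F k p) ((grFil W F k (k + 1 - p)).map (conj (Gr W k)))

/-- The Hodge number `h^{p,q} = dim Gr_F^p Gr^W_{p+q}`. -/
def hodgeNumber (W : ℤ → Submodule ℚ V) (F : ℤ → Submodule ℂ (ℂ ⊗[ℚ] V)) (p q : ℤ) : ℕ :=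
  Module.finrank ℂ (grFil W F (p + q) p ⧸
    (grFil W F (p + q) (p + 1)).submoduleOf (grFil W F (p + q) p))

/-- `Q` is a graded polarization of `(V, W, F)`: the first Riemann bilinear relations hold, and
for the Weil operator `C` (equal to `i^{p-q}` on the `(p,q)`-part) the Hermitian form
`Q_k(C u, conj v)` is positive definite. -/
structure IsPolarized (W : ℤ → Submodule ℚ V) (Q : ∀ k, LinearMap.BilinForm ℚ (Gr W k))
    (F : ℤ → Submodule ℂ (ℂ ⊗[ℚ] V)) : Prop where
  riemann : ∀ k p, ∀ u ∈ grFil W F k p, ∀ v ∈ grFil W F k (k - p + 1),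
    (Q k).baseChange ℂ u v = 0
  positive : ∀ k, ∃ C : Module.End ℂ (ℂ ⊗[ℚ] Gr W k),
    (∀ p q, p + q = k → ∀ u ∈ grFil W F k p ⊓ (grFil W F k q).map (conj (Gr W k)),
      C u = Complex.I ^ (p - q) • u) ∧
    ∀ u, u ≠ 0 → 0 < ((Q k).baseChange ℂ (C u) (conj (Gr W k) u)).re ∧
      ((Q k).baseChange ℂ (C u) (conj (Gr W k) u)).im = 0

variable (V) in
/-- The data defining a classifying space: a finite increasing filtration `W` of `V`,
non-degenerate `(-1)^k`-symmetric forms `Q k` on `Gr_k^W`, and a partition `h` of `dim V`. -/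
structure Datum where
  W : ℤ → Submodule ℚ V
  W_mono : Monotone W
  W_bot : ∃ a, W a = ⊥
  W_top : ∃ b, W b = ⊤
  Q : ∀ k, LinearMap.BilinForm ℚ (Gr W k)
  Q_nondegenerate : ∀ k, (Q k).Nondegenerate
  Q_symm : ∀ k x y, Q k x y = (-1 : ℚ) ^ k * Q k y x
  h : ℤ × ℤ →₀ ℕ
  h_sum : (h.sum fun _ m => m) = Module.finrank ℚ V

namespace Datum

variable (δ : Datum V)

/-- The indices `p` with `Gr_F^p ≠ 0`, that is, `h^{p,q} ≠ 0` for some `q`. -/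
abbrev Jump : Type := {p : ℤ // p ∈ δ.h.support.image Prod.fst}

/-- The dimension of `F^p`, namely `∑_{r ≥ p, s} h^{r,s}`. -/
def dimF (p : δ.Jump) : ℕ := ∑ rs ∈ δ.h.support with p.1 ≤ rs.1, δ.h rs

/-- The product of Grassmannians in which Hodge filtrations with Hodge numbers `h` live: such a
filtration is determined by its members `F^p`, where `p` is a jump. -/
abbrev Flags : Type _ := GrProd (ℂ ⊗[ℚ] V) δ.dimF

variable {δ}

/-- The filtration of `V_ℂ` with given members at the jumps. -/
def fil (x : δ.Flags) (p : ℤ) : Submodule ℂ (ℂ ⊗[ℚ] V) :=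
  ⨆ j : δ.Jump, ⨆ _ : p ≤ j.1, (x j).1

variable (δ) in
/-- The classifying space `ℳ` of mixed Hodge structures with weight filtration `W`, Hodge numbers
`h` and graded polarization `Q`. It is a locally closed complex submanifold of the product of
Grassmannians `δ.Flags`, from which it has its complex structure. -/
def classifyingSpace : Set δ.Flags :=
  {x | (∀ j : δ.Jump, fil x j.1 = (x j).1) ∧ IsMHS δ.W (fil x) ∧
    (∀ p q, hodgeNumber δ.W (fil x) p q = δ.h (p, q)) ∧ IsPolarized δ.W δ.Q (fil x)}

end Datum

/-- Deligne's bigrading `I^{p,q}` of a mixed Hodge structure. -/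
def deligneI (W : ℤ → Submodule ℚ V) (F : ℤ → Submodule ℂ (ℂ ⊗[ℚ] V)) (p q : ℤ) :
    Submodule ℂ (ℂ ⊗[ℚ] V) :=
  F p ⊓ (W (p + q)).baseChange ℂ ⊓
    (((F q).map (conj V) ⊓ (W (p + q)).baseChange ℂ) ⊔
      ⨆ j : ℕ, ⨆ _ : 1 ≤ j, (F (q - j)).map (conj V) ⊓ (W (p + q - j - 1)).baseChange ℂ)

/-- The image of `h : 𝕊_ℂ → GL(V_ℂ)`, where `𝕊(ℂ) = ℂˣ × ℂˣ` and `h(z, w)` is multiplication by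
`z^{-p} w^{-q}` on `I^{p,q}`. -/
def deligneTorus (W : ℤ → Submodule ℚ V) (F : ℤ → Submodule ℂ (ℂ ⊗[ℚ] V)) :
    Set (LinearMap.GeneralLinearGroup ℂ (ℂ ⊗[ℚ] V)) :=
  {g | ∃ z w : ℂˣ, ∀ p q, ∀ v ∈ deligneI W F p q,
    (g : Module.End ℂ (ℂ ⊗[ℚ] V)) v = ((z : ℂ) ^ (-p) * (w : ℂ) ^ (-q)) • v}

/-- The `(r,s)`-part of `𝔤𝔩(V_ℂ) = End(V_ℂ)` for the adjoint Hodge structure `Ad ∘ h`. -/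
def adjointPart (W : ℤ → Submodule ℚ V) (F : ℤ → Submodule ℂ (ℂ ⊗[ℚ] V)) (r s : ℤ) :
    Submodule ℂ (Module.End ℂ (ℂ ⊗[ℚ] V)) where
  carrier := {A | ∀ p q, ∀ v ∈ deligneI W F p q, A v ∈ deligneI W F (p + r) (q + s)}
  add_mem' hA hB p q v hv := add_mem (hA p q v hv) (hB p q v hv)
  zero_mem' _ _ _ _ := zero_mem _
  smul_mem' c _ hA p q v hv := Submodule.smul_mem _ c (hA p q v hv)

/-! ### Linear algebraic groups over `ℚ` -/

variable [FiniteDimensional ℚ V]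

/-- The matrix entries of an endomorphism of `V_ℂ` with respect to a basis of `V`. -/
def entries (A : Module.End ℂ (ℂ ⊗[ℚ] V)) :
    Fin (Module.finrank ℚ V) × Fin (Module.finrank ℚ V) → ℂ := fun ij =>
  LinearMap.toMatrix ((Module.finBasis ℚ V).baseChange ℂ) ((Module.finBasis ℚ V).baseChange ℂ) A
    ij.1 ij.2

/-- `G` is the group of complex points of an algebraic `ℚ`-subgroup of `GL(V)`: it is cut out in
`GL(V_ℂ)` by polynomials with rational coefficients. (Algebraic groups in characteristic zero are
reduced, hence determined by their complex points.) -/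
def IsQAlgebraic (G : Subgroup (LinearMap.GeneralLinearGroup ℂ (ℂ ⊗[ℚ] V))) : Prop :=
  ∃ S : Set (MvPolynomial (Fin (Module.finrank ℚ V) × Fin (Module.finrank ℚ V)) ℚ),
    ∀ g, g ∈ G ↔ ∀ f ∈ S, MvPolynomial.aeval (entries (g : Module.End ℂ (ℂ ⊗[ℚ] V))) f = 0

/-- The Mumford--Tate group: the smallest algebraic `ℚ`-subgroup of `GL(V)` whose complexification
contains the image of `h : 𝕊_ℂ → GL(V_ℂ)`. -/
def mumfordTate (W : ℤ → Submodule ℚ V) (F : ℤ → Submodule ℂ (ℂ ⊗[ℚ] V)) :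
    Subgroup (LinearMap.GeneralLinearGroup ℂ (ℂ ⊗[ℚ] V)) :=
  sInf {G | IsQAlgebraic G ∧ deligneTorus W F ⊆ G}

theorem isQAlgebraic_mumfordTate (W : ℤ → Submodule ℚ V) (F : ℤ → Submodule ℂ (ℂ ⊗[ℚ] V)) :
    IsQAlgebraic (mumfordTate W F) := by
  refine ⟨{f | ∃ G : Subgroup (LinearMap.GeneralLinearGroup ℂ (ℂ ⊗[ℚ] V)),
    deligneTorus W F ⊆ G ∧ IsQAlgebraic G ∧ ∀ g ∈ G,
      MvPolynomial.aeval (entries (g : Module.End ℂ (ℂ ⊗[ℚ] V))) f = 0}, fun g => ⟨?_, ?_⟩⟩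
  · rintro hg f ⟨G, hG, hGa, hf⟩
    exact hf g (Subgroup.mem_sInf.1 hg G ⟨hGa, hG⟩)
  · intro h
    refine Subgroup.mem_sInf.2 ?_
    rintro G ⟨⟨S, hS⟩, hG⟩
    exact (hS g).2 fun f hf => h f ⟨G, hG, ⟨S, hS⟩, fun g' hg' => (hS g').1 hg' f hf⟩

/-- The complex Lie algebra `Lie G_ℂ ⊆ End(V_ℂ)`: the Zariski tangent space of `G` at `1`, cut out
by the differentials at `1` of all polynomials that vanish on `G`. -/
def lieAlg (G : Subgroup (LinearMap.GeneralLinearGroup ℂ (ℂ ⊗[ℚ] V))) :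
    Submodule ℂ (Module.End ℂ (ℂ ⊗[ℚ] V)) where
  carrier := {A | ∀ f : MvPolynomial (Fin (Module.finrank ℚ V) × Fin (Module.finrank ℚ V)) ℂ,
    (∀ g ∈ G, MvPolynomial.eval (entries (g : Module.End ℂ (ℂ ⊗[ℚ] V))) f = 0) →
      ∑ ij, entries A ij *
        MvPolynomial.eval (entries (1 : Module.End ℂ (ℂ ⊗[ℚ] V))) (MvPolynomial.pderiv ij f) = 0}
  add_mem' := by
    intro A B hA hB f hf
    have h : ∀ ij, entries (A + B) ij = entries A ij + entries B ij := fun ij => by simp [entries]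
    simp only [h, add_mul, Finset.sum_add_distrib, hA f hf, hB f hf, add_zero]
  zero_mem' := by
    intro f _
    simp [entries]
  smul_mem' := by
    intro c A hA f hf
    have h : ∀ ij, entries (c • A) ij = c * entries A ij := fun ij => by simp [entries]
    simp only [h, mul_assoc, ← Finset.mul_sum, hA f hf, mul_zero]

/-- The unipotent radical: the largest normal unipotent algebraic subgroup (in characteristic zero
it is connected and defined over `ℚ`). -/
def unipotentRadical (G : Subgroup (LinearMap.GeneralLinearGroup ℂ (ℂ ⊗[ℚ] V))) :
    Subgroup (LinearMap.GeneralLinearGroup ℂ (ℂ ⊗[ℚ] V)) :=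
  sSup {U | IsQAlgebraic U ∧ U ≤ G ∧ (U.subgroupOf G).Normal ∧
    ∀ u ∈ U, IsNilpotent ((u : Module.End ℂ (ℂ ⊗[ℚ] V)) - 1)}

/-- The group of real points `G(ℝ)`, as a subset of `End(V_ℂ)`: the elements of `G(ℂ)` that
commute with complex conjugation. -/
def realPoints (G : Subgroup (LinearMap.GeneralLinearGroup ℂ (ℂ ⊗[ℚ] V))) :
    Set (Module.End ℂ (ℂ ⊗[ℚ] V)) :=
  {A | (∃ g ∈ G, (g : Module.End ℂ (ℂ ⊗[ℚ] V)) = A) ∧ ∀ v, A (conj V v) = conj V (A v)}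

/-- The identity component `G(ℝ)⁺` of the real Lie group `G(ℝ)`, for the topology of the
finite-dimensional vector space `End(V_ℂ)`. -/
def realIdentityComponent (G : Subgroup (LinearMap.GeneralLinearGroup ℂ (ℂ ⊗[ℚ] V))) :
    Set (LinearMap.GeneralLinearGroup ℂ (ℂ ⊗[ℚ] V)) :=
  letI : TopologicalSpace (Module.End ℂ (ℂ ⊗[ℚ] V)) :=
    moduleTopology ℂ (Module.End ℂ (ℂ ⊗[ℚ] V))
  {g | (g : Module.End ℂ (ℂ ⊗[ℚ] V)) ∈ connectedComponentIn (realPoints G) 1}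

/-! ### Weak Mumford--Tate domains -/

namespace Datum

variable {δ : Datum V}

/-- The orbit `G(ℝ)⁺ R_u(G)(ℂ) x`. -/
def orbit (G : Subgroup (LinearMap.GeneralLinearGroup ℂ (ℂ ⊗[ℚ] V))) (x : δ.Flags) :
    Set δ.Flags :=
  {y | ∃ g ∈ realIdentityComponent G, ∃ u ∈ unipotentRadical G, y = (g * u) • x}

/-- `N` is a normal algebraic `ℚ`-subgroup of the Mumford--Tate group of `x`, and `D` is the orbit
`N(ℝ)⁺ R_u(N)(ℂ) x`. For `N = MT(x)` this says that `D` is the Mumford--Tate domain of `x`. -/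
structure IsOrbitOfNormal (D : Set δ.Flags) (x : δ.Flags)
    (N : Subgroup (LinearMap.GeneralLinearGroup ℂ (ℂ ⊗[ℚ] V))) : Prop where
  algebraic : IsQAlgebraic N
  le : N ≤ mumfordTate δ.W (fil x)
  normal : (N.subgroupOf (mumfordTate δ.W (fil x))).Normal
  eq_orbit : D = orbit N x

/-- Weak Mumford--Tate domains in the classifying space. -/
def IsWeakMTDomain (D : Set δ.Flags) : Prop :=
  D ⊆ δ.classifyingSpace ∧ ∃ x ∈ D, ∃ N, IsOrbitOfNormal D x N

/-- `⨁_{r < 0} (Lie N_ℂ)^{r,s}`, for the adjoint Hodge structure defined by `x`. -/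
def negativePart (x : δ.Flags) (N : Subgroup (LinearMap.GeneralLinearGroup ℂ (ℂ ⊗[ℚ] V))) :
    Submodule ℂ (Module.End ℂ (ℂ ⊗[ℚ] V)) :=
  ⨆ r : ℤ, ⨆ _ : r < 0, ⨆ s : ℤ, lieAlg N ⊓ adjointPart δ.W (fil x) r s

end Datum

end Hodge

end MHS
end

/-! Write `F` for the Hodge filtration of the base point, `W` for the complexified weight filtration
and `β k` for the form on the weight-`k` graded piece. Two facts about `N` carry the proof. Since
`N` is normal in the Mumford--Tate group, the Deligne torus normalizes it, so `Lie N` is bigraded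
(`Sys.Base.lie_le`). Since the Mumford--Tate group consists of similitudes (`mumfordTate_le_simil`),
`N` preserves `W` and every `β k` up to a scalar. They are packaged, with algebraicity over the
rationals, in `Sys.Base`.

The orbit `D` is rewritten as the orbit of `H1 = K1 * N1`, where `K1` consists of the elements of
the real identity component that preserve the forms exactly and `N1` of the elements of `N` that act
trivially on the graded pieces. `N1` is unipotent, normal and algebraic, hence contained in the
unipotent radical. Conversely, at each polarized point `γF` with `γ` in `N`, `Lie N` is the sum of
its real skew elements, its elements of negative weight and the stabilizer of `γF`
(`Sys.Base.lie_le_skew`). Hence `H1` sweeps out a neighbourhood of `γF` in its `N`-orbit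
(`Sys.Base.eventually_mem_H1`), and connected families of group elements do not leave an `H1`-orbit
as long as the points stay polarized (`Sys.Base.exists_H1`).

The heart is `Sys.Base.exists_of_tendsto`: if points `gF` of the orbit converge to a point `F'` of
the classifying space, then `F'` lies in the `N`-orbit of `F`, and `gF = dF'` with `d` in `N`
tending to `1`. The weight-zero part of `g` stays bounded because it preserves a polarization and
both `F` and `F'` are polarized (`Sys.Pt.limit_eq_zero`). The remaining factor is in `N1`; without
changing its effect on `F` it can be made strictly triangular for the filtration opposite to `F`
(`Sys.Base.exists_strict`), and it then converges by transversality (`Sys.Pt.exists_limit_strict`).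

Together with the previous openness this shows that `D` is closed in the classifying space. Together
with the local form of Cartan's closed subgroup theorem it shows that, near any of its points `y`,
`D` is exactly the image of small `X` under `X ↦ exp(X) y`, with `X` in a complement of the
stabilizer in `Lie N` (`Sys.IsOrbit.isParam`). Such parametrizations straighten to slice charts, so
`D` is an embedded complex submanifold. At the base point the part of `Lie N` of negative first
degree is a complement of the stabilizer, which gives the tangent space. -/

noncomputable section

namespace MHS

set_option linter.unusedSectionVars false

/-! ### Deligne's splitting for opposed filtrations -/

section Splitting

variable {E : Type*} [AddCommGroup E] [Module ℂ E]

/-- Three finite filtrations `W` (increasing), `F`, `G` (decreasing) such that `F` and `G` induce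
`k`-opposed filtrations on every graded piece of `W`. -/
structure Opposed (W F G : ℤ → Submodule ℂ E) : Prop where
  mono : Monotone W
  bot : ∃ a, W a = ⊥
  top : ∃ b, W b = ⊤
  antiF : Antitone F
  topF : ∃ a, F a = ⊤
  botF : ∃ b, F b = ⊥
  antiG : Antitone G
  span : ∀ k p q, p + q = k + 1 → W k ≤ (F p ⊓ W k) ⊔ (G q ⊓ W k) ⊔ W (k - 1)
  disj : ∀ k p q, p + q = k + 1 → ∀ u ∈ F p ⊓ W k, ∀ v ∈ G q ⊓ W k, u - v ∈ W (k - 1) →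
    u ∈ W (k - 1)

/-- The summand `I^{p,q}` of Deligne's splitting. -/
def splitPart (W F G : ℤ → Submodule ℂ E) (p q : ℤ) : Submodule ℂ E :=
  F p ⊓ W (p + q) ⊓
    ((G q ⊓ W (p + q)) ⊔ ⨆ j : ℕ, ⨆ _ : 1 ≤ j, G (q - j) ⊓ W (p + q - j - 1))

variable {W F G : ℤ → Submodule ℂ E}

theorem splitPart_le_F (p q : ℤ) : splitPart W F G p q ≤ F p := inf_le_left.trans inf_le_left

theorem splitPart_le_W (p q : ℤ) : splitPart W F G p q ≤ W (p + q) :=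
  inf_le_left.trans inf_le_right

namespace Opposed

variable (h : Opposed W F G)
include h

theorem exists_bot_le : ∃ a, ∀ k ≤ a, W k = ⊥ := by
  obtain ⟨a, ha⟩ := h.bot
  exact ⟨a, fun k hk => le_bot_iff.1 (ha ▸ h.mono hk)⟩

/-- The terms with `j ≤ k - l - 1` lie in `G (q - (k - l - 1))`, and the terms with larger `j` lie
in `W (l - 1)`. So an element of the tail that falls into `W l` has its class in `Gr_l` in that step
of `G`. -/
theorem tail_inf_le (q k l : ℤ) (hl : l < k) :
    ((G q ⊓ W k) ⊔ (⨆ j : ℕ, ⨆ _ : 1 ≤ j, G (q - j) ⊓ W (k - j - 1))) ⊓ W l ≤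
      (G (q - (k - l - 1)) ⊓ W l) ⊔ W (l - 1) := by
  have key : (G q ⊓ W k) ⊔ (⨆ j : ℕ, ⨆ _ : 1 ≤ j, G (q - j) ⊓ W (k - j - 1)) ≤
      G (q - (k - l - 1)) ⊔ W (l - 1) := by
    refine sup_le (inf_le_left.trans ((h.antiG (by omega)).trans le_sup_left)) ?_
    refine iSup_le fun j => iSup_le fun hj => ?_
    by_cases hjl : (j : ℤ) ≤ k - l - 1
    · exact inf_le_left.trans ((h.antiG (by omega)).trans le_sup_left)
    · exact inf_le_right.trans ((h.mono (by omega)).trans le_sup_right)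
  rintro x ⟨hx, hxl⟩
  obtain ⟨g, hg, w, hw, rfl⟩ := Submodule.mem_sup.1 (key hx)
  have : g ∈ W l := by
    have := sub_mem hxl (h.mono (by omega : l - 1 ≤ l) hw)
    simpa using this
  exact Submodule.add_mem_sup ⟨hg, this⟩ hw

/-- If an element falls into `W l` with `l < p + q`, its class in `Gr_l` lies in `F p` and in `G (q
- (p + q - l - 1))`. These indices add up to `l + 1`, so opposedness kills the class; descending in
`l` kills the element. -/
theorem splitPart_inf (p q : ℤ) : splitPart W F G p q ⊓ W (p + q - 1) = ⊥ := by
  obtain ⟨a, ha⟩ := h.exists_bot_le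
  have key : ∀ n : ℕ, ∀ x ∈ splitPart W F G p q ⊓ W (p + q - 1), x ∈ W (p + q - 1 - n) := by
    intro n
    induction n with
    | zero => intro x hx; simpa using hx.2
    | succ n ih =>
      intro x hx
      have h1 := ih x hx
      have h2 := h.tail_inf_le q (p + q) (p + q - 1 - n) (by omega) ⟨hx.1.2, h1⟩
      obtain ⟨g, hg, w, hw, hgw⟩ := Submodule.mem_sup.1 h2
      have h3 := h.disj (p + q - 1 - n) p (q - (p + q - (p + q - 1 - n) - 1)) (by ring) x
        ⟨hx.1.1.1, h1⟩ g hg (by rw [← hgw]; simpa using hw)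
      convert h3 using 2
      push_cast; ring
  rw [eq_bot_iff]
  intro x hx
  have := key (p + q - 1 - a).toNat x hx
  rwa [ha _ (by omega)] at this

theorem exists_conj_rep (p q : ℤ) {x : E} (hx : x ∈ splitPart W F G p q) :
    ∃ v ∈ G q ⊓ W (p + q), x - v ∈ W (p + q - 1) := by
  obtain ⟨v, hv, w, hw, rfl⟩ := Submodule.mem_sup.1 hx.2
  refine ⟨v, hv, ?_⟩
  have : (⨆ j : ℕ, ⨆ _ : 1 ≤ j, G (q - j) ⊓ W (p + q - j - 1)) ≤ W (p + q - 1) :=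
    iSup_le fun j => iSup_le fun hj => inf_le_right.trans (h.mono (by omega))
  simpa using this hw

/-- Successive correction down the weights: the error is split by opposedness, its `F`-part is
subtracted from `u'` and its `G`-part is added to `t`. The first correction, in weight `p + q - 1`,
still has `G`-index `q` and is absorbed in the main term. The next ones, in weight `p + q - j - 1`,
need the index `q - j`, which dictates the shape of the tail. -/
theorem exists_lift_aux (p q : ℤ) (u v : E) (hu : u ∈ F p ⊓ W (p + q))
    (hv : v ∈ G q ⊓ W (p + q)) (huv : u - v ∈ W (p + q - 1)) (n : ℕ) :
    ∃ u' ∈ F p ⊓ W (p + q), u' - u ∈ W (p + q - 1) ∧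
      ∃ t ∈ (G q ⊓ W (p + q)) ⊔ ⨆ j : ℕ, ⨆ _ : 1 ≤ j, G (q - j) ⊓ W (p + q - j - 1),
        u' - t ∈ W (p + q - 2 - n) := by
  induction n with
  | zero =>
    have h1 := h.span (p + q - 1) p q (by ring) huv
    obtain ⟨y, hy, c, hc, hyc⟩ := Submodule.mem_sup.1 h1
    obtain ⟨a, ha, b, hb, rfl⟩ := Submodule.mem_sup.1 hy
    have hW : W (p + q - 1) ≤ W (p + q) := h.mono (by omega)
    refine ⟨u - a, sub_mem hu ⟨ha.1, hW ha.2⟩, by simpa using ha.2, v + b,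
      Submodule.mem_sup_left (add_mem hv ⟨hb.1, hW hb.2⟩), ?_⟩
    have : u - a - (v + b) = c := by
      rw [show u - a - (v + b) = (u - v) - (a + b) by abel, ← hyc]; abel
    rw [this]
    convert hc using 2
    push_cast; ring
  | succ n ih =>
    obtain ⟨u', hu', hd, t, ht, hut⟩ := ih
    have h1 := h.span (p + q - 2 - n) p (q - (n + 1 : ℕ)) (by push_cast; ring) hut
    obtain ⟨y, hy, c, hc, hyc⟩ := Submodule.mem_sup.1 h1
    obtain ⟨a, ha, b, hb, rfl⟩ := Submodule.mem_sup.1 hy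
    have hW : W (p + q - 2 - n) ≤ W (p + q - 1) := h.mono (by omega)
    refine ⟨u' - a, sub_mem hu' ⟨ha.1, h.mono (by omega) ha.2⟩, ?_, t + b, ?_, ?_⟩
    · rw [show u' - a - u = u' - u - a by abel]
      exact sub_mem hd (hW ha.2)
    · refine add_mem ht (Submodule.mem_sup_right ?_)
      refine Submodule.mem_iSup_of_mem (n + 1) (Submodule.mem_iSup_of_mem (by omega) ?_)
      refine ⟨hb.1, ?_⟩
      have := hb.2
      rwa [show p + q - 2 - (n : ℤ) = p + q - ((n + 1 : ℕ) : ℤ) - 1 by push_cast; ring] at this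
    · have : u' - a - (t + b) = c := by
        rw [show u' - a - (t + b) = (u' - t) - (a + b) by abel, ← hyc]; abel
      rw [this]
      convert hc using 2
      push_cast; ring

/-- Classes of type `(p,q)` in `Gr_{p+q}` lift to `I^{p,q}`. -/
theorem exists_lift (p q : ℤ) (u v : E) (hu : u ∈ F p ⊓ W (p + q))
    (hv : v ∈ G q ⊓ W (p + q)) (huv : u - v ∈ W (p + q - 1)) :
    ∃ w ∈ splitPart W F G p q, w - u ∈ W (p + q - 1) := by
  obtain ⟨a, ha⟩ := h.exists_bot_le
  obtain ⟨u', hu', hd, t, ht, hut⟩ := h.exists_lift_aux p q u v hu hv huv (p + q - 2 - a).toNat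
  rw [ha _ (by omega), Submodule.mem_bot, sub_eq_zero] at hut
  exact ⟨u', ⟨hu', hut ▸ ht⟩, hd⟩

/-- Descending induction on `p`. Splitting `x` by opposedness at the indices `p + 1` and `k - p`,
and removing the part in `F (p + 1)`, leaves a class of type `(p, k - p)`, which lifts to the
splitting. -/
theorem F_inf_W_le_aux (k p : ℤ) :
    F p ⊓ W k ≤ (⨆ i : ℤ × ℤ, ⨆ _ : p ≤ i.1 ∧ i.1 + i.2 = k, splitPart W F G i.1 i.2) ⊔
      W (k - 1) := by
  obtain ⟨b, hb⟩ := h.botF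
  have key : ∀ n : ℕ, ∀ p, b - n ≤ p → F p ⊓ W k ≤
      (⨆ i : ℤ × ℤ, ⨆ _ : p ≤ i.1 ∧ i.1 + i.2 = k, splitPart W F G i.1 i.2) ⊔ W (k - 1) := by
    intro n
    induction n with
    | zero =>
      intro p hp
      have : F p = ⊥ := le_bot_iff.1 (hb ▸ h.antiF (by simpa using hp))
      rw [this]; simp
    | succ n ih =>
      intro p hp x hx
      obtain ⟨y, hy, c, hc, hyc⟩ := Submodule.mem_sup.1
        (h.span k (p + 1) (k - p) (by ring) hx.2)
      obtain ⟨a, ha, g, hg, rfl⟩ := Submodule.mem_sup.1 hy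
      have hxa : x - a ∈ F p ⊓ W k := sub_mem hx ⟨h.antiF (by omega) ha.1, ha.2⟩
      have hk : p + (k - p) = k := by ring
      obtain ⟨w, hw, hwd⟩ := h.exists_lift p (k - p) (x - a) g (by rwa [hk]) (by rwa [hk])
        (by
          rw [hk, ← hyc, show a + g + c - a - g = c by abel]; exact hc)
      rw [hk] at hwd
      have h1 : (⨆ i : ℤ × ℤ, ⨆ _ : p + 1 ≤ i.1 ∧ i.1 + i.2 = k, splitPart W F G i.1 i.2) ≤
          ⨆ i : ℤ × ℤ, ⨆ _ : p ≤ i.1 ∧ i.1 + i.2 = k, splitPart W F G i.1 i.2 :=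
        iSup_le fun i => iSup_le fun hi =>
          le_iSup₂_of_le (f := fun (i : ℤ × ℤ) (_ : p ≤ i.1 ∧ i.1 + i.2 = k) =>
            splitPart W F G i.1 i.2) i ⟨by omega, hi.2⟩ le_rfl
      have ha' := sup_le_sup_right h1 (W (k - 1)) (ih (p + 1) (by push_cast at hp; omega) ha)
      have hw' : w ∈ (⨆ i : ℤ × ℤ, ⨆ _ : p ≤ i.1 ∧ i.1 + i.2 = k, splitPart W F G i.1 i.2) :=
        Submodule.mem_iSup_of_mem (p, k - p) (Submodule.mem_iSup_of_mem ⟨le_rfl, hk⟩ hw)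
      have : x = a + (w - (w - (x - a))) := by abel
      rw [this]
      exact add_mem ha' (sub_mem (Submodule.mem_sup_left hw') (Submodule.mem_sup_right hwd))
  exact key (b - p).toNat p (by omega)

theorem F_inf_W_eq (k p : ℤ) :
    F p ⊓ W k = ⨆ i : ℤ × ℤ, ⨆ _ : p ≤ i.1 ∧ i.1 + i.2 ≤ k, splitPart W F G i.1 i.2 := by
  apply le_antisymm
  · obtain ⟨a, ha⟩ := h.exists_bot_le
    have key : ∀ n : ℕ, ∀ k, k ≤ a + n → F p ⊓ W k ≤
        ⨆ i : ℤ × ℤ, ⨆ _ : p ≤ i.1 ∧ i.1 + i.2 ≤ k, splitPart W F G i.1 i.2 := by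
      intro n
      induction n with
      | zero => intro k hk; rw [ha k (by simpa using hk)]; simp
      | succ n ih =>
        intro k hk x hx
        obtain ⟨w, hw, c, hc, rfl⟩ := Submodule.mem_sup.1 (h.F_inf_W_le_aux k p hx)
        have h1 : (⨆ i : ℤ × ℤ, ⨆ _ : p ≤ i.1 ∧ i.1 + i.2 = k, splitPart W F G i.1 i.2) ≤
            F p := iSup₂_le fun i hi => (splitPart_le_F _ _).trans (h.antiF hi.1)
        have hc' : c ∈ F p ⊓ W (k - 1) := ⟨by simpa using sub_mem hx.1 (h1 hw), hc⟩
        refine add_mem ?_ ?_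
        · refine (iSup₂_le fun i hi => ?_ : (⨆ i : ℤ × ℤ, ⨆ _ : p ≤ i.1 ∧ i.1 + i.2 = k,
            splitPart W F G i.1 i.2) ≤ _) hw
          exact le_iSup₂_of_le (f := fun (i : ℤ × ℤ) (_ : p ≤ i.1 ∧ i.1 + i.2 ≤ k) =>
            splitPart W F G i.1 i.2) i ⟨hi.1, hi.2.le⟩ le_rfl
        · refine (iSup₂_le fun i hi => ?_ : (⨆ i : ℤ × ℤ, ⨆ _ : p ≤ i.1 ∧ i.1 + i.2 ≤ k - 1,
            splitPart W F G i.1 i.2) ≤ _) (ih (k - 1) (by push_cast at hk; omega) hc')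
          exact le_iSup₂_of_le (f := fun (i : ℤ × ℤ) (_ : p ≤ i.1 ∧ i.1 + i.2 ≤ k) =>
            splitPart W F G i.1 i.2) i ⟨hi.1, by omega⟩ le_rfl
    exact key (k - a).toNat k (by omega)
  · exact iSup₂_le fun i hi => le_inf ((splitPart_le_F _ _).trans (h.antiF hi.1))
      ((splitPart_le_W _ _).trans (h.mono hi.2))

theorem F_eq (p : ℤ) :
    F p = ⨆ i : ℤ × ℤ, ⨆ _ : p ≤ i.1, splitPart W F G i.1 i.2 := by
  apply le_antisymm
  · obtain ⟨b, hb⟩ := h.top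
    have := h.F_inf_W_eq b p
    rw [hb, inf_top_eq] at this
    rw [this]
    exact iSup₂_le fun i hi => le_iSup₂_of_le (f := fun (i : ℤ × ℤ) (_ : p ≤ i.1) =>
            splitPart W F G i.1 i.2) i hi.1 le_rfl
  · exact iSup₂_le fun i hi => (splitPart_le_F _ _).trans (h.antiF hi)

theorem W_eq (k : ℤ) :
    W k = ⨆ i : ℤ × ℤ, ⨆ _ : i.1 + i.2 ≤ k, splitPart W F G i.1 i.2 := by
  apply le_antisymm
  · obtain ⟨b, hb⟩ := h.topF
    have := h.F_inf_W_eq k b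
    rw [hb, top_inf_eq] at this
    rw [this]
    exact iSup₂_le fun i hi => le_iSup₂_of_le (f := fun (i : ℤ × ℤ) (_ : i.1 + i.2 ≤ k) =>
            splitPart W F G i.1 i.2) i hi.2 le_rfl
  · exact iSup₂_le fun i hi => (splitPart_le_W _ _).trans (h.mono hi)

theorem iSup_splitPart : ⨆ i : ℤ × ℤ, splitPart W F G i.1 i.2 = ⊤ := by
  obtain ⟨b, hb⟩ := h.topF
  rw [← hb, h.F_eq, eq_comm]
  refine le_antisymm (iSup₂_le fun i _ => le_iSup (fun i : ℤ × ℤ => splitPart W F G i.1 i.2) i) ?_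
  rw [← h.F_eq, hb]; exact le_top

/-- Among the nonzero terms take one of maximal weight and, within that weight, of minimal `p`. All
other terms lie in `F (p + 1)` or in lower weight, while this one lies in `G q` modulo lower weight.
Since `(p + 1) + q` exceeds the weight by one, its class vanishes, and `splitPart_inf` makes it
zero. -/
theorem sum_eq_zero (s : Finset (ℤ × ℤ)) (x : ℤ × ℤ → E)
    (hx : ∀ i ∈ s, x i ∈ splitPart W F G i.1 i.2) (h0 : ∑ i ∈ s, x i = 0) :
    ∀ i ∈ s, x i = 0 := by
  classical
  by_contra! hne
  obtain ⟨i0, hi0, hne0⟩ := hne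
  obtain ⟨m, hm, hmax⟩ := Finset.exists_max_image (s.filter fun i => x i ≠ 0)
    (fun i => toLex (i.1 + i.2, -i.1)) ⟨i0, by simp [hi0, hne0]⟩
  rw [Finset.mem_filter] at hm
  obtain ⟨p, q⟩ := m
  apply hm.2
  have hsum : ∑ i ∈ s.erase (p, q), x i ∈ (F (p + 1) ⊓ W (p + q)) ⊔ W (p + q - 1) := by
    refine sum_mem fun i hi => ?_
    rw [Finset.mem_erase] at hi
    by_cases hxi : x i = 0
    · rw [hxi]; exact zero_mem _
    have h1 := hmax i (by simp [hi.2, hxi])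
    rw [Prod.Lex.le_iff] at h1
    simp only [ofLex_toLex] at h1
    rcases h1 with h1 | ⟨h1, h2⟩
    · exact Submodule.mem_sup_right (h.mono (by omega) (splitPart_le_W _ _ (hx i hi.2)))
    · have : p + 1 ≤ i.1 := by
        rcases lt_or_eq_of_le (by omega : p ≤ i.1) with h3 | h3
        · omega
        · exact absurd (Prod.ext h3.symm (by simp only; omega)) hi.1
      exact Submodule.mem_sup_left ⟨h.antiF this (splitPart_le_F _ _ (hx i hi.2)),
        h.mono h1.le (splitPart_le_W _ _ (hx i hi.2))⟩
  obtain ⟨a, ha, c, hc, hac⟩ := Submodule.mem_sup.1 hsum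
  have hxm := hx _ hm.1
  obtain ⟨v, hv, hxv⟩ := h.exists_conj_rep p q hxm
  have hrel : x (p, q) + (a + c) = 0 := by rw [hac, Finset.add_sum_erase s x hm.1, h0]
  have haW : a ∈ W (p + q - 1) := by
    refine h.disj (p + q) (p + 1) q (by ring) a ha (-v) (neg_mem hv) ?_
    have : a - -v = -((x (p, q) - v) + c) + (x (p, q) + (a + c)) := by abel
    rw [this, hrel, add_zero]
    exact neg_mem (add_mem hxv hc)
  have : x (p, q) ∈ splitPart W F G p q ⊓ W (p + q - 1) := by
    refine ⟨hxm, ?_⟩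
    rw [eq_neg_of_add_eq_zero_left hrel]
    exact neg_mem (add_mem haW hc)
  rwa [h.splitPart_inf, Submodule.mem_bot] at this

theorem isInternal : DirectSum.IsInternal fun i : ℤ × ℤ => splitPart W F G i.1 i.2 := by
  classical
  rw [DirectSum.isInternal_submodule_iff_iSupIndep_and_iSup_eq_top]
  refine ⟨?_, h.iSup_splitPart⟩
  apply iSupIndep_of_dfinsupp_lsum_injective
  rw [injective_iff_map_eq_zero]
  intro f hf
  ext i
  by_cases hi : i ∈ f.support
  · have := h.sum_eq_zero f.support (fun i => (f i : E)) (fun i _ => (f i).2) (by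
      rw [← hf]
      simp [DFinsupp.lsum_apply_apply, DFinsupp.sumAddHom_apply, DFinsupp.sum])
    simpa using this i hi
  · simpa using hi

end Opposed

/-! ### Diagonal endomorphisms -/

section Diag

variable {ι : Type*} [DecidableEq ι] {I : ι → Submodule ℂ E}

/-- The endomorphism which is multiplication by `c i` on the summand `I i`. -/
def diag (hI : DirectSum.IsInternal I) (c : ι → ℂ) : Module.End ℂ E :=
  (DirectSum.toModule ℂ ι E fun i => c i • (I i).subtype) ∘ₗ
    (LinearEquiv.ofBijective (DirectSum.coeLinearMap I) hI).symm.toLinearMap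

theorem diag_apply (hI : DirectSum.IsInternal I) (c : ι → ℂ) {i : ι} {v : E} (hv : v ∈ I i) :
    diag hI c v = c i • v := by
  have : (LinearEquiv.ofBijective (DirectSum.coeLinearMap I) hI).symm v =
      DirectSum.lof ℂ ι (fun i => I i) i ⟨v, hv⟩ := by
    rw [LinearEquiv.symm_apply_eq]
    exact (DirectSum.coeLinearMap_lof I i ⟨v, hv⟩).symm
  rw [diag, LinearMap.comp_apply, LinearEquiv.coe_coe, this, DirectSum.toModule_lof]
  rfl

theorem ext_of_isInternal {E' : Type*} [AddCommGroup E'] [Module ℂ E']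
    (hI : DirectSum.IsInternal I) {A B : E →ₗ[ℂ] E'} (h : ∀ i, ∀ v ∈ I i, A v = B v) : A = B := by
  have h1 : (⊤ : Submodule ℂ E) ≤ LinearMap.eqLocus A B := by
    rw [← hI.submodule_iSup_eq_top]
    exact iSup_le fun i v hv => h i v hv
  exact LinearMap.ext fun v => h1 (Submodule.mem_top (x := v))

theorem diag_mul (hI : DirectSum.IsInternal I) (c c' : ι → ℂ) :
    diag hI c * diag hI c' = diag hI (c * c') :=
  ext_of_isInternal hI fun i v hv => by
    simp [diag_apply hI _ hv, smul_smul, mul_comm]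

theorem diag_one (hI : DirectSum.IsInternal I) : diag hI 1 = 1 :=
  ext_of_isInternal hI fun i v hv => by simp [diag_apply hI _ hv]

theorem diag_apply_of_mem_iSup (hI : DirectSum.IsInternal I) (c : ι → ℂ) (a : ℂ) {p : ι → Prop}
    (hc : ∀ i, p i → c i = a) {v : E} (hv : v ∈ ⨆ i, ⨆ _ : p i, I i) :
    diag hI c v = a • v := by
  have h1 : (⨆ i, ⨆ _ : p i, I i) ≤ LinearMap.eqLocus (diag hI c) (a • LinearMap.id) :=
    iSup₂_le fun i hi v hv => by simp [LinearMap.mem_eqLocus, diag_apply hI c hv, hc i hi]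
  exact h1 hv

theorem diag_mem_iSup (hI : DirectSum.IsInternal I) (c : ι → ℂ) {p : ι → Prop}
    (hc : ∀ i, ¬ p i → c i = 0) (v : E) : diag hI c v ∈ ⨆ i, ⨆ _ : p i, I i := by
  have h1 : (⊤ : Submodule ℂ E) ≤ (⨆ i, ⨆ _ : p i, I i).comap (diag hI c) := by
    rw [← hI.submodule_iSup_eq_top]
    refine iSup_le fun i v hv => ?_
    rw [Submodule.mem_comap, diag_apply hI c hv]
    by_cases hi : p i
    · exact Submodule.smul_mem _ _ (Submodule.mem_iSup_of_mem i (Submodule.mem_iSup_of_mem hi hv))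
    · rw [hc i hi, zero_smul]; exact zero_mem _
  exact h1 Submodule.mem_top

end Diag

end Splitting

/-! ### Complexified weight filtrations and their graded pieces -/

section Bridge

section Conj

variable {U U' : Type*} [AddCommGroup U] [Module ℚ U] [AddCommGroup U'] [Module ℚ U']

@[simp] theorem conj_tmul (c : ℂ) (u : U) : conj U (c ⊗ₜ u) = (starRingEnd ℂ c) ⊗ₜ u := rfl

@[simp] theorem conj_conj (x : ℂ ⊗[ℚ] U) : conj U (conj U x) = x := by
  induction x with
  | zero => simp
  | tmul a u => simp
  | add x y hx hy => rw [map_add, map_add, hx, hy]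

theorem conj_baseChange (f : U →ₗ[ℚ] U') (x : ℂ ⊗[ℚ] U) :
    conj U' (f.baseChange ℂ x) = f.baseChange ℂ (conj U x) := by
  induction x with
  | zero => simp
  | tmul a u => simp
  | add x y hx hy => simp only [map_add, hx, hy]

theorem mem_map_conj {S : Submodule ℂ (ℂ ⊗[ℚ] U)} {x : ℂ ⊗[ℚ] U} :
    x ∈ S.map (conj U) ↔ conj U x ∈ S := by
  constructor
  · rintro ⟨y, hy, rfl⟩
    simpa using hy
  · intro hx
    exact ⟨conj U x, hx, conj_conj x⟩

theorem baseChange_le {p : Submodule ℚ U} {T : Submodule ℂ (ℂ ⊗[ℚ] U)}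
    (h : ∀ u ∈ p, (1 : ℂ) ⊗ₜ u ∈ T) : p.baseChange ℂ ≤ T := by
  rw [Submodule.baseChange_eq_span, Submodule.span_le]
  rintro _ ⟨u, hu, rfl⟩
  exact h u hu

theorem conj_mem_baseChange {p : Submodule ℚ U} {x : ℂ ⊗[ℚ] U} (hx : x ∈ p.baseChange ℂ) :
    conj U x ∈ p.baseChange ℂ := by
  have : p.baseChange ℂ ≤ (p.baseChange ℂ).comap (conj U) := baseChange_le fun u hu => by
    rw [Submodule.mem_comap, conj_tmul]; exact Submodule.tmul_mem_baseChange_of_mem _ hu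
  exact this hx

theorem bilin_conj (Q : LinearMap.BilinForm ℚ U) (x y : ℂ ⊗[ℚ] U) :
    Q.baseChange ℂ (conj U x) (conj U y) = starRingEnd ℂ (Q.baseChange ℂ x y) := by
  induction x with
  | zero => simp
  | tmul a u =>
    induction y with
    | zero => simp
    | tmul b v => simp [Rat.smul_def]
    | add x y hx hy => simp only [map_add, hx, hy]
  | add x z hx hz => simp only [map_add, LinearMap.add_apply, hx, hz]

end Conj

variable {V : Type*} [AddCommGroup V] [Module ℚ V]

/-- The complexification of the weight filtration. -/
abbrev Wc (W : ℤ → Submodule ℚ V) (k : ℤ) : Submodule ℂ (ℂ ⊗[ℚ] V) := (W k).baseChange ℂ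

/-- An extension to `V` of the projection `W_k → Gr_k`. -/
def grProj (W : ℤ → Submodule ℚ V) (k : ℤ) : V →ₗ[ℚ] Gr W k :=
  ((W (k - 1)).submoduleOf (W k)).mkQ ∘ₗ ((W k).subtype.exists_leftInverse_of_injective
    (LinearMap.ker_eq_bot.2 (W k).subtype_injective)).choose

theorem grProj_apply (W : ℤ → Submodule ℚ V) (k : ℤ) (u : W k) :
    grProj W k u = ((W (k - 1)).submoduleOf (W k)).mkQ u := by
  have := ((W k).subtype.exists_leftInverse_of_injective
    (LinearMap.ker_eq_bot.2 (W k).subtype_injective)).choose_spec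
  have h2 := LinearMap.congr_fun this u
  simp only [LinearMap.comp_apply, Submodule.subtype_apply, LinearMap.id_apply] at h2
  rw [grProj, LinearMap.comp_apply, h2]

/-- A linear section of the projection `W_k → Gr_k`, with values in `V`. -/
def grSec (W : ℤ → Submodule ℚ V) (k : ℤ) : Gr W k →ₗ[ℚ] V :=
  (W k).subtype ∘ₗ (((W (k - 1)).submoduleOf (W k)).mkQ.exists_rightInverse_of_surjective
    (Submodule.range_mkQ _)).choose

theorem grSec_mem (W : ℤ → Submodule ℚ V) (k : ℤ) (g : Gr W k) : grSec W k g ∈ W k :=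
  Subtype.prop _

theorem grProj_grSec (W : ℤ → Submodule ℚ V) (k : ℤ) (g : Gr W k) :
    grProj W k (grSec W k g) = g := by
  rw [grSec, LinearMap.comp_apply, Submodule.subtype_apply, grProj_apply]
  exact LinearMap.congr_fun (((W (k - 1)).submoduleOf (W k)).mkQ.exists_rightInverse_of_surjective
    (Submodule.range_mkQ _)).choose_spec g

theorem grProj_eq_zero_iff (W : ℤ → Submodule ℚ V) (k : ℤ) {u : V} (hu : u ∈ W k) :
    grProj W k u = 0 ↔ u ∈ W (k - 1) := by
  have := grProj_apply W k ⟨u, hu⟩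
  rw [show grProj W k u = _ from this, Submodule.mkQ_apply, Submodule.Quotient.mk_eq_zero]
  rfl

/-- The complexified projection to `Gr_k`, extended to `V_ℂ`. -/
def gp (W : ℤ → Submodule ℚ V) (k : ℤ) : (ℂ ⊗[ℚ] V) →ₗ[ℂ] (ℂ ⊗[ℚ] Gr W k) :=
  (grProj W k).baseChange ℂ

/-- The complexified section of `gp`. -/
def gs (W : ℤ → Submodule ℚ V) (k : ℤ) : (ℂ ⊗[ℚ] Gr W k) →ₗ[ℂ] (ℂ ⊗[ℚ] V) :=
  (grSec W k).baseChange ℂ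

theorem gs_mem (W : ℤ → Submodule ℚ V) (k : ℤ) (g : ℂ ⊗[ℚ] Gr W k) : gs W k g ∈ Wc W k := by
  induction g with
  | zero => simp
  | tmul a u => exact Submodule.tmul_mem_baseChange_of_mem _ (grSec_mem W k u)
  | add x y hx hy => rw [map_add]; exact add_mem hx hy

theorem gp_gs (W : ℤ → Submodule ℚ V) (k : ℤ) (g : ℂ ⊗[ℚ] Gr W k) : gp W k (gs W k g) = g := by
  induction g with
  | zero => simp
  | tmul a u => simp [gp, gs, grProj_grSec]
  | add x y hx hy => rw [map_add, map_add, hx, hy]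

theorem gp_conj (W : ℤ → Submodule ℚ V) (k : ℤ) (x : ℂ ⊗[ℚ] V) :
    gp W k (conj V x) = conj _ (gp W k x) := (conj_baseChange _ _).symm

theorem sub_gs_gp_mem {W : ℤ → Submodule ℚ V} {k : ℤ} {x : ℂ ⊗[ℚ] V} (hx : x ∈ Wc W k) :
    x - gs W k (gp W k x) ∈ Wc W (k - 1) := by
  have : Wc W k ≤ (Wc W (k - 1)).comap (LinearMap.id - gs W k ∘ₗ gp W k) := by
    refine baseChange_le fun u hu => ?_
    have : (1 : ℂ) ⊗ₜ[ℚ] u - gs W k (gp W k (1 ⊗ₜ[ℚ] u)) =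
        (1 : ℂ) ⊗ₜ[ℚ] (u - grSec W k (grProj W k u)) := by
      simp [gp, gs, TensorProduct.tmul_sub]
    rw [Submodule.mem_comap, LinearMap.sub_apply, LinearMap.id_apply, LinearMap.comp_apply, this]
    refine Submodule.tmul_mem_baseChange_of_mem _ ?_
    rw [← grProj_eq_zero_iff W k (sub_mem hu (grSec_mem W k _)), map_sub, grProj_grSec, sub_self]
  exact this hx

theorem gp_eq_zero_of_mem {W : ℤ → Submodule ℚ V} (hW : Monotone W) {k : ℤ} {x : ℂ ⊗[ℚ] V}
    (hx : x ∈ Wc W (k - 1)) : gp W k x = 0 := by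
  have : Wc W (k - 1) ≤ LinearMap.ker (gp W k) := by
    refine baseChange_le fun u hu => ?_
    rw [LinearMap.mem_ker, gp, LinearMap.baseChange_tmul,
      (grProj_eq_zero_iff W k (hW (by omega) hu)).2 hu, TensorProduct.tmul_zero]
  exact this hx

theorem gp_eq_zero_iff {W : ℤ → Submodule ℚ V} (hW : Monotone W) {k : ℤ} {x : ℂ ⊗[ℚ] V}
    (hx : x ∈ Wc W k) : gp W k x = 0 ↔ x ∈ Wc W (k - 1) := by
  refine ⟨fun h => ?_, gp_eq_zero_of_mem hW⟩
  simpa [h] using sub_gs_gp_mem hx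

theorem Wc_mono {W : ℤ → Submodule ℚ V} (hW : Monotone W) : Monotone (Wc W) := fun _ _ h =>
  Submodule.baseChange_mono ℂ (hW h)

theorem gp_eq_iff {W : ℤ → Submodule ℚ V} (hW : Monotone W) {k : ℤ} {x y : ℂ ⊗[ℚ] V}
    (hx : x ∈ Wc W k) (hy : y ∈ Wc W k) : gp W k x = gp W k y ↔ x - y ∈ Wc W (k - 1) := by
  rw [← gp_eq_zero_iff hW (sub_mem hx hy), map_sub, sub_eq_zero]

theorem grFil_eq (W : ℤ → Submodule ℚ V) (F : ℤ → Submodule ℂ (ℂ ⊗[ℚ] V)) (k p : ℤ) :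
    grFil W F k p = (F p ⊓ Wc W k).map (gp W k) := by
  have hq : ∀ a : ℂ ⊗[ℚ] W k, gp W k ((W k).subtype.baseChange ℂ a) =
      ((W (k - 1)).submoduleOf (W k)).mkQ.baseChange ℂ a := by
    intro a
    induction a with
    | zero => simp
    | tmul a u =>
      rw [gp, LinearMap.baseChange_tmul, LinearMap.baseChange_tmul, LinearMap.baseChange_tmul,
        Submodule.subtype_apply, grProj_apply]
    | add x y hx hy => rw [map_add, map_add, map_add, hx, hy]
  ext ξ
  constructor
  · rintro ⟨a, ha, rfl⟩
    refine ⟨(W k).subtype.baseChange ℂ a, ⟨ha, ?_⟩, hq a⟩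
    clear ha
    induction a with
    | zero => simp
    | tmul a u => exact Submodule.tmul_mem_baseChange_of_mem _ u.2
    | add x y hx hy => rw [map_add]; exact add_mem hx hy
  · rintro ⟨x, ⟨hxF, hxW⟩, rfl⟩
    have : Wc W k ≤ LinearMap.range ((W k).subtype.baseChange ℂ) :=
      baseChange_le fun u hu => ⟨1 ⊗ₜ ⟨u, hu⟩, by simp⟩
    obtain ⟨a, rfl⟩ := this hxW
    exact ⟨a, hxF, (hq a).symm⟩

/-- The conjugate of a filtration of `V_ℂ`. -/
abbrev cF (F : ℤ → Submodule ℂ (ℂ ⊗[ℚ] V)) (q : ℤ) : Submodule ℂ (ℂ ⊗[ℚ] V) := (F q).map (conj V)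

theorem mem_map_conj_grFil {W : ℤ → Submodule ℚ V} {F : ℤ → Submodule ℂ (ℂ ⊗[ℚ] V)} {k q : ℤ}
    {ξ : ℂ ⊗[ℚ] Gr W k} :
    ξ ∈ (grFil W F k q).map (conj _) ↔ ∃ v ∈ cF F q ⊓ Wc W k, gp W k v = ξ := by
  rw [mem_map_conj, grFil_eq]
  constructor
  · rintro ⟨x, hx, hxx⟩
    refine ⟨conj V x, ⟨mem_map_conj.2 (by simpa using hx.1), conj_mem_baseChange hx.2⟩, ?_⟩
    rw [gp_conj, hxx, conj_conj]
  · rintro ⟨v, hv, rfl⟩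
    exact ⟨conj V v, ⟨mem_map_conj.1 hv.1, conj_mem_baseChange hv.2⟩, gp_conj _ _ _⟩

theorem IsMHS.opposed {W : ℤ → Submodule ℚ V} {F : ℤ → Submodule ℂ (ℂ ⊗[ℚ] V)}
    (hW : Monotone W) (hb : ∃ a, W a = ⊥) (ht : ∃ a, W a = ⊤) (h : IsMHS W F) :
    Opposed (Wc W) F (cF F) where
  mono := Wc_mono hW
  bot := hb.imp fun a ha => by simp [Wc, ha]
  top := ht.imp fun a ha => by simp [Wc, ha]
  antiF := h.anti
  topF := h.exists_top
  botF := h.exists_bot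
  antiG := fun a b hab => Submodule.map_mono (h.anti hab)
  span := by
    intro k p q hpq x hx
    obtain rfl : q = k + 1 - p := by omega
    have h1 : gp W k x ∈ grFil W F k p ⊔ (grFil W F k (k + 1 - p)).map (conj (Gr W k)) := by
      rw [(h.pure k p).sup_eq_top]; trivial
    obtain ⟨y, hy, z, hz, hyz⟩ := Submodule.mem_sup.1 h1
    rw [mem_map_conj_grFil] at hz
    rw [grFil_eq] at hy
    obtain ⟨a, ha, rfl⟩ := hy
    obtain ⟨b, hb, rfl⟩ := hz
    have h2 : x - (a + b) ∈ Wc W (k - 1) := by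
      rw [← gp_eq_iff hW hx (add_mem ha.2 hb.2), map_add, hyz]
    exact Submodule.mem_sup.2 ⟨a + b, Submodule.add_mem_sup ha hb, _, h2, by abel⟩
  disj := by
    intro k p q hpq u hu v hv huv
    obtain rfl : q = k + 1 - p := by omega
    rw [← gp_eq_iff hW hu.2 hv.2] at huv
    rw [← gp_eq_zero_iff hW hu.2, ← Submodule.mem_bot ℂ, ← (h.pure k p).inf_eq_bot]
    refine ⟨?_, mem_map_conj_grFil.2 ⟨v, hv, huv.symm⟩⟩
    rw [grFil_eq]
    exact ⟨u, hu, rfl⟩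

theorem deligneI_le_F (W : ℤ → Submodule ℚ V) (F : ℤ → Submodule ℂ (ℂ ⊗[ℚ] V)) (p q : ℤ) :
    deligneI W F p q ≤ F p := inf_le_left.trans inf_le_left

theorem deligneI_le_W (W : ℤ → Submodule ℚ V) (F : ℤ → Submodule ℂ (ℂ ⊗[ℚ] V)) (p q : ℤ) :
    deligneI W F p q ≤ Wc W (p + q) := inf_le_left.trans inf_le_right

namespace Datum

variable (δ : Datum V)

/-- The complexified form `Q_k`, transported to `V_ℂ`. It is meaningful on `W_k`. -/
def β (k : ℤ) : LinearMap.BilinForm ℂ (ℂ ⊗[ℚ] V) :=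
  ((δ.Q k).baseChange ℂ).compl₁₂ (gp δ.W k) (gp δ.W k)

theorem β_apply (k : ℤ) (u v : ℂ ⊗[ℚ] V) :
    δ.β k u v = (δ.Q k).baseChange ℂ (gp δ.W k u) (gp δ.W k v) := rfl

theorem β_conj (k : ℤ) (u v : ℂ ⊗[ℚ] V) :
    δ.β k (conj V u) (conj V v) = starRingEnd ℂ (δ.β k u v) := by
  rw [β_apply, gp_conj, gp_conj, bilin_conj, β_apply]

variable {δ}

theorem β_congr {k : ℤ} {u u' v v' : ℂ ⊗[ℚ] V} (hu : u - u' ∈ Wc δ.W (k - 1))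
    (hv : v - v' ∈ Wc δ.W (k - 1)) : δ.β k u v = δ.β k u' v' := by
  have h1 := gp_eq_zero_of_mem δ.W_mono hu
  have h2 := gp_eq_zero_of_mem δ.W_mono hv
  rw [map_sub, sub_eq_zero] at h1 h2
  rw [β_apply, β_apply, h1, h2]

/-- The congruence `u ≡ v` says that the class of `u` has type `(p, q)`. On it the Weil operator is
the scalar `I ^ (p - q)`, so the vanishing of `β k u (conj u)` contradicts positivity unless the
class is zero. -/
theorem β_pos {F : ℤ → Submodule ℂ (ℂ ⊗[ℚ] V)} (h : IsPolarized δ.W δ.Q F) {k p q : ℤ}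
    (hpq : p + q = k) {u v : ℂ ⊗[ℚ] V} (hu : u ∈ F p ⊓ Wc δ.W k) (hv : v ∈ cF F q ⊓ Wc δ.W k)
    (huv : u - v ∈ Wc δ.W (k - 1)) (h0 : δ.β k u (conj V u) = 0) : u ∈ Wc δ.W (k - 1) := by
  obtain ⟨C, hC, hpos⟩ := h.positive k
  rw [← gp_eq_zero_iff δ.W_mono hu.2]
  by_contra hne
  have h1 := hC p q hpq (gp δ.W k u) ⟨by rw [grFil_eq]; exact ⟨u, hu, rfl⟩,
    mem_map_conj_grFil.2 ⟨v, hv, ((gp_eq_iff δ.W_mono hu.2 hv.2).2 huv).symm⟩⟩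
  have h2 := (hpos _ hne).1
  rw [h1, ← gp_conj, map_smul, LinearMap.smul_apply, ← β_apply, h0] at h2
  simp at h2

/-- Positivity applied to the conjugate of `v` exhibits a class, `C (conj v)`, that pairs
nontrivially with the class of `v`. -/
theorem β_nondegenerate {F : ℤ → Submodule ℂ (ℂ ⊗[ℚ] V)} (h : IsPolarized δ.W δ.Q F) {k : ℤ}
    {v : ℂ ⊗[ℚ] V} (hv : v ∈ Wc δ.W k) (h0 : ∀ u ∈ Wc δ.W k, δ.β k u v = 0) :
    v ∈ Wc δ.W (k - 1) := by
  obtain ⟨C, -, hpos⟩ := h.positive k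
  rw [← gp_eq_zero_iff δ.W_mono hv]
  by_contra hne
  have h1 : conj _ (gp δ.W k v) ≠ 0 := fun h => hne (by rw [← conj_conj (gp δ.W k v), h, map_zero])
  have h2 := (hpos _ h1).1
  have h3 := h0 (gs δ.W k (C (conj _ (gp δ.W k v)))) (gs_mem _ _ _)
  rw [β_apply, gp_gs] at h3
  rw [conj_conj, h3] at h2
  simp at h2

theorem β_nondegenerate' {F : ℤ → Submodule ℂ (ℂ ⊗[ℚ] V)} (h : IsPolarized δ.W δ.Q F) {k : ℤ}
    {u : ℂ ⊗[ℚ] V} (hu : u ∈ Wc δ.W k) (h0 : ∀ v ∈ Wc δ.W k, δ.β k u v = 0) :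
    u ∈ Wc δ.W (k - 1) := by
  refine β_nondegenerate h hu fun v hv => ?_
  have key : ∀ x y : ℂ ⊗[ℚ] Gr δ.W k, (δ.Q k).baseChange ℂ x y =
      ((-1 : ℚ) ^ k : ℚ) • (δ.Q k).baseChange ℂ y x := by
    intro x y
    induction x with
    | zero => simp
    | tmul a u =>
      induction y with
      | zero => simp
      | tmul b v =>
        simp only [LinearMap.BilinForm.baseChange_tmul]
        rw [δ.Q_symm k u v, mul_smul, mul_comm b a]
      | add x y hx hy => simp only [map_add, hx, hy, LinearMap.add_apply, smul_add]
    | add x z hx hz => simp only [map_add, LinearMap.add_apply, hx, hz, smul_add]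
  rw [β_apply, key, ← β_apply, h0 v hv, smul_zero]

theorem β_riemann {F : ℤ → Submodule ℂ (ℂ ⊗[ℚ] V)} (h : IsPolarized δ.W δ.Q F) {k p q : ℤ}
    (hpq : p + q = k + 1) {u v : ℂ ⊗[ℚ] V} (hu : u ∈ F p ⊓ Wc δ.W k)
    (hv : v ∈ F q ⊓ Wc δ.W k) : δ.β k u v = 0 := by
  obtain rfl : q = k - p + 1 := by omega
  refine h.riemann k p _ ?_ _ ?_
  · rw [grFil_eq]; exact ⟨u, hu, rfl⟩
  · rw [grFil_eq]; exact ⟨v, hv, rfl⟩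

/-- The bilinear relations for Deligne's splitting. -/
theorem β_eq_zero_of_ne {F : ℤ → Submodule ℂ (ℂ ⊗[ℚ] V)} (hF : IsMHS δ.W F)
    (h : IsPolarized δ.W δ.Q F) {k p q p' q' : ℤ}
    (hpq : p + q = k) (hpq' : p' + q' = k) (hne : p' ≠ q) {u v : ℂ ⊗[ℚ] V}
    (hu : u ∈ deligneI δ.W F p q) (hv : v ∈ deligneI δ.W F p' q') : δ.β k u v = 0 := by
  have ho := hF.opposed δ.W_mono δ.W_bot δ.W_top
  subst hpq
  have hvW : v ∈ Wc δ.W (p + q) := by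
    have := deligneI_le_W _ _ _ _ hv
    rwa [hpq'] at this
  -- If `p' > q`, the first Riemann relation applies directly to `F p` and `F (q + 1)`. If `p' < q`,
  -- then `q' > p`; modulo lower weight both vectors are conjugates of vectors in `F q` and `F (p +
  -- 1)`, and the relation is used there.
  rcases lt_or_gt_of_ne hne with hlt | hlt
  · obtain ⟨u', hu', huu⟩ := ho.exists_conj_rep p q hu
    obtain ⟨v', hv', hvv⟩ := ho.exists_conj_rep p' q' hv
    rw [hpq'] at hv' hvv
    rw [β_congr (δ := δ) (k := p + q) huu hvv, ← conj_conj u', ← conj_conj v', β_conj]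
    have hu2 : conj V u' ∈ F q ⊓ Wc δ.W (p + q) :=
      ⟨mem_map_conj.1 hu'.1, conj_mem_baseChange hu'.2⟩
    have hv2 : conj V v' ∈ F (p + 1) ⊓ Wc δ.W (p + q) :=
      ⟨hF.anti (by omega) (mem_map_conj.1 hv'.1), conj_mem_baseChange hv'.2⟩
    rw [β_riemann h (by ring) hu2 hv2, map_zero]
  · exact β_riemann h (p := p) (q := q + 1) (by ring) ⟨deligneI_le_F _ _ _ _ hu, deligneI_le_W _ _ _ _ hu⟩
      ⟨hF.anti (by omega) (deligneI_le_F _ _ _ _ hv), hvW⟩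

end Datum

end Bridge

/-! ### Closed subgroups of the units of a Banach algebra -/

section Cartan

open Filter Topology NormedSpace

variable {𝔸 : Type*} [NormedRing 𝔸] [NormedAlgebra ℝ 𝔸] [FiniteDimensional ℝ 𝔸]

/-- `G` contains no small exponentials of elements of a complement of its Lie algebra. -/
theorem eventually_exp_mem_imp_eq_zero (G : Subgroup 𝔸ˣ)
    (hcl : ∀ u : 𝔸ˣ, (u : 𝔸) ∈ closure ((fun u : 𝔸ˣ => (u : 𝔸)) '' G) → u ∈ G)
    (𝔤 𝔪 : Submodule ℝ 𝔸)
    (hg : ∀ X : 𝔸, (∀ t : ℝ, exp (t • X) ∈ (fun u : 𝔸ˣ => (u : 𝔸)) '' G) → X ∈ 𝔤)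
    (hd : Disjoint 𝔤 𝔪) :
    ∀ᶠ m in 𝓝 (0 : 𝔸), m ∈ 𝔪 → exp m ∈ (fun u : 𝔸ˣ => (u : 𝔸)) '' G → m = 0 := by
  have : CompleteSpace 𝔸 := FiniteDimensional.complete ℝ 𝔸
  let _ : NormedAlgebra ℚ 𝔸 := NormedAlgebra.restrictScalars ℚ ℝ 𝔸
  have : ProperSpace 𝔸 := FiniteDimensional.proper ℝ 𝔸
  by_contra hcon
  rw [Filter.not_eventually] at hcon
  have hne : NeBot (𝓝 (0 : 𝔸) ⊓ 𝓟 {m | ¬(m ∈ 𝔪 → exp m ∈ (fun u : 𝔸ˣ => (u : 𝔸)) '' G → m = 0)}) :=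
    Filter.frequently_mem_iff_neBot.1 hcon
  -- An ultrafilter replaces the sequence of counterexamples `m → 0`. By compactness of the sphere,
  -- the directions of `m` converge along it.
  set 𝓤 := Ultrafilter.of (𝓝 (0 : 𝔸) ⊓
    𝓟 {m | ¬(m ∈ 𝔪 → exp m ∈ (fun u : 𝔸ˣ => (u : 𝔸)) '' G → m = 0)}) with h𝓤
  have hle := Ultrafilter.of_le (𝓝 (0 : 𝔸) ⊓
    𝓟 {m | ¬(m ∈ 𝔪 → exp m ∈ (fun u : 𝔸ˣ => (u : 𝔸)) '' G → m = 0)})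
  have h0 : Tendsto id (𝓤 : Filter 𝔸) (𝓝 0) := hle.trans inf_le_left
  have hP : ∀ᶠ m in (𝓤 : Filter 𝔸), m ∈ 𝔪 ∧ exp m ∈ (fun u : 𝔸ˣ => (u : 𝔸)) '' G ∧ m ≠ 0 := by
    filter_upwards [hle.trans inf_le_right (mem_principal_self _)] with m hm
    simpa only [Set.mem_ofPred_eq, Classical.not_imp, and_assoc] using hm
  obtain ⟨A, hA1, hA⟩ : ∃ A ∈ Metric.sphere (0 : 𝔸) 1,
      Tendsto (fun m : 𝔸 => ‖m‖⁻¹ • m) (𝓤 : Filter 𝔸) (𝓝 A) := by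
    have := (isCompact_sphere (0 : 𝔸) 1).ultrafilter_le_nhds (𝓤.map fun m : 𝔸 => ‖m‖⁻¹ • m) (by
      rw [le_principal_iff, Ultrafilter.mem_coe, Ultrafilter.mem_map]
      filter_upwards [hP] with m hm
      have : ‖m‖ ≠ 0 := norm_ne_zero_iff.2 hm.2.2
      simp [norm_smul, this])
    exact this
  have hAm : A ∈ 𝔪 := by
    have hc : IsClosed (𝔪 : Set 𝔸) := Submodule.closed_of_finiteDimensional 𝔪
    refine hc.mem_of_tendsto hA ?_
    filter_upwards [hP] with m hm using 𝔪.smul_mem _ hm.1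
  have hAg : A ∈ 𝔤 := by
    refine hg A fun t => ?_
    -- An integer multiple of `m` approximating `t • A` has for exponential an integer power of `exp
    -- m`, hence an element of `G`. As `G` is closed, `exp (t • A)` is in `G`, so the limit
    -- direction lies in both `𝔤` and `𝔪`.
    have hlim : Tendsto (fun m : 𝔸 => exp ((⌊t / ‖m‖⌋ : ℝ) • m)) (𝓤 : Filter 𝔸)
        (𝓝 (exp (t • A))) := by
      refine (exp_continuous (𝔸 := 𝔸)).continuousAt.tendsto.comp ?_
      have hs : Tendsto (fun m : 𝔸 => (⌊t / ‖m‖⌋ : ℝ) * ‖m‖) (𝓤 : Filter 𝔸) (𝓝 t) := by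
        have hn : Tendsto (fun m : 𝔸 => ‖m‖) (𝓤 : Filter 𝔸) (𝓝 0) := by
          simpa using h0.norm
        have h1 : Tendsto (fun m : 𝔸 => t - ‖m‖) (𝓤 : Filter 𝔸) (𝓝 t) := by
          simpa using hn.const_sub t
        refine tendsto_of_tendsto_of_tendsto_of_le_of_le' h1 tendsto_const_nhds ?_ ?_
        · filter_upwards [hP] with m hm
          have hpos : 0 < ‖m‖ := norm_pos_iff.2 hm.2.2
          have := (Int.sub_one_lt_floor (t / ‖m‖)).le
          calc t - ‖m‖ = (t / ‖m‖ - 1) * ‖m‖ := by field_simp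
            _ ≤ _ := by gcongr
        · filter_upwards [hP] with m hm
          have hpos : 0 < ‖m‖ := norm_pos_iff.2 hm.2.2
          calc (⌊t / ‖m‖⌋ : ℝ) * ‖m‖ ≤ (t / ‖m‖) * ‖m‖ := by gcongr; exact Int.floor_le _
            _ = t := by field_simp
      refine (hs.smul hA).congr' ?_
      filter_upwards [hP] with m hm
      have hpos : ‖m‖ ≠ 0 := norm_ne_zero_iff.2 hm.2.2
      rw [smul_smul, mul_assoc, mul_inv_cancel₀ hpos, mul_one]
    obtain ⟨u, hu⟩ := isUnit_exp (t • A)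
    refine ⟨u, hcl u ?_, hu⟩
    rw [hu]
    refine mem_closure_of_tendsto hlim ?_
    filter_upwards [hP] with m hm
    obtain ⟨v, hv, hvm⟩ := hm.2.1
    refine ⟨v ^ ⌊t / ‖m‖⌋, G.zpow_mem hv _, ?_⟩
    change v.val = exp m at hvm
    change ((v ^ ⌊t / ‖m‖⌋ : 𝔸ˣ) : 𝔸) = _
    rw [Int.cast_smul_eq_zsmul]
    rcases ⌊t / ‖m‖⌋ with n | n
    · rw [Int.ofNat_eq_natCast, zpow_natCast, Units.val_pow_eq_pow_val, hvm, natCast_zsmul, exp_nsmul]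
    · have h3 : exp ((Int.negSucc n) • m) * exp ((n + 1) • m) = 1 := by
        rw [← exp_add_of_commute]
        · rw [negSucc_zsmul]; simp
        · rw [negSucc_zsmul]; exact ((Commute.refl m).smul_right _).smul_left _ |>.neg_left
      rw [exp_nsmul, ← hvm] at h3
      rw [zpow_negSucc, Units.inv_eq_of_mul_eq_one_left]
      simpa using h3
  have : A = 0 := by simpa using hd.le_bot ⟨hAg, hAm⟩
  simp [this] at hA1

/-- A smooth map into `G` whose derivative at `0` covers the Lie algebra covers a neighbourhood
of `1` in `G`. -/
theorem eventually_mem_image_of_range {P : Type*} [NormedAddCommGroup P] [NormedSpace ℝ P]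
    [CompleteSpace P] (G : Subgroup 𝔸ˣ)
    (hcl : ∀ u : 𝔸ˣ, (u : 𝔸) ∈ closure ((fun u : 𝔸ˣ => (u : 𝔸)) '' G) → u ∈ G)
    (𝔤 : Submodule ℝ 𝔸)
    (hg : ∀ X : 𝔸, (∀ t : ℝ, exp (t • X) ∈ (fun u : 𝔸ˣ => (u : 𝔸)) '' G) → X ∈ 𝔤)
    {Ψ : P → 𝔸} {Ψ' : P →L[ℝ] 𝔸} (hΨ : HasStrictFDerivAt Ψ Ψ' 0) (h0 : Ψ 0 = 1)
    (hG : ∀ p, Ψ p ∈ (fun u : 𝔸ˣ => (u : 𝔸)) '' G) (hr : ∀ X ∈ 𝔤, ∃ p, Ψ' p = X)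
    {U : Set P} (hU : U ∈ 𝓝 0) :
    ∀ᶠ g in 𝓝 (1 : 𝔸), g ∈ (fun u : 𝔸ˣ => (u : 𝔸)) '' G → g ∈ Ψ '' U := by
  have : CompleteSpace 𝔸 := FiniteDimensional.complete ℝ 𝔸
  obtain ⟨𝔪, h𝔪⟩ := Submodule.exists_isCompl 𝔤
  have hsmall := eventually_exp_mem_imp_eq_zero G hcl 𝔤 𝔪 hg h𝔪.disjoint
  -- `Θ` is a submersion at `0`, so it covers a neighbourhood of `1`. If `Ψ p * exp m` belongs to
  -- `G` then so does `exp m`, and the previous result forces `m = 0`.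
  let Θ : P × 𝔪 → 𝔸 := fun x => Ψ x.1 * exp (x.2 : 𝔸)
  have hexp : HasStrictFDerivAt (fun m : 𝔪 => exp (m : 𝔸)) 𝔪.subtypeL 0 := by
    have h1 : HasStrictFDerivAt (exp : 𝔸 → 𝔸) (1 : 𝔸 →L[ℝ] 𝔸) (𝔪.subtypeL 0) := by
      rw [map_zero]; exact hasStrictFDerivAt_exp_zero
    exact h1.comp (0 : 𝔪) 𝔪.subtypeL.hasStrictFDerivAt
  have hΘ : HasStrictFDerivAt Θ (Ψ'.comp (ContinuousLinearMap.fst ℝ P 𝔪) +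
      𝔪.subtypeL.comp (ContinuousLinearMap.snd ℝ P 𝔪)) (0 : P × 𝔪) := by
    have h1 : HasStrictFDerivAt (fun x : P × 𝔪 => Ψ x.1)
        (Ψ'.comp (ContinuousLinearMap.fst ℝ P 𝔪)) 0 :=
      HasStrictFDerivAt.comp (0 : P × 𝔪) (g := Ψ) (by exact hΨ) hasStrictFDerivAt_fst
    have h2 : HasStrictFDerivAt (fun x : P × 𝔪 => exp (x.2 : 𝔸))
        (𝔪.subtypeL.comp (ContinuousLinearMap.snd ℝ P 𝔪)) 0 :=
      HasStrictFDerivAt.comp (0 : P × 𝔪) (g := fun m : 𝔪 => exp (m : 𝔸)) (by exact hexp)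
        hasStrictFDerivAt_snd
    refine (h1.mul' h2).congr_fderiv ?_
    ext x <;> simp [h0]
  have hsurj : (Ψ'.comp (ContinuousLinearMap.fst ℝ P 𝔪) +
      𝔪.subtypeL.comp (ContinuousLinearMap.snd ℝ P 𝔪)).range = ⊤ := by
    rw [eq_top_iff]
    intro X _
    have hX : X ∈ 𝔤 ⊔ 𝔪 := by rw [h𝔪.sup_eq_top]; trivial
    obtain ⟨a, ha, b, hb, rfl⟩ := Submodule.mem_sup.1 hX
    obtain ⟨p, rfl⟩ := hr a ha
    exact ⟨(p, ⟨b, hb⟩), by simp⟩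
  have hmap := hΘ.map_nhds_eq_of_surj hsurj
  have hΘ0 : Θ 0 = 1 := by simp [Θ, h0]
  rw [hΘ0] at hmap
  have hV : {x : P × 𝔪 | x.1 ∈ U ∧ ((x.2 : 𝔸) ∈ 𝔪 →
      exp (x.2 : 𝔸) ∈ (fun u : 𝔸ˣ => (u : 𝔸)) '' G → (x.2 : 𝔸) = 0)} ∈ 𝓝 (0 : P × 𝔪) := by
    refine Filter.Eventually.and ((continuous_fst.tendsto' (0 : P × 𝔪) 0 rfl).eventually hU) ?_
    exact ((continuous_subtype_val.comp continuous_snd).tendsto' (0 : P × 𝔪) (0 : 𝔸) rfl).eventually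
      hsmall
  have himg := image_mem_map (m := Θ) hV
  rw [hmap] at himg
  filter_upwards [himg]
  rintro _ ⟨⟨p, m⟩, ⟨hp, hm⟩, rfl⟩ ⟨g, hgG, hgp⟩
  obtain ⟨u, hu, hup⟩ := hG p
  have hm0 : (m : 𝔸) = 0 := by
    refine hm m.2 ⟨u⁻¹ * g, G.mul_mem (G.inv_mem hu) hgG, ?_⟩
    change (g : 𝔸) = Ψ p * exp (m : 𝔸) at hgp
    change (u : 𝔸) = Ψ p at hup
    change ((u⁻¹ * g : 𝔸ˣ) : 𝔸) = exp (m : 𝔸)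
    rw [Units.val_mul, hgp, ← hup, Units.inv_mul_cancel_left]
  exact ⟨p, hp, by simp [Θ, hm0]⟩

end Cartan

/-! ### Kernels of constant rank -/

section Kernel

open Filter Topology

variable {X Y : Type*} [NormedAddCommGroup X] [NormedSpace ℂ X] [FiniteDimensional ℂ X]
  [NormedAddCommGroup Y] [NormedSpace ℂ Y] [FiniteDimensional ℂ Y]

/-- Kernels of constant dimension vary continuously. -/
theorem exists_tendsto_ker {α : Type*} {l : Filter α} {L : α → X →L[ℂ] Y} {L₀ : X →L[ℂ] Y}
    (hL : Tendsto L l (𝓝 L₀))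
    (hd : ∀ᶠ a in l, Module.finrank ℂ (L a).ker = Module.finrank ℂ L₀.ker)
    {b : X} (hb : L₀ b = 0) :
    ∃ b' : α → X, (∀ᶠ a in l, L a (b' a) = 0) ∧ Tendsto b' l (𝓝 b) := by
  have : CompleteSpace X := FiniteDimensional.complete ℂ X
  obtain ⟨S, hS⟩ := Submodule.exists_isCompl L₀.ker
  obtain ⟨g, hg⟩ := ((L₀ : X →ₗ[ℂ] Y) ∘ₗ S.subtype).exists_leftInverse_of_injective (by
    rw [LinearMap.ker_eq_bot']
    intro s hs
    have : (s : X) ∈ L₀.ker ⊓ S := ⟨hs, s.2⟩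
    rw [hS.inf_eq_bot] at this
    simpa using this)
  let R : Y →L[ℂ] X := LinearMap.toContinuousLinearMap (S.subtype ∘ₗ g)
  have hR : ∀ x, L₀ (R (L₀ x)) = L₀ x := by
    intro x
    have hx : x ∈ L₀.ker ⊔ S := by rw [hS.sup_eq_top]; trivial
    obtain ⟨k, hk, s, hs, rfl⟩ := Submodule.mem_sup.1 hx
    have hk' : L₀ k = 0 := hk
    have h1 : g (L₀ s) = ⟨s, hs⟩ := LinearMap.congr_fun hg ⟨s, hs⟩
    simp [R, hk', h1]
  -- Since `L₀ R L₀ = L₀`, the operator `M a` carries the kernel of `L a` into that of `L₀`; by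
  -- equality of dimensions, onto it once `M a` is invertible. As `M a → 1`, the vectors `(M a)⁻¹ b`
  -- tend to `b`.
  let M : α → X →L[ℂ] X := fun a => 1 - R.comp L₀ + R.comp (L a)
  have hM : Tendsto M l (𝓝 1) := by
    have h1 : Tendsto (fun a => R.comp (L a)) l (𝓝 (R.comp L₀)) :=
      (ContinuousLinearMap.compL ℂ X Y X R).continuous.continuousAt.tendsto.comp hL
    simpa [M] using (tendsto_const_nhds (x := 1 - R.comp L₀)).add h1
  have hMu : ∀ᶠ a in l, IsUnit (M a) := hM.eventually (Units.isOpen.mem_nhds isUnit_one)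
  have hinv : Tendsto (fun a => Ring.inverse (M a)) l (𝓝 1) := by
    have := (NormedRing.inverse_continuousAt (1 : (X →L[ℂ] X)ˣ)).tendsto.comp
      (show Tendsto M l (𝓝 ((1 : (X →L[ℂ] X)ˣ) : X →L[ℂ] X)) from hM)
    simpa [Function.comp_def] using this
  refine ⟨fun a => Ring.inverse (M a) b, ?_, ?_⟩
  · filter_upwards [hMu, hd] with a hu hda
    have hinj : Function.Injective (M a) := (ContinuousLinearMap.isUnit_iff_bijective.1 hu).1
    have hmap : (L a).ker.map (M a : X →ₗ[ℂ] X) = L₀.ker := by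
      apply Submodule.eq_of_le_of_finrank_eq
      · rintro _ ⟨v, hv, rfl⟩
        have hv' : L a v = 0 := hv
        change L₀ (M a v) = 0
        simp [M, hv', hR]
      · rw [← hda]
        exact (LinearEquiv.finrank_eq (Submodule.equivMapOfInjective (M a : X →ₗ[ℂ] X) hinj _)).symm
    have hb' : b ∈ (L a).ker.map (M a : X →ₗ[ℂ] X) := by rw [hmap]; exact hb
    obtain ⟨v, hv, rfl⟩ := hb'
    have : Ring.inverse (M a) (M a v) = v := by
      have := Ring.inverse_mul_cancel _ hu
      exact congrArg (fun f : X →L[ℂ] X => f v) this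
    simp only [ContinuousLinearMap.coe_coe, this]
    exact hv
  · have := (ContinuousLinearMap.apply ℂ X b).continuous.continuousAt.tendsto.comp hinv
    simpa [Function.comp_def] using this

end Kernel

/-! ### Norms on `V_ℂ` and `End(V_ℂ)` -/

section EndNorm

variable (E : Type*) [NormedAddCommGroup E] [NormedSpace ℂ E] [FiniteDimensional ℂ E]

/-- The operator norm on the endomorphisms of a finite-dimensional normed space. -/
abbrev endNormedRing : NormedRing (Module.End ℂ E) :=
  NormedRing.induced (Module.End ℂ E) (E →L[ℂ] E) (Module.End.toContinuousLinearMap (𝕜 := ℂ) E)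
    (Module.End.toContinuousLinearMap (𝕜 := ℂ) E).injective

attribute [local instance] endNormedRing

/-- The operator norm is a norm of algebras. -/
abbrev endNormedAlgebra : NormedAlgebra ℂ (Module.End ℂ E) :=
  NormedAlgebra.induced ℂ (Module.End ℂ E) (E →L[ℂ] E)
    (Module.End.toContinuousLinearMap (𝕜 := ℂ) E)

attribute [local instance] endNormedAlgebra

theorem end_completeSpace : CompleteSpace (Module.End ℂ E) := FiniteDimensional.complete ℂ _

end EndNorm

/-! ### Exponentials as units of a Banach algebra -/

section Exp

open NormedSpace

variable {𝔸 : Type*} [NormedRing 𝔸] [NormedAlgebra ℂ 𝔸] [CompleteSpace 𝔸]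

/-- The exponential as a unit. -/
def expU (X : 𝔸) : 𝔸ˣ :=
  letI : NormedAlgebra ℚ 𝔸 := NormedAlgebra.restrictScalars ℚ ℂ 𝔸
  { val := exp X
    inv := exp (-X)
    val_inv := by
      rw [← exp_add_of_commute (Commute.refl X).neg_right, add_neg_cancel, exp_zero]
    inv_val := by
      rw [← exp_add_of_commute (Commute.refl X).neg_left, neg_add_cancel, exp_zero] }

@[simp] theorem expU_val (X : 𝔸) : (expU X : 𝔸) = exp X := rfl

theorem expU_neg (X : 𝔸) : expU (-X) = (expU X)⁻¹ := Units.ext rfl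

theorem expU_conj (g : 𝔸ˣ) (X : 𝔸) :
    expU ((g : 𝔸) * X * (g⁻¹ : 𝔸ˣ)) = g * expU X * g⁻¹ := by
  let _ : NormedAlgebra ℚ 𝔸 := NormedAlgebra.restrictScalars ℚ ℂ 𝔸
  exact Units.ext (exp_units_conj g X)

theorem exp_continuous' : Continuous (exp : 𝔸 → 𝔸) := by
  let _ : NormedAlgebra ℚ 𝔸 := NormedAlgebra.restrictScalars ℚ ℂ 𝔸
  exact exp_continuous

end Exp

/-! ### Algebraic subgroups of `GL(V_ℂ)` and their Lie algebras -/

section AlgGroup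

open NormedSpace Filter Topology

variable {E : Type*} [NormedAddCommGroup E] [NormedSpace ℂ E] [FiniteDimensional ℂ E] {n : ℕ}

attribute [local instance] endNormedRing endNormedAlgebra

/-- Index set of matrix entries. -/
abbrev Ent (n : ℕ) : Type := Fin n × Fin n

/-- Matrix entries with respect to a basis. -/
def ent (b : Module.Basis (Fin n) ℂ E) (A : Module.End ℂ E) : Ent n → ℂ := fun ij =>
  LinearMap.toMatrix b b A ij.1 ij.2

/-- `G` is cut out in `GL(E)` by polynomials with rational coefficients. -/
def IsQAlg (b : Module.Basis (Fin n) ℂ E) (G : Subgroup (LinearMap.GeneralLinearGroup ℂ E)) :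
    Prop :=
  ∃ S : Set (MvPolynomial (Ent n) ℚ),
    ∀ g, g ∈ G ↔ ∀ f ∈ S, MvPolynomial.aeval (ent b (g : Module.End ℂ E)) f = 0

/-- The Zariski tangent space at `1` of a subgroup of `GL(E)`. -/
def lie (b : Module.Basis (Fin n) ℂ E) (G : Subgroup (LinearMap.GeneralLinearGroup ℂ E)) :
    Submodule ℂ (Module.End ℂ E) where
  carrier := {A | ∀ f : MvPolynomial (Ent n) ℂ,
    (∀ g ∈ G, MvPolynomial.eval (ent b (g : Module.End ℂ E)) f = 0) →
      ∑ ij, ent b A ij *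
        MvPolynomial.eval (ent b (1 : Module.End ℂ E)) (MvPolynomial.pderiv ij f) = 0}
  add_mem' := by
    intro A B hA hB f hf
    have h : ∀ ij, ent b (A + B) ij = ent b A ij + ent b B ij := fun ij => by simp [ent]
    simp only [h, add_mul, Finset.sum_add_distrib, hA f hf, hB f hf, add_zero]
  zero_mem' := by
    intro f _
    simp [ent]
  smul_mem' := by
    intro c A hA f hf
    have h : ∀ ij, ent b (c • A) ij = c * ent b A ij := fun ij => by simp [ent]
    simp only [h, mul_assoc, ← Finset.mul_sum, hA f hf, mul_zero]

/-- Matrix entries as a linear equivalence. -/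
def entEquiv (b : Module.Basis (Fin n) ℂ E) : Module.End ℂ E ≃L[ℂ] (Ent n → ℂ) :=
  ((LinearMap.toMatrix b b).trans
      ((LinearEquiv.curry ℂ ℂ (Fin n) (Fin n)).symm)).toContinuousLinearEquiv

variable (b : Module.Basis (Fin n) ℂ E)

theorem entEquiv_apply (A : Module.End ℂ E) : entEquiv b A = ent b A := rfl

theorem continuous_ent : Continuous (ent b) := (entEquiv b).continuous

/-- The identity component of the real points is defined with the module topology; the analysis uses
the operator norm. In finite dimension the two topologies agree. -/
theorem end_topology_eq : (inferInstance : TopologicalSpace (Module.End ℂ E)) =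
    moduleTopology ℂ (Module.End ℂ E) :=
  have := IsModuleTopology.iso (R := ℂ) (entEquiv (Module.finBasis ℂ E)).symm
  eq_moduleTopology ℂ _

theorem ent_mul (A B : Module.End ℂ E) (i j) :
    ent b (A * B) (i, j) = ∑ k, ent b A (i, k) * ent b B (k, j) := by
  simp only [ent]
  rw [LinearMap.toMatrix_mul, Matrix.mul_apply]

/-- The conjugation on `End(E)` defined by a conjugation of `E`. -/
def conjEnd (σ : E →ₛₗ[starRingEnd ℂ] E) (hσ : Function.Involutive σ) :
    Module.End ℂ E →+* Module.End ℂ E where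
  toFun A := (σ.comp A).comp σ
  map_one' := by ext x; exact hσ x
  map_mul' A B := by ext x; simp [hσ (B (σ x))]
  map_zero' := by ext; simp
  map_add' A B := by ext; simp

section Conj

variable {b} {σ : E →ₛₗ[starRingEnd ℂ] E} (hσ : Function.Involutive σ)

@[simp] theorem conjEnd_apply (A : Module.End ℂ E) (v : E) :
    conjEnd σ hσ A v = σ (A (σ v)) := rfl

theorem conjEnd_conjEnd (A : Module.End ℂ E) : conjEnd σ hσ (conjEnd σ hσ A) = A := by
  ext x; simp [hσ x, hσ (A x)]

theorem conjEnd_smul (c : ℂ) (A : Module.End ℂ E) :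
    conjEnd σ hσ (c • A) = starRingEnd ℂ c • conjEnd σ hσ A := by
  ext; simp

theorem repr_conj (hb : ∀ i, σ (b i) = b i) (x : E) (i : Fin n) :
    b.repr (σ x) i = starRingEnd ℂ (b.repr x i) := by
  have h : σ x = ∑ j, starRingEnd ℂ (b.repr x j) • b j := by
    conv_lhs => rw [← b.sum_repr x]
    rw [map_sum]
    exact Finset.sum_congr rfl fun j _ => by rw [map_smulₛₗ, hb]
  rw [h, b.repr_sum_self]

theorem ent_conjEnd (hb : ∀ i, σ (b i) = b i) (A : Module.End ℂ E) (ij : Ent n) :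
    ent b (conjEnd σ hσ A) ij = starRingEnd ℂ (ent b A ij) := by
  simp only [ent, LinearMap.toMatrix_apply, conjEnd_apply, repr_conj hb, hb]

theorem continuous_conjEnd : Continuous (conjEnd σ hσ) := by
  let f : Module.End ℂ E →ₗ[ℝ] Module.End ℂ E :=
    { toFun := conjEnd σ hσ
      map_add' := map_add _
      map_smul' := fun c A => by
        rw [← Complex.coe_smul, conjEnd_smul]; simp }
  exact f.continuous_of_finiteDimensional

theorem exp_conjEnd (A : Module.End ℂ E) : conjEnd σ hσ (exp A) = exp (conjEnd σ hσ A) := by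
  have := end_completeSpace E
  let _ : NormedAlgebra ℚ (Module.End ℂ E) := NormedAlgebra.restrictScalars ℚ ℂ _
  exact map_exp (conjEnd σ hσ) (continuous_conjEnd hσ) A

end Conj

theorem hasDerivAt_eval {κ : Type*} [Fintype κ] (f : MvPolynomial κ ℂ) {c : ℂ → κ → ℂ}
    {c' : κ → ℂ} {t : ℂ} (hc : HasDerivAt c c' t) :
    HasDerivAt (fun s => MvPolynomial.eval (c s) f)
      (∑ i, c' i * MvPolynomial.eval (c t) (MvPolynomial.pderiv i f)) t := by
  classical
  have hc' := hasDerivAt_pi.1 hc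
  induction f using MvPolynomial.induction_on with
  | C a => simpa using hasDerivAt_const t a
  | add p q hp hq =>
    simp only [map_add]
    refine (hp.add hq).congr_deriv ?_
    simp only [mul_add, Finset.sum_add_distrib]
  | mul_X p n hp =>
    have := hp.mul (hc' n)
    simp only [map_mul, MvPolynomial.eval_X]
    refine this.congr_deriv ?_
    simp only [Derivation.leibniz, MvPolynomial.pderiv_X, map_add, smul_eq_mul, map_mul,
      MvPolynomial.eval_X, mul_add, Finset.sum_add_distrib, Finset.sum_mul]
    rw [add_comm]
    congr 1
    · rw [Finset.sum_eq_single n]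
      · simp; ring
      · intro b _ hb
        simp [Pi.single_apply, hb.symm]
      · simp
    · exact Finset.sum_congr rfl fun i _ => by ring

variable {b} {N : Subgroup (LinearMap.GeneralLinearGroup ℂ E)}

/-- The complex polynomial `f` vanishes on `N`. -/
def Vanishes (b : Module.Basis (Fin n) ℂ E) (N : Subgroup (LinearMap.GeneralLinearGroup ℂ E))
    (f : MvPolynomial (Ent n) ℂ) : Prop :=
  ∀ g ∈ N, MvPolynomial.eval (ent b (g : Module.End ℂ E)) f = 0

/-- The rational equations that define `N` are among the complex polynomials vanishing on `N`. This
form of the membership test matches the definition of the Zariski tangent space. -/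
theorem IsQAlg.mem_iff (hN : IsQAlg b N)
    (g : LinearMap.GeneralLinearGroup ℂ E) :
    g ∈ N ↔ ∀ f, Vanishes b N f →
      MvPolynomial.eval (ent b (g : Module.End ℂ E)) f = 0 := by
  refine ⟨fun hg f hf => hf g hg, fun h => ?_⟩
  obtain ⟨S, hS⟩ := hN
  have key : ∀ (g : LinearMap.GeneralLinearGroup ℂ E) (f : MvPolynomial (Ent n) ℚ),
      MvPolynomial.eval (ent b (g : Module.End ℂ E))
        (MvPolynomial.map (algebraMap ℚ ℂ) f) =
      MvPolynomial.aeval (ent b (g : Module.End ℂ E)) f := fun g f => by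
    rw [MvPolynomial.eval_map, MvPolynomial.aeval_def]
  refine (hS g).2 fun f hf => ?_
  rw [← key]
  exact h _ fun g' hg' => by rw [key]; exact (hS g').1 hg' f hf

theorem continuous_eval_ent (b : Module.Basis (Fin n) ℂ E) (f : MvPolynomial (Ent n) ℂ) :
    Continuous fun A : Module.End ℂ E => MvPolynomial.eval (ent b A) f :=
  (MvPolynomial.continuous_eval f).comp (continuous_ent b)

theorem IsQAlg.mem_of_closure (hN : IsQAlg b N)
    (u : LinearMap.GeneralLinearGroup ℂ E)
    (hu : (u : Module.End ℂ E) ∈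
      closure ((fun u : (Module.End ℂ E)ˣ => (u : Module.End ℂ E)) '' N)) :
    u ∈ N := by
  rw [hN.mem_iff]
  intro f hf
  have : IsClosed {A : Module.End ℂ E | MvPolynomial.eval (ent b A) f = 0} :=
    isClosed_eq (continuous_eval_ent b f) continuous_const
  refine closure_minimal ?_ this hu
  rintro _ ⟨g, hg, rfl⟩
  exact hf g hg

theorem IsQAlg.mem_of_tendsto (hN : IsQAlg b N) {α : Type*} {l : Filter α} [l.NeBot]
    {g : α → LinearMap.GeneralLinearGroup ℂ E} (hg : ∀ᶠ a in l, g a ∈ N)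
    {u : LinearMap.GeneralLinearGroup ℂ E}
    (hu : Tendsto (fun a => (g a : Module.End ℂ E)) l
      (𝓝 (u : Module.End ℂ E))) : u ∈ N :=
  hN.mem_of_closure u (mem_closure_of_tendsto hu (hg.mono fun a ha => ⟨g a, ha, rfl⟩))

/-- The polynomial `A ↦ f (g A)`. -/
def leftTranslate (b : Module.Basis (Fin n) ℂ E) (g : Module.End ℂ E) (f : MvPolynomial (Ent n) ℂ) :
    MvPolynomial (Ent n) ℂ :=
  MvPolynomial.bind₁ (fun ij : Ent n =>
    ∑ k, MvPolynomial.C (ent b g (ij.1, k)) * MvPolynomial.X (k, ij.2)) f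

theorem eval_leftTranslate (g A : Module.End ℂ E) (f : MvPolynomial (Ent n) ℂ) :
    MvPolynomial.eval (ent b A) (leftTranslate b g f) =
      MvPolynomial.eval (ent b (g * A)) f := by
  rw [leftTranslate, MvPolynomial.eval, MvPolynomial.eval₂Hom_bind₁]
  congr 1
  congr 1
  ext ij
  obtain ⟨i, j⟩ := ij
  rw [ent_mul]
  simp

/-- The derivation of the polynomial functions defined by the right multiplication by `X`. -/
def rightDeriv (b : Module.Basis (Fin n) ℂ E) (X : Module.End ℂ E) (f : MvPolynomial (Ent n) ℂ) :
    MvPolynomial (Ent n) ℂ :=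
  ∑ ij : Ent n, (∑ k, MvPolynomial.X (ij.1, k) * MvPolynomial.C (ent b X (k, ij.2))) *
    MvPolynomial.pderiv ij f

theorem eval_rightDeriv (X A : Module.End ℂ E) (f : MvPolynomial (Ent n) ℂ) :
    MvPolynomial.eval (ent b A) (rightDeriv b X f) =
      ∑ ij, ent b (A * X) ij * MvPolynomial.eval (ent b A) (MvPolynomial.pderiv ij f) := by
  simp only [rightDeriv, map_sum, map_mul, MvPolynomial.eval_X, MvPolynomial.eval_C]
  exact Finset.sum_congr rfl fun ij _ => by rw [← ent_mul]

theorem hasDerivAt_ent {c : ℂ → Module.End ℂ E} {c' : Module.End ℂ E}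
    {t : ℂ} (hc : HasDerivAt c c' t) : HasDerivAt (fun s => ent b (c s)) (ent b c') t :=
  (entEquiv b).toContinuousLinearMap.hasFDerivAt.comp_hasDerivAt t hc

/-- The derivative at `1`, in the direction `X`, of the translate `A ↦ f (g * A)` is the value at
`g` of `rightDeriv b X f`. For `g` in `N` the translate still vanishes on `N`. Thus the vanishing
ideal of `N` is stable under this derivation. -/
theorem vanishes_rightDeriv {X : Module.End ℂ E} (hX : X ∈ lie b N)
    {f : MvPolynomial (Ent n) ℂ} (hf : Vanishes b N f) : Vanishes b N (rightDeriv b X f) := by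
  intro g hg
  have h1 := hX (leftTranslate b g f) fun g' hg' => by
    rw [eval_leftTranslate, ← Units.val_mul]; exact hf _ (N.mul_mem hg hg')
  have hc : HasDerivAt (fun t : ℂ => (1 : Module.End ℂ E) + t • X) X 0 := by
    simpa using (hasDerivAt_id (0 : ℂ)).smul_const X |>.const_add 1
  have hd1 := hasDerivAt_eval (leftTranslate b g f) (hasDerivAt_ent (b := b) hc)
  have hc2 : HasDerivAt (fun t : ℂ => (g : Module.End ℂ E) * (1 + t • X)) (g * X) 0 :=
    hc.const_mul _
  have hd2 := hasDerivAt_eval f (hasDerivAt_ent (b := b) hc2)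
  simp only [eval_leftTranslate] at hd1
  have := hd1.unique hd2
  simp only [zero_smul, add_zero, mul_one] at this
  rw [eval_rightDeriv, ← this]
  exact h1

theorem deriv_eval_exp (b : Module.Basis (Fin n) ℂ E) (X : Module.End ℂ E) (f : MvPolynomial (Ent n) ℂ) (t : ℂ) :
    HasDerivAt (fun t : ℂ => MvPolynomial.eval (ent b (exp (t • X))) f)
      (MvPolynomial.eval (ent b (exp (t • X))) (rightDeriv b X f)) t := by
  have := end_completeSpace E
  rw [eval_rightDeriv]
  exact hasDerivAt_eval f (hasDerivAt_ent (b := b) (hasDerivAt_exp_smul_const X t))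

/-- For `f` in the vanishing ideal, every derivative at `0` of the entire function `t ↦ f (exp (t
X))` is the value at `1` of another element of the ideal, hence zero. So the function vanishes
identically. -/
theorem exp_mem_of_mem_lie (hN : IsQAlg b N) {X : Module.End ℂ E}
    (hX : X ∈ lie b N) {u : LinearMap.GeneralLinearGroup ℂ E}
    (hu : (u : Module.End ℂ E) = exp X) : u ∈ N := by
  rw [hN.mem_iff]
  intro f hf
  have hiter : ∀ (m : ℕ) (f : MvPolynomial (Ent n) ℂ), Vanishes b N f →
      iteratedDeriv m (fun t : ℂ => MvPolynomial.eval (ent b (exp (t • X))) f) 0 = 0 := by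
    intro m
    induction m with
    | zero =>
      intro f hf
      simpa using hf 1 N.one_mem
    | succ m ih =>
      intro f hf
      rw [iteratedDeriv_succ', show deriv (fun t : ℂ => MvPolynomial.eval (ent b (exp (t • X))) f)
        = _ from funext fun t => (deriv_eval_exp b X f t).deriv]
      exact ih _ (vanishes_rightDeriv hX hf)
  have h := Complex.taylorSeries_eq_of_entire' 0 1
    (f := fun t : ℂ => MvPolynomial.eval (ent b (exp (t • X))) f)
    (fun t => (deriv_eval_exp b X f t).differentiableAt)
  simp only [hiter _ f hf, mul_zero, zero_mul, tsum_zero, one_smul] at h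
  rw [hu, ← h]

theorem mem_lie_of_exp {X : Module.End ℂ E}
    (hX : ∀ t : ℝ, exp ((t : ℂ) • X) ∈
      (fun u : (Module.End ℂ E)ˣ => (u : Module.End ℂ E)) '' N) :
    X ∈ lie b N := by
  intro f hf
  have h1 := (deriv_eval_exp b X f 0).comp_ofReal (z := (0 : ℝ))
  have h2 : (fun t : ℝ => MvPolynomial.eval (ent b (exp ((t : ℂ) • X))) f) = fun _ => 0 := by
    ext t
    obtain ⟨u, hu, hut⟩ := hX t
    rw [← hut]
    exact hf u hu
  rw [h2] at h1
  have := h1.unique (hasDerivAt_const _ _)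
  simpa [eval_rightDeriv] using this

theorem mem_lie_iff (hN : IsQAlg b N) [CompleteSpace (Module.End ℂ E)]
    {X : Module.End ℂ E} :
    X ∈ lie b N ↔ ∀ t : ℂ, expU (t • X) ∈ N :=
  ⟨fun h t => exp_mem_of_mem_lie hN ((lie b N).smul_mem t h) rfl,
    fun h => mem_lie_of_exp fun t => ⟨expU ((t : ℂ) • X), h t, rfl⟩⟩

section Conj

variable {σ : E →ₛₗ[starRingEnd ℂ] E} (hσ : Function.Involutive σ)

/-- The conjugation on `GL(E)` defined by a conjugation of `E`. -/
def conjGL (σ : E →ₛₗ[starRingEnd ℂ] E) (hσ : Function.Involutive σ) :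
    LinearMap.GeneralLinearGroup ℂ E →* LinearMap.GeneralLinearGroup ℂ E :=
  Units.map (conjEnd σ hσ).toMonoidHom

theorem conjGL_val (g : LinearMap.GeneralLinearGroup ℂ E) :
    (conjGL σ hσ g : Module.End ℂ E) = conjEnd σ hσ g := rfl

theorem IsQAlg.conjGL_mem (hN : IsQAlg b N) (hb : ∀ i, σ (b i) = b i)
    {g : LinearMap.GeneralLinearGroup ℂ E} (hg : g ∈ N) : conjGL σ hσ g ∈ N := by
  obtain ⟨S, hS⟩ := hN
  rw [hS] at hg ⊢
  intro f hf
  have h1 : ent b (conjGL σ hσ g : Module.End ℂ E) =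
      fun ij => starRingEnd ℂ (ent b (g : Module.End ℂ E) ij) :=
    funext fun ij => ent_conjEnd hσ hb _ ij
  have h2 := congrArg (starRingEnd ℂ) (hg f hf)
  rw [map_zero, MvPolynomial.aeval_def, MvPolynomial.hom_eval₂] at h2
  rw [h1, MvPolynomial.aeval_def, ← h2]
  congr 1
  ext q; simp

/-- Rational equations make `N` stable under conjugation; the Lie algebra inherits this through its
characterization by exponentials. -/
theorem conjEnd_mem_lie (hN : IsQAlg b N) (hb : ∀ i, σ (b i) = b i) {X : Module.End ℂ E}
    (hX : X ∈ lie b N) : conjEnd σ hσ X ∈ lie b N := by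
  have := end_completeSpace E
  rw [mem_lie_iff hN] at hX ⊢
  intro t
  have h1 := hN.conjGL_mem hσ hb (hX (starRingEnd ℂ t))
  convert h1 using 1
  apply Units.ext
  change exp _ = conjEnd σ hσ (exp _)
  rw [exp_conjEnd, conjEnd_smul]
  simp

end Conj

theorem conj_mem_lie (hN : IsQAlg b N) {X : Module.End ℂ E}
    (hX : X ∈ lie b N) {g : LinearMap.GeneralLinearGroup ℂ E}
    (hg : ∀ n ∈ N, g * n * g⁻¹ ∈ N) :
    (g : Module.End ℂ E) * X * (g⁻¹ : LinearMap.GeneralLinearGroup ℂ E) ∈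
      lie b N := by
  have := end_completeSpace E
  rw [mem_lie_iff hN] at hX ⊢
  intro t
  have h1 := hg _ (hX t)
  rw [← expU_conj] at h1
  convert h1 using 2
  simp

end AlgGroup

/-! ### Filtered vector spaces with a real structure and graded forms -/

section Sys

open NormedSpace Filter Topology

variable {E : Type*} [NormedAddCommGroup E] [NormedSpace ℂ E] [FiniteDimensional ℂ E] {n : ℕ}

attribute [local instance] endNormedRing endNormedAlgebra

variable (E) in
/-- A complex vector space with a real structure, a weight filtration, and bilinear forms on the
graded pieces (regarded as degenerate forms on the whole space). -/
structure Sys where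
  σ : E →ₛₗ[starRingEnd ℂ] E
  invol : Function.Involutive σ
  W : ℤ → Submodule ℂ E
  mono : Monotone W
  bot : ∃ a, W a = ⊥
  top : ∃ a, W a = ⊤
  W_conj : ∀ {k v}, v ∈ W k → σ v ∈ W k
  β : ℤ → LinearMap.BilinForm ℂ E
  β_congr : ∀ {k u u' v v'}, u - u' ∈ W (k - 1) → v - v' ∈ W (k - 1) → β k u v = β k u' v'
  β_nondeg : ∀ {k u}, u ∈ W k → (∀ v ∈ W k, β k u v = 0) → u ∈ W (k - 1)

namespace Sys

variable (S : Sys E)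

/-- The conjugate filtration. -/
def cF (F : ℤ → Submodule ℂ E) (q : ℤ) : Submodule ℂ E := (F q).map S.σ

variable {S} in
theorem mem_cF {F : ℤ → Submodule ℂ E} {q : ℤ} {v : E} : v ∈ S.cF F q ↔ S.σ v ∈ F q := by
  constructor
  · rintro ⟨w, hw, rfl⟩; rwa [S.invol]
  · intro h; exact ⟨_, h, S.invol v⟩

/-- `F` is a polarized mixed Hodge structure. -/
structure Pt (F : ℤ → Submodule ℂ E) : Prop where
  opp : Opposed S.W F (S.cF F)
  pos : ∀ {k p q u v}, p + q = k → u ∈ F p ⊓ S.W k → v ∈ S.cF F q ⊓ S.W k →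
    u - v ∈ S.W (k - 1) → S.β k u (S.σ u) = 0 → u ∈ S.W (k - 1)

/-- `N` is an algebraic `ℚ`-group that preserves the weight filtration and the forms, the latter up
to scalars. -/
structure Grp (b : Module.Basis (Fin n) ℂ E) (N : Subgroup (LinearMap.GeneralLinearGroup ℂ E)) :
    Prop where
  alg : IsQAlg b N
  real : ∀ i, S.σ (b i) = b i
  map_W : ∀ g ∈ N, ∀ k, ∀ v ∈ S.W k, (g : Module.End ℂ E) v ∈ S.W k
  scale : ∀ g ∈ N, ∀ k, ∃ c : ℂ, ∀ u ∈ S.W k, ∀ v ∈ S.W k,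
    S.β k ((g : Module.End ℂ E) u) ((g : Module.End ℂ E) v) = c * S.β k u v

end Sys

theorem hasDerivAt_mem {X : Type*} [NormedAddCommGroup X] [NormedSpace ℂ X]
    [FiniteDimensional ℂ X] (T : Submodule ℂ X) {c : ℂ → X} {c' : X} {t : ℂ}
    (hc : HasDerivAt c c' t) (h : ∀ s, c s ∈ T) : c' ∈ T := by
  have h1 := hasDerivAt_iff_tendsto_slope.1 hc
  exact T.closed_of_finiteDimensional.mem_of_tendsto h1
    (Eventually.of_forall fun s => T.smul_mem _ (T.sub_mem (h s) (h t)))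

theorem hasDerivAt_end_apply {c : ℂ → Module.End ℂ E} {c' : Module.End ℂ E} {t : ℂ}
    (hc : HasDerivAt c c' t) (v : E) : HasDerivAt (fun s => c s v) (c' v) t :=
  (LinearMap.toContinuousLinearMap
    (LinearMap.applyₗ v : Module.End ℂ E →ₗ[ℂ] E)).hasFDerivAt.comp_hasDerivAt t hc

theorem hasDerivAt_bilin (B : LinearMap.BilinForm ℂ E) {c d : ℂ → E} {c' d' : E} {t : ℂ}
    (hc : HasDerivAt c c' t) (hd : HasDerivAt d d' t) :
    HasDerivAt (fun s => B (c s) (d s)) (B c' (d t) + B (c t) d') t := by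
  have h1 : HasDerivAt (fun s => LinearMap.toContinuousBilinearMap B (c s))
      (LinearMap.toContinuousBilinearMap B c') t :=
    (LinearMap.toContinuousBilinearMap B).hasFDerivAt.comp_hasDerivAt t hc
  exact h1.clm_apply hd

theorem hasDerivAt_exp_apply (X : Module.End ℂ E) (t : ℂ) (v : E) :
    HasDerivAt (fun s : ℂ => exp (s • X) v) (exp (t • X) (X v)) t := by
  have := end_completeSpace E
  exact hasDerivAt_end_apply (hasDerivAt_exp_smul_const X t) v

theorem exp_zero_smul_apply (X : Module.End ℂ E) (v : E) : exp ((0 : ℂ) • X) v = v := by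
  let _ : NormedAlgebra ℚ (Module.End ℂ E) := NormedAlgebra.restrictScalars ℚ ℂ _
  rw [zero_smul, exp_zero, Module.End.one_apply]

theorem exp_mem_of_mem {X : Module.End ℂ E} {T : Submodule ℂ E} (h : ∀ v ∈ T, X v ∈ T) {v : E}
    (hv : v ∈ T) : exp X v ∈ T := by
  have := end_completeSpace E
  have h1 : HasSum (fun m : ℕ => ((m.factorial : ℂ)⁻¹ • X ^ m)) (exp X) := 
    exp_series_hasSum_exp' X
  have h2 := (LinearMap.toContinuousLinearMap
    (LinearMap.applyₗ v : Module.End ℂ E →ₗ[ℂ] E)).hasSum h1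
  have h3 : ∀ m : ℕ, (X ^ m) v ∈ T := fun m => by
    induction m with
    | zero => simpa
    | succ m ih => rw [pow_succ']; exact h _ ih
  exact T.closed_of_finiteDimensional.mem_of_tendsto h2
    (Eventually.of_forall fun s => T.sum_mem fun m _ => T.smul_mem _ (h3 m))

/-- The exponential of an endomorphism that maps a filtration step `T` into a smaller `T'`. -/
theorem exp_sub_mem {X : Module.End ℂ E} {T T' : Submodule ℂ E} (h : ∀ v ∈ T, X v ∈ T')
    (h' : ∀ v ∈ T', X v ∈ T') {v : E} (hv : v ∈ T) : exp X v - v ∈ T' := by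
  have := end_completeSpace E
  have h1 : HasSum (fun m : ℕ => ((m.factorial : ℂ)⁻¹ • X ^ m)) (exp X) := 
    exp_series_hasSum_exp' X
  have h2 := (LinearMap.toContinuousLinearMap
    (LinearMap.applyₗ v : Module.End ℂ E →ₗ[ℂ] E)).hasSum h1
  have h4 := (hasSum_nat_add_iff' 1).2 h2
  have h3 : ∀ m : ℕ, (X ^ (m + 1)) v ∈ T' := fun m => by
    induction m with
    | zero => simpa using h v hv
    | succ m ih => rw [pow_succ']; exact h' _ ih
  have h5 := T'.closed_of_finiteDimensional.mem_of_tendsto h4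
    (Eventually.of_forall fun s => T'.sum_mem fun m _ => by
      simpa using T'.smul_mem _ (h3 m))
  simpa using h5

theorem exp_bilin {B : LinearMap.BilinForm ℂ E} {T : Submodule ℂ E} {X : Module.End ℂ E}
    (hX : ∀ v ∈ T, X v ∈ T) (h : ∀ u ∈ T, ∀ v ∈ T, B (X u) v + B u (X v) = 0) {u v : E}
    (hu : u ∈ T) (hv : v ∈ T) : B (exp X u) (exp X v) = B u v := by
  have hd : ∀ t : ℂ, HasDerivAt (fun t : ℂ => B (exp (t • X) u) (exp (t • X) v)) 0 t := by
    intro t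
    have h1 := hasDerivAt_bilin B (hasDerivAt_exp_apply X t u) (hasDerivAt_exp_apply X t v)
    refine h1.congr_deriv ?_
    have hc : ∀ w, exp (t • X) (X w) = X (exp (t • X) w) := fun w => by
      let _ : NormedAlgebra ℚ (Module.End ℂ E) := NormedAlgebra.restrictScalars ℚ ℂ _
      have := ((Commute.refl X).smul_left t).exp_left
      exact congrArg (fun A : Module.End ℂ E => A w) this.eq
    have ht : ∀ v ∈ T, (t • X) v ∈ T := fun v hv => T.smul_mem t (hX v hv)
    rw [hc, hc]
    exact h _ (exp_mem_of_mem ht hu) _ (exp_mem_of_mem ht hv)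
  have h2 := is_const_of_deriv_eq_zero (fun t => (hd t).differentiableAt)
    (fun t => (hd t).deriv) 1 0
  simpa [exp_zero_smul_apply] using h2

namespace Sys

variable {S : Sys E} {b : Module.Basis (Fin n) ℂ E}
  {N : Subgroup (LinearMap.GeneralLinearGroup ℂ E)} {X : Module.End ℂ E}

theorem Grp.exp_mem (hN : S.Grp b N) (hX : X ∈ lie b N) (t : ℂ) :
    have := end_completeSpace E
    expU (t • X) ∈ N :=
  have := end_completeSpace E
  (mem_lie_iff hN.alg).1 hX t

theorem Grp.lie_map_W (hN : S.Grp b N) (hX : X ∈ lie b N) {k : ℤ} {v : E} (hv : v ∈ S.W k) :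
    X v ∈ S.W k := by
  have h := hasDerivAt_mem (S.W k) (hasDerivAt_exp_apply X 0 v)
    fun t => hN.map_W _ (hN.exp_mem hX t) k v hv
  rwa [exp_zero_smul_apply] at h

/-- The multiplier of `exp (t X)` is not known to be differentiable in `t`. What is differentiated
is the proportionality of the values at two pairs of vectors, in which the multiplier has been
eliminated. -/
theorem Grp.lie_β (hN : S.Grp b N) (hX : X ∈ lie b N) (k : ℤ) :
    ∃ c : ℂ, ∀ u ∈ S.W k, ∀ v ∈ S.W k,
      S.β k (X u) v + S.β k u (X v) = c * S.β k u v := by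
  have hd : ∀ u v, HasDerivAt (fun t : ℂ => S.β k (exp (t • X) u) (exp (t • X) v))
      (S.β k (X u) v + S.β k u (X v)) 0 := fun u v => by
    simpa only [exp_zero_smul_apply] using
      hasDerivAt_bilin (S.β k) (hasDerivAt_exp_apply X 0 u) (hasDerivAt_exp_apply X 0 v)
  by_cases h0 : ∀ u ∈ S.W k, ∀ v ∈ S.W k, S.β k u v = 0
  · refine ⟨0, fun u hu v hv => ?_⟩
    rw [h0 _ (hN.lie_map_W hX hu) _ hv, h0 _ hu _ (hN.lie_map_W hX hv)]; simp
  · push Not at h0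
    obtain ⟨u', hu', v', hv', hne⟩ := h0
    refine ⟨(S.β k (X u') v' + S.β k u' (X v')) / S.β k u' v', fun u hu v hv => ?_⟩
    have h1 := (hd u v).mul_const (S.β k u' v')
    have h2 := (hd u' v').mul_const (S.β k u v)
    have h3 : (fun t : ℂ => S.β k (exp (t • X) u) (exp (t • X) v) * S.β k u' v') =
        fun t : ℂ => S.β k (exp (t • X) u') (exp (t • X) v') * S.β k u v := by
      ext t
      obtain ⟨c, hc⟩ := hN.scale _ (hN.exp_mem hX t) k
      have e1 := hc u hu v hv
      have e2 := hc u' hu' v' hv'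
      rw [expU_val] at e1 e2
      rw [e1, e2]; ring
    rw [h3] at h1
    field_simp
    exact h1.unique h2

/-- With multiplier `c`, moving `X` across the form turns it into `c - X`. If `c ≠ 0`, this is
bijective on `W k` when `X` is nilpotent; writing `v = (c - X) ^ m w` with `X ^ m = 0` gives `β u v
= β (X ^ m u) w = 0`. So either `c = 0` or the form vanishes, and `X` is skew in both cases. -/
theorem Grp.lie_β_of_isNilpotent (hN : S.Grp b N) (hX : X ∈ lie b N) (hnil : IsNilpotent X)
    {k : ℤ} {u v : E} (hu : u ∈ S.W k) (hv : v ∈ S.W k) :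
    S.β k (X u) v + S.β k u (X v) = 0 := by
  obtain ⟨c, hc⟩ := hN.lie_β hX k
  rw [hc u hu v hv]
  by_cases hc0 : c = 0
  · simp [hc0]
  have hmap : ∀ v ∈ S.W k, (c • 1 - X : Module.End ℂ E) v ∈ S.W k := fun v hv =>
    (S.W k).sub_mem ((S.W k).smul_mem c hv) (hN.lie_map_W hX hv)
  have hinj : Function.Injective (c • 1 - X : Module.End ℂ E) := by
    have h1 : IsUnit (c • 1 - X : Module.End ℂ E) :=
      sub_eq_add_neg (c • (1 : Module.End ℂ E)) X ▸
        hnil.neg.isUnit_add_left_of_commute ((Units.mk0 c hc0 • (1 : (Module.End ℂ E)ˣ)).isUnit)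
          ((Commute.one_right _).smul_right c)
    exact ((Module.End.isUnit_iff _).1 h1).1
  have hpow : ∀ m : ℕ, ∀ v ∈ S.W k, ∃ w ∈ S.W k, ((c • 1 - X : Module.End ℂ E) ^ m) w = v := by
    intro m
    induction m with
    | zero => exact fun v hv => ⟨v, hv, rfl⟩
    | succ m ih =>
      intro v hv
      obtain ⟨w, hw, hwv⟩ := ih v hv
      have hsurj := (LinearMap.injective_iff_surjective
        (f := (c • 1 - X : Module.End ℂ E).restrict hmap)).1 (fun x y hxy => by
          have := congrArg Subtype.val hxy
          exact Subtype.ext (hinj this))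
      obtain ⟨w', hw'⟩ := hsurj ⟨w, hw⟩
      refine ⟨w', w'.2, ?_⟩
      rw [pow_succ, Module.End.mul_apply, ← hwv]
      exact congrArg _ (congrArg Subtype.val hw')
  have hshift : ∀ m : ℕ, ∀ u ∈ S.W k, ∀ v ∈ S.W k,
      S.β k ((X ^ m) u) v = S.β k u (((c • 1 - X : Module.End ℂ E) ^ m) v) := by
    intro m
    induction m with
    | zero => simp
    | succ m ih =>
      intro u hu v hv
      rw [pow_succ, Module.End.mul_apply, ih _ (hN.lie_map_W hX hu) _ hv, pow_succ',
        Module.End.mul_apply]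
      have hm : ((c • 1 - X : Module.End ℂ E) ^ m) v ∈ S.W k := by
        clear ih
        induction m with
        | zero => simpa
        | succ m ih => rw [pow_succ', Module.End.mul_apply]; exact hmap _ ih
      have := hc u hu _ hm
      simp only [LinearMap.sub_apply, LinearMap.smul_apply, Module.End.one_apply, map_sub, map_smul,
        smul_eq_mul]
      linear_combination this
  obtain ⟨m, hm⟩ := hnil
  obtain ⟨w, hw, rfl⟩ := hpow m v hv
  rw [← hshift m u hu w hw, hm]
  simp

end Sys

end Sys

open NormedSpace Filter Topology

/-! ### Gradings -/

section Grading

variable {E : Type*} [AddCommGroup E] [Module ℂ E]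

/-- An `f`-stable subspace contains the components of its elements along distinct eigenvalues. The
induction removes the term `a` by applying `f - c a`. -/
theorem mem_of_sum_mem {M ι : Type*} [AddCommGroup M] [Module ℂ M] (f : M →ₗ[ℂ] M)
    {p : Submodule ℂ M} (hp : ∀ x ∈ p, f x ∈ p) (s : Finset ι) (x : ι → M) (c : ι → ℂ)
    (hc : Set.InjOn c s) (hx : ∀ i ∈ s, f (x i) = c i • x i) (hs : ∑ i ∈ s, x i ∈ p) :
    ∀ i ∈ s, x i ∈ p := by
  classical
  induction s using Finset.induction_on generalizing x with
  | empty => simp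
  | insert a s ha ih =>
    have hs' := p.sub_mem (hp _ hs) (p.smul_mem (c a) hs)
    rw [map_sum, Finset.sum_insert ha, Finset.sum_insert ha, smul_add,
      hx a (Finset.mem_insert_self a s), add_sub_add_left_eq_sub, Finset.smul_sum,
      ← Finset.sum_sub_distrib] at hs'
    have h1 := ih (fun i => f (x i) - c a • x i) (hc.mono (by simp)) (fun i hi => by
      rw [hx i (Finset.mem_insert_of_mem hi), map_sub, map_smul, map_smul,
        hx i (Finset.mem_insert_of_mem hi)]
      module) hs'
    have h2 : ∀ i ∈ s, x i ∈ p := fun i hi => by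
      have := h1 i hi
      simp only [hx i (Finset.mem_insert_of_mem hi), ← sub_smul] at this
      have hne : c i - c a ≠ 0 := sub_ne_zero.2 fun h =>
        ha ((hc (by simp [hi]) (by simp) h) ▸ hi)
      exact (p.smul_mem_iff hne).1 this
    intro i hi
    rcases Finset.mem_insert.1 hi with rfl | hi
    · rw [Finset.sum_insert ha] at hs
      exact (p.add_mem_iff_left (p.sum_mem h2)).1 hs
    · exact h2 i hi

variable {ι : Type*} [DecidableEq ι] {I : ι → Submodule ℂ E}

theorem exists_finset_eq_bot [FiniteDimensional ℂ E] (hI : DirectSum.IsInternal I) :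
    ∃ s : Finset ι, ∀ i ∉ s, I i = ⊥ := by
  have h := WellFoundedGT.finite_ne_bot_of_iSupIndep hI.submodule_iSupIndep
  exact ⟨h.toFinset, fun i hi => by simpa using hi⟩

/-- The projection onto a summand. -/
def proj (hI : DirectSum.IsInternal I) (i : ι) : Module.End ℂ E := diag hI (Pi.single i 1)

theorem proj_apply_self (hI : DirectSum.IsInternal I) {i : ι} {v : E} (hv : v ∈ I i) :
    proj hI i v = v := by
  rw [proj, diag_apply hI _ hv]; simp

theorem proj_apply_ne (hI : DirectSum.IsInternal I) {i j : ι} (hij : j ≠ i) {v : E}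
    (hv : v ∈ I j) : proj hI i v = 0 := by
  rw [proj, diag_apply hI _ hv, Pi.single_eq_of_ne hij, zero_smul]

theorem proj_mem (hI : DirectSum.IsInternal I) (i : ι) (v : E) : proj hI i v ∈ I i := by
  have := diag_mem_iSup hI (Pi.single i (1 : ℂ)) (p := fun j => j = i)
    (fun j hj => Pi.single_eq_of_ne hj _) v
  simpa [proj] using this

theorem diag_eq_sum (hI : DirectSum.IsInternal I) {s : Finset ι} (hs : ∀ i ∉ s, I i = ⊥)
    (c : ι → ℂ) : diag hI c = ∑ i ∈ s, c i • proj hI i := by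
  refine ext_of_isInternal hI fun j v hv => ?_
  rw [diag_apply hI c hv, LinearMap.sum_apply]
  by_cases hj : j ∈ s
  · rw [Finset.sum_eq_single_of_mem j hj fun i _ hij => ?_]
    · rw [LinearMap.smul_apply, proj_apply_self hI hv]
    · rw [LinearMap.smul_apply, proj_apply_ne hI hij.symm hv, smul_zero]
  · have : v = 0 := by simpa [hs j hj] using hv
    simp [this]

theorem sum_proj (hI : DirectSum.IsInternal I) {s : Finset ι} (hs : ∀ i ∉ s, I i = ⊥) :
    ∑ i ∈ s, proj hI i = 1 := by
  rw [← diag_one hI, diag_eq_sum hI hs]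
  simp

theorem proj_eq_zero_of_mem_iSup (hI : DirectSum.IsInternal I) {p : ι → Prop} {i : ι} (hi : ¬ p i)
    {v : E} (hv : v ∈ ⨆ j, ⨆ _ : p j, I j) : proj hI i v = 0 := by
  have := diag_apply_of_mem_iSup hI (Pi.single i (1 : ℂ)) 0 (p := p)
    (fun j hj => Pi.single_eq_of_ne (fun h : j = i => hi (h ▸ hj)) _) hv
  rwa [zero_smul] at this

theorem mem_iSup_of_proj (hI : DirectSum.IsInternal I) {p : ι → Prop} [FiniteDimensional ℂ E]
    {v : E} (hv : ∀ i, ¬ p i → proj hI i v = 0) : v ∈ ⨆ j, ⨆ _ : p j, I j := by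
  obtain ⟨s, hs⟩ := exists_finset_eq_bot hI
  have h1 : v = ∑ i ∈ s, proj hI i v := by
    conv_lhs => rw [← Module.End.one_apply (R := ℂ) v, ← sum_proj hI hs, LinearMap.sum_apply]
  rw [h1]
  refine Submodule.sum_mem _ fun i _ => ?_
  by_cases hp : p i
  · exact Submodule.mem_iSup_of_mem i (Submodule.mem_iSup_of_mem hp (proj_mem hI i v))
  · rw [hv i hp]; exact Submodule.zero_mem _

/-- The unit attached to invertible scalars. -/
def diagUnit (hI : DirectSum.IsInternal I) (c : ι → ℂˣ) : (Module.End ℂ E)ˣ where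
  val := diag hI fun i => c i
  inv := diag hI fun i => (c i)⁻¹
  val_inv := by
    rw [diag_mul, ← diag_one hI]
    congr 1; ext i; simp
  inv_val := by
    rw [diag_mul, ← diag_one hI]
    congr 1; ext i; simp

end Grading

/-! ### The grading of the Lie algebra -/

section Base

variable {E : Type*} [NormedAddCommGroup E] [NormedSpace ℂ E] [FiniteDimensional ℂ E] {n : ℕ}

attribute [local instance] endNormedRing endNormedAlgebra

namespace Sys

/-- Deligne's splitting. -/
abbrev I (S : Sys E) (F : ℤ → Submodule ℂ E) (i : ℤ × ℤ) : Submodule ℂ E :=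
  splitPart S.W F (S.cF F) i.1 i.2

/-- The bigrading of `End E`. -/
def adj (S : Sys E) (F : ℤ → Submodule ℂ E) (m : ℤ × ℤ) : Submodule ℂ (Module.End ℂ E) where
  carrier := {A | ∀ i, ∀ v ∈ S.I F i, A v ∈ S.I F (i + m)}
  add_mem' hA hB p v hv := add_mem (hA p v hv) (hB p v hv)
  zero_mem' _ _ _ := zero_mem _
  smul_mem' c _ hA p v hv := Submodule.smul_mem _ c (hA p v hv)

/-- `N` is normalized by the torus attached to the Hodge structure `F`. -/
structure Base (S : Sys E) (b : Module.Basis (Fin n) ℂ E)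
    (N : Subgroup (LinearMap.GeneralLinearGroup ℂ E)) (F : ℤ → Submodule ℂ E) : Prop where
  grp : S.Grp b N
  pt : S.Pt F
  torus : ∀ z w : ℂˣ, ∀ t : LinearMap.GeneralLinearGroup ℂ E,
    (∀ p q, ∀ v ∈ splitPart S.W F (S.cF F) p q,
      (t : Module.End ℂ E) v = ((z : ℂ) ^ (-p) * (w : ℂ) ^ (-q)) • v) →
    ∀ g ∈ N, t * g * t⁻¹ ∈ N

variable {S : Sys E} {b : Module.Basis (Fin n) ℂ E}
  {N : Subgroup (LinearMap.GeneralLinearGroup ℂ E)} {F : ℤ → Submodule ℂ E}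

theorem I_le_W (i : ℤ × ℤ) : S.I F i ≤ S.W (i.1 + i.2) := splitPart_le_W _ _

theorem I_le_F (i : ℤ × ℤ) : S.I F i ≤ F i.1 := splitPart_le_F _ _

theorem Pt.isInternal (h : S.Pt F) : DirectSum.IsInternal (S.I F) := h.opp.isInternal

theorem Pt.W_eq (h : S.Pt F) (k : ℤ) : S.W k = ⨆ i : ℤ × ℤ, ⨆ _ : i.1 + i.2 ≤ k, S.I F i :=
  h.opp.W_eq k

theorem Pt.F_eq (h : S.Pt F) (p : ℤ) : F p = ⨆ i : ℤ × ℤ, ⨆ _ : p ≤ i.1, S.I F i :=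
  h.opp.F_eq p

theorem Pt.eq_zero_of_mem_I (h : S.Pt F) {i : ℤ × ℤ} {k : ℤ} (hk : k < i.1 + i.2) {v : E}
    (hv : v ∈ S.I F i) (hv' : v ∈ S.W k) : v = 0 := by
  have := h.opp.splitPart_inf i.1 i.2
  rw [eq_bot_iff] at this
  exact this ⟨hv, S.mono (by omega) hv'⟩

/-- The element `(z, w)` of the torus. -/
def Pt.tor (h : S.Pt F) (z w : ℂˣ) : LinearMap.GeneralLinearGroup ℂ E :=
  diagUnit h.isInternal fun i => z ^ (-i.1) * w ^ (-i.2)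

theorem Pt.tor_apply (h : S.Pt F) (z w : ℂˣ) {i : ℤ × ℤ} {v : E} (hv : v ∈ S.I F i) :
    (h.tor z w : Module.End ℂ E) v = ((z : ℂ) ^ (-i.1) * (w : ℂ) ^ (-i.2)) • v := by
  refine (diag_apply h.isInternal _ hv).trans ?_
  simp

theorem Base.tor_conj_mem (h : S.Base b N F) (z w : ℂˣ) {g : LinearMap.GeneralLinearGroup ℂ E}
    (hg : g ∈ N) : h.pt.tor z w * g * (h.pt.tor z w)⁻¹ ∈ N :=
  h.torus z w _ (fun p q _ hv => h.pt.tor_apply z w (i := (p, q)) hv) g hg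

theorem Pt.tor_adj (h : S.Pt F) (z w : ℂˣ) {m : ℤ × ℤ} {A : Module.End ℂ E} (hA : A ∈ S.adj F m) :
    (h.tor z w : Module.End ℂ E) * A * ((h.tor z w)⁻¹ : LinearMap.GeneralLinearGroup ℂ E) =
      ((z : ℂ) ^ (-m.1) * (w : ℂ) ^ (-m.2)) • A := by
  have key : (h.tor z w : Module.End ℂ E) * A =
      ((z : ℂ) ^ (-m.1) * (w : ℂ) ^ (-m.2)) • (A * (h.tor z w : Module.End ℂ E)) := by
    refine ext_of_isInternal h.isInternal fun i v hv => ?_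
    rw [Module.End.mul_apply, h.tor_apply z w (hA i v hv), LinearMap.smul_apply,
      Module.End.mul_apply, h.tor_apply z w hv, map_smul, smul_smul]
    congr 1
    simp only [Prod.fst_add, Prod.snd_add, neg_add, zpow_add₀ z.ne_zero, zpow_add₀ w.ne_zero]
    ring
  rw [key, smul_mul_assoc, mul_assoc, Units.mul_inv, mul_one]

/-- By unique factorization, the single torus element `(2, 3)` acts on the bidegrees by pairwise
distinct scalars; it alone splits every stable subspace into its bihomogeneous parts. -/
theorem two_three_injective :
    Function.Injective fun m : ℤ × ℤ => (2 : ℂ) ^ (-m.1) * (3 : ℂ) ^ (-m.2) := by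
  rintro ⟨a, b⟩ ⟨c, d⟩ h
  have h' : (2 : ℚ) ^ (-a) * (3 : ℚ) ^ (-b) = (2 : ℚ) ^ (-c) * (3 : ℚ) ^ (-d) := by
    apply Rat.cast_injective (α := ℂ)
    push_cast
    exact h
  have two : Fact (Nat.Prime 2) := ⟨Nat.prime_two⟩
  have three : Fact (Nat.Prime 3) := ⟨Nat.prime_three⟩
  have e : ∀ p : ℕ, [Fact p.Prime] → ∀ a b : ℤ, padicValRat p ((2 : ℚ) ^ (-a) * (3 : ℚ) ^ (-b)) =
      -a * padicValRat p 2 + -b * padicValRat p 3 := fun p _ a b => by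
    rw [padicValRat.mul (by positivity) (by positivity), padicValRat.zpow, padicValRat.zpow]
  have h2 := congrArg (padicValRat 2) h'
  have h3 := congrArg (padicValRat 3) h'
  rw [e, e] at h2 h3
  have e22 : padicValRat 2 2 = 1 := by simpa using padicValRat.self (p := 2) (by norm_num)
  have e33 : padicValRat 3 3 = 1 := by simpa using padicValRat.self (p := 3) (by norm_num)
  have e23 : padicValRat 2 3 = 0 := by
    have := padicValRat.of_nat (p := 2) (n := 3)
    rw [padicValNat.eq_zero_of_not_dvd (by norm_num)] at this
    simpa using this
  have e32 : padicValRat 3 2 = 0 := by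
    have := padicValRat.of_nat (p := 3) (n := 2)
    rw [padicValNat.eq_zero_of_not_dvd (by norm_num)] at this
    simpa using this
  rw [e22, e23] at h2
  rw [e33, e32] at h3
  ext <;> simp only <;> linarith

/-- Conjugation by the torus element `(2, 3)` preserves `Lie N` and has distinct eigenvalues on the
bihomogeneous components, so these components lie in `Lie N`. Those of positive weight vanish
because `Lie N` preserves the weight filtration. -/
theorem Base.lie_le (h : S.Base b N F) : lie b N ≤
    ⨆ m : ℤ × ℤ, ⨆ _ : m.1 + m.2 ≤ 0, lie b N ⊓ S.adj F m := by
  classical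
  intro X hX
  have hI := h.pt.isInternal
  obtain ⟨s, hs⟩ := exists_finset_eq_bot hI
  let Y : ℤ × ℤ → Module.End ℂ E := fun m =>
    ∑ x ∈ s ×ˢ s with x.2 - x.1 = m, proj hI x.2 * X * proj hI x.1
  let s' : Finset (ℤ × ℤ) := (s ×ˢ s).image fun x => x.2 - x.1
  have hsum : ∑ m ∈ s', Y m = X := by
    rw [Finset.sum_fiberwise_of_maps_to (fun x hx => Finset.mem_image_of_mem _ hx),
      Finset.sum_product_right]
    simp only [← Finset.mul_sum, ← Finset.sum_mul, sum_proj hI hs, mul_one, one_mul]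
  have hadj : ∀ m, Y m ∈ S.adj F m := by
    intro m
    refine Submodule.sum_mem _ fun x hx => ?_
    intro i v hv
    obtain ⟨-, rfl⟩ := Finset.mem_filter.1 hx
    rw [Module.End.mul_apply, Module.End.mul_apply]
    by_cases hi : i = x.1
    · subst hi
      rw [add_sub_cancel]
      exact proj_mem hI _ _
    · rw [proj_apply_ne hI hi hv, map_zero, map_zero]
      exact Submodule.zero_mem _
  let t := h.pt.tor (Units.mk0 2 two_ne_zero) (Units.mk0 3 three_ne_zero)
  let f : Module.End ℂ E →ₗ[ℂ] Module.End ℂ E :=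
    LinearMap.mulLeft ℂ (t : Module.End ℂ E) ∘ₗ
      LinearMap.mulRight ℂ ((t⁻¹ : LinearMap.GeneralLinearGroup ℂ E) : Module.End ℂ E)
  have hf : ∀ A, f A = (t : Module.End ℂ E) * A *
      ((t⁻¹ : LinearMap.GeneralLinearGroup ℂ E) : Module.End ℂ E) := fun A => (mul_assoc _ _ _).symm
  have hmem : ∀ m ∈ s', Y m ∈ lie b N := by
    refine mem_of_sum_mem f (fun A hA => ?_) s' Y _ two_three_injective.injOn
      (fun m _ => ?_) (by rwa [hsum])
    · rw [hf]
      exact conj_mem_lie h.grp.alg hA fun g hg => h.tor_conj_mem _ _ hg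
    · rw [hf]
      exact h.pt.tor_adj _ _ (hadj m)
  rw [← hsum]
  refine Submodule.sum_mem _ fun m hm => ?_
  by_cases hwt : m.1 + m.2 ≤ 0
  · exact Submodule.mem_iSup_of_mem m (Submodule.mem_iSup_of_mem hwt ⟨hmem m hm, hadj m⟩)
  · have : Y m = 0 := ext_of_isInternal hI fun i v hv =>
      h.pt.eq_zero_of_mem_I (k := i.1 + i.2) (by simp only [Prod.fst_add, Prod.snd_add]; omega)
        (hadj m i v hv) (h.grp.lie_map_W (hmem m hm) (I_le_W i hv))
    rw [this]; exact Submodule.zero_mem _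

/-- The summand of weight `k` of the splitting. -/
abbrev Iw (S : Sys E) (F : ℤ → Submodule ℂ E) (k : ℤ) : Submodule ℂ E :=
  ⨆ i : ℤ × ℤ, ⨆ _ : i.1 + i.2 = k, S.I F i

/-- Conjugation by `h(z, z)` multiplies the block of `g` from weight `b` to weight `a` by `z ^ (b -
a)`, and the blocks with `a > b` are zero. As `z → 0` only the weight-preserving blocks survive. The
limit is invertible, its inverse being the corresponding limit for `g⁻¹`, and it lies in `N` because
`N` is closed in the general linear group. -/
theorem Base.exists_weight_zero (h : S.Base b N F) {g : LinearMap.GeneralLinearGroup ℂ E}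
    (hg : g ∈ N) : ∃ γ ∈ N, (∀ i, ∀ v ∈ S.I F i, (γ : Module.End ℂ E) v ∈ S.Iw F (i.1 + i.2)) ∧
      ∀ k, ∀ v ∈ S.W k, (γ : Module.End ℂ E) v - (g : Module.End ℂ E) v ∈ S.W (k - 1) := by
  classical
  have hI := h.pt.isInternal
  obtain ⟨s, hs⟩ := exists_finset_eq_bot hI
  let γ : Module.End ℂ E → Module.End ℂ E := fun A =>
    ∑ i ∈ s, ∑ j ∈ s, if i.1 + i.2 = j.1 + j.2 then proj hI i * A * proj hI j else 0
  let z : ℕ → ℂˣ := fun m => Units.mk0 (2⁻¹ : ℂ) (by norm_num) ^ m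
  have hz0 : ∀ e : ℤ, 0 < e → Tendsto (fun m => ((z m : ℂˣ) : ℂ) ^ e) atTop (𝓝 0) := by
    intro e he
    lift e to ℕ using he.le
    have : ∀ m, ((z m : ℂˣ) : ℂ) ^ (e : ℤ) = ((2⁻¹ : ℂ) ^ e) ^ m := fun m => by
      simp [z, ← pow_mul, mul_comm]
    simp only [this]
    refine tendsto_pow_atTop_nhds_zero_of_norm_lt_one ?_
    rw [norm_pow]
    exact pow_lt_one₀ (by positivity) (by norm_num) (by omega)
  have hlim : ∀ A : LinearMap.GeneralLinearGroup ℂ E, A ∈ N →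
      Tendsto (fun m => ((h.pt.tor (z m) (z m) * A * (h.pt.tor (z m) (z m))⁻¹ :
        LinearMap.GeneralLinearGroup ℂ E) : Module.End ℂ E)) atTop (𝓝 (γ A)) := by
    intro A hA
    have e1 : ∀ m, ((h.pt.tor (z m) (z m) * A * (h.pt.tor (z m) (z m))⁻¹ :
        LinearMap.GeneralLinearGroup ℂ E) : Module.End ℂ E) =
        ∑ i ∈ s, ∑ j ∈ s, ((z m : ℂˣ) : ℂ) ^ ((j.1 + j.2) - (i.1 + i.2)) •
          (proj hI i * (A : Module.End ℂ E) * proj hI j) := by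
      intro m
      have e2 : (h.pt.tor (z m) (z m) : Module.End ℂ E) =
          ∑ i ∈ s, ((z m : ℂˣ) : ℂ) ^ (-(i.1 + i.2)) • proj hI i := by
        rw [← diag_eq_sum hI hs]
        refine congrArg (diag hI) (funext fun i => ?_)
        rw [neg_add, zpow_add₀ (z m).ne_zero]; simp
      have e3 : ((h.pt.tor (z m) (z m))⁻¹ : LinearMap.GeneralLinearGroup ℂ E) =
          (∑ i ∈ s, ((z m : ℂˣ) : ℂ) ^ (i.1 + i.2) • proj hI i : Module.End ℂ E) := by
        rw [← diag_eq_sum hI hs]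
        refine congrArg (diag hI) (funext fun i => ?_)
        rw [zpow_add₀ (z m).ne_zero]; simp [mul_comm]
      rw [Units.val_mul, Units.val_mul, e2, e3, Finset.sum_mul, Finset.sum_mul]
      refine Finset.sum_congr rfl fun i _ => ?_
      rw [Finset.mul_sum]
      refine Finset.sum_congr rfl fun j _ => ?_
      rw [smul_mul_assoc, smul_mul_assoc, mul_smul_comm, smul_smul, ← zpow_add₀ (z m).ne_zero]
      congr 2
      ring
    simp only [e1]
    refine tendsto_finsetSum _ fun i _ => tendsto_finsetSum _ fun j _ => ?_
    split_ifs with hij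
    · simp [hij]
    · rcases lt_or_gt_of_ne hij with hlt | hlt
      · simpa using (hz0 _ (sub_pos.2 hlt)).smul_const
          (proj hI i * (A : Module.End ℂ E) * proj hI j)
      · have : proj hI i * (A : Module.End ℂ E) * proj hI j = 0 := by
          ext v
          have h1 := h.grp.map_W A hA _ _ (I_le_W j (proj_mem hI j v))
          rw [h.pt.W_eq] at h1
          exact proj_eq_zero_of_mem_iSup hI (by omega) h1
        simp [this]
  have hmul : γ g * γ (g⁻¹ : LinearMap.GeneralLinearGroup ℂ E) = 1 := by
    refine tendsto_nhds_unique ((hlim g hg).mul (hlim g⁻¹ (N.inv_mem hg))) ?_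
    refine tendsto_const_nhds.congr fun m => ?_
    rw [← Units.val_mul]; group; simp
  have hmul' : γ (g⁻¹ : LinearMap.GeneralLinearGroup ℂ E) * γ g = 1 := by
    refine tendsto_nhds_unique ((hlim g⁻¹ (N.inv_mem hg)).mul (hlim g hg)) ?_
    refine tendsto_const_nhds.congr fun m => ?_
    rw [← Units.val_mul]; group; simp
  have hin : ∀ i, ∀ v ∈ S.I F i, γ g v ∈ S.Iw F (i.1 + i.2) := by
    intro i v hv
    simp only [γ, LinearMap.sum_apply]
    refine Submodule.sum_mem _ fun j _ => Submodule.sum_mem _ fun l _ => ?_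
    split_ifs with hjl
    · by_cases hl : i = l
      · subst hl
        exact Submodule.mem_iSup_of_mem j (Submodule.mem_iSup_of_mem hjl (proj_mem hI _ _))
      · rw [Module.End.mul_apply, proj_apply_ne hI hl hv, map_zero]
        exact Submodule.zero_mem _
    · exact Submodule.zero_mem _
  refine ⟨⟨γ g, _, hmul, hmul'⟩, h.grp.alg.mem_of_tendsto
    (Eventually.of_forall fun m => h.tor_conj_mem (z m) (z m) hg) (hlim g hg), hin, ?_⟩
  have hsub : ∀ i, ∀ v ∈ S.I F i, γ g v - (g : Module.End ℂ E) v ∈ S.W (i.1 + i.2 - 1) := by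
    intro i v hv
    by_cases his : i ∈ s
    swap
    · have : v = 0 := by simpa [hs i his] using hv
      simp [this]
    have e1 : γ g v = ∑ j ∈ s, if j.1 + j.2 = i.1 + i.2 then
        proj hI j ((g : Module.End ℂ E) v) else 0 := by
      simp only [γ, LinearMap.sum_apply]
      refine Finset.sum_congr rfl fun j _ => ?_
      rw [Finset.sum_eq_single_of_mem i his fun l _ hl => ?_]
      · split_ifs
        · rw [Module.End.mul_apply, Module.End.mul_apply, proj_apply_self hI hv]
        · simp
      · split_ifs
        · rw [Module.End.mul_apply, proj_apply_ne hI hl.symm hv, map_zero]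
        · simp
    have e2 : (g : Module.End ℂ E) v = ∑ j ∈ s, proj hI j ((g : Module.End ℂ E) v) := by
      rw [← LinearMap.sum_apply, sum_proj hI hs, Module.End.one_apply]
    rw [e1, e2, ← Finset.sum_sub_distrib]
    refine Submodule.sum_mem _ fun j _ => ?_
    rw [← e2]
    split_ifs with hj
    · simp
    · rw [zero_sub]
      refine Submodule.neg_mem _ ?_
      by_cases hlt : j.1 + j.2 ≤ i.1 + i.2
      · exact S.mono (by omega) (I_le_W j (proj_mem hI j _))
      · have h1 := h.grp.map_W g hg _ _ (I_le_W i hv)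
        rw [h.pt.W_eq] at h1
        rw [proj_eq_zero_of_mem_iSup hI hlt h1]
        exact Submodule.zero_mem _
  intro k v hv
  change (γ g - (g : Module.End ℂ E)) v ∈ _
  rw [h.pt.W_eq] at hv
  have h1 : (⨆ i : ℤ × ℤ, ⨆ _ : i.1 + i.2 ≤ k, S.I F i) ≤
      (S.W (k - 1)).comap (γ g - (g : Module.End ℂ E)) :=
    iSup₂_le fun i hi v hv => S.mono (by omega) (hsub i v hv)
  exact h1 hv

end Sys

end Base

open NormedSpace Filter Topology

/-! ### One-parameter groups through unipotent elements -/

section Unipotent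

/-- The binomial coefficient `t choose j` as a polynomial in `t`. -/
def binomPoly (j : ℕ) : Polynomial ℂ := Polynomial.C ((j.factorial : ℂ)⁻¹) * descPochhammer ℂ j

theorem binomPoly_eval_natCast (j m : ℕ) : (binomPoly j).eval (m : ℂ) = (m.choose j : ℂ) := by
  rw [binomPoly, Polynomial.eval_mul, Polynomial.eval_C, descPochhammer_eval_eq_descFactorial,
    Nat.descFactorial_eq_factorial_mul_choose, Nat.cast_mul]
  field_simp [Nat.factorial_ne_zero j]

theorem binomPoly_zero : binomPoly 0 = 1 := by simp [binomPoly]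

theorem binomPoly_one : binomPoly 1 = Polynomial.X := by simp [binomPoly]

variable {E : Type*} [NormedAddCommGroup E] [NormedSpace ℂ E] [FiniteDimensional ℂ E] {n : ℕ}

attribute [local instance] endNormedRing endNormedAlgebra

/-- The power `(1 + ν) ^ t` of a unipotent element (`ν ^ (d + 2) = 0`). -/
def unipPow (ν : Module.End ℂ E) (d : ℕ) (t : ℂ) : Module.End ℂ E :=
  ∑ j ∈ Finset.range (d + 2), (binomPoly j).eval t • ν ^ j

theorem unipPow_natCast {ν : Module.End ℂ E} {d : ℕ} (hν : ν ^ (d + 2) = 0) (m : ℕ) :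
    unipPow ν d m = (1 + ν) ^ m := by
  have h1 : ∀ l, m + 1 ≤ l → (1 + ν) ^ m = ∑ j ∈ Finset.range l, (m.choose j : ℂ) • ν ^ j := by
    intro l hl
    rw [add_comm, (Commute.one_right ν).add_pow]
    rw [Finset.sum_subset (Finset.range_subset_range.2 hl) fun j _ hj => ?_]
    · refine Finset.sum_congr rfl fun j _ => ?_
      rw [one_pow, mul_one, Nat.cast_smul_eq_nsmul, nsmul_eq_mul, Nat.cast_comm]
    · rw [Nat.choose_eq_zero_of_lt (by simpa using hj)]; simp
  rw [h1 (max (m + 1) (d + 2)) (le_max_left _ _), unipPow]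
  rw [Finset.sum_subset (Finset.range_subset_range.2 (le_max_right (m + 1) (d + 2)))
    fun j _ hj => ?_]
  · simp only [binomPoly_eval_natCast]
  · have : ν ^ j = 0 := by
      have hj' : d + 2 ≤ j := by simpa using hj
      rw [← Nat.add_sub_cancel' hj', pow_add, hν, zero_mul]
    rw [this, smul_zero]

theorem unipPow_sub_one (ν : Module.End ℂ E) (d : ℕ) (t : ℂ) :
    unipPow ν d t = 1 + ν * ∑ j ∈ Finset.range (d + 1), (binomPoly (j + 1)).eval t • ν ^ j := by
  rw [unipPow, Finset.sum_range_succ', binomPoly_zero, add_comm, Finset.mul_sum]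
  simp [pow_succ']

theorem unipPow_isUnit {ν : Module.End ℂ E} (d : ℕ) (hν : IsNilpotent ν) (t : ℂ) :
    IsUnit (unipPow ν d t) := by
  rw [unipPow_sub_one]
  refine IsNilpotent.isUnit_one_add (Commute.isNilpotent_mul_right ?_ hν)
  exact Commute.sum_right _ _ _ fun j _ => ((Commute.refl ν).pow_right j).smul_right _

theorem continuous_unipPow (ν : Module.End ℂ E) (d : ℕ) : Continuous (unipPow ν d) := by
  unfold unipPow
  exact continuous_finsetSum _ fun j _ => ((binomPoly j).continuous).smul continuous_const

/-- The logarithm of the unipotent element `1 + ν`. -/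
def unipLog (ν : Module.End ℂ E) (d : ℕ) : Module.End ℂ E :=
  ν + ν ^ 2 * ∑ j ∈ Finset.range d, (binomPoly (j + 2)).derivative.eval 0 • ν ^ j

theorem hasDerivAt_unipPow (ν : Module.End ℂ E) (d : ℕ) :
    HasDerivAt (unipPow ν d) (unipLog ν d) 0 := by
  have h1 : HasDerivAt (unipPow ν d)
      (∑ j ∈ Finset.range (d + 2), (binomPoly j).derivative.eval 0 • ν ^ j) 0 := by
    unfold unipPow
    exact HasDerivAt.fun_sum fun j _ => ((binomPoly j).hasDerivAt 0).smul_const _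
  refine h1.congr_deriv ?_
  rw [Finset.sum_range_succ', Finset.sum_range_succ', binomPoly_zero, binomPoly_one, unipLog,
    Finset.mul_sum]
  simp only [Polynomial.derivative_one, Polynomial.eval_zero, zero_smul, add_zero, zero_add,
    Polynomial.derivative_X, Polynomial.eval_one, one_smul, pow_one]
  rw [add_comm]
  congr 1
  refine Finset.sum_congr rfl fun j _ => ?_
  rw [mul_smul_comm, ← pow_add, add_comm 2 j]

variable {b : Module.Basis (Fin n) ℂ E} {U : Subgroup (LinearMap.GeneralLinearGroup ℂ E)}

/-- For `f` vanishing on `U`, the value of `f` at `(1 + ν) ^ t` is a polynomial in `t` with a zero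
at every natural number, hence the zero polynomial. -/
theorem unipPow_mem (hU : IsQAlg b U) {u : LinearMap.GeneralLinearGroup ℂ E} (hu : u ∈ U)
    {d : ℕ} (hd : ((u : Module.End ℂ E) - 1) ^ (d + 2) = 0) (t : ℂ)
    {v : LinearMap.GeneralLinearGroup ℂ E}
    (hv : (v : Module.End ℂ E) = unipPow ((u : Module.End ℂ E) - 1) d t) : v ∈ U := by
  rw [hU.mem_iff]
  intro f hf
  set ν := (u : Module.End ℂ E) - 1
  let q : Polynomial ℂ := MvPolynomial.aeval (fun ij : Ent n =>
    ∑ j ∈ Finset.range (d + 2), Polynomial.C (ent b (ν ^ j) ij) * binomPoly j) f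
  have hq : ∀ t : ℂ, q.eval t = MvPolynomial.eval (ent b (unipPow ν d t)) f := by
    intro t
    have h1 := MvPolynomial.map_aeval (fun ij : Ent n =>
      ∑ j ∈ Finset.range (d + 2), Polynomial.C (ent b (ν ^ j) ij) * binomPoly j)
      (Polynomial.evalRingHom t) f
    rw [Polynomial.coe_evalRingHom] at h1
    rw [show q.eval t = _ from h1, MvPolynomial.eval]
    congr 1
    congr 1
    · ext; simp
    · ext ij
      rw [unipPow, ← entEquiv_apply, map_sum, Finset.sum_apply,
        Polynomial.eval_finsetSum]
      refine Finset.sum_congr rfl fun j _ => ?_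
      rw [map_smul, Pi.smul_apply, entEquiv_apply]
      simp [mul_comm]
  have h0 : q = 0 := by
    refine Polynomial.eq_zero_of_infinite_isRoot q
      ((Set.infinite_range_of_injective Nat.cast_injective (α := ℕ) (β := ℂ)).mono ?_)
    rintro _ ⟨m, rfl⟩
    change q.eval _ = 0
    rw [hq, unipPow_natCast hd, add_sub_cancel, ← Units.val_pow_eq_pow_val]
    exact hf _ (U.pow_mem hu m)
  rw [hv, ← hq, h0, Polynomial.eval_zero]

/-- A unipotent element of an algebraic group lies on a one-parameter group. -/
theorem exists_unipotent_path (hU : IsQAlg b U) {u : LinearMap.GeneralLinearGroup ℂ E} (hu : u ∈ U)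
    (hn : IsNilpotent ((u : Module.End ℂ E) - 1)) :
    ∃ P : ℂ → LinearMap.GeneralLinearGroup ℂ E, (∀ t, P t ∈ U) ∧ P 0 = 1 ∧ P 1 = u ∧
      Continuous fun t => (P t : Module.End ℂ E) := by
  obtain ⟨d, hd⟩ := hn
  have hd2 : ((u : Module.End ℂ E) - 1) ^ (d + 2) = 0 := by rw [pow_add, hd, zero_mul]
  let P : ℂ → LinearMap.GeneralLinearGroup ℂ E := fun t =>
    (unipPow_isUnit (ν := (u : Module.End ℂ E) - 1) d ⟨d, hd⟩ t).unit
  refine ⟨P, fun t => unipPow_mem hU hu hd2 t rfl, Units.ext ?_, Units.ext ?_, ?_⟩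
  · change unipPow _ d 0 = 1
    simpa using unipPow_natCast hd2 0
  · change unipPow _ d 1 = _
    simpa using unipPow_natCast hd2 1
  · exact continuous_unipPow _ _

theorem hasDerivAt_curve_mem_lie {c : ℂ → LinearMap.GeneralLinearGroup ℂ E} {X : Module.End ℂ E}
    (hc : HasDerivAt (fun t => (c t : Module.End ℂ E)) X 0) (hU : ∀ t, c t ∈ U) (h0 : c 0 = 1) :
    X ∈ lie b U := by
  intro f hf
  have h1 := hasDerivAt_eval f (hasDerivAt_ent (b := b) hc)
  have h2 : (fun t => MvPolynomial.eval (ent b (c t : Module.End ℂ E)) f) = fun _ => 0 :=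
    funext fun t => hf _ (hU t)
  rw [h2, h0] at h1
  exact h1.unique (hasDerivAt_const _ _)

theorem unipLog_mem (hU : IsQAlg b U) {u : LinearMap.GeneralLinearGroup ℂ E} (hu : u ∈ U)
    {d : ℕ} (hd : ((u : Module.End ℂ E) - 1) ^ (d + 2) = 0) :
    unipLog ((u : Module.End ℂ E) - 1) d ∈ lie b U := by
  refine hasDerivAt_curve_mem_lie
    (c := fun t => (unipPow_isUnit (ν := (u : Module.End ℂ E) - 1) d ⟨_, hd⟩ t).unit)
    (hasDerivAt_unipPow _ d) (fun t => unipPow_mem hU hu hd t rfl) (Units.ext ?_)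
  simpa using unipPow_natCast hd 0

end Unipotent

open NormedSpace Filter Topology

/-! ### Decompositions of the Lie algebra at points of the orbit -/

section Open

variable {E : Type*} [NormedAddCommGroup E] [NormedSpace ℂ E] [FiniteDimensional ℂ E] {n : ℕ}

attribute [local instance] endNormedRing endNormedAlgebra

/-- The image of a filtration under a linear automorphism. -/
def mapF (g : LinearMap.GeneralLinearGroup ℂ E) (F : ℤ → Submodule ℂ E) (p : ℤ) : Submodule ℂ E :=
  (F p).map (g : Module.End ℂ E)

theorem gl_inv_apply (g : LinearMap.GeneralLinearGroup ℂ E) (v : E) :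
    ((g⁻¹ : LinearMap.GeneralLinearGroup ℂ E) : Module.End ℂ E) ((g : Module.End ℂ E) v) = v := by
  rw [← Module.End.mul_apply, Units.inv_mul, Module.End.one_apply]

theorem gl_apply_inv (g : LinearMap.GeneralLinearGroup ℂ E) (v : E) :
    (g : Module.End ℂ E) (((g⁻¹ : LinearMap.GeneralLinearGroup ℂ E) : Module.End ℂ E) v) = v := by
  rw [← Module.End.mul_apply, Units.mul_inv, Module.End.one_apply]

theorem gl_injective (g : LinearMap.GeneralLinearGroup ℂ E) :
    Function.Injective (g : Module.End ℂ E) := 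
  Function.LeftInverse.injective (g := ((g⁻¹ : LinearMap.GeneralLinearGroup ℂ E) : Module.End ℂ E))
    (gl_inv_apply g)

theorem mem_mapF {g : LinearMap.GeneralLinearGroup ℂ E} {F : ℤ → Submodule ℂ E} {p : ℤ} {v : E} :
    v ∈ mapF g F p ↔ ((g⁻¹ : LinearMap.GeneralLinearGroup ℂ E) : Module.End ℂ E) v ∈ F p := by
  constructor
  · rintro ⟨w, hw, rfl⟩; rwa [gl_inv_apply]
  · intro h; exact ⟨_, h, gl_apply_inv g v⟩

theorem apply_mem_mapF {g : LinearMap.GeneralLinearGroup ℂ E} {F : ℤ → Submodule ℂ E} {p : ℤ}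
    {v : E} : (g : Module.End ℂ E) v ∈ mapF g F p ↔ v ∈ F p := by
  rw [mem_mapF, gl_inv_apply]

theorem mapF_mul (g h : LinearMap.GeneralLinearGroup ℂ E) (F : ℤ → Submodule ℂ E) :
    mapF (g * h) F = mapF g (mapF h F) := by
  ext p v
  simp [mem_mapF, mul_inv_rev]

theorem mapF_one (F : ℤ → Submodule ℂ E) : mapF 1 F = F := by
  ext p v
  simp [mem_mapF]

theorem finrank_mapF (g : LinearMap.GeneralLinearGroup ℂ E) (F : ℤ → Submodule ℂ E) (p : ℤ) :
    Module.finrank ℂ (mapF g F p) = Module.finrank ℂ (F p) :=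
  ((F p).equivMapOfInjective _ (gl_injective g)).finrank_eq.symm

theorem mapF_eq_of_le {g : LinearMap.GeneralLinearGroup ℂ E} {F F' : ℤ → Submodule ℂ E}
    (h : ∀ p, ∀ v ∈ F p, (g : Module.End ℂ E) v ∈ F' p)
    (hd : ∀ p, Module.finrank ℂ (F p) = Module.finrank ℂ (F' p)) : mapF g F = F' := by
  ext1 p
  refine Submodule.eq_of_le_of_finrank_eq ?_ ((finrank_mapF g F p).trans (hd p))
  rintro _ ⟨v, hv, rfl⟩
  exact h p v hv

namespace Sys

variable {S : Sys E} {b : Module.Basis (Fin n) ℂ E}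
  {N : Subgroup (LinearMap.GeneralLinearGroup ℂ E)} {F : ℤ → Submodule ℂ E}

/-- The elements of the Lie algebra that shift a filtration by `r`. -/
def FL (b : Module.Basis (Fin n) ℂ E) (N : Subgroup (LinearMap.GeneralLinearGroup ℂ E))
    (G : ℤ → Submodule ℂ E) (r : ℤ) : Submodule ℂ (Module.End ℂ E) where
  carrier := {X | X ∈ lie b N ∧ ∀ p, ∀ v ∈ G p, X v ∈ G (p + r)}
  add_mem' hA hB := ⟨add_mem hA.1 hB.1, fun p v hv => add_mem (hA.2 p v hv) (hB.2 p v hv)⟩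
  zero_mem' := ⟨zero_mem _, fun _ _ _ => zero_mem _⟩
  smul_mem' c _ hA := ⟨Submodule.smul_mem _ c hA.1, fun p v hv => Submodule.smul_mem _ c (hA.2 p v hv)⟩

/-- The elements of the Lie algebra that act trivially on the graded pieces. -/
def nm (S : Sys E) (b : Module.Basis (Fin n) ℂ E)
    (N : Subgroup (LinearMap.GeneralLinearGroup ℂ E)) : Submodule ℂ (Module.End ℂ E) where
  carrier := {X | X ∈ lie b N ∧ ∀ k, ∀ v ∈ S.W k, X v ∈ S.W (k - 1)}
  add_mem' hA hB := ⟨add_mem hA.1 hB.1, fun p v hv => add_mem (hA.2 p v hv) (hB.2 p v hv)⟩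
  zero_mem' := ⟨zero_mem _, fun _ _ _ => zero_mem _⟩
  smul_mem' c _ hA := ⟨Submodule.smul_mem _ c hA.1, fun p v hv => Submodule.smul_mem _ c (hA.2 p v hv)⟩

/-- The adjoint action. -/
def Ad (g : LinearMap.GeneralLinearGroup ℂ E) : Module.End ℂ E →ₗ[ℂ] Module.End ℂ E :=
  LinearMap.mulLeft ℂ (g : Module.End ℂ E) ∘ₗ
    LinearMap.mulRight ℂ ((g⁻¹ : LinearMap.GeneralLinearGroup ℂ E) : Module.End ℂ E)

theorem Ad_apply (g : LinearMap.GeneralLinearGroup ℂ E) (X : Module.End ℂ E) :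
    Ad g X = (g : Module.End ℂ E) * X * (g⁻¹ : LinearMap.GeneralLinearGroup ℂ E) :=
  (mul_assoc _ _ _).symm

theorem Ad_apply_apply (g : LinearMap.GeneralLinearGroup ℂ E) (X : Module.End ℂ E) (v : E) :
    Ad g X v = (g : Module.End ℂ E)
      (X (((g⁻¹ : LinearMap.GeneralLinearGroup ℂ E) : Module.End ℂ E) v)) := rfl

theorem Ad_inv_Ad (g : LinearMap.GeneralLinearGroup ℂ E) (X : Module.End ℂ E) :
    Ad g⁻¹ (Ad g X) = X := by
  ext v
  rw [Ad_apply_apply, Ad_apply_apply, inv_inv, gl_inv_apply, gl_inv_apply]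

theorem Ad_injective (g : LinearMap.GeneralLinearGroup ℂ E) : Function.Injective (Ad g) :=
  Function.LeftInverse.injective (g := Ad g⁻¹) (Ad_inv_Ad g)

theorem Ad_mem_lie (hN : IsQAlg b N) {g : LinearMap.GeneralLinearGroup ℂ E} (hg : g ∈ N)
    {X : Module.End ℂ E} (hX : X ∈ lie b N) : Ad g X ∈ lie b N := by
  rw [Ad_apply]
  exact conj_mem_lie hN hX fun m hm => N.mul_mem (N.mul_mem hg hm) (N.inv_mem hg)

theorem finrank_eq_of_Ad {g : LinearMap.GeneralLinearGroup ℂ E}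
    {T T' : Submodule ℂ (Module.End ℂ E)} (h : ∀ X ∈ T, Ad g X ∈ T')
    (h' : ∀ X ∈ T', Ad g⁻¹ X ∈ T) : Module.finrank ℂ T = Module.finrank ℂ T' := by
  apply le_antisymm
  · exact LinearMap.finrank_le_finrank_of_injective (f := (Ad g).restrict h)
      fun x y hxy => Subtype.ext (Ad_injective g (congrArg Subtype.val hxy))
  · exact LinearMap.finrank_le_finrank_of_injective (f := (Ad g⁻¹).restrict h')
      fun x y hxy => Subtype.ext (Ad_injective g⁻¹ (congrArg Subtype.val hxy))

theorem Ad_mem_FL (hN : IsQAlg b N) {g : LinearMap.GeneralLinearGroup ℂ E} (hg : g ∈ N) (r : ℤ)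
    {X : Module.End ℂ E} (hX : X ∈ FL b N F r) : Ad g X ∈ FL b N (mapF g F) r := by
  refine ⟨Ad_mem_lie hN hg hX.1, fun p v hv => ?_⟩
  rw [Ad_apply_apply, apply_mem_mapF]
  exact hX.2 p _ (mem_mapF.1 hv)

theorem Ad_mem_FL' (hN : IsQAlg b N) {g : LinearMap.GeneralLinearGroup ℂ E} (hg : g ∈ N) (r : ℤ)
    {X : Module.End ℂ E} (hX : X ∈ FL b N (mapF g F) r) : Ad g⁻¹ X ∈ FL b N F r := by
  have := Ad_mem_FL hN (N.inv_mem hg) r hX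
  rwa [← mapF_mul, inv_mul_cancel, mapF_one] at this

theorem Grp.Ad_mem_nm (hN : S.Grp b N) {g : LinearMap.GeneralLinearGroup ℂ E} (hg : g ∈ N)
    {X : Module.End ℂ E} (hX : X ∈ S.nm b N) : Ad g X ∈ S.nm b N := by
  refine ⟨Ad_mem_lie hN.alg hg hX.1, fun k v hv => ?_⟩
  exact hN.map_W g hg _ _ (hX.2 k _ (hN.map_W _ (N.inv_mem hg) k v hv))

theorem finrank_FL (hN : IsQAlg b N) {g : LinearMap.GeneralLinearGroup ℂ E} (hg : g ∈ N) (r : ℤ) :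
    Module.finrank ℂ (FL b N F r) = Module.finrank ℂ (FL b N (mapF g F) r) :=
  finrank_eq_of_Ad (g := g) (fun _ h => Ad_mem_FL hN hg r h) (fun _ h => Ad_mem_FL' hN hg r h)

theorem Grp.finrank_FL_sup_nm (hN : S.Grp b N) {g : LinearMap.GeneralLinearGroup ℂ E} (hg : g ∈ N)
    (r : ℤ) : Module.finrank ℂ (FL b N F r ⊔ S.nm b N : Submodule ℂ (Module.End ℂ E)) =
      Module.finrank ℂ (FL b N (mapF g F) r ⊔ S.nm b N : Submodule ℂ (Module.End ℂ E)) := by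
  refine finrank_eq_of_Ad (g := g) (fun X h => ?_) (fun X h => ?_)
  · obtain ⟨Y, hY, Z, hZ, rfl⟩ := Submodule.mem_sup.1 h
    rw [map_add]
    exact Submodule.add_mem_sup (Ad_mem_FL hN.alg hg r hY) (hN.Ad_mem_nm hg hZ)
  · obtain ⟨Y, hY, Z, hZ, rfl⟩ := Submodule.mem_sup.1 h
    rw [map_add]
    exact Submodule.add_mem_sup (Ad_mem_FL' hN.alg hg r hY) (hN.Ad_mem_nm (N.inv_mem hg) hZ)

theorem FL_isNilpotent {G : ℤ → Submodule ℂ E} (hG : Antitone G) (ht : ∃ a, G a = ⊤)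
    (hb : ∃ a, G a = ⊥) {X : Module.End ℂ E} (hX : X ∈ FL b N G 1) : IsNilpotent X := by
  obtain ⟨a, ha⟩ := ht
  obtain ⟨c, hc⟩ := hb
  have h : ∀ m : ℕ, ∀ v, (X ^ m) v ∈ G (a + m) := fun m => by
    induction m with
    | zero => intro v; simp [ha]
    | succ m ih =>
      intro v
      rw [pow_succ', Module.End.mul_apply]
      have := hX.2 _ _ (ih v)
      rwa [add_assoc, ← Nat.cast_succ] at this
  refine ⟨(c - a).toNat, LinearMap.ext fun v => ?_⟩
  have h1 := hG (show c ≤ a + (c - a).toNat by omega) (h _ v)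
  rwa [hc] at h1

theorem conjEnd_mem_FL (hN : S.Grp b N) {r : ℤ} {X : Module.End ℂ E}
    (hX : X ∈ FL b N (S.cF F) r) : conjEnd S.σ S.invol X ∈ FL b N F r := by
  refine ⟨conjEnd_mem_lie S.invol hN.alg hN.real hX.1, fun p v hv => ?_⟩
  rw [conjEnd_apply, ← mem_cF]
  exact hX.2 p _ (mem_cF.2 (by rwa [S.invol]))

theorem conjEnd_mem_FL' (hN : S.Grp b N) {r : ℤ} {X : Module.End ℂ E}
    (hX : X ∈ FL b N F r) : conjEnd S.σ S.invol X ∈ FL b N (S.cF F) r := by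
  refine ⟨conjEnd_mem_lie S.invol hN.alg hN.real hX.1, fun p v hv => ?_⟩
  rw [conjEnd_apply, mem_cF, S.invol]
  exact hX.2 p _ (mem_cF.1 hv)

theorem conjEnd_mem_nm (hN : S.Grp b N) {X : Module.End ℂ E}
    (hX : X ∈ S.nm b N) : conjEnd S.σ S.invol X ∈ S.nm b N := by
  refine ⟨conjEnd_mem_lie S.invol hN.alg hN.real hX.1, fun k v hv => ?_⟩
  exact S.W_conj (hX.2 k _ (S.W_conj hv))

/-- Deligne's splitting is exchanged with its conjugate only modulo lower weight: the class of `u`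
has type `(p, q)`, so that of its conjugate has type `(q, p)` and lifts to the splitting. -/
theorem Pt.exists_conj_I (h : S.Pt F) {p q : ℤ} {u : E} (hu : u ∈ S.I F (p, q)) :
    ∃ w ∈ S.I F (q, p), S.σ u - w ∈ S.W (p + q - 1) := by
  obtain ⟨v, hv, huv⟩ := h.opp.exists_conj_rep p q hu
  have h1 : S.σ v ∈ F q ⊓ S.W (q + p) :=
    ⟨mem_cF.1 hv.1, by rw [add_comm]; exact S.W_conj hv.2⟩
  have h2 : S.σ u ∈ S.cF F p ⊓ S.W (q + p) :=
    ⟨mem_cF.2 (by rw [S.invol]; exact I_le_F _ hu),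
      by rw [add_comm]; exact S.W_conj (I_le_W _ hu)⟩
  have h3 : S.σ v - S.σ u ∈ S.W (q + p - 1) := by
    rw [← map_sub, ← neg_sub u v, map_neg, add_comm q p]
    exact Submodule.neg_mem _ (S.W_conj huv)
  obtain ⟨w, hw, hwv⟩ := h.opp.exists_lift q p _ _ h1 h2 h3
  refine ⟨w, hw, ?_⟩
  rw [add_comm p q]
  have := Submodule.add_mem _ hwv h3
  rw [← Submodule.neg_mem_iff]
  convert this using 1
  abel

theorem Pt.eq_zero_of_mem_of_mem (h : S.Pt F) (P : ℤ × ℤ → Prop) {v : E}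
    (h1 : v ∈ ⨆ i, ⨆ _ : P i, S.I F i) (h2 : v ∈ ⨆ i, ⨆ _ : ¬ P i, S.I F i) : v = 0 := by
  have := mem_iSup_of_proj h.isInternal (p := fun _ => False) (v := v) fun i _ => by
    by_cases hi : P i
    · exact proj_eq_zero_of_mem_iSup h.isInternal (p := fun i => ¬ P i) (by simpa) h2
    · exact proj_eq_zero_of_mem_iSup h.isInternal hi h1
  simpa using this

theorem Pt.eq_of_forall_I (h : S.Pt F) {A B : Module.End ℂ E}
    (hAB : ∀ i, ∀ v ∈ S.I F i, A v = B v) : A = B := ext_of_isInternal h.isInternal hAB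

/-- An element of the Lie algebra whose action on the graded pieces has type `m`. -/
theorem Base.mem_sup_of_graded (h : S.Base b N F) {m : ℤ × ℤ} (hm : m.1 + m.2 = 0)
    {X : Module.End ℂ E} (hX : X ∈ lie b N)
    (hXm : ∀ i, ∀ v ∈ S.I F i, ∃ w ∈ S.I F (i + m), X v - w ∈ S.W (i.1 + i.2 - 1)) :
    X ∈ (lie b N ⊓ S.adj F m) ⊔ S.nm b N := by
  have h1 : lie b N ≤ ((lie b N ⊓ S.adj F m) ⊔ S.nm b N) ⊔
      ⨆ l : ℤ × ℤ, ⨆ _ : l.1 + l.2 = 0 ∧ l ≠ m, lie b N ⊓ S.adj F l := by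
    refine h.lie_le.trans (iSup₂_le fun l hl => ?_)
    by_cases hlm : l = m
    · subst hlm; exact le_sup_left.trans le_sup_left
    by_cases h0 : l.1 + l.2 = 0
    · exact le_sup_of_le_right (le_iSup₂_of_le (f := fun (l : ℤ × ℤ)
        (_ : l.1 + l.2 = 0 ∧ l ≠ m) => lie b N ⊓ S.adj F l) l ⟨h0, hlm⟩ le_rfl)
    · refine le_sup_of_le_left (le_sup_of_le_right ?_)
      rintro Y ⟨hY, hYl⟩
      refine ⟨hY, fun k v hv => ?_⟩
      rw [h.pt.W_eq] at hv
      refine (iSup₂_le fun i hi v hv => ?_ :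
        (⨆ i : ℤ × ℤ, ⨆ _ : i.1 + i.2 ≤ k, S.I F i) ≤ (S.W (k - 1)).comap Y) hv
      exact S.mono (by simp only [Prod.fst_add, Prod.snd_add]; omega) (I_le_W _ (hYl i v hv))
  obtain ⟨Y, hY, R, hR, rfl⟩ := Submodule.mem_sup.1 (h1 hX)
  -- `R` collects the weight-zero components of bidegree other than `m`. On `I^i` its values lie in
  -- summands of the same weight different from `I^(i + m)`; by the assumption on `X` they also lie
  -- in `I^(i + m)` plus lower weights, so they vanish.
  have hR0 : R = 0 := h.pt.eq_of_forall_I fun i v hv => by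
    rw [LinearMap.zero_apply]
    have hRv : R v ∈ ⨆ j : ℤ × ℤ, ⨆ _ : j.1 + j.2 = i.1 + i.2 ∧ j ≠ i + m, S.I F j := by
      refine (iSup₂_le fun l hl A hA => ?_ :
        (⨆ l : ℤ × ℤ, ⨆ _ : l.1 + l.2 = 0 ∧ l ≠ m, lie b N ⊓ S.adj F l) ≤
          (⨆ j : ℤ × ℤ, ⨆ _ : j.1 + j.2 = i.1 + i.2 ∧ j ≠ i + m, S.I F j).comap
            (LinearMap.applyₗ v)) hR
      refine Submodule.mem_iSup_of_mem (i + l) (Submodule.mem_iSup_of_mem ⟨?_, ?_⟩ (hA.2 i v hv))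
      · simp only [Prod.fst_add, Prod.snd_add]; omega
      · simpa using hl.2
    refine h.pt.eq_zero_of_mem_of_mem _ hRv ?_
    obtain ⟨Y1, hY1, Z, hZ, rfl⟩ := Submodule.mem_sup.1 hY
    obtain ⟨w, hw, hwX⟩ := hXm i v hv
    have e : R v = ((Y1 + Z + R) v - w) - Z v + (w - Y1 v) := by
      simp only [LinearMap.add_apply]; abel
    rw [e]
    refine Submodule.add_mem _ ?_ ?_
    · have : ((Y1 + Z + R) v - w) - Z v ∈ S.W (i.1 + i.2 - 1) :=
        Submodule.sub_mem _ hwX (hZ.2 _ _ (I_le_W i hv))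
      rw [h.pt.W_eq] at this
      exact (iSup₂_le fun j hj => le_iSup₂_of_le (f := fun (j : ℤ × ℤ)
        (_ : ¬ (j.1 + j.2 = i.1 + i.2 ∧ j ≠ i + m)) => S.I F j) j (by omega) le_rfl :
        (⨆ j : ℤ × ℤ, ⨆ _ : j.1 + j.2 ≤ i.1 + i.2 - 1, S.I F j) ≤ _) this
    · exact Submodule.mem_iSup_of_mem (i + m) (Submodule.mem_iSup_of_mem (by simp)
        (Submodule.sub_mem _ hw (hY1.2 i v hv)))
  rw [hR0, add_zero]
  exact hY

theorem Base.adj_le_FL (h : S.Base b N F) {m : ℤ × ℤ} {r : ℤ} (hm : r ≤ m.1) :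
    lie b N ⊓ S.adj F m ≤ FL b N F r := by
  rintro X ⟨hX, hXm⟩
  refine ⟨hX, fun p v hv => ?_⟩
  rw [h.pt.F_eq] at hv
  refine (iSup₂_le fun i hi v hv => ?_ :
    (⨆ i : ℤ × ℤ, ⨆ _ : p ≤ i.1, S.I F i) ≤ (F (p + r)).comap X) hv
  exact h.pt.opp.antiF (by simp only [Prod.fst_add]; omega) (I_le_F _ (hXm i v hv))

theorem Base.adj_le_nm (h : S.Base b N F) {m : ℤ × ℤ} (hm : m.1 + m.2 < 0) :
    lie b N ⊓ S.adj F m ≤ S.nm b N := by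
  rintro X ⟨hX, hXm⟩
  refine ⟨hX, fun k v hv => ?_⟩
  rw [h.pt.W_eq] at hv
  refine (iSup₂_le fun i hi v hv => ?_ :
    (⨆ i : ℤ × ℤ, ⨆ _ : i.1 + i.2 ≤ k, S.I F i) ≤ (S.W (k - 1)).comap X) hv
  exact S.mono (by simp only [Prod.fst_add, Prod.snd_add]; omega) (I_le_W _ (hXm i v hv))

/-- Bidegrees with nonnegative first entry lie in `F⁰`, and those of negative weight act trivially
on the graded pieces. What remains is type `(-a, a)` with `a > 0`; its conjugate has type `(a, -a)`
modulo negative weight, so it lies in the first step of the conjugate filtration. -/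
theorem Base.lie_le_sup (h : S.Base b N F) :
    lie b N ≤ (FL b N F 0 ⊔ S.nm b N) ⊔ (FL b N (S.cF F) 1 ⊔ S.nm b N) := by
  refine h.lie_le.trans (iSup₂_le fun m hm => ?_)
  by_cases h0 : 0 ≤ m.1
  · exact (h.adj_le_FL h0).trans (le_sup_left.trans le_sup_left)
  by_cases h1 : m.1 + m.2 < 0
  · exact (h.adj_le_nm h1).trans (le_sup_right.trans le_sup_left)
  refine le_sup_of_le_right ?_
  rintro X ⟨hX, hXm⟩
  have hm' : m.2 = -m.1 := by omega
  have key : conjEnd S.σ S.invol X ∈ (lie b N ⊓ S.adj F (-m.1, m.1)) ⊔ S.nm b N := by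
    refine h.mem_sup_of_graded (by simp) (conjEnd_mem_lie S.invol h.grp.alg h.grp.real hX)
      fun i u hu => ?_
    obtain ⟨w, hw, huw⟩ := h.pt.exists_conj_I (p := i.1) (q := i.2) hu
    have hw2 := hXm _ w hw
    obtain ⟨w', hw', hww⟩ := h.pt.exists_conj_I (p := i.2 + m.1) (q := i.1 + m.2) hw2
    refine ⟨w', ?_, ?_⟩
    · convert hw' using 2
      simp [Prod.ext_iff, hm']
    · have e : conjEnd S.σ S.invol X u - w' = S.σ (X (S.σ u - w)) + (S.σ (X w) - w') := by
        rw [conjEnd_apply, map_sub, map_sub]; abel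
      rw [e]
      refine Submodule.add_mem _ (S.W_conj (h.grp.lie_map_W hX huw)) ?_
      convert hww using 2
      rw [hm']; ring
  obtain ⟨Y, hY, Z, hZ, hYZ⟩ := Submodule.mem_sup.1 key
  have e : X = conjEnd S.σ S.invol Y + conjEnd S.σ S.invol Z := by
    rw [← map_add, hYZ, conjEnd_conjEnd]
  rw [e]
  exact Submodule.add_mem_sup (conjEnd_mem_FL' h.grp (h.adj_le_FL (by simp only; omega) hY))
    (conjEnd_mem_nm h.grp hZ)

/-- Modulo lower weight, the value on a vector of type `(p, q)` lies both in `F^p` and in the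
conjugate of `F^(q + 1)`, so opposedness makes it zero on the graded piece. No torus is involved, so
this is available at every polarized point. -/
theorem Pt.inf_le_nm (hN : S.Grp b N) {G : ℤ → Submodule ℂ E} (h : S.Pt G) :
    (FL b N G 0 ⊔ S.nm b N) ⊓ (FL b N (S.cF G) 1 ⊔ S.nm b N) ≤ S.nm b N := by
  rintro X ⟨h1, h2⟩
  obtain ⟨X1, hX1, Z1, hZ1, rfl⟩ := Submodule.mem_sup.1 h1
  obtain ⟨X2, hX2, Z2, hZ2, he⟩ := Submodule.mem_sup.1 h2
  refine Submodule.add_mem _ ⟨hX1.1, fun k v hv => ?_⟩ hZ1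
  rw [h.W_eq] at hv
  refine (iSup₂_le fun i hi v hv => ?_ :
    (⨆ i : ℤ × ℤ, ⨆ _ : i.1 + i.2 ≤ k, S.I G i) ≤ (S.W (k - 1)).comap X1) hv
  rw [Submodule.mem_comap]
  refine S.mono (show i.1 + i.2 - 1 ≤ k - 1 by omega) ?_
  obtain ⟨w, hw, hvw⟩ := h.opp.exists_conj_rep i.1 i.2 hv
  refine h.opp.disj (i.1 + i.2) i.1 (i.2 + 1) (by ring) (X1 v) ⟨?_, hN.lie_map_W hX1.1 (I_le_W i hv)⟩
    (X2 w) ⟨hX2.2 _ _ hw.1, hN.lie_map_W hX2.1 hw.2⟩ ?_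
  · have := hX1.2 _ _ (I_le_F i hv)
    rwa [add_zero] at this
  · have e : X1 v - X2 w = - Z1 v + (Z2 v + X2 (v - w)) := by
      have := congrArg (fun A : Module.End ℂ E => A v) he
      simp only [LinearMap.add_apply] at this
      rw [map_sub, eq_sub_of_add_eq this.symm]; abel
    rw [e]
    refine Submodule.add_mem _ (Submodule.neg_mem _ (hZ1.2 _ _ (I_le_W i hv)))
      (Submodule.add_mem _ (hZ2.2 _ _ (I_le_W i hv)) (hN.lie_map_W hX2.1 hvw))

theorem cF_mapF (hN : S.Grp b N) (g : LinearMap.GeneralLinearGroup ℂ E) :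
    S.cF (mapF g F) = mapF (conjGL S.σ S.invol g) (S.cF F) := by
  ext p v
  rw [mem_cF, mem_mapF, mem_mapF, mem_cF, ← map_inv, conjGL_val, conjEnd_apply, S.invol]

/-- The decomposition of the Lie algebra behind the openness of real orbits. -/
theorem Base.lie_le_sup_mapF (h : S.Base b N F) {γ : LinearMap.GeneralLinearGroup ℂ E}
    (hγ : γ ∈ N) (hy : S.Pt (mapF γ F)) :
    lie b N ≤ (FL b N (mapF γ F) 0 ⊔ S.nm b N) ⊔ (FL b N (S.cF (mapF γ F)) 1 ⊔ S.nm b N) := by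
  -- The splitting of `Lie N` by the torus is only at hand at `F`, so the result is carried to `γF`
  -- by counting dimensions. `Ad γ` and `Ad` of the conjugate of `γ` identify the two summands with
  -- those at `F`, while the intersection at `γF` is contained in `nm`, hence no bigger than at `F`.
  -- The sum therefore has at least the dimension of `Lie N`.
  have hA := h.grp.finrank_FL_sup_nm (F := F) hγ 0
  have hB := h.grp.finrank_FL_sup_nm (F := S.cF F) (h.grp.alg.conjGL_mem S.invol h.grp.real hγ) 1
  rw [← cF_mapF h.grp] at hB
  have hle : ∀ (G G' : ℤ → Submodule ℂ E),
      (FL b N G 0 ⊔ S.nm b N) ⊔ (FL b N G' 1 ⊔ S.nm b N) ≤ lie b N := fun G G' =>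
    sup_le (sup_le (fun _ h => h.1) fun _ h => h.1) (sup_le (fun _ h => h.1) fun _ h => h.1)
  have hx := le_antisymm h.lie_le_sup (hle _ _)
  have d1 := Submodule.finrank_sup_add_finrank_inf_eq (FL b N F 0 ⊔ S.nm b N)
    (FL b N (S.cF F) 1 ⊔ S.nm b N)
  have d2 := Submodule.finrank_sup_add_finrank_inf_eq (FL b N (mapF γ F) 0 ⊔ S.nm b N)
    (FL b N (S.cF (mapF γ F)) 1 ⊔ S.nm b N)
  have d3 := Submodule.finrank_mono (hy.inf_le_nm h.grp)
  have d4 := Submodule.finrank_mono (show S.nm b N ≤ (FL b N F 0 ⊔ S.nm b N) ⊓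
    (FL b N (S.cF F) 1 ⊔ S.nm b N) from le_inf le_sup_right le_sup_right)
  rw [← hx] at d1
  refine (Submodule.eq_of_le_of_finrank_le (hle _ _) ?_).ge
  omega

/-- The real elements of the Lie algebra that are skew for the forms. -/
def skew (S : Sys E) (b : Module.Basis (Fin n) ℂ E)
    (N : Subgroup (LinearMap.GeneralLinearGroup ℂ E)) : Submodule ℝ (Module.End ℂ E) where
  carrier := {X | X ∈ lie b N ∧ (∀ v, X (S.σ v) = S.σ (X v)) ∧
    ∀ k, ∀ u ∈ S.W k, ∀ v ∈ S.W k, S.β k (X u) v + S.β k u (X v) = 0}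
  add_mem' := by
    rintro A B ⟨h1, h2, h3⟩ ⟨h1', h2', h3'⟩
    refine ⟨add_mem h1 h1', fun v => by simp [h2, h2'], fun k u hu v hv => ?_⟩
    simp only [LinearMap.add_apply, map_add]
    linear_combination h3 k u hu v hv + h3' k u hu v hv
  zero_mem' := ⟨zero_mem _, by simp, by simp⟩
  smul_mem' := by
    rintro c A ⟨h1, h2, h3⟩
    rw [← Complex.coe_smul]
    refine ⟨Submodule.smul_mem _ _ h1, fun v => ?_, fun k u hu v hv => ?_⟩
    · rw [LinearMap.smul_apply, LinearMap.smul_apply, h2, map_smulₛₗ, Complex.conj_ofReal]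
    · simp only [LinearMap.smul_apply, map_smul, smul_eq_mul]
      linear_combination (c : ℂ) * h3 k u hu v hv

theorem Base.lie_le_skew (h : S.Base b N F) {γ : LinearMap.GeneralLinearGroup ℂ E}
    (hγ : γ ∈ N) (hy : S.Pt (mapF γ F)) {X : Module.End ℂ E} (hX : X ∈ lie b N) :
    ∃ A ∈ S.skew b N, ∃ B ∈ S.nm b N, ∃ C ∈ FL b N (mapF γ F) 0, A + B + C = X := by
  obtain ⟨Y1, h1, Y2, h2, rfl⟩ := Submodule.mem_sup.1 (h.lie_le_sup_mapF hγ hy hX)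
  obtain ⟨E0, hE0, B1, hB1, rfl⟩ := Submodule.mem_sup.1 h1
  obtain ⟨E2, hE2, B2, hB2, rfl⟩ := Submodule.mem_sup.1 h2
  -- The component `E2` is completed to the real element `E1 + E2` by its conjugate `E1`.
  -- Subtracting `E1` again costs nothing, because it lies in `F¹`, hence in the stabilizer of the
  -- filtration.
  have hE1 := conjEnd_mem_FL h.grp hE2
  set E1 := conjEnd S.σ S.invol E2 with hE1def
  -- Shifting a finite filtration by one makes `E1`, and with it `E2`, nilpotent. So both are skew
  -- for the forms, although `N` preserves these only up to scalars.
  have hn1 : IsNilpotent E1 := FL_isNilpotent hy.opp.antiF hy.opp.topF hy.opp.botF hE1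
  have hn2 : IsNilpotent E2 := by
    have := hn1.map (conjEnd S.σ S.invol)
    rwa [hE1def, conjEnd_conjEnd] at this
  refine ⟨E1 + E2, ⟨add_mem hE1.1 hE2.1, fun v => ?_, fun k u hu v hv => ?_⟩, B1 + B2,
    add_mem hB1 hB2, E0 - E1, Submodule.sub_mem _ hE0 ⟨hE1.1, fun p v hv => ?_⟩, by abel⟩
  · simp only [LinearMap.add_apply, hE1def, conjEnd_apply, map_add, S.invol v,
      S.invol (E2 (S.σ v))]
    rw [add_comm]
  · have e1 := h.grp.lie_β_of_isNilpotent hE1.1 hn1 hu hv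
    have e2 := h.grp.lie_β_of_isNilpotent hE2.1 hn2 hu hv
    simp only [LinearMap.add_apply, map_add]
    linear_combination e1 + e2
  · exact hy.opp.antiF (by omega) (hE1.2 p v hv)

end Sys

end Open

open NormedSpace Filter Topology

/-! ### The orbit of real and unipotent points as an orbit of `H1` -/

section Orbit

variable {E : Type*} [NormedAddCommGroup E] [NormedSpace ℂ E] [FiniteDimensional ℂ E] {n : ℕ}

attribute [local instance] endNormedRing endNormedAlgebra

namespace Sys

variable {S : Sys E} {b : Module.Basis (Fin n) ℂ E}
  {N : Subgroup (LinearMap.GeneralLinearGroup ℂ E)} {F : ℤ → Submodule ℂ E}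

/-- The real points of `N`. -/
def realPts (S : Sys E) (N : Subgroup (LinearMap.GeneralLinearGroup ℂ E)) :
    Set (Module.End ℂ E) :=
  {A | (∃ g ∈ N, (g : Module.End ℂ E) = A) ∧ ∀ v, A (S.σ v) = S.σ (A v)}

/-- The identity component of the real points of `N`. -/
def realComp (S : Sys E) (N : Subgroup (LinearMap.GeneralLinearGroup ℂ E)) :
    Set (LinearMap.GeneralLinearGroup ℂ E) :=
  {g | (g : Module.End ℂ E) ∈ connectedComponentIn (S.realPts N) 1}

/-- The unipotent radical. -/
def uniRad (b : Module.Basis (Fin n) ℂ E) (N : Subgroup (LinearMap.GeneralLinearGroup ℂ E)) :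
    Subgroup (LinearMap.GeneralLinearGroup ℂ E) :=
  sSup {U | IsQAlg b U ∧ U ≤ N ∧ (U.subgroupOf N).Normal ∧
    ∀ u ∈ U, IsNilpotent ((u : Module.End ℂ E) - 1)}

theorem one_mem_realPts : (1 : Module.End ℂ E) ∈ S.realPts N :=
  ⟨⟨1, N.one_mem, rfl⟩, fun _ => rfl⟩

theorem realComp_subset {g : LinearMap.GeneralLinearGroup ℂ E} (hg : g ∈ S.realComp N) :
    g ∈ N ∧ ∀ v, (g : Module.End ℂ E) (S.σ v) = S.σ ((g : Module.End ℂ E) v) := by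
  obtain ⟨⟨g', hg', h⟩, h2⟩ := connectedComponentIn_subset _ _ hg
  exact ⟨Units.ext h ▸ hg', h2⟩

theorem realPts_inv {g : LinearMap.GeneralLinearGroup ℂ E}
    (h : ∀ v, (g : Module.End ℂ E) (S.σ v) = S.σ ((g : Module.End ℂ E) v)) (v : E) :
    ((g⁻¹ : LinearMap.GeneralLinearGroup ℂ E) : Module.End ℂ E) (S.σ v) =
      S.σ (((g⁻¹ : LinearMap.GeneralLinearGroup ℂ E) : Module.End ℂ E) v) := by
  apply gl_injective g
  rw [gl_apply_inv, h, gl_apply_inv]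

theorem mul_mem_realPts {g : LinearMap.GeneralLinearGroup ℂ E} (hg : g ∈ N)
    (hr : ∀ v, (g : Module.End ℂ E) (S.σ v) = S.σ ((g : Module.End ℂ E) v))
    {A : Module.End ℂ E} (hA : A ∈ S.realPts N) : (g : Module.End ℂ E) * A ∈ S.realPts N := by
  obtain ⟨⟨a, ha, rfl⟩, h2⟩ := hA
  exact ⟨⟨g * a, N.mul_mem hg ha, rfl⟩, fun v => by simp [h2, hr]⟩

theorem image_mul_isPreconnected (g : Module.End ℂ E) {s : Set (Module.End ℂ E)}
    (hs : IsPreconnected s) : IsPreconnected ((fun A => g * A) '' s) :=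
  hs.image _ (continuous_const.mul continuous_id).continuousOn

/-- The identity component as a subgroup. -/
def realCompSubgroup (S : Sys E) (N : Subgroup (LinearMap.GeneralLinearGroup ℂ E)) :
    Subgroup (LinearMap.GeneralLinearGroup ℂ E) where
  carrier := S.realComp N
  one_mem' := mem_connectedComponentIn one_mem_realPts
  mul_mem' := by
    intro g h hg hh
    obtain ⟨hgN, hgr⟩ := realComp_subset hg
    have hpre := image_mul_isPreconnected (g : Module.End ℂ E)
      (isPreconnected_connectedComponentIn (F := S.realPts N) (x := 1))
    have hsub := hpre.subset_connectedComponentIn (F := S.realPts N) (x := (g : Module.End ℂ E))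
      ⟨1, mem_connectedComponentIn one_mem_realPts, mul_one _⟩ (by
        rintro _ ⟨A, hA, rfl⟩
        exact mul_mem_realPts hgN hgr (connectedComponentIn_subset _ _ hA))
    have heq := connectedComponentIn_eq (show (g : Module.End ℂ E) ∈ connectedComponentIn (S.realPts N) 1 from hg)
    change ((g * h : LinearMap.GeneralLinearGroup ℂ E) : Module.End ℂ E) ∈
      connectedComponentIn (S.realPts N) 1
    rw [heq]
    exact hsub ⟨h, hh, rfl⟩
  inv_mem' := by
    intro g hg
    obtain ⟨hgN, hgr⟩ := realComp_subset hg
    have hpre := image_mul_isPreconnected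
      ((g⁻¹ : LinearMap.GeneralLinearGroup ℂ E) : Module.End ℂ E)
      (isPreconnected_connectedComponentIn (F := S.realPts N) (x := 1))
    exact hpre.subset_connectedComponentIn (F := S.realPts N) (x := 1)
      ⟨g, hg, Units.inv_mul g⟩ (by
        rintro _ ⟨A, hA, rfl⟩
        exact mul_mem_realPts (N.inv_mem hgN) (realPts_inv hgr)
          (connectedComponentIn_subset _ _ hA))
      ⟨1, mem_connectedComponentIn one_mem_realPts, mul_one _⟩

/-- The elements of the identity component that preserve the forms. -/
def K1 (hN : S.Grp b N) : Subgroup (LinearMap.GeneralLinearGroup ℂ E) where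
  carrier := {g | g ∈ S.realCompSubgroup N ∧ ∀ k, ∀ u ∈ S.W k, ∀ v ∈ S.W k,
    S.β k ((g : Module.End ℂ E) u) ((g : Module.End ℂ E) v) = S.β k u v}
  one_mem' := ⟨one_mem _, fun _ _ _ _ _ => rfl⟩
  mul_mem' := by
    rintro g h ⟨hg, hg'⟩ ⟨hh, hh'⟩
    refine ⟨mul_mem hg hh, fun k u hu v hv => ?_⟩
    have hW := hN.map_W h (realComp_subset hh).1 k
    rw [Units.val_mul, Module.End.mul_apply, Module.End.mul_apply, hg' k _ (hW u hu) _ (hW v hv),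
      hh' k u hu v hv]
  inv_mem' := by
    rintro g ⟨hg, hg'⟩
    refine ⟨inv_mem hg, fun k u hu v hv => ?_⟩
    have hW := hN.map_W g⁻¹ (N.inv_mem (realComp_subset hg).1) k
    rw [← hg' k _ (hW u hu) _ (hW v hv), gl_apply_inv, gl_apply_inv]

/-- The elements of `N` that act trivially on the graded pieces. -/
def N1 (hN : S.Grp b N) : Subgroup (LinearMap.GeneralLinearGroup ℂ E) where
  carrier := {g | g ∈ N ∧ ∀ k, ∀ v ∈ S.W k, (g : Module.End ℂ E) v - v ∈ S.W (k - 1)}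
  one_mem' := ⟨one_mem _, fun _ _ _ => by simp⟩
  mul_mem' := by
    rintro g h ⟨hg, hg'⟩ ⟨hh, hh'⟩
    refine ⟨mul_mem hg hh, fun k v hv => ?_⟩
    rw [Units.val_mul, Module.End.mul_apply]
    simpa using Submodule.add_mem _ (hg' k _ (hN.map_W h hh k v hv)) (hh' k v hv)
  inv_mem' := by
    rintro g ⟨hg, hg'⟩
    refine ⟨inv_mem hg, fun k v hv => ?_⟩
    have := Submodule.neg_mem _ (hg' k _ (hN.map_W g⁻¹ (N.inv_mem hg) k v hv))
    rwa [gl_apply_inv, neg_sub] at this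

theorem N1_conj (hN : S.Grp b N) {g u : LinearMap.GeneralLinearGroup ℂ E} (hg : g ∈ N)
    (hu : u ∈ N1 hN) : g * u * g⁻¹ ∈ N1 hN := by
  refine ⟨N.mul_mem (N.mul_mem hg hu.1) (N.inv_mem hg), fun k v hv => ?_⟩
  have h1 := hN.map_W g⁻¹ (N.inv_mem hg) k v hv
  have h2 := hN.map_W g hg _ _ (hu.2 k _ h1)
  rwa [map_sub, gl_apply_inv] at h2

/-- The product of `K1` and `N1`. -/
def H1 (hN : S.Grp b N) : Subgroup (LinearMap.GeneralLinearGroup ℂ E) where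
  carrier := {h | ∃ k ∈ K1 hN, ∃ u ∈ N1 hN, h = k * u}
  one_mem' := ⟨1, one_mem _, 1, one_mem _, (mul_one 1).symm⟩
  mul_mem' := by
    rintro _ _ ⟨k, hk, u, hu, rfl⟩ ⟨k', hk', u', hu', rfl⟩
    refine ⟨k * k', mul_mem hk hk', (k'⁻¹ * u * k'⁻¹⁻¹) * u',
      mul_mem (N1_conj hN (N.inv_mem (realComp_subset hk'.1).1) hu) hu', ?_⟩
    group
  inv_mem' := by
    rintro _ ⟨k, hk, u, hu, rfl⟩
    refine ⟨k⁻¹, inv_mem hk, k * u⁻¹ * k⁻¹,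
      N1_conj hN (realComp_subset hk.1).1 (inv_mem hu), ?_⟩
    group

theorem K1_le_H1 (hN : S.Grp b N) : K1 hN ≤ H1 hN := fun k hk =>
  ⟨k, hk, 1, one_mem _, (mul_one k).symm⟩

theorem N1_le_H1 (hN : S.Grp b N) : N1 hN ≤ H1 hN := fun u hu =>
  ⟨1, one_mem _, u, hu, (one_mul u).symm⟩

theorem H1_le (hN : S.Grp b N) : H1 hN ≤ N := by
  rintro _ ⟨k, hk, u, hu, rfl⟩
  exact mul_mem (realComp_subset hk.1).1 hu.1

variable [CompleteSpace (Module.End ℂ E)]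

theorem expU_mem_K1 (hN : S.Grp b N) {X : Module.End ℂ E} (hX : X ∈ S.skew b N) :
    expU X ∈ K1 hN := by
  obtain ⟨h1, h2, h3⟩ := hX
  refine ⟨?_, fun k u hu v hv => exp_bilin (fun v hv => hN.lie_map_W h1 hv) (h3 k) hu hv⟩
  have hpre : IsPreconnected ((fun t : ℝ => exp ((t : ℂ) • X)) '' Set.univ) :=
    isPreconnected_univ.image _ (exp_continuous'.comp
      (Complex.continuous_ofReal.smul continuous_const)).continuousOn
  refine hpre.subset_connectedComponentIn (F := S.realPts N) (x := 1)
      ⟨0, trivial, ?_⟩ ?_ ⟨1, trivial, ?_⟩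
  · ext v; exact exp_zero_smul_apply X v
  · rintro _ ⟨t, -, rfl⟩
    refine ⟨⟨expU ((t : ℂ) • X), hN.exp_mem h1 t, rfl⟩, fun v => ?_⟩
    have hc : conjEnd S.σ S.invol ((t : ℂ) • X) = (t : ℂ) • X := by
      rw [conjEnd_smul, Complex.conj_ofReal]
      congr 1
      ext v; simp [h2, S.invol (X v)]
    have := exp_conjEnd S.invol ((t : ℂ) • X)
    rw [hc] at this
    have h4 := congrArg (fun A : Module.End ℂ E => A (S.σ v)) this
    simp only [conjEnd_apply, S.invol v] at h4
    exact h4.symm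
  · simp

theorem expU_mem_N1 (hN : S.Grp b N) {X : Module.End ℂ E} (hX : X ∈ S.nm b N) :
    expU X ∈ N1 hN := by
  refine ⟨by simpa using hN.exp_mem hX.1 1, fun k v hv => exp_sub_mem (hX.2 k) (fun v hv => ?_) hv⟩
  exact S.mono (by omega) (hX.2 _ v hv)

theorem mapF_expU {X : Module.End ℂ E} (hX : X ∈ FL b N F 0) : mapF (expU X) F = F :=
  mapF_eq_of_le (fun p v hv => exp_mem_of_mem (fun v hv => by simpa using hX.2 p v hv) hv)
    fun _ => rfl

theorem hasStrictFDerivAt_exp_subtype {𝔸 : Type*} [NormedRing 𝔸] [NormedAlgebra ℝ 𝔸]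
    [CompleteSpace 𝔸] (T : Submodule ℝ 𝔸) :
    HasStrictFDerivAt (fun m : T => exp (m : 𝔸)) T.subtypeL 0 := by
  have h1 : HasStrictFDerivAt (exp : 𝔸 → 𝔸) (1 : 𝔸 →L[ℝ] 𝔸) (T.subtypeL 0) := by
    rw [map_zero]; exact hasStrictFDerivAt_exp_zero
  exact h1.comp (0 : T) T.subtypeL.hasStrictFDerivAt

theorem IsQAlg_exp_real {X : Module.End ℂ E}
    (h : ∀ t : ℝ, exp (t • X) ∈ (fun u : (Module.End ℂ E)ˣ => (u : Module.End ℂ E)) '' N) :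
    X ∈ (lie b N).restrictScalars ℝ :=
  mem_lie_of_exp fun t => by simpa using h t

/-- By `Base.lie_le_skew` the product of the exponentials of `skew`, of `nm` and of the stabilizer
of `γF` has derivative onto `Lie N`, so it covers a neighbourhood of `1` in `N`. The last factor
fixes `γF`, and the first two lie in `H1`. -/
theorem Base.eventually_mem_H1 (h : S.Base b N F) {γ : LinearMap.GeneralLinearGroup ℂ E}
    (hγ : γ ∈ N) (hy : S.Pt (mapF γ F)) :
    ∀ᶠ A in 𝓝 (1 : Module.End ℂ E), ∀ δ ∈ N, (δ : Module.End ℂ E) = A →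
      ∃ g ∈ H1 h.grp, mapF δ (mapF γ F) = mapF g (mapF γ F) := by
  let P := S.skew b N × (S.nm b N).restrictScalars ℝ × (FL b N (mapF γ F) 0).restrictScalars ℝ
  let Ψ : P → Module.End ℂ E := fun x =>
    exp (x.1 : Module.End ℂ E) * (exp (x.2.1 : Module.End ℂ E) * exp (x.2.2 : Module.End ℂ E))
  have e1 : HasStrictFDerivAt (fun x : P => exp (x.1 : Module.End ℂ E))
      ((S.skew b N).subtypeL.comp (ContinuousLinearMap.fst ℝ _ _)) 0 :=
    HasStrictFDerivAt.comp (0 : P) (g := fun m : S.skew b N => exp (m : Module.End ℂ E))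
      (by exact hasStrictFDerivAt_exp_subtype (S.skew b N)) hasStrictFDerivAt_fst
  have e2 : HasStrictFDerivAt (fun x : P => exp (x.2.1 : Module.End ℂ E))
      (((S.nm b N).restrictScalars ℝ).subtypeL.comp
        ((ContinuousLinearMap.fst ℝ _ _).comp (ContinuousLinearMap.snd ℝ _ _))) 0 :=
    HasStrictFDerivAt.comp (0 : P)
      (g := fun m : (S.nm b N).restrictScalars ℝ => exp (m : Module.End ℂ E))
      (by exact hasStrictFDerivAt_exp_subtype ((S.nm b N).restrictScalars ℝ))
      (HasStrictFDerivAt.comp (0 : P) hasStrictFDerivAt_fst hasStrictFDerivAt_snd)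
  have e3 : HasStrictFDerivAt (fun x : P => exp (x.2.2 : Module.End ℂ E))
      (((FL b N (mapF γ F) 0).restrictScalars ℝ).subtypeL.comp
        ((ContinuousLinearMap.snd ℝ _ _).comp (ContinuousLinearMap.snd ℝ _ _))) 0 :=
    HasStrictFDerivAt.comp (0 : P)
      (g := fun m : (FL b N (mapF γ F) 0).restrictScalars ℝ => exp (m : Module.End ℂ E))
      (by exact hasStrictFDerivAt_exp_subtype ((FL b N (mapF γ F) 0).restrictScalars ℝ))
      (HasStrictFDerivAt.comp (0 : P) hasStrictFDerivAt_snd hasStrictFDerivAt_snd)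
  have z1 : exp (((0 : P).1 : S.skew b N) : Module.End ℂ E) = 1 := exp_zero
  have z2 : exp (((0 : P).2.1 : (S.nm b N).restrictScalars ℝ) : Module.End ℂ E) = 1 := exp_zero
  have z3 : exp (((0 : P).2.2 : (FL b N (mapF γ F) 0).restrictScalars ℝ) : Module.End ℂ E) = 1 :=
    exp_zero
  have hΨ := e1.mul' (e2.mul' e3)
  have z4 : ((fun x : P => exp (x.2.1 : Module.End ℂ E)) *
      fun x : P => exp (x.2.2 : Module.End ℂ E)) 0 = 1 := by
    rw [Pi.mul_apply, z2, z3, mul_one]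
  rw [z1, z2, z3, z4, one_smul, one_smul, MulOpposite.op_one, one_smul, one_smul] at hΨ
  have hmem : ∀ x : P, (expU (x.1 : Module.End ℂ E) * (expU (x.2.1 : Module.End ℂ E) *
      expU (x.2.2 : Module.End ℂ E))) ∈ N := fun x =>
    mul_mem (by simpa using h.grp.exp_mem x.1.2.1 1)
      (mul_mem (by simpa using h.grp.exp_mem x.2.1.2.1 1)
        (by simpa using h.grp.exp_mem x.2.2.2.1 1))
  have key := eventually_mem_image_of_range N (fun u hu => h.grp.alg.mem_of_closure u hu)
    ((lie b N).restrictScalars ℝ) (fun X hX => IsQAlg_exp_real hX) (Ψ := Ψ) hΨ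
    (by simp [Ψ]) (fun x => ⟨_, hmem x, rfl⟩) (fun X hX => by
      obtain ⟨A, hA, B, hB, C, hC, rfl⟩ := h.lie_le_skew hγ hy hX
      exact ⟨(⟨A, hA⟩, ⟨B, hB⟩, ⟨C, hC⟩), by
        change C + B + A = A + B + C
        abel⟩) (U := Set.univ) univ_mem
  filter_upwards [key] with A hA δ hδ hδA
  obtain ⟨x, -, hx⟩ := hA ⟨δ, hδ, hδA⟩
  have hδx : δ = expU (x.1 : Module.End ℂ E) * (expU (x.2.1 : Module.End ℂ E) *
      expU (x.2.2 : Module.End ℂ E)) := Units.ext (hδA.trans hx.symm)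
  refine ⟨expU (x.1 : Module.End ℂ E) * expU (x.2.1 : Module.End ℂ E),
    mul_mem (K1_le_H1 _ (expU_mem_K1 h.grp x.1.2)) (N1_le_H1 _ (expU_mem_N1 h.grp x.2.1.2)), ?_⟩
  rw [hδx, ← mul_assoc, mapF_mul, mapF_expU x.2.2.2]

/-- Moving along a connected set of elements of `N`. -/
theorem Base.exists_H1_of_preconnected (h : S.Base b N F) {γ : LinearMap.GeneralLinearGroup ℂ E}
    (hγ : γ ∈ N) {T : Type*} [TopologicalSpace T] {s : Set T} (hs : IsPreconnected s)
    (P : T → LinearMap.GeneralLinearGroup ℂ E)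
    (hP : ContinuousOn (fun t => (P t : Module.End ℂ E)) s) (hPN : ∀ t ∈ s, P t ∈ N)
    (hy : ∀ t ∈ s, S.Pt (mapF (P t) (mapF γ F))) {t₀ t₁ : T} (h0 : t₀ ∈ s) (h1 : t₁ ∈ s) :
    ∃ g ∈ H1 h.grp, mapF (P t₁) (mapF γ F) = mapF g (mapF (P t₀) (mapF γ F)) := by
  -- Lying in the same `H1`-orbit is an equivalence relation on the parameters, and by
  -- `eventually_mem_H1` it holds between neighbouring ones. On a preconnected set there is then a
  -- single class.
  refine hs.induction₂ (fun t t' => ∃ g ∈ H1 h.grp,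
    mapF (P t') (mapF γ F) = mapF g (mapF (P t) (mapF γ F))) (fun t ht => ?_) ?_ ?_ h0 h1
  · have e : mapF (P t) (mapF γ F) = mapF (P t * γ) F := (mapF_mul _ _ _).symm
    have hev := h.eventually_mem_H1 (N.mul_mem (hPN t ht) hγ) (e ▸ hy t ht)
    have hc : ContinuousWithinAt (fun t' => (P t' : Module.End ℂ E) *
        ((P t)⁻¹ : LinearMap.GeneralLinearGroup ℂ E)) s t := (hP t ht).mul_const _
    have hc1 : Tendsto (fun t' => (P t' : Module.End ℂ E) *
        ((P t)⁻¹ : LinearMap.GeneralLinearGroup ℂ E)) (𝓝[s] t) (𝓝 1) := by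
      have := hc.tendsto
      rwa [Units.mul_inv] at this
    filter_upwards [hc1.eventually hev, self_mem_nhdsWithin] with t' ht' hts
    obtain ⟨g, hg, hgt⟩ := ht' (P t' * (P t)⁻¹) (N.mul_mem (hPN t' hts) (N.inv_mem (hPN t ht))) rfl
    refine ⟨g, hg, ?_⟩
    rw [e, ← hgt, ← e, ← mapF_mul (P t' * (P t)⁻¹) (P t), inv_mul_cancel_right]
  · rintro t t' t'' - - - ⟨g, hg, hgt⟩ ⟨g', hg', hgt'⟩
    exact ⟨g' * g, mul_mem hg' hg, by rw [hgt', hgt, mapF_mul]⟩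
  · rintro t t' - - ⟨g, hg, hgt⟩
    exact ⟨g⁻¹, inv_mem hg, by rw [hgt, ← mapF_mul g⁻¹ g, inv_mul_cancel, mapF_one]⟩

theorem uniRad_le : uniRad b N ≤ N := sSup_le fun _ hU => hU.2.1

/-- The orbit is the orbit of `H1`. -/
theorem Base.exists_H1 (h : S.Base b N F)
    (hM : ∀ g ∈ S.realComp N, ∀ u ∈ uniRad b N, S.Pt (mapF (g * u) F))
    {g : LinearMap.GeneralLinearGroup ℂ E} (hg : g ∈ S.realComp N)
    {u : LinearMap.GeneralLinearGroup ℂ E} (hu : u ∈ uniRad b N) :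
    ∃ a ∈ H1 h.grp, mapF (g * u) F = mapF a F := by
  have h1R : (1 : LinearMap.GeneralLinearGroup ℂ E) ∈ S.realComp N :=
    (S.realCompSubgroup N).one_mem
  -- The radical is generated by unipotent groups, and each of their elements is joined to `1` by a
  -- one-parameter group inside the same group. Along such a path the points are polarized by `hM`.
  -- The extra factor `w` carries the generators already applied, as needed for products.
  have step1 : ∀ u ∈ uniRad b N, ∀ w ∈ uniRad b N,
      ∃ a ∈ H1 h.grp, mapF u (mapF w F) = mapF a (mapF w F) := by
    intro u hu
    rw [uniRad, sSup_eq_iSup'] at hu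
    induction hu using Subgroup.iSup_induction' with
    | hp U u hu =>
      obtain ⟨U, hUq, hUN, hUn, hUu⟩ := U
      intro w hw
      have hUR : U ≤ uniRad b N := le_sSup ⟨hUq, hUN, hUn, hUu⟩
      obtain ⟨P, hPU, hP0, hP1, hPc⟩ := exists_unipotent_path hUq hu (hUu u hu)
      obtain ⟨a, ha, hau⟩ := h.exists_H1_of_preconnected (uniRad_le hw) isPreconnected_univ P
        hPc.continuousOn (fun t _ => hUN (hPU t)) (fun t _ => by
          have := hM 1 h1R (P t * w) (mul_mem (hUR (hPU t)) hw)
          rwa [one_mul, mapF_mul] at this) (Set.mem_univ 0) (Set.mem_univ 1)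
      rw [hP0, hP1, mapF_one] at hau
      exact ⟨a, ha, hau⟩
    | h1 => exact fun w _ => ⟨1, one_mem _, rfl⟩
    | hmul u u' hu hu' ih ih' =>
      intro w hw
      rw [← sSup_eq_iSup'] at hu'
      obtain ⟨a', ha', hau'⟩ := ih' w hw
      obtain ⟨a, ha, hau⟩ := ih (u' * w) (mul_mem hu' hw)
      refine ⟨a * a', mul_mem ha ha', ?_⟩
      rw [mapF_mul, ← mapF_mul u' w, hau, mapF_mul, hau', mapF_mul]
  obtain ⟨a, ha, hau⟩ := step1 u hu 1 (one_mem _)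
  rw [mapF_one] at hau
  -- The real points are a set of endomorphisms; each is lifted to the general linear group by
  -- choice. The lift has the same underlying endomorphism, so it is continuous for the topology
  -- used to define the component.
  have hcont : ContinuousOn (fun A : S.realPts N => ((Classical.choose A.2.1 :
      LinearMap.GeneralLinearGroup ℂ E) : Module.End ℂ E)) Set.univ := by
    refine continuousOn_univ.2 (continuous_subtype_val.congr fun A => ?_)
    exact (Classical.choose_spec A.2.1).2.symm
  have hpre : IsPreconnected
      ((↑) ⁻¹' connectedComponentIn (S.realPts N) 1 : Set (S.realPts N)) := by
    rw [← Topology.IsInducing.subtypeVal.isPreconnected_image, Subtype.image_preimage_coe,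
      Set.inter_eq_right.2 (connectedComponentIn_subset _ _)]
    exact isPreconnected_connectedComponentIn
  have hch : ∀ (A : S.realPts N) (g : LinearMap.GeneralLinearGroup ℂ E),
      (g : Module.End ℂ E) = A → Classical.choose A.2.1 = g := fun A g hgA =>
    Units.ext ((Classical.choose_spec A.2.1).2.trans hgA.symm)
  have hgp : (g : Module.End ℂ E) ∈ S.realPts N := connectedComponentIn_subset _ _ hg
  obtain ⟨a', ha', hag⟩ := h.exists_H1_of_preconnected (uniRad_le hu) hpre
    (fun A => Classical.choose A.2.1) (hcont.mono (Set.subset_univ _))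
    (fun A _ => (Classical.choose_spec A.2.1).1) (fun A hA => by
      have := hM (Classical.choose A.2.1) (by
        change ((Classical.choose A.2.1 : LinearMap.GeneralLinearGroup ℂ E) : Module.End ℂ E) ∈
          connectedComponentIn (S.realPts N) 1
        rw [(Classical.choose_spec A.2.1).2]; exact hA) u hu
      rwa [mapF_mul] at this) (t₀ := ⟨1, one_mem_realPts⟩) (t₁ := ⟨g, hgp⟩)
      (mem_connectedComponentIn one_mem_realPts) hg
  rw [hch ⟨g, hgp⟩ g rfl, hch ⟨1, one_mem_realPts⟩ 1 rfl, mapF_one] at hag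
  refine ⟨a' * a, mul_mem ha' ha, ?_⟩
  rw [mapF_mul, hag, hau, mapF_mul]

end Sys

end Orbit

open NormedSpace Filter Topology

/-! ### Strictly triangular representatives for elements acting trivially on graded pieces -/

section Strict

variable {E : Type*} [NormedAddCommGroup E] [NormedSpace ℂ E] [FiniteDimensional ℂ E] {n : ℕ}

attribute [local instance] endNormedRing endNormedAlgebra

theorem eq_zero_of_descending {U : ℤ → Submodule ℂ E} (hU : Monotone U) (hb : ∃ a, U a = ⊥)
    (ht : ∃ a, U a = ⊤) {v : E} (h : ∀ k, v ∈ U k → v ∈ U (k - 1)) : v = 0 := by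
  obtain ⟨a, ha⟩ := hb
  obtain ⟨c, hc⟩ := ht
  have key : ∀ m : ℕ, v ∈ U (c - m) := fun m => by
    induction m with
    | zero => simp [hc]
    | succ m ih =>
      have := h _ ih
      rwa [sub_sub, ← Nat.cast_succ] at this
  have := hU (show c - (c - a).toNat ≤ a by omega) (key (c - a).toNat)
  simpa [ha] using this

/-- Second-order approximation of the exponential on a filtration. -/
theorem exp_sub_sub_mem {X : Module.End ℂ E} {T T' : Submodule ℂ E} (h : ∀ v ∈ T, X (X v) ∈ T')
    (h' : ∀ v ∈ T', X v ∈ T') {v : E} (hv : v ∈ T) : exp X v - v - X v ∈ T' := by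
  have := end_completeSpace E
  have h1 : HasSum (fun m : ℕ => ((m.factorial : ℂ)⁻¹ • X ^ m)) (exp X) :=
    exp_series_hasSum_exp' X
  have h2 := (LinearMap.toContinuousLinearMap
    (LinearMap.applyₗ v : Module.End ℂ E →ₗ[ℂ] E)).hasSum h1
  have h4 := (hasSum_nat_add_iff' 2).2 h2
  have h3 : ∀ m : ℕ, (X ^ (m + 2)) v ∈ T' := fun m => by
    induction m with
    | zero => simpa [pow_two] using h v hv
    | succ m ih => rw [add_right_comm, pow_succ']; exact h' _ ih
  have h5 := T'.closed_of_finiteDimensional.mem_of_tendsto h4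
    (Eventually.of_forall fun s => T'.sum_mem fun m _ => by
      simpa using T'.smul_mem _ (h3 m))
  simpa [Finset.sum_range_succ, sub_sub] using h5

namespace Sys

variable {S : Sys E} {b : Module.Basis (Fin n) ℂ E}
  {N : Subgroup (LinearMap.GeneralLinearGroup ℂ E)} {F : ℤ → Submodule ℂ E}

/-- The opposite filtration of the Hodge filtration defined by Deligne's splitting. -/
def Lo (S : Sys E) (F : ℤ → Submodule ℂ E) (p : ℤ) : Submodule ℂ E :=
  ⨆ i : ℤ × ℤ, ⨆ _ : i.1 ≤ p, S.I F i

theorem Lo_mono : Monotone (S.Lo F) := fun p q hpq => iSup₂_le fun i hi =>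
  le_iSup₂_of_le (f := fun (i : ℤ × ℤ) (_ : i.1 ≤ q) => S.I F i) i (hi.trans hpq) le_rfl

theorem I_le_Lo (i : ℤ × ℤ) : S.I F i ≤ S.Lo F i.1 :=
  le_iSup₂_of_le (f := fun (j : ℤ × ℤ) (_ : j.1 ≤ i.1) => S.I F j) i le_rfl le_rfl

theorem Pt.Lo_bot (h : S.Pt F) : ∃ a, S.Lo F a = ⊥ := by
  obtain ⟨a, ha⟩ := h.opp.topF
  refine ⟨a - 1, (Submodule.eq_bot_iff _).2 fun v hv => ?_⟩
  refine h.eq_zero_of_mem_of_mem (fun i => i.1 ≤ a - 1) hv ?_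
  have h1 : v ∈ F a := by rw [ha]; trivial
  rw [h.F_eq] at h1
  exact (iSup₂_le fun i hi => le_iSup₂_of_le
    (f := fun (i : ℤ × ℤ) (_ : ¬ i.1 ≤ a - 1) => S.I F i) i (by omega) le_rfl :
    (⨆ i : ℤ × ℤ, ⨆ _ : a ≤ i.1, S.I F i) ≤ _) h1

theorem Pt.Lo_top (h : S.Pt F) : ∃ a, S.Lo F a = ⊤ := by
  obtain ⟨c, hc⟩ := h.opp.botF
  refine ⟨c, ?_⟩
  rw [eq_top_iff, ← h.opp.iSup_splitPart]
  refine iSup_le fun i => ?_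
  by_cases hi : i.1 ≤ c
  · exact (I_le_Lo i).trans (Lo_mono hi)
  · refine (I_le_F i).trans ?_
    exact (h.opp.antiF (by omega : c ≤ i.1)).trans (hc ▸ bot_le)

/-- `g` agrees with `1 + Y` to first order, where `Y` lowers weights by `m`. -/
def Approx (S : Sys E) (m : ℤ) (g Y : Module.End ℂ E) : Prop :=
  (∀ k, ∀ v ∈ S.W k, Y v ∈ S.W (k - m)) ∧ ∀ k, ∀ v ∈ S.W k, g v - v - Y v ∈ S.W (k - m - 1)

/-- The cross terms lower weights by at least `2 * m`, which is at least `m + 1` as `m ≥ 1`. So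
first-order terms add under multiplication. -/
theorem Approx.mul {m : ℤ} (hm : 1 ≤ m) {g g' Y Y' : Module.End ℂ E} (h : S.Approx m g Y)
    (h' : S.Approx m g' Y') : S.Approx m (g * g') (Y + Y') := by
  refine ⟨fun k v hv => add_mem (h.1 k v hv) (h'.1 k v hv), fun k v hv => ?_⟩
  have hg : ∀ k, ∀ v ∈ S.W k, g v ∈ S.W k := fun k v hv => by
    have e : g v = (g v - v - Y v) + v + Y v := by abel
    rw [e]
    exact add_mem (add_mem (S.mono (by omega) (h.2 k v hv)) hv) (S.mono (by omega) (h.1 k v hv))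
  have e : (g * g') v - v - (Y + Y') v =
      (g v - v - Y v) + g (g' v - v - Y' v) + ((g (Y' v) - Y' v - Y (Y' v)) + Y (Y' v)) := by
    simp only [Module.End.mul_apply, LinearMap.add_apply, map_sub]
    abel
  rw [e]
  refine add_mem (add_mem (h.2 k v hv) (hg _ _ (h'.2 k v hv))) (add_mem ?_ ?_)
  · exact S.mono (by omega) (h.2 _ _ (h'.1 k v hv))
  · exact S.mono (by omega) (h.1 _ _ (h'.1 k v hv))

theorem approx_exp {m : ℤ} (hm : 1 ≤ m) {Y : Module.End ℂ E}
    (hY : ∀ k, ∀ v ∈ S.W k, Y v ∈ S.W (k - m)) : S.Approx m (exp Y) Y := by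
  refine ⟨hY, fun k v hv => exp_sub_sub_mem (T := S.W k) (fun v hv => ?_) (fun v hv => ?_) hv⟩
  · exact S.mono (by omega) (hY _ _ (hY _ v hv))
  · exact S.mono (by omega) (hY _ v hv)

theorem exists_pow_eq_zero {m : ℤ} (hm : 1 ≤ m) {Y : Module.End ℂ E}
    (hY : ∀ k, ∀ v ∈ S.W k, Y v ∈ S.W (k - m)) : ∃ d : ℕ, Y ^ d = 0 := by
  obtain ⟨a, ha⟩ := S.bot
  obtain ⟨c, hc⟩ := S.top
  have key : ∀ d : ℕ, ∀ v, (Y ^ d) v ∈ S.W (c - d) := fun d => by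
    induction d with
    | zero => simp [hc]
    | succ d ih =>
      intro v
      rw [pow_succ', Module.End.mul_apply]
      refine S.mono ?_ (hY _ _ (ih v))
      push_cast; omega
  refine ⟨(c - a).toNat, LinearMap.ext fun v => ?_⟩
  have := S.mono (show c - (c - a).toNat ≤ a by omega) (key _ v)
  simpa [ha] using this

/-- The logarithm of an element of `N` that lowers weights. -/
theorem Grp.exists_log (hN : S.Grp b N) {m : ℤ} (hm : 1 ≤ m)
    {u : LinearMap.GeneralLinearGroup ℂ E} (hu : u ∈ N)
    (hum : ∀ k, ∀ v ∈ S.W k, (u : Module.End ℂ E) v - v ∈ S.W (k - m)) :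
    ∃ X ∈ lie b N, S.Approx m (u : Module.End ℂ E) X := by
  set ν := (u : Module.End ℂ E) - 1 with hν
  have hνW : ∀ k, ∀ v ∈ S.W k, ν v ∈ S.W (k - m) := hum
  obtain ⟨d, hd⟩ := exists_pow_eq_zero hm hνW
  have hd2 : ν ^ (d + 2) = 0 := by rw [pow_add, hd, zero_mul]
  refine ⟨unipLog ν d, unipLog_mem hN.alg hu hd2, ?_⟩
  have hQ : ∀ k, ∀ v ∈ S.W k,
      (∑ j ∈ Finset.range d, (binomPoly (j + 2)).derivative.eval 0 • ν ^ j) v ∈ S.W k := by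
    intro k v hv
    rw [LinearMap.sum_apply]
    have hpow : ∀ j : ℕ, (ν ^ j) v ∈ S.W k := fun j => by
      induction j with
      | zero => simpa
      | succ j ih =>
        rw [pow_succ', Module.End.mul_apply]
        exact S.mono (by omega) (hνW _ _ ih)
    exact Submodule.sum_mem _ fun j _ => Submodule.smul_mem _ _ (hpow j)
  have h2 : ∀ k, ∀ v ∈ S.W k, (unipLog ν d - ν) v ∈ S.W (k - m - 1) := by
    intro k v hv
    rw [unipLog, add_sub_cancel_left, Module.End.mul_apply, pow_two, Module.End.mul_apply]
    exact S.mono (by omega) (hνW _ _ (hνW _ _ (hQ k v hv)))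
  refine ⟨fun k v hv => ?_, fun k v hv => ?_⟩
  · have := add_mem (S.mono (by omega) (h2 k v hv)) (hνW k v hv)
    rwa [LinearMap.sub_apply, sub_add_cancel] at this
  · have e : (u : Module.End ℂ E) v - v - unipLog ν d v = -((unipLog ν d - ν) v) := by
      simp [hν]
    rw [e]
    exact neg_mem (h2 k v hv)

/-- Splitting an element of the Lie algebra of weight at most `-m` into its components. -/
theorem Base.exists_split (h : S.Base b N F) {m : ℤ} (hm : 1 ≤ m) {X : Module.End ℂ E}
    (hX : X ∈ lie b N) (hXm : ∀ k, ∀ v ∈ S.W k, X v ∈ S.W (k - m)) :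
    ∃ A ∈ lie b N, ∃ B ∈ FL b N F 0, ∃ R : Module.End ℂ E, X = A + B + R ∧
      (∀ p, ∀ v ∈ S.Lo F p, A v ∈ S.Lo F (p - 1)) ∧
      (∀ k, ∀ v ∈ S.W k, A v ∈ S.W (k - m)) ∧ (∀ k, ∀ v ∈ S.W k, B v ∈ S.W (k - m)) ∧
      ∀ k, ∀ v ∈ S.W k, R v ∈ S.W (k - m - 1) := by
  let 𝔞 : (ℤ × ℤ → Prop) → Submodule ℂ (Module.End ℂ E) := fun P =>
    ⨆ l : ℤ × ℤ, ⨆ _ : P l, lie b N ⊓ S.adj F l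
  have hle : ∀ (P : ℤ × ℤ → Prop) {T : Submodule ℂ (Module.End ℂ E)},
      (∀ l, P l → lie b N ⊓ S.adj F l ≤ T) → 𝔞 P ≤ T := fun P T hT => iSup₂_le hT
  have hge : ∀ (P : ℤ × ℤ → Prop) (l), P l → lie b N ⊓ S.adj F l ≤ 𝔞 P := fun P l hl =>
    le_iSup₂_of_le (f := fun (l : ℤ × ℤ) (_ : P l) => lie b N ⊓ S.adj F l) l hl le_rfl
  have hlie : ∀ P, 𝔞 P ≤ lie b N := fun P => hle P fun l _ => inf_le_left
  have hW : ∀ (P : ℤ × ℤ → Prop) (e : ℤ), (∀ l, P l → l.1 + l.2 ≤ e) → ∀ Y ∈ 𝔞 P,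
      ∀ k, ∀ v ∈ S.W k, Y v ∈ S.W (k + e) := by
    intro P e hP Y hY k v hv
    rw [h.pt.W_eq] at hv
    refine (iSup₂_le fun i hi v hv => ?_ :
      (⨆ i : ℤ × ℤ, ⨆ _ : i.1 + i.2 ≤ k, S.I F i) ≤ (S.W (k + e)).comap Y) hv
    refine (hle P fun l hl A hA => ?_ : 𝔞 P ≤ (S.W (k + e)).comap (LinearMap.applyₗ v)) hY
    have := hP l hl
    exact S.mono (by simp only [Prod.fst_add, Prod.snd_add]; omega) (I_le_W _ (hA.2 i v hv))
  have hsplit : lie b N ≤ 𝔞 (fun l => l.1 + l.2 = -m ∧ l.1 < 0) ⊔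
      (𝔞 (fun l => l.1 + l.2 = -m ∧ 0 ≤ l.1) ⊔
        (𝔞 (fun l => l.1 + l.2 ≤ -m - 1) ⊔ 𝔞 (fun l => -m < l.1 + l.2))) := by
    refine h.lie_le.trans (iSup₂_le fun l _ => ?_)
    rcases lt_trichotomy (l.1 + l.2) (-m) with hlt | heq | hgt
    · exact le_sup_of_le_right (le_sup_of_le_right (le_sup_of_le_left (hge _ l (by omega))))
    · by_cases h0 : l.1 < 0
      · exact le_sup_of_le_left (hge _ l ⟨heq, h0⟩)
      · exact le_sup_of_le_right (le_sup_of_le_left (hge _ l ⟨heq, by omega⟩))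
    · exact le_sup_of_le_right (le_sup_of_le_right (le_sup_of_le_right (hge _ l (by omega))))
  obtain ⟨A, hA, Y, hY, rfl⟩ := Submodule.mem_sup.1 (hsplit hX)
  obtain ⟨B, hB, Z, hZ, rfl⟩ := Submodule.mem_sup.1 hY
  obtain ⟨R, hR, H, hH, rfl⟩ := Submodule.mem_sup.1 hZ
  have hAW : ∀ k, ∀ v ∈ S.W k, A v ∈ S.W (k - m) := hW _ (-m) (fun l hl => hl.1.le) A hA
  have hBW : ∀ k, ∀ v ∈ S.W k, B v ∈ S.W (k - m) := hW _ (-m) (fun l hl => hl.1.le) B hB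
  have hRW : ∀ k, ∀ v ∈ S.W k, R v ∈ S.W (k - m - 1) := fun k v hv => by
    have := hW _ (-m - 1) (fun l hl => hl) R hR k v hv
    rwa [← add_sub_assoc] at this
  -- `H` gathers the components of weight greater than `-m`. Since `X`, `A`, `B` and `R` all lower
  -- weights by at least `m`, so does `H`, which is possible only if it vanishes.
  have hH0 : H = 0 := h.pt.eq_of_forall_I fun i v hv => by
    rw [LinearMap.zero_apply]
    refine h.pt.eq_zero_of_mem_of_mem (fun j => i.1 + i.2 - m < j.1 + j.2) ?_ ?_
    · refine (hle _ fun l hl A hA => ?_ : 𝔞 (fun l => -m < l.1 + l.2) ≤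
        (⨆ j : ℤ × ℤ, ⨆ _ : i.1 + i.2 - m < j.1 + j.2, S.I F j).comap (LinearMap.applyₗ v)) hH
      exact Submodule.mem_iSup_of_mem (i + l) (Submodule.mem_iSup_of_mem
        (by simp only [Prod.fst_add, Prod.snd_add]; omega) (hA.2 i v hv))
    · have hvW := I_le_W i hv
      have h1 : H v ∈ S.W (i.1 + i.2 - m) := by
        have e : H v = (A + (B + (R + H))) v - A v - B v - R v := by
          simp only [LinearMap.add_apply]; abel
        rw [e]
        exact sub_mem (sub_mem (sub_mem (hXm _ v hvW) (hAW _ v hvW)) (hBW _ v hvW))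
          (S.mono (by omega) (hRW _ v hvW))
      rw [h.pt.W_eq] at h1
      exact (iSup₂_le fun j hj => le_iSup₂_of_le (f := fun (j : ℤ × ℤ)
        (_ : ¬ (i.1 + i.2 - m < j.1 + j.2)) => S.I F j) j (by omega) le_rfl :
        (⨆ j : ℤ × ℤ, ⨆ _ : j.1 + j.2 ≤ i.1 + i.2 - m, S.I F j) ≤ _) h1
  refine ⟨A, hlie _ hA, B, hle _ (fun l hl => h.adj_le_FL hl.2) hB, R, by rw [hH0]; abel, ?_, hAW,
    hBW, hRW⟩
  intro p v hv
  refine (iSup₂_le fun i hi v hv => ?_ :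
    (⨆ i : ℤ × ℤ, ⨆ _ : i.1 ≤ p, S.I F i) ≤ (S.Lo F (p - 1)).comap A) hv
  refine (hle _ fun l hl Z hZ => ?_ : 𝔞 (fun l => l.1 + l.2 = -m ∧ l.1 < 0) ≤
    (S.Lo F (p - 1)).comap (LinearMap.applyₗ v)) hA
  exact Lo_mono (by simp only [Prod.fst_add]; omega) (I_le_Lo _ (hZ.2 i v hv))

/-- An element of `N` acting trivially on the graded pieces can be replaced, without changing its
effect on the Hodge filtration, by one that is strictly triangular for the opposite filtration. -/
theorem Base.exists_strict (h : S.Base b N F) {u : LinearMap.GeneralLinearGroup ℂ E}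
    (hu : u ∈ N1 h.grp) : ∃ w ∈ N, mapF w F = mapF u F ∧
      ∀ p, ∀ v ∈ S.Lo F p, (w : Module.End ℂ E) v - v ∈ S.Lo F (p - 1) := by
  have := end_completeSpace E
  obtain ⟨a, ha⟩ := S.bot
  obtain ⟨c, hc⟩ := S.top
  -- Induction on the depth `m` to which `u` is trivial on the weight filtration; `e` bounds the
  -- number of steps left before `u = 1`. To first order the logarithm of `u` is `A + B`, with `A`
  -- of negative first degree and `B` in `F⁰`, so `exp (-A) u exp (-B)` is trivial to depth `m + 1`.
  -- The factor `exp (-B)` fixes `F`, and `exp A` is strictly triangular for the opposite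
  -- filtration.
  have key : ∀ e : ℕ, ∀ m : ℤ, 1 ≤ m → c - m ≤ a + e → ∀ u ∈ N,
      (∀ k, ∀ v ∈ S.W k, (u : Module.End ℂ E) v - v ∈ S.W (k - m)) →
      ∃ w ∈ N, mapF w F = mapF u F ∧
        ∀ p, ∀ v ∈ S.Lo F p, (w : Module.End ℂ E) v - v ∈ S.Lo F (p - 1) := by
    intro e
    induction e with
    | zero =>
      intro m _ hcm u _ hu
      refine ⟨1, N.one_mem, ?_, fun p v _ => by simp⟩
      congr 1
      refine Units.ext (LinearMap.ext fun v => ?_)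
      have h1 := S.mono (by simpa using hcm) (hu c v (by rw [hc]; trivial))
      rw [ha, Submodule.mem_bot, sub_eq_zero] at h1
      exact h1.symm
    | succ e ih =>
      intro m hm hcm u hu hum
      obtain ⟨X, hX, hXu⟩ := h.grp.exists_log hm hu hum
      obtain ⟨A, hA, B, hB, R, rfl, hALo, hAW, hBW, hRW⟩ := h.exists_split hm hX hXu.1
      have hneg : ∀ {Y : Module.End ℂ E}, (∀ k, ∀ v ∈ S.W k, Y v ∈ S.W (k - m)) →
          ∀ k, ∀ v ∈ S.W k, (-Y) v ∈ S.W (k - m) := fun hY k v hv => neg_mem (hY k v hv)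
      have happ := ((approx_exp hm (hneg hAW)).mul hm hXu).mul hm (approx_exp hm (hneg hBW))
      have hmem : expU (-A) * u * expU (-B) ∈ N :=
        mul_mem (mul_mem (by simpa using h.grp.exp_mem (neg_mem hA) 1) hu)
          (by simpa using h.grp.exp_mem (neg_mem hB.1) 1)
      obtain ⟨w, hw, hwF, hwLo⟩ := ih (m + 1) (by omega) (by push_cast at hcm; omega) _ hmem
        fun k v hv => by
          have h1 := happ.2 k v hv
          have h2 := add_mem h1 (hRW k v hv)
          have e : (-A + (A + B + R) + -B) v = R v := by
            rw [show -A + (A + B + R) + -B = R by abel]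
          rw [e, sub_add_cancel, sub_sub] at h2
          exact h2
      refine ⟨expU A * w, mul_mem (by simpa using h.grp.exp_mem hA 1) hw, ?_, fun p v hv => ?_⟩
      · rw [mapF_mul, hwF, ← mapF_mul, mul_assoc, mapF_mul, mapF_mul, mapF_mul,
          mapF_expU (neg_mem hB), ← mapF_mul, expU_neg, mul_inv_cancel, mapF_one]
      · have h1 : (w : Module.End ℂ E) v ∈ S.Lo F p := by
          have := add_mem (Lo_mono (by omega) (hwLo p v hv)) hv
          rwa [sub_add_cancel] at this
        have h2 : exp A ((w : Module.End ℂ E) v) - (w : Module.End ℂ E) v ∈ S.Lo F (p - 1) :=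
          exp_sub_mem (T := S.Lo F p) (hALo p) (fun v hv => Lo_mono (by omega) (hALo _ v hv)) h1
        have h3 := add_mem h2 (hwLo p v hv)
        rwa [sub_add_sub_cancel] at h3
  exact key (c - 1 - a).toNat 1 le_rfl (by omega) u hu.1 hu.2

end Sys

end Strict

open NormedSpace Filter Topology

/-! ### Limits of endomorphisms and of filtrations -/

section Key

variable {E : Type*} [NormedAddCommGroup E] [NormedSpace ℂ E] [FiniteDimensional ℂ E] {n : ℕ}

attribute [local instance] endNormedRing endNormedAlgebra

section Limits

variable {α : Type*} {l : Filter α}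

theorem tendsto_end_apply {A : α → Module.End ℂ E} {A₀ : Module.End ℂ E}
    (h : Tendsto A l (𝓝 A₀)) {v : α → E} {v₀ : E} (hv : Tendsto v l (𝓝 v₀)) :
    Tendsto (fun z => A z (v z)) l (𝓝 (A₀ v₀)) := by
  let B : Module.End ℂ E →ₗ[ℂ] E →ₗ[ℂ] E := LinearMap.id
  let B' : Module.End ℂ E →L[ℂ] E →L[ℂ] E :=
    LinearMap.toContinuousLinearMap ((LinearMap.toContinuousLinearMap :
      (E →ₗ[ℂ] E) ≃ₗ[ℂ] (E →L[ℂ] E)).toLinearMap ∘ₗ B)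
  have h1 : Continuous fun x : Module.End ℂ E × E => B' x.1 x.2 := B'.continuous₂
  exact (h1.tendsto (A₀, v₀)).comp (h.prodMk_nhds hv)

theorem tendsto_constr {κ : Type*} [Finite κ] (b : Module.Basis κ ℂ E) {f : α → κ → E} {f₀ : κ → E}
    (h : ∀ j, Tendsto (fun z => f z j) l (𝓝 (f₀ j))) :
    Tendsto (fun z => (b.constr ℂ (f z) : Module.End ℂ E)) l (𝓝 (b.constr ℂ f₀)) := by
  have := Fintype.ofFinite κ
  have hc : Continuous fun g : κ → E => (b.constr ℂ g : Module.End ℂ E) :=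
    (b.constr (M' := E) ℂ).toLinearMap.continuous_of_finiteDimensional
  exact (hc.tendsto f₀).comp (tendsto_pi_nhds.2 h)

theorem exists_tendsto_of_forall_mem {ι : Type*} {I : ι → Submodule ℂ E} (hI : ⨆ i, I i = ⊤)
    {A : α → Module.End ℂ E} (h : ∀ i, ∀ v ∈ I i, ∃ y, Tendsto (fun z => A z v) l (𝓝 y)) :
    ∃ A₀, Tendsto A l (𝓝 A₀) := by
  let T : Submodule ℂ E :=
    { carrier := {v | ∃ y, Tendsto (fun z => A z v) l (𝓝 y)}
      add_mem' := by
        rintro v w ⟨y, hy⟩ ⟨y', hy'⟩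
        exact ⟨y + y', by simpa using hy.add hy'⟩
      zero_mem' := ⟨0, by simpa using tendsto_const_nhds⟩
      smul_mem' := by
        rintro c v ⟨y, hy⟩
        exact ⟨c • y, by simpa using hy.const_smul c⟩ }
  have hT : T = ⊤ := top_le_iff.1 (hI ▸ iSup_le fun i => h i)
  have hT' : ∀ v, ∃ y, Tendsto (fun z => A z v) l (𝓝 y) := fun v =>
    show v ∈ T by rw [hT]; trivial
  choose y hy using hT'
  let b := Module.finBasis ℂ E
  refine ⟨_, (tendsto_constr b (fun j => hy (b j))).congr fun z => ?_⟩
  exact b.ext fun j => by simp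

theorem tendsto_gl_inv {g : α → LinearMap.GeneralLinearGroup ℂ E}
    {u : LinearMap.GeneralLinearGroup ℂ E}
    (h : Tendsto (fun z => (g z : Module.End ℂ E)) l (𝓝 (u : Module.End ℂ E))) :
    Tendsto (fun z => ((g z)⁻¹ : LinearMap.GeneralLinearGroup ℂ E).val) l
      (𝓝 (u⁻¹ : LinearMap.GeneralLinearGroup ℂ E).val) := by
  have := end_completeSpace E
  have h1 := (NormedRing.inverse_continuousAt u).tendsto.comp h
  rw [Ring.inverse_unit] at h1
  exact h1.congr fun z => Ring.inverse_unit _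

theorem exists_gl_of_tendsto_one {A : α → Module.End ℂ E} (h : Tendsto A l (𝓝 1)) :
    ∃ a : α → LinearMap.GeneralLinearGroup ℂ E, (∀ᶠ z in l, (a z : Module.End ℂ E) = A z) ∧
      Tendsto (fun z => (a z : Module.End ℂ E)) l (𝓝 1) := by
  classical
  have := end_completeSpace E
  have h1 : ∀ᶠ z in l, IsUnit (A z) := h.eventually (Units.isOpen.mem_nhds isUnit_one)
  let a : α → LinearMap.GeneralLinearGroup ℂ E := fun z => if hz : IsUnit (A z) then hz.unit else 1
  have h2 : ∀ᶠ z in l, (a z : Module.End ℂ E) = A z := h1.mono fun z hz => by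
    simp only [a, dif_pos hz]; rfl
  exact ⟨a, h2, h.congr' (h2.mono fun z hz => hz.symm)⟩

theorem mem_of_tendsto' [l.NeBot] {T : Submodule ℂ E} {f : α → E} {y : E} (h : Tendsto f l (𝓝 y))
    (hf : ∀ᶠ z in l, f z ∈ T) : y ∈ T :=
  T.closed_of_finiteDimensional.mem_of_tendsto h hf

end Limits

namespace Sys

variable {S : Sys E} {b : Module.Basis (Fin n) ℂ E}
  {N : Subgroup (LinearMap.GeneralLinearGroup ℂ E)} {F F' : ℤ → Submodule ℂ E}

theorem continuous_σ : Continuous S.σ := by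
  let f : E →ₗ[ℝ] E :=
    { toFun := S.σ
      map_add' := map_add S.σ
      map_smul' := fun c v => by
        rw [← Complex.coe_smul, map_smulₛₗ, Complex.conj_ofReal, Complex.coe_smul]; rfl }
  have : FiniteDimensional ℝ E := FiniteDimensional.complexToReal E
  exact f.continuous_of_finiteDimensional

theorem continuous_β (k : ℤ) : Continuous fun x : E × E => S.β k x.1 x.2 := by
  let B' : E →L[ℂ] E →L[ℂ] ℂ :=
    LinearMap.toContinuousLinearMap ((LinearMap.toContinuousLinearMap :
      (E →ₗ[ℂ] ℂ) ≃ₗ[ℂ] (E →L[ℂ] ℂ)).toLinearMap ∘ₗ S.β k)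
  exact B'.continuous₂

theorem Pt.F_inf_W_eq (h : S.Pt F) (k p : ℤ) :
    F p ⊓ S.W k = ⨆ i : ℤ × ℤ, ⨆ _ : p ≤ i.1 ∧ i.1 + i.2 ≤ k, S.I F i :=
  h.opp.F_inf_W_eq k p

theorem Grp.map_W_iff (hN : S.Grp b N) {g : LinearMap.GeneralLinearGroup ℂ E} (hg : g ∈ N)
    {k : ℤ} {v : E} : (g : Module.End ℂ E) v ∈ S.W k ↔ v ∈ S.W k :=
  ⟨fun h => by simpa [gl_inv_apply] using hN.map_W _ (N.inv_mem hg) k _ h, hN.map_W g hg k v⟩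

theorem Grp.finrank_mapF_inf (hN : S.Grp b N) {g : LinearMap.GeneralLinearGroup ℂ E} (hg : g ∈ N)
    (p k : ℤ) : Module.finrank ℂ (mapF g F p ⊓ S.W k : Submodule ℂ E) =
      Module.finrank ℂ (F p ⊓ S.W k : Submodule ℂ E) := by
  have : (mapF g F p ⊓ S.W k : Submodule ℂ E) =
      (F p ⊓ S.W k).map (g : Module.End ℂ E) := by
    ext v
    constructor
    · rintro ⟨⟨w, hw, rfl⟩, hv⟩
      exact ⟨w, ⟨hw, (hN.map_W_iff hg).1 hv⟩, rfl⟩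
    · rintro ⟨w, ⟨hw, hw'⟩, rfl⟩
      exact ⟨⟨w, hw, rfl⟩, (hN.map_W_iff hg).2 hw'⟩
  rw [this]
  exact (Submodule.equivMapOfInjective _ (gl_injective g) _).finrank_eq.symm

variable {α : Type*} {l : Filter α}

/-- Vectors of a limit filtration are limits of vectors, compatibly with the weight filtration. -/
theorem exists_tendsto_mem {T Wk : Submodule ℂ E} {Tz : α → Submodule ℂ E}
    {θ : α → Module.End ℂ E} (hθ : Tendsto θ l (𝓝 1)) (hT : ∀ᶠ z in l, T.map (θ z) = Tz z)
    (hd : ∀ᶠ z in l, Module.finrank ℂ (Tz z ⊓ Wk : Submodule ℂ E) =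
      Module.finrank ℂ (T ⊓ Wk : Submodule ℂ E)) {v : E} (hv : v ∈ T ⊓ Wk) :
    ∃ v' : α → E, (∀ᶠ z in l, v' z ∈ Tz z ⊓ Wk) ∧ Tendsto v' l (𝓝 v) := by
  obtain ⟨C, hC⟩ := Submodule.exists_isCompl Wk
  obtain ⟨a, ha, -⟩ := exists_gl_of_tendsto_one hθ
  -- With `q` of kernel `Wk`, the vectors of `T` that `θ z` sends into `Wk` form the kernel of `q ∘
  -- θ z` on `T`. The assumption `hd` says that its dimension is eventually constant, so
  -- `exists_tendsto_ker` applies.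
  let q : Module.End ℂ E := C.projection Wk hC.symm
  have hq : ∀ v, q v = 0 ↔ v ∈ Wk := fun v => by
    rw [← LinearMap.mem_ker, Submodule.ker_projection]
  let comp : Module.End ℂ E →ₗ[ℂ] (T →L[ℂ] E) :=
    (LinearMap.toContinuousLinearMap : (T →ₗ[ℂ] E) ≃ₗ[ℂ] (T →L[ℂ] E)).toLinearMap ∘ₗ
      (LinearMap.lcomp ℂ E T.subtype ∘ₗ LinearMap.llcomp ℂ E E E q)
  have hcomp : ∀ A (t : T), comp A t = q (A t) := fun A t => rfl
  have hL : Tendsto (fun z => comp (θ z)) l (𝓝 (comp 1)) :=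
    (comp.continuous_of_finiteDimensional.tendsto 1).comp hθ
  have hker : ∀ g : LinearMap.GeneralLinearGroup ℂ E,
      Module.finrank ℂ (comp (g : Module.End ℂ E)).ker =
        Module.finrank ℂ (T.map (g : Module.End ℂ E) ⊓ Wk : Submodule ℂ E) := fun g => by
    have h1 : (T.map (g : Module.End ℂ E) ⊓ Wk : Submodule ℂ E) =
        (comp (g : Module.End ℂ E)).ker.map ((g : Module.End ℂ E) ∘ₗ T.subtype) := by
      ext w
      constructor
      · rintro ⟨⟨t, ht, rfl⟩, hw⟩
        exact ⟨⟨t, ht⟩, (hq _).2 hw, rfl⟩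
      · rintro ⟨t, ht, rfl⟩
        exact ⟨⟨t, t.2, rfl⟩, (hq _).1 ht⟩
    rw [h1]
    have hi : Function.Injective ((g : Module.End ℂ E) ∘ₗ T.subtype) := by
      rw [LinearMap.coe_comp]
      exact (gl_injective g).comp T.injective_subtype
    exact (Submodule.equivMapOfInjective _ hi _).finrank_eq
  have hk1 : Module.finrank ℂ (comp 1).ker = Module.finrank ℂ (T ⊓ Wk : Submodule ℂ E) := by
    have := hker 1
    rw [Units.val_one] at this
    rw [this, show T.map (1 : Module.End ℂ E) = T from Submodule.map_id T]
  have hdim : ∀ᶠ z in l, Module.finrank ℂ (comp (θ z)).ker = Module.finrank ℂ (comp 1).ker := by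
    filter_upwards [ha, hT, hd] with z h1 h2 h3
    rw [hk1, ← h3, ← h2, ← h1, hker]
  obtain ⟨b', hb', hb''⟩ := exists_tendsto_ker hL hdim (b := (⟨v, hv.1⟩ : T)) ((hq v).2 hv.2)
  refine ⟨fun z => θ z (b' z), ?_, ?_⟩
  · filter_upwards [hb', hT] with z h1 h2
    exact ⟨h2 ▸ ⟨b' z, (b' z).2, rfl⟩, (hq _).1 h1⟩
  · have h1 : Tendsto (fun z => ((b' z : T) : E)) l (𝓝 v) :=
      (continuous_subtype_val.tendsto _).comp hb''
    simpa using tendsto_end_apply hθ h1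

/-- On a basis adapted to Deligne's splitting of `F'`, each vector of `I^(p,q)` is replaced by a
nearby vector of `Fz p ⊓ W (p + q)`. The resulting linear map tends to `1`, carries `F'` to the
nearby filtration by equality of dimensions, and preserves `W`. A map that worked for each step of
`F'` separately would not give this. -/
theorem Pt.exists_tendsto_one (hy : S.Pt F') {Fz : α → ℤ → Submodule ℂ E}
    (hanti : ∀ z, Antitone (Fz z)) {θ : ℤ → α → Module.End ℂ E}
    (hθ : ∀ p, Tendsto (θ p) l (𝓝 1)) (hF : ∀ p, ∀ᶠ z in l, (F' p).map (θ p z) = Fz z p)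
    (hd : ∀ p k, ∀ z, Module.finrank ℂ (Fz z p ⊓ S.W k : Submodule ℂ E) =
      Module.finrank ℂ (F' p ⊓ S.W k : Submodule ℂ E)) :
    ∃ a : α → LinearMap.GeneralLinearGroup ℂ E,
      Tendsto (fun z => (a z : Module.End ℂ E)) l (𝓝 1) ∧
      (∀ᶠ z in l, mapF (a z) F' = Fz z) ∧
      ∀ᶠ z in l, ∀ k, ∀ v ∈ S.W k, (a z : Module.End ℂ E) v ∈ S.W k := by
  classical
  let B := hy.isInternal.collectedBasis fun i => Module.finBasis ℂ (S.I F' i)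
  have hB : ∀ j, B j ∈ S.I F' j.1 := fun j => hy.isInternal.collectedBasis_mem _ j
  have hfin : Finite (Σ i, Fin (Module.finrank ℂ (S.I F' i))) := Module.Finite.finite_basis B
  have hex : ∀ j, ∃ v' : α → E, (∀ᶠ z in l, v' z ∈ Fz z j.1.1 ⊓ S.W (j.1.1 + j.1.2)) ∧
      Tendsto v' l (𝓝 (B j)) := fun j =>
    exists_tendsto_mem (hθ j.1.1) (hF j.1.1) (Eventually.of_forall (hd _ _))
      ⟨I_le_F _ (hB j), I_le_W _ (hB j)⟩
  choose v' hv' hv'' using hex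
  have hA : Tendsto (fun z => (B.constr ℂ (fun j => v' j z) : Module.End ℂ E)) l (𝓝 1) := by
    convert tendsto_constr (l := l) B (f := fun z j => v' j z) hv'' using 2
    exact (B.ext fun j => by simp)
  obtain ⟨a, ha, ha1⟩ := exists_gl_of_tendsto_one hA
  have hI : ∀ᶠ z in l, ∀ i, ∀ v ∈ S.I F' i,
      (a z : Module.End ℂ E) v ∈ Fz z i.1 ⊓ S.W (i.1 + i.2) := by
    filter_upwards [ha, eventually_all.2 hv'] with z h1 h2 i v hv
    have hspan : S.I F' i = Submodule.span ℂ (Set.range fun j => B ⟨i, j⟩) := by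
      have h3 := congrArg (Submodule.map (S.I F' i).subtype) (Module.finBasis ℂ (S.I F' i)).span_eq
      rw [Submodule.map_span, Submodule.map_top, Submodule.range_subtype, ← Set.range_comp] at h3
      refine h3.symm.trans (congrArg _ (congrArg _ (funext fun j => ?_)))
      simp [B, DirectSum.IsInternal.collectedBasis_coe]
    rw [hspan] at hv
    have h4 : Submodule.span ℂ (Set.range fun j => B ⟨i, j⟩) ≤
        (Fz z i.1 ⊓ S.W (i.1 + i.2)).comap (a z : Module.End ℂ E) := by
      rw [Submodule.span_le]
      rintro _ ⟨j, rfl⟩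
      change (a z : Module.End ℂ E) (B ⟨i, j⟩) ∈ Fz z i.1 ⊓ S.W (i.1 + i.2)
      rw [h1, Module.Basis.constr_basis]
      exact h2 ⟨i, j⟩
    exact h4 hv
  refine ⟨a, ha1, ?_, ?_⟩
  · filter_upwards [hI] with z hz
    refine mapF_eq_of_le (fun p v hv => ?_) fun p => ?_
    · have h1 : F' p ≤ (Fz z p).comap (a z : Module.End ℂ E) := by
        rw [hy.F_eq]
        exact iSup₂_le fun i hi v hv => hanti z hi (hz i v hv).1
      exact h1 hv
    · obtain ⟨c, hc⟩ := S.top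
      have := hd p c z
      rw [hc, inf_top_eq, inf_top_eq] at this
      exact this.symm
  · filter_upwards [hI] with z hz k v hv
    have h1 : S.W k ≤ (S.W k).comap (a z : Module.End ℂ E) := by
      conv_lhs => rw [hy.W_eq]
      exact iSup₂_le fun i hi v hv => S.mono hi (hz i v hv).2
    exact h1 hv

end Sys

end Key

open NormedSpace Filter Topology

/-! ### Boundedness of weight-zero parts from the polarization -/

section KeyLimit

variable {E : Type*} [NormedAddCommGroup E] [NormedSpace ℂ E] [FiniteDimensional ℂ E] {n : ℕ}

attribute [local instance] endNormedRing endNormedAlgebra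

namespace Sys

variable {S : Sys E} {b : Module.Basis (Fin n) ℂ E}
  {N : Subgroup (LinearMap.GeneralLinearGroup ℂ E)} {F F' : ℤ → Submodule ℂ E}

theorem β_apply_of_mem {γ k : Module.End ℂ E}
    (h : ∀ m, ∀ v ∈ S.W m, γ v - k v ∈ S.W (m - 1))
    (hk : ∀ m, ∀ u ∈ S.W m, ∀ v ∈ S.W m, S.β m (k u) (k v) = S.β m u v) {m : ℤ} {u v : E}
    (hu : u ∈ S.W m) (hv : v ∈ S.W m) : S.β m (γ u) (γ v) = S.β m u v :=
  (S.β_congr (h m u hu) (h m v hv)).trans (hk m u hu v hv)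

theorem Pt.eq_zero_of_Iw (h : S.Pt F) {k : ℤ} {v : E} (hv : v ∈ S.Iw F k)
    (hv' : v ∈ S.W (k - 1)) : v = 0 := by
  refine h.eq_zero_of_mem_of_mem (fun i => i.1 + i.2 = k) hv ?_
  rw [h.W_eq] at hv'
  refine (iSup₂_le fun i hi => ?_ : (⨆ i : ℤ × ℤ, ⨆ _ : i.1 + i.2 ≤ k - 1, S.I F i) ≤ _) hv'
  exact le_iSup₂_of_le (f := fun (i : ℤ × ℤ) (_ : ¬ i.1 + i.2 = k) => S.I F i) i (by omega) le_rfl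

theorem finrank_map_gl (a : LinearMap.GeneralLinearGroup ℂ E) (T : Submodule ℂ E) :
    Module.finrank ℂ (T.map (a : Module.End ℂ E)) = Module.finrank ℂ T :=
  (Submodule.equivMapOfInjective _ (gl_injective a) _).finrank_eq.symm

theorem inv_apply_mem {a : LinearMap.GeneralLinearGroup ℂ E} {T : Submodule ℂ E}
    (h : ∀ v ∈ T, (a : Module.End ℂ E) v ∈ T) {v : E} (hv : v ∈ T) :
    ((a⁻¹ : LinearMap.GeneralLinearGroup ℂ E) : Module.End ℂ E) v ∈ T := by
  have h1 : T.map (a : Module.End ℂ E) = T := by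
    refine Submodule.eq_of_le_of_finrank_eq ?_ (finrank_map_gl a T)
    rintro _ ⟨w, hw, rfl⟩
    exact h w hw
  rw [← h1] at hv
  obtain ⟨w, hw, rfl⟩ := hv
  rwa [gl_inv_apply]

/-- `γ z` agrees on graded pieces with the real operator `k z`, and the scaling factor is real; so
the limit is real modulo lower weight. -/
theorem limit_apply_σ {α : Type*} {l : Filter α} [l.NeBot] {k γ : α → Module.End ℂ E} {r : α → ℝ}
    {A : Module.End ℂ E} (hkr : ∀ z v, k z (S.σ v) = S.σ (k z v))
    (hγk : ∀ z m, ∀ v ∈ S.W m, γ z v - k z v ∈ S.W (m - 1))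
    (hA : Tendsto (fun z => (r z : ℂ) • γ z) l (𝓝 A)) {m : ℤ} {v : E} (hv : v ∈ S.W m) :
    A (S.σ v) - S.σ (A v) ∈ S.W (m - 1) := by
  have h1 := (tendsto_end_apply hA (tendsto_const_nhds (x := S.σ v))).sub
    ((continuous_σ (S := S)).continuousAt.tendsto.comp
      (tendsto_end_apply hA (tendsto_const_nhds (x := v))))
  refine mem_of_tendsto' h1 (Eventually.of_forall fun z => ?_)
  have e1 : ((r z : ℂ) • γ z) (S.σ v) - S.σ (((r z : ℂ) • γ z) v) =
      (r z : ℂ) • (γ z (S.σ v) - k z (S.σ v) - S.σ (γ z v - k z v)) := by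
    rw [LinearMap.smul_apply, LinearMap.smul_apply, map_smulₛₗ, Complex.conj_ofReal, map_sub,
      hkr, ← smul_sub]
    congr 1; abel
  change ((r z : ℂ) • γ z) (S.σ v) - S.σ (((r z : ℂ) • γ z) v) ∈ _
  rw [e1]
  exact Submodule.smul_mem _ _ (Submodule.sub_mem _ (hγk z m _ (S.W_conj hv))
    (S.W_conj (hγk z m v hv)))

/-- Modulo lower weight, `γ z v` is the image under `a z` of a vector of `F' p`. Applying the
inverse of `a z`, which preserves `W` and tends to `1`, puts the limit in the closed subspace on the
right. -/
theorem limit_apply_F {α : Type*} {l : Filter α} [l.NeBot]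
    {a : α → LinearMap.GeneralLinearGroup ℂ E} {γ : α → Module.End ℂ E} {r : α → ℝ}
    {A : Module.End ℂ E} (ha : Tendsto (fun z => (a z : Module.End ℂ E)) l (𝓝 1))
    (haW : ∀ᶠ z in l, ∀ k, ∀ v ∈ S.W k, (a z : Module.End ℂ E) v ∈ S.W k)
    {m p : ℤ} {v : E} (hγW : ∀ z, γ z v ∈ S.W m)
    (hγF : ∀ᶠ z in l, ∃ f ∈ F' p, (a z : Module.End ℂ E) f - γ z v ∈ S.W (m - 1))
    (hA : Tendsto (fun z => (r z : ℂ) • γ z) l (𝓝 A)) :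
    A v ∈ (F' p ⊓ S.W m) ⊔ S.W (m - 1) := by
  have hainv := tendsto_gl_inv (u := 1) (by simpa using ha)
  have h1 := tendsto_end_apply hainv (tendsto_end_apply hA (tendsto_const_nhds (x := v)))
  rw [inv_one, Units.val_one, Module.End.one_apply] at h1
  refine mem_of_tendsto' h1 ?_
  filter_upwards [haW, hγF] with z h2 ⟨f, hf, hfv⟩
  have h4 := inv_apply_mem (h2 _) hfv
  rw [map_sub, gl_inv_apply] at h4
  have h6 : f ∈ S.W m := by
    have := add_mem (S.mono (by omega) h4) (inv_apply_mem (h2 _) (hγW z))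
    rwa [sub_add_cancel] at this
  rw [LinearMap.smul_apply, map_smul]
  refine Submodule.smul_mem _ _ (Submodule.mem_sup.2 ⟨f, ⟨hf, h6⟩, _, neg_mem h4, ?_⟩)
  abel

/-- `γ z` preserves the Hermitian values of the forms, so those of the rescaled operator are `r z ^
2` times a constant and tend to zero. -/
theorem limit_β {α : Type*} {l : Filter α} [l.NeBot] {k γ : α → Module.End ℂ E} {r : α → ℝ}
    {A : Module.End ℂ E} (hkr : ∀ z v, k z (S.σ v) = S.σ (k z v))
    (hkβ : ∀ z m, ∀ u ∈ S.W m, ∀ v ∈ S.W m, S.β m (k z u) (k z v) = S.β m u v)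
    (hγk : ∀ z m, ∀ v ∈ S.W m, γ z v - k z v ∈ S.W (m - 1)) (hr : Tendsto r l (𝓝 0))
    (hA : Tendsto (fun z => (r z : ℂ) • γ z) l (𝓝 A)) {m : ℤ} {v : E} (hv : v ∈ S.W m) :
    S.β m (A v) (S.σ (A v)) = 0 := by
  have l1 := tendsto_end_apply hA (tendsto_const_nhds (x := v))
  have l2 := (continuous_β (S := S) m).continuousAt.tendsto.comp
    (l1.prodMk_nhds ((continuous_σ (S := S)).continuousAt.tendsto.comp l1))
  have l4 : Tendsto (fun z => (r z : ℂ)) l (𝓝 0) :=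
    (Complex.continuous_ofReal.tendsto' 0 0 rfl).comp hr
  have l3 := (l4.mul l4).mul_const (S.β m v (S.σ v))
  rw [zero_mul, zero_mul] at l3
  refine tendsto_nhds_unique (l2.congr fun z => ?_) l3
  change S.β m (((r z : ℂ) • γ z) v) (S.σ (((r z : ℂ) • γ z) v)) = _
  have h3 := S.W_conj (hγk z m v hv)
  rw [map_sub, ← hkr] at h3
  have h4 : S.β m (γ z v) (S.σ (γ z v)) = S.β m v (S.σ v) :=
    (S.β_congr (hγk z m v hv) h3).trans (hkβ z m v hv _ (S.W_conj hv))
  rw [LinearMap.smul_apply, S.σ.map_smulₛₗ, Complex.conj_ofReal, LinearMap.map_smul₂, map_smul, h4,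
    smul_eq_mul, smul_eq_mul, mul_assoc]

/-- The weight-zero parts of the elements of `K1` that carry `F` close to a polarized point remain
bounded: a limit of their normalizations vanishes. -/
theorem Pt.limit_eq_zero (h : S.Pt F) (hy : S.Pt F') {A : Module.End ℂ E}
    (hAW : ∀ m, ∀ v ∈ S.W m, A v ∈ S.W m)
    (hAI : ∀ i, ∀ v ∈ S.I F i, A v ∈ S.Iw F (i.1 + i.2))
    (hAF : ∀ m p, ∀ v ∈ F p ⊓ S.W m, A v ∈ (F' p ⊓ S.W m) ⊔ S.W (m - 1))
    (hAσ : ∀ m, ∀ v ∈ S.W m, A (S.σ v) - S.σ (A v) ∈ S.W (m - 1))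
    (hAβ : ∀ m, ∀ v ∈ S.W m, S.β m (A v) (S.σ (A v)) = 0) : A = 0 := by
  refine h.eq_of_forall_I fun i v hv => ?_
  obtain ⟨p, q⟩ := i
  have hvF : v ∈ F p := I_le_F _ hv
  have hvW : v ∈ S.W (p + q) := I_le_W _ hv
  obtain ⟨w, hw, hvw⟩ := h.exists_conj_I hv
  have hwF : w ∈ F q := I_le_F _ hw
  have hwW : w ∈ S.W (p + q) := by rw [add_comm]; exact I_le_W _ hw
  -- Modulo lower weight, `A v` equals `e` in `F' p`, and its conjugate equals `A w`, hence `f` in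
  -- `F' q`. So `A v` has type `(p, q)` for `F'`. As its Hermitian value is zero, positivity at `F'`
  -- puts it in lower weight, and an operator respecting the splitting by weight then has `A v = 0`.
  obtain ⟨e, he, e', he', hee⟩ := Submodule.mem_sup.1 (hAF _ p v ⟨hvF, hvW⟩)
  obtain ⟨f, hf, f', hf', hff⟩ := Submodule.mem_sup.1 (hAF (p + q) q w ⟨hwF, hwW⟩)
  have h1 : S.σ (A v) - f ∈ S.W (p + q - 1) := by
    have : S.σ (A v) - f = -(A (S.σ v) - S.σ (A v)) + A (S.σ v - w) + f' := by
      rw [map_sub, ← hff]; abel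
    rw [this]
    exact add_mem (add_mem (neg_mem (hAσ _ v hvW)) (hAW _ _ hvw)) hf'
  have h2 : A v - S.σ f ∈ S.W (p + q - 1) := by
    have := S.W_conj h1
    rwa [map_sub, S.invol] at this
  have h3 : A v - e ∈ S.W (p + q - 1) := by rw [← hee, add_sub_cancel_left]; exact he'
  have h4 : S.σ (A v) - S.σ e ∈ S.W (p + q - 1) := by
    rw [← map_sub]; exact S.W_conj h3
  have h6 : e ∈ S.W (p + q - 1) := by
    have hσf : S.σ f ∈ S.cF F' q := ⟨f, hf.1, rfl⟩
    refine hy.pos rfl he ⟨hσf, S.W_conj hf.2⟩ ?_ ?_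
    · have := Submodule.sub_mem _ h2 h3
      rwa [sub_sub_sub_cancel_left] at this
    · rw [← S.β_congr h3 h4]; exact hAβ _ v hvW
  refine h.eq_zero_of_Iw (hAI _ v hv) ?_
  have := add_mem h3 h6
  rwa [sub_add_cancel] at this

/-- If the norms are bounded, a limit exists by compactness; it preserves the nondegenerate forms,
so it is injective, hence invertible, and lies in `N`. If they are unbounded, they tend to infinity
along the ultrafilter, and the operators divided by their norms have a limit of norm `1`, which
`limit_eq_zero` excludes. -/
theorem Pt.exists_limit (h : S.Pt F) (hN : S.Grp b N) (hy : S.Pt F') {α : Type*} {l : Ultrafilter α}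
    {a k γ : α → LinearMap.GeneralLinearGroup ℂ E}
    (ha : Tendsto (fun z => (a z : Module.End ℂ E)) l (𝓝 1))
    (haW : ∀ᶠ z in (l : Filter α), ∀ k, ∀ v ∈ S.W k, (a z : Module.End ℂ E) v ∈ S.W k)
    (hk : ∀ z, k z ∈ K1 hN) (hγ : ∀ z, γ z ∈ N)
    (hγk : ∀ z m, ∀ v ∈ S.W m,
      (γ z : Module.End ℂ E) v - (k z : Module.End ℂ E) v ∈ S.W (m - 1))
    (hγI : ∀ z i, ∀ v ∈ S.I F i, (γ z : Module.End ℂ E) v ∈ S.Iw F (i.1 + i.2))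
    (hγF : ∀ᶠ z in (l : Filter α), ∀ m p, ∀ v ∈ F p ⊓ S.W m, ∃ f ∈ F' p,
      (a z : Module.End ℂ E) f - (γ z : Module.End ℂ E) v ∈ S.W (m - 1)) :
    ∃ γ₀ ∈ N, Tendsto (fun z => (γ z : Module.End ℂ E)) l (𝓝 (γ₀ : Module.End ℂ E)) := by
  have hkN := fun z => (realComp_subset (hk z).1)
  have hprop : ProperSpace (Module.End ℂ E) := FiniteDimensional.proper ℂ _
  have hcpt : ∀ (R : ℝ) (f : α → Module.End ℂ E), (∀ᶠ z in (l : Filter α), ‖f z‖ ≤ R) →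
      ∃ A, Tendsto f l (𝓝 A) := fun R f hf => by
    obtain ⟨A, -, hA⟩ := (isCompact_closedBall (0 : Module.End ℂ E) R).ultrafilter_le_nhds
      (l.map f) (by
        rw [le_principal_iff]
        exact hf.mono fun z hz => mem_closedBall_zero_iff.2 hz)
    exact ⟨A, hA⟩
  by_cases hbd : ∃ R : ℝ, ∀ᶠ z in (l : Filter α), ‖(γ z : Module.End ℂ E)‖ ≤ R
  · obtain ⟨R, hR⟩ := hbd
    obtain ⟨A, hA⟩ := hcpt R _ hR
    have hAW : ∀ m, ∀ v ∈ S.W m, A v ∈ S.W m := fun m v hv =>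
      mem_of_tendsto' (tendsto_end_apply hA tendsto_const_nhds)
        (Eventually.of_forall fun z => hN.map_W _ (hγ z) m v hv)
    have hβ : ∀ m, ∀ u ∈ S.W m, ∀ v ∈ S.W m, S.β m (A u) (A v) = S.β m u v := fun m u hu v hv => by
      have l2 := ((continuous_β (S := S) m).tendsto _).comp
        ((tendsto_end_apply hA (tendsto_const_nhds (x := u))).prodMk_nhds
          (tendsto_end_apply hA (tendsto_const_nhds (x := v))))
      refine tendsto_nhds_unique (l2.congr fun z => ?_) tendsto_const_nhds
      exact β_apply_of_mem (hγk z) (hk z).2 hu hv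
    have hinj : Function.Injective A := by
      rw [injective_iff_map_eq_zero]
      intro v hv
      refine eq_zero_of_descending S.mono S.bot S.top fun m hm => S.β_nondeg hm fun w hw => ?_
      rw [← hβ m v hm w hw, hv]; simp
    have hu : IsUnit A := LinearMap.isUnit_iff_ker_eq_bot A |>.2 (LinearMap.ker_eq_bot.2 hinj)
    exact ⟨hu.unit, hN.alg.mem_of_tendsto (l := l) (Eventually.of_forall hγ) hA, hA⟩
  · exfalso
    have hlt : ∀ R : ℝ, ∀ᶠ z in (l : Filter α), R < ‖(γ z : Module.End ℂ E)‖ := fun R =>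
      (Ultrafilter.eventually_not.2 fun hR => hbd ⟨R, hR⟩).mono fun z hz => not_le.1 hz
    have hr : Tendsto (fun z => ‖(γ z : Module.End ℂ E)‖⁻¹) l (𝓝 0) :=
      tendsto_inv_atTop_zero.comp (tendsto_atTop.2 fun R => (hlt R).mono fun z hz => hz.le)
    have hone : ∀ᶠ z in (l : Filter α), ‖((‖(γ z : Module.End ℂ E)‖⁻¹ : ℝ) : ℂ) •
        (γ z : Module.End ℂ E)‖ = 1 := (hlt 0).mono fun z hz => by
      rw [norm_smul, Complex.norm_real, norm_inv, norm_norm, inv_mul_cancel₀ hz.ne']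
    obtain ⟨A, hA⟩ := hcpt 1 _ (hone.mono fun z hz => hz.le)
    have hAv := fun v => tendsto_end_apply hA (tendsto_const_nhds (x := v))
    have hA0 : A = 0 := h.limit_eq_zero hy
      (fun m v hv => mem_of_tendsto' (hAv v) (Eventually.of_forall fun z =>
        Submodule.smul_mem _ _ (hN.map_W _ (hγ z) m v hv)))
      (fun i v hv => mem_of_tendsto' (hAv v) (Eventually.of_forall fun z =>
        Submodule.smul_mem _ _ (hγI z i v hv)))
      (fun m p v hv => limit_apply_F ha haW (fun z => hN.map_W _ (hγ z) m v hv.2)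
        (hγF.mono fun z hz => hz m p v hv) hA)
      (fun m v hv => limit_apply_σ (fun z => (hkN z).2) hγk hA hv)
      (fun m v hv => limit_β (fun z => (hkN z).2) (fun z => (hk z).2) hγk hr hA hv)
    have h1 : ‖A‖ = 1 := tendsto_nhds_unique (hA.norm.congr' hone) tendsto_const_nhds
    rw [hA0, norm_zero] at h1
    exact zero_ne_one h1

end Sys

end KeyLimit

open NormedSpace Filter Topology

/-! ### Convergence of orbit points inside the classifying space -/

section KeyLemma

variable {E : Type*} [NormedAddCommGroup E] [NormedSpace ℂ E] [FiniteDimensional ℂ E] {n : ℕ}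

attribute [local instance] endNormedRing endNormedAlgebra

namespace Sys

variable {S : Sys E} {b : Module.Basis (Fin n) ℂ E}
  {N : Subgroup (LinearMap.GeneralLinearGroup ℂ E)} {F F' : ℤ → Submodule ℂ E}

theorem N1_apply_mem (hN : S.Grp b N) {u : LinearMap.GeneralLinearGroup ℂ E} (hu : u ∈ N1 hN)
    {m p : ℤ} {v : E} (hv : v ∈ mapF u F p ⊓ S.W m) : v ∈ (F p ⊓ S.W m) ⊔ S.W (m - 1) := by
  obtain ⟨⟨f, hf, rfl⟩, hv⟩ := hv
  have hfW : f ∈ S.W m := (hN.map_W_iff hu.1).1 hv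
  exact Submodule.mem_sup.2 ⟨f, ⟨hf, hfW⟩, _, hu.2 m f hfW, add_sub_cancel _ _⟩

/-- The hypothesis places the graded pieces of `T` inside those of `F p`. As `S.Lo F (p - 1)` is the
sum of the complementary summands of Deligne's splitting, a common vector lies in ever lower weight.
-/
theorem Pt.disjoint_Lo (h : S.Pt F) {p : ℤ} {T : Submodule ℂ E}
    (hT : ∀ m, ∀ v ∈ T ⊓ S.W m, v ∈ (F p ⊓ S.W m) ⊔ S.W (m - 1)) :
    Disjoint T (S.Lo F (p - 1)) := by
  rw [Submodule.disjoint_def]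
  intro v hvT hvL
  refine eq_zero_of_descending S.mono S.bot S.top fun m hm => ?_
  obtain ⟨f, hf, w, hw, hfw⟩ := Submodule.mem_sup.1 (hT m v ⟨hvT, hm⟩)
  rw [h.W_eq]
  refine mem_iSup_of_proj h.isInternal fun i hi => ?_
  rcases lt_or_ge m (i.1 + i.2) with hmi | hmi
  · rw [h.W_eq] at hm
    exact proj_eq_zero_of_mem_iSup h.isInternal (by omega) hm
  rcases le_or_gt p i.1 with hpi | hpi
  · exact proj_eq_zero_of_mem_iSup h.isInternal (p := fun i : ℤ × ℤ => i.1 ≤ p - 1)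
      (by omega) hvL
  · rw [h.F_inf_W_eq] at hf
    rw [h.W_eq] at hw
    rw [← hfw, map_add, proj_eq_zero_of_mem_iSup h.isInternal (by omega) hf,
      proj_eq_zero_of_mem_iSup h.isInternal hi hw, add_zero]

/-- The lower-triangular elements carrying `F` towards `G` converge. -/
theorem Pt.exists_limit_strict (h : S.Pt F) (hN : S.Grp b N) {G : ℤ → Submodule ℂ E} {α : Type*}
    {l : Filter α} [l.NeBot] {c w : α → LinearMap.GeneralLinearGroup ℂ E}
    (hc : Tendsto (fun z => (c z : Module.End ℂ E)) l (𝓝 1)) (hw : ∀ z, w z ∈ N)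
    (hwL : ∀ z p, ∀ v ∈ S.Lo F p, (w z : Module.End ℂ E) v - v ∈ S.Lo F (p - 1))
    (hcG : ∀ᶠ z in l, mapF (c z) G = mapF (w z) F)
    (hG : ∀ m p, ∀ v ∈ G p ⊓ S.W m, v ∈ (F p ⊓ S.W m) ⊔ S.W (m - 1))
    (hd : ∀ p, Module.finrank ℂ (F p) = Module.finrank ℂ (G p)) :
    ∃ w₀ ∈ N, Tendsto (fun z => (w z : Module.End ℂ E)) l (𝓝 (w₀ : Module.End ℂ E)) ∧
      mapF w₀ F = G := by
  have := end_completeSpace E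
  have hcinv := tendsto_gl_inv (u := 1) (by simpa using hc)
  rw [inv_one, Units.val_one] at hcinv
  have hcw : ∀ᶠ z in l, ∀ p, ∀ v ∈ F p,
      ((c z)⁻¹ : LinearMap.GeneralLinearGroup ℂ E).val ((w z : Module.End ℂ E) v) ∈ G p :=
    hcG.mono fun z hz p v hv => by
      have : (w z : Module.End ℂ E) v ∈ mapF (c z) G p := by
        rw [hz]; exact apply_mem_mapF.2 hv
      exact mem_mapF.1 this
  have hconv : ∀ i, ∀ v ∈ S.I F i, ∃ y, Tendsto (fun z => (w z : Module.End ℂ E) v) l (𝓝 y) := by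
    intro i v hv
    -- `ρ` is a projection onto the relevant step of the opposite filtration that kills `G i.1`. It
    -- turns the membership of `(c z)⁻¹ (w z v)` in `G i.1` into a linear equation.
    obtain ⟨C, hC, hC'⟩ := (h.disjoint_Lo (hG · i.1)).exists_isCompl
    let ρ : Module.End ℂ E := (S.Lo F (i.1 - 1)).projection C hC'.symm
    have hρL : ∀ x ∈ S.Lo F (i.1 - 1), ρ x = x := fun x hx =>
      Submodule.projection_apply_left hC'.symm ⟨x, hx⟩
    have hρG : ∀ x ∈ G i.1, ρ x = 0 := fun x hx => by
      have : x ∈ LinearMap.ker ρ := by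
        rw [Submodule.ker_projection]; exact hC hx
      exact this
    -- Write `w z v = v + ℓ` with `ℓ` in the step onto which `ρ` projects. The equation `ρ ((c z)⁻¹
    -- (v + ℓ)) = 0` reads `T z ℓ = -ρ ((c z)⁻¹ v)`, because `ρ ℓ = ℓ`. As `T z → 1`, it can be
    -- solved for `ℓ`, and the solution converges.
    let T : α → Module.End ℂ E := fun z =>
      1 - ρ * (1 - ((c z)⁻¹ : LinearMap.GeneralLinearGroup ℂ E).val)
    have hT : Tendsto T l (𝓝 1) := by
      have := (tendsto_const_nhds (x := (1 : Module.End ℂ E))).sub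
        ((tendsto_const_nhds (x := ρ)).mul
          ((tendsto_const_nhds (x := (1 : Module.End ℂ E))).sub hcinv))
      simpa using this
    obtain ⟨t, ht, ht1⟩ := exists_gl_of_tendsto_one hT
    have htinv := tendsto_gl_inv (u := 1) (by simpa using ht1)
    refine ⟨v + (1 : Module.End ℂ E) (-ρ ((1 : Module.End ℂ E) v)), ?_⟩
    rw [inv_one, Units.val_one] at htinv
    have hlim := tendsto_end_apply htinv
      ((tendsto_end_apply (tendsto_const_nhds (x := ρ)) (tendsto_end_apply hcinv
        (tendsto_const_nhds (x := v)))).neg)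
    refine (tendsto_const_nhds.add hlim).congr' ?_
    filter_upwards [ht, hcw] with z h1 h2
    have hℓ := hwL z i.1 v (I_le_Lo i hv)
    set ℓ := (w z : Module.End ℂ E) v - v with hℓdef
    have h3 : ρ (((c z)⁻¹ : LinearMap.GeneralLinearGroup ℂ E).val (v + ℓ)) = 0 := by
      refine hρG _ ?_
      rw [hℓdef, add_sub_cancel]
      exact h2 _ v (I_le_F _ hv)
    have h4 : (t z : Module.End ℂ E) ℓ =
        -ρ (((c z)⁻¹ : LinearMap.GeneralLinearGroup ℂ E).val v) := by
      rw [h1]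
      simp only [T, LinearMap.sub_apply, Module.End.mul_apply, Module.End.one_apply, map_sub,
        hρL ℓ hℓ]
      rw [map_add, map_add] at h3
      rw [sub_sub_cancel, ← add_eq_zero_iff_eq_neg, add_comm]
      exact h3
    rw [← h4, gl_inv_apply, hℓdef, add_sub_cancel]
  have hsup : ⨆ i, S.I F i = ⊤ := h.isInternal.submodule_iSup_eq_top
  obtain ⟨A, hA⟩ := exists_tendsto_of_forall_mem hsup hconv
  have hAL : ∀ p, ∀ v ∈ S.Lo F p, A v - v ∈ S.Lo F (p - 1) := fun p v hv =>
    mem_of_tendsto' ((tendsto_end_apply hA tendsto_const_nhds).sub tendsto_const_nhds)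
      (Eventually.of_forall fun z => hwL z p v hv)
  have hinj : Function.Injective A := by
    rw [injective_iff_map_eq_zero]
    intro v hv
    refine eq_zero_of_descending (Lo_mono (S := S) (F := F)) h.Lo_bot h.Lo_top fun p hp => ?_
    have := hAL p v hp
    rw [hv, zero_sub] at this
    exact neg_mem_iff.1 this
  have hu : IsUnit A := (LinearMap.isUnit_iff_ker_eq_bot A).2 (LinearMap.ker_eq_bot.2 hinj)
  refine ⟨hu.unit, hN.alg.mem_of_tendsto (l := l) (Eventually.of_forall hw) hA, hA,
    mapF_eq_of_le (fun p v hv => ?_) hd⟩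
  have h1 := tendsto_end_apply hcinv (tendsto_end_apply hA (tendsto_const_nhds (x := v)))
  exact mem_of_tendsto' h1 (hcw.mono fun z hz => hz p v hv)

/-- Points of the orbit that converge to a point `F'` of the classifying space are moved to `F'` by
elements of `N` converging to the identity. -/
theorem Base.exists_of_tendsto (h : S.Base b N F) (hy : S.Pt F') {α : Type*} {l : Ultrafilter α}
    (hd : ∀ p k, Module.finrank ℂ (F' p ⊓ S.W k : Submodule ℂ E) =
      Module.finrank ℂ (F p ⊓ S.W k : Submodule ℂ E))
    {g : α → LinearMap.GeneralLinearGroup ℂ E} (hg : ∀ z, g z ∈ H1 h.grp)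
    {θ : ℤ → α → Module.End ℂ E} (hθ : ∀ p, Tendsto (θ p) l (𝓝 1))
    (hF : ∀ p, ∀ᶠ z in (l : Filter α), (F' p).map (θ p z) = mapF (g z) F p) :
    (∃ γ ∈ N, F' = mapF γ F) ∧ ∃ d : α → LinearMap.GeneralLinearGroup ℂ E, (∀ z, d z ∈ N) ∧
      Tendsto (fun z => (d z : Module.End ℂ E)) l (𝓝 1) ∧
      ∀ᶠ z in (l : Filter α), mapF (g z) F = mapF (d z) F' := by
  have hN := h.grp
  have hgN : ∀ z, g z ∈ N := fun z => H1_le hN (hg z)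
  choose k hk u hu hku using hg
  have hkN : ∀ z, k z ∈ N := fun z => (realComp_subset (hk z).1).1
  -- Here `γ z` is the weight-zero part of the factor `k z` of `g z`. It agrees with `k z`, and so
  -- with `g z`, on graded pieces, but respects the splitting at `F`.
  choose γ hγ hγI hγk using fun z => h.exists_weight_zero (hkN z)
  obtain ⟨a, ha, haF, haW⟩ := hy.exists_tendsto_one (l := (l : Filter α))
    (Fz := fun z => mapF (g z) F) (fun z p q hpq => Submodule.map_mono (h.pt.opp.antiF hpq)) hθ hF
    (fun p k z => by rw [hN.finrank_mapF_inf (hgN z), hd])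
  have hγg : ∀ z m, ∀ v ∈ S.W m,
      (g z : Module.End ℂ E) v - (γ z : Module.End ℂ E) v ∈ S.W (m - 1) := fun z m v hv => by
    have h1 := hN.map_W _ (hkN z) _ _ ((hu z).2 m v hv)
    have h2 := Submodule.sub_mem _ h1 (hγk z m v hv)
    rw [hku, Units.val_mul, Module.End.mul_apply]
    rwa [map_sub, sub_sub_sub_comm, sub_self, sub_zero] at h2
  obtain ⟨γ₀, hγ₀, hγlim⟩ := h.pt.exists_limit hN hy ha haW hk hγ hγk hγI
    (haF.mono fun z hz m p v hv => by
      have h1 : (g z : Module.End ℂ E) v ∈ mapF (a z) F' p := by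
        rw [hz]; exact apply_mem_mapF.2 hv.1
      obtain ⟨f, hf, hfv⟩ := h1
      exact ⟨f, hf, by rw [hfv]; exact hγg z m v hv.2⟩)
  -- Removing the convergent factor `γ z` leaves an element of `N1`. It may still be unbounded
  -- because of the stabilizer of `F`; the triangular representative `w z` removes this ambiguity.
  have hu' : ∀ z, (γ z)⁻¹ * g z ∈ N1 hN := fun z => by
    refine ⟨mul_mem (N.inv_mem (hγ z)) (hgN z), fun m v hv => ?_⟩
    have h1 := hN.map_W _ (N.inv_mem (hγ z)) _ _ (hγg z m v hv)
    rwa [map_sub, gl_inv_apply] at h1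
  choose w hw hwF hwL using fun z => h.exists_strict (hu' z)
  let c : α → LinearMap.GeneralLinearGroup ℂ E := fun z => (γ z)⁻¹ * a z * γ₀
  have hγinv := tendsto_gl_inv hγlim
  have hc : Tendsto (fun z => (c z : Module.End ℂ E)) l (𝓝 1) := by
    have := (hγinv.mul ha).mul (tendsto_const_nhds (x := (γ₀ : Module.End ℂ E)))
    rwa [mul_one, Units.inv_mul] at this
  let G := mapF γ₀⁻¹ F'
  have hcG : ∀ᶠ z in (l : Filter α), mapF (c z) G = mapF (w z) F := haF.mono fun z hz => by
    rw [hwF z, mapF_mul (γ z)⁻¹ (g z), ← hz, ← mapF_mul, ← mapF_mul, mul_inv_cancel_right]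
  -- `c z v` lies in the filtration `w z F`, the image of `F` under an element of `N1`, hence in a
  -- closed subspace independent of `z`. Since `c z v → v`, so does `v`.
  have hG : ∀ m p, ∀ v ∈ G p ⊓ S.W m, v ∈ (F p ⊓ S.W m) ⊔ S.W (m - 1) := fun m p v hv => by
    have h1 := tendsto_end_apply hc (tendsto_const_nhds (x := v))
    refine mem_of_tendsto' h1 ?_
    filter_upwards [hcG, haW] with z h2 h3
    refine N1_apply_mem hN (hu' z) ⟨?_, ?_⟩
    · rw [← hwF z, ← h2]
      exact apply_mem_mapF.2 hv.1
    · exact hN.map_W _ (N.inv_mem (hγ z)) _ _ (h3 _ _ (hN.map_W _ hγ₀ _ _ hv.2))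
  have hdG : ∀ p, Module.finrank ℂ (F p) = Module.finrank ℂ (G p) := fun p => by
    obtain ⟨c, hc⟩ := S.top
    have := hd p c
    rw [hc, inf_top_eq, inf_top_eq] at this
    rw [finrank_mapF, this]
  obtain ⟨w₀, hw₀, hwlim, hwG⟩ := h.pt.exists_limit_strict hN hc hw hwL hcG hG hdG
  -- The limit satisfies `w₀ F = G = γ₀⁻¹ F'`, whence `F' = γ₀ w₀ F`. Likewise `g z F = γ z w z F`,
  -- so `d z = γ z w z (γ₀ w₀)⁻¹` carries `F'` to it.
  refine ⟨⟨γ₀ * w₀, mul_mem hγ₀ hw₀, ?_⟩, fun z => γ z * w z * (w₀⁻¹ * γ₀⁻¹), fun z => ?_, ?_, ?_⟩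
  · rw [mapF_mul, hwG, ← mapF_mul, mul_inv_cancel, mapF_one]
  · exact mul_mem (mul_mem (hγ z) (hw z)) (mul_mem (inv_mem hw₀) (inv_mem hγ₀))
  · have := (hγlim.mul hwlim).mul
      (tendsto_const_nhds (x := ((w₀⁻¹ * γ₀⁻¹ : LinearMap.GeneralLinearGroup ℂ E) : Module.End ℂ E)))
    rwa [← Units.val_mul, ← Units.val_mul, ← mul_inv_rev, mul_inv_cancel, Units.val_one] at this
  · refine Eventually.of_forall fun z => ?_
    rw [mapF_mul, mapF_mul _ γ₀⁻¹, show mapF γ₀⁻¹ F' = mapF w₀ F from hwG.symm, ← mapF_mul w₀⁻¹, inv_mul_cancel, mapF_one, mapF_mul, hwF z,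
      ← mapF_mul, mul_inv_cancel_left]

end Sys

end KeyLemma

open NormedSpace Filter Topology

/-! ### Closedness and local shape of the orbit -/

section LocalStructure

variable {E : Type*} [NormedAddCommGroup E] [NormedSpace ℂ E] [FiniteDimensional ℂ E] {n : ℕ}

attribute [local instance] endNormedRing endNormedAlgebra

namespace Sys

variable {S : Sys E} {b : Module.Basis (Fin n) ℂ E}
  {N : Subgroup (LinearMap.GeneralLinearGroup ℂ E)} {F F' : ℤ → Submodule ℂ E}

variable [CompleteSpace (Module.End ℂ E)]

/-- The orbit is closed in the classifying space. -/
theorem Base.mem_orbit_of_tendsto (h : S.Base b N F) (hy : S.Pt F') {α : Type*} {l : Ultrafilter α}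
    (hd : ∀ p k, Module.finrank ℂ (F' p ⊓ S.W k : Submodule ℂ E) =
      Module.finrank ℂ (F p ⊓ S.W k : Submodule ℂ E))
    {g : α → LinearMap.GeneralLinearGroup ℂ E} (hg : ∀ z, g z ∈ H1 h.grp)
    {θ : ℤ → α → Module.End ℂ E} (hθ : ∀ p, Tendsto (θ p) l (𝓝 1))
    (hF : ∀ p, ∀ᶠ z in (l : Filter α), (F' p).map (θ p z) = mapF (g z) F p) :
    ∃ a ∈ H1 h.grp, F' = mapF a F := by
  obtain ⟨⟨γ, hγ, rfl⟩, d, hdN, hd1, hdF⟩ := h.exists_of_tendsto hy hd hg hθ hF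
  -- As `F'` is a polarized point of the `N`-orbit, openness of the `H1`-orbit holds at `F'` itself:
  -- for `d z` close to `1`, the points `F'` and `d z F' = g z F` are in one `H1`-orbit.
  have h1 := hd1.eventually (h.eventually_mem_H1 hγ hy)
  obtain ⟨z, hz, hz'⟩ := (hdF.and h1).exists
  obtain ⟨a, ha, ha'⟩ := hz' _ (hdN z) rfl
  refine ⟨a⁻¹ * g z, mul_mem (inv_mem ha) (hg z), ?_⟩
  rw [mapF_mul, hz, ha', ← mapF_mul, inv_mul_cancel, mapF_one]

/-- Near a point of the orbit, small elements of `Lie N` stay in the orbit. -/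
theorem Base.eventually_expU_mem (h : S.Base b N F) {γ : LinearMap.GeneralLinearGroup ℂ E}
    (hγ : γ ∈ H1 h.grp) (hy : S.Pt (mapF γ F)) :
    ∀ᶠ X in 𝓝 (0 : Module.End ℂ E), X ∈ lie b N →
      ∃ a ∈ H1 h.grp, mapF (expU X) (mapF γ F) = mapF a F := by
  have h1 : Tendsto (fun X : Module.End ℂ E => (expU X : Module.End ℂ E)) (𝓝 0) (𝓝 1) :=
    exp_continuous'.tendsto' _ _ exp_zero
  filter_upwards [h1.eventually (h.eventually_mem_H1 (H1_le _ hγ) hy)] with X hX hXl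
  obtain ⟨a, ha, ha'⟩ := hX _ (by simpa using h.grp.exp_mem hXl 1) rfl
  exact ⟨a * γ, mul_mem ha hγ, by rw [ha', mapF_mul]⟩

/-- Products `exp X exp Y`, with `X` in `C` near `0` and `Y` in the stabilizer, cover `N` near `1`;
the second factor does not move `F'`. -/
theorem IsQAlg_eventually_mem_image (hN : S.Grp b N) {C : Submodule ℂ (Module.End ℂ E)}
    (hC : C ≤ lie b N) (hC' : lie b N ≤ C ⊔ FL b N F' 0) {U : Set C} (hU : U ∈ 𝓝 0) :
    ∀ᶠ A in 𝓝 (1 : Module.End ℂ E), ∀ δ ∈ N, (δ : Module.End ℂ E) = A →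
      ∃ X ∈ U, mapF δ F' = mapF (expU (X : Module.End ℂ E)) F' := by
  let P := C.restrictScalars ℝ × (FL b N F' 0).restrictScalars ℝ
  let Ψ : P → Module.End ℂ E := fun x => exp (x.1 : Module.End ℂ E) * exp (x.2 : Module.End ℂ E)
  have e1 : HasStrictFDerivAt (fun x : P => exp (x.1 : Module.End ℂ E))
      ((C.restrictScalars ℝ).subtypeL.comp (ContinuousLinearMap.fst ℝ _ _)) 0 :=
    HasStrictFDerivAt.comp (0 : P) (g := fun m : C.restrictScalars ℝ => exp (m : Module.End ℂ E))
      (by exact hasStrictFDerivAt_exp_subtype (C.restrictScalars ℝ)) hasStrictFDerivAt_fst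
  have e2 : HasStrictFDerivAt (fun x : P => exp (x.2 : Module.End ℂ E))
      (((FL b N F' 0).restrictScalars ℝ).subtypeL.comp (ContinuousLinearMap.snd ℝ _ _)) 0 :=
    HasStrictFDerivAt.comp (0 : P)
      (g := fun m : (FL b N F' 0).restrictScalars ℝ => exp (m : Module.End ℂ E))
      (by exact hasStrictFDerivAt_exp_subtype ((FL b N F' 0).restrictScalars ℝ))
      hasStrictFDerivAt_snd
  have z1 : exp (((0 : P).1 : C.restrictScalars ℝ) : Module.End ℂ E) = 1 := exp_zero
  have z2 : exp (((0 : P).2 : (FL b N F' 0).restrictScalars ℝ) : Module.End ℂ E) = 1 := exp_zero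
  have hΨ := e1.mul' e2
  rw [z1, z2, one_smul, MulOpposite.op_one, one_smul] at hΨ
  have hmem : ∀ x : P, expU (x.1 : Module.End ℂ E) * expU (x.2 : Module.End ℂ E) ∈ N := fun x =>
    mul_mem (by simpa using hN.exp_mem (hC x.1.2) 1) (by simpa using hN.exp_mem x.2.2.1 1)
  have hU' : (Prod.fst ⁻¹' U : Set P) ∈ 𝓝 (0 : P) :=
    (continuous_fst (X := C) (Y := FL b N F' 0)).continuousAt.preimage_mem_nhds hU
  have key := eventually_mem_image_of_range N (fun u hu => hN.alg.mem_of_closure u hu)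
    ((lie b N).restrictScalars ℝ) (fun X hX => IsQAlg_exp_real hX) (Ψ := Ψ) hΨ
    (by simp [Ψ]) (fun x => ⟨_, hmem x, rfl⟩) (fun X hX => by
      obtain ⟨A, hA, B, hB, rfl⟩ := Submodule.mem_sup.1 (hC' hX)
      exact ⟨(⟨A, hA⟩, ⟨B, hB⟩), by
        change B + A = A + B
        abel⟩) hU'
  filter_upwards [key] with A hA δ hδ hδA
  obtain ⟨x, hxU, hx⟩ := hA ⟨δ, hδ, hδA⟩
  have hδx : δ = expU (x.1 : Module.End ℂ E) * expU (x.2 : Module.End ℂ E) :=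
    Units.ext (hδA.trans hx.symm)
  exact ⟨x.1, hxU, by rw [hδx, mapF_mul, mapF_expU x.2.2]⟩

/-- Near a point of the orbit, the orbit is parametrized by a complement of `F⁰ Lie N`. -/
theorem Base.eventually_mem_image (h : S.Base b N F) (hy : S.Pt F') {α : Type*} {l : Ultrafilter α}
    (hd : ∀ p k, Module.finrank ℂ (F' p ⊓ S.W k : Submodule ℂ E) =
      Module.finrank ℂ (F p ⊓ S.W k : Submodule ℂ E))
    {g : α → LinearMap.GeneralLinearGroup ℂ E} (hg : ∀ z, g z ∈ H1 h.grp)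
    {θ : ℤ → α → Module.End ℂ E} (hθ : ∀ p, Tendsto (θ p) l (𝓝 1))
    (hF : ∀ p, ∀ᶠ z in (l : Filter α), (F' p).map (θ p z) = mapF (g z) F p)
    {C : Submodule ℂ (Module.End ℂ E)}
    (hC : C ≤ lie b N) (hC' : lie b N ≤ C ⊔ FL b N F' 0) {U : Set C} (hU : U ∈ 𝓝 0) :
    ∀ᶠ z in (l : Filter α), ∃ X ∈ U, mapF (g z) F = mapF (expU (X : Module.End ℂ E)) F' := by
  obtain ⟨-, d, hdN, hd1, hdF⟩ := h.exists_of_tendsto hy hd hg hθ hF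
  have h1 := hd1.eventually (IsQAlg_eventually_mem_image h.grp hC hC' hU)
  filter_upwards [h1, hdF] with z h2 h3
  obtain ⟨X, hX, hX'⟩ := h2 _ (hdN z) rfl
  exact ⟨X, hX, h3.trans hX'⟩

end Sys

end LocalStructure

open Filter Topology

/-! ### From local parametrizations to slice charts -/

section Submanifold

variable {H : Type} [NormedAddCommGroup H] [NormedSpace ℂ H] [FiniteDimensional ℂ H]
  {M : Type*} [TopologicalSpace M] [ChartedSpace H M]
  {Ed : Type} [NormedAddCommGroup Ed] [NormedSpace ℂ Ed] [FiniteDimensional ℂ Ed]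
  {R : Type} [NormedAddCommGroup R] [NormedSpace ℂ R] [FiniteDimensional ℂ R]

/-- `ψ` is a local parametrization, at the point `ψ 0`, of the subset `D` of `M`. -/
structure IsParam (D : Set M) (ψ : Ed → M) : Prop where
  smooth : ContMDiffAt 𝓘(ℂ, Ed) 𝓘(ℂ, H) ω ψ 0
  inj : Function.Injective (mfderiv 𝓘(ℂ, Ed) 𝓘(ℂ, H) ψ 0)
  mem : ∀ᶠ v in 𝓝 0, ψ v ∈ D
  small : ∀ U ∈ 𝓝 (0 : Ed), ∀ᶠ z in 𝓝 (ψ 0), z ∈ D → z ∈ ψ '' U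

theorem mfderiv_eq_fderiv_chart {X : Type*} [NormedAddCommGroup X] [NormedSpace ℂ X]
    {ψ : X → M} {v : X} (h : MDifferentiableAt 𝓘(ℂ, X) 𝓘(ℂ, H) ψ v) :
    (mfderiv 𝓘(ℂ, X) 𝓘(ℂ, H) ψ v : X →L[ℂ] H) = fderiv ℂ (chartAt H (ψ v) ∘ ψ) v := by
  have h1 := h.mfderiv
  simp only [mfld_simps, fderivWithin_univ] at h1
  exact h1

variable [IsManifold 𝓘(ℂ, H) ω M]

/-- A local parametrization is the slice of a chart. -/
theorem IsParam.exists_slice {D : Set M} {ψ : Ed → M} (h : IsParam (H := H) D ψ)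
    (L₀ : (Ed × R) ≃L[ℂ] H) :
    ∃ Φ ∈ IsManifold.maximalAtlas 𝓘(ℂ, H) ω M, ψ 0 ∈ Φ.source ∧ Φ (ψ 0) = 0 ∧
      (∀ z ∈ Φ.source, z ∈ D ↔ (L₀.symm (Φ z)).2 = 0) ∧
      ∀ z ∈ Φ.source, z ∈ D → ψ (L₀.symm (Φ z)).1 = z := by
  set y := ψ 0 with hy
  let c := chartAt H y
  have hyc : y ∈ c.source := mem_chart_source H y
  have hcont : ContinuousAt ψ 0 := h.smooth.continuousAt
  let f : Ed → H := c ∘ ψ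
  have hf : ContDiffAt ℂ ω f 0 := by
    have h1 : ContMDiffAt 𝓘(ℂ, Ed) 𝓘(ℂ, H) ω f 0 :=
      (contMDiffAt_of_mem_maximalAtlas (IsManifold.chart_mem_maximalAtlas y) hyc).comp 0 h.smooth
    exact contMDiffAt_iff_contDiffAt.1 h1
  have hf' : HasFDerivAt f (fderiv ℂ f 0) 0 := (hf.differentiableAt (by simp)).hasFDerivAt
  have hinj : Function.Injective (fderiv ℂ f 0) := by
    have h1 := h.inj
    have h2 := mfderiv_eq_fderiv_chart (h.smooth.mdifferentiableAt (by simp))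
    intro a b hab
    refine h1 ?_
    have h3 : (fderiv ℂ (chartAt H (ψ 0) ∘ ψ) 0) a = (fderiv ℂ (chartAt H (ψ 0) ∘ ψ) 0) b := hab
    rw [← h2] at h3
    exact h3
  obtain ⟨Q, hQ⟩ := Submodule.exists_isCompl (LinearMap.range (fderiv ℂ f 0 : Ed →ₗ[ℂ] H))
  have hdim : Module.finrank ℂ Q = Module.finrank ℂ R := by
    have h1 := Submodule.finrank_add_eq_of_isCompl hQ
    rw [LinearMap.finrank_range_of_inj hinj] at h1
    have h2 := L₀.toLinearEquiv.finrank_eq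
    rw [Module.finrank_prod] at h2
    omega
  let q : R ≃ₗ[ℂ] Q := LinearEquiv.ofFinrankEq _ _ hdim.symm
  let q' : R →L[ℂ] H := LinearMap.toContinuousLinearMap (Q.subtype ∘ₗ q.toLinearMap)
  let Lc : H →L[ℂ] H := ((fderiv ℂ f 0).coprod q').comp (L₀.symm : H →L[ℂ] Ed × R)
  have hLinj : Function.Injective Lc := by
    have h1 : Function.Injective ((fderiv ℂ f 0).coprod q') := by
      rw [injective_iff_map_eq_zero]
      rintro ⟨v, r⟩ hvr
      have h2' : fderiv ℂ f 0 v + q' r = 0 := by simpa using hvr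
      have h2 : fderiv ℂ f 0 v + (q r : H) = 0 := h2'
      have h3 : fderiv ℂ f 0 v ∈ LinearMap.range (fderiv ℂ f 0 : Ed →ₗ[ℂ] H) := ⟨v, rfl⟩
      have h4 : fderiv ℂ f 0 v = 0 := (Submodule.disjoint_def.1 hQ.disjoint) _ h3 (by
        rw [eq_neg_of_add_eq_zero_left h2]; exact Q.neg_mem (q r).2)
      have h5 : (q r : H) = 0 := by rwa [h4, zero_add] at h2
      have h6 : r = 0 := by simpa using h5
      have h7 : v = 0 := hinj (h4.trans (map_zero _).symm)
      rw [h6, h7]; rfl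
    exact h1.comp L₀.symm.injective
  let L : H ≃L[ℂ] H := (LinearEquiv.ofInjectiveEndo (Lc : H →ₗ[ℂ] H) hLinj).toContinuousLinearEquiv
  -- The parametrization, read in a chart, is extended by a linear map onto a complement of the
  -- image of its derivative. By the inverse function theorem this is a local isomorphism, and
  -- composing the chart with its inverse turns the image of `ψ` into a coordinate slice.
  let Ψ : H → H := fun x => f (L₀.symm x).1 + q' (L₀.symm x).2
  have hΨ0 : ContDiffAt ℂ ω Ψ 0 := by
    have h1 : ContDiffAt ℂ ω (fun x : H => (L₀.symm x).1) 0 :=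
      contDiffAt_fst.comp 0 L₀.symm.contDiff.contDiffAt
    have h2 : ContDiffAt ℂ ω (fun x : H => (L₀.symm x).2) 0 :=
      contDiffAt_snd.comp 0 L₀.symm.contDiff.contDiffAt
    have h3 : ContDiffAt ℂ ω f (L₀.symm 0).1 := by rwa [map_zero]
    exact (h3.comp 0 h1).add (q'.contDiff.contDiffAt.comp 0 h2)
  have hΨ' : HasFDerivAt Ψ (L : H →L[ℂ] H) 0 := by
    have h1 : HasFDerivAt (fun x : H => (L₀.symm x).1)
        ((ContinuousLinearMap.fst ℂ Ed R).comp (L₀.symm : H →L[ℂ] Ed × R)) 0 :=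
      ((ContinuousLinearMap.fst ℂ Ed R).comp (L₀.symm : H →L[ℂ] Ed × R)).hasFDerivAt
    have h2 : HasFDerivAt (fun x : H => q' (L₀.symm x).2)
        (q'.comp ((ContinuousLinearMap.snd ℂ Ed R).comp (L₀.symm : H →L[ℂ] Ed × R))) 0 :=
      (q'.comp ((ContinuousLinearMap.snd ℂ Ed R).comp (L₀.symm : H →L[ℂ] Ed × R))).hasFDerivAt
    have h3 : HasFDerivAt f (fderiv ℂ f 0) (L₀.symm 0).1 := by rwa [map_zero]
    have h4 := (h3.comp (0 : H) h1).add h2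
    exact h4
  let Θ := hΨ0.toOpenPartialHomeomorph Ψ hΨ' (by simp)
  have hΘ : ∀ x, Θ x = Ψ x := fun _ => rfl
  have hΘ0 : (0 : H) ∈ Θ.source := hΨ0.mem_toOpenPartialHomeomorph_source hΨ' (by simp)
  have hΨy : Ψ 0 = c y := by simp [Ψ, f, y]
  have hcy : c y ∈ Θ.target := hΨy ▸ Θ.map_source hΘ0
  have hΘy : Θ.symm (c y) = 0 := by rw [← hΨy]; exact Θ.left_inv hΘ0
  have hinv : ContDiffAt ℂ ω Θ.symm (c y) := by
    rw [← hΨy]; exact hΨ0.to_localInverse hΨ' (by simp)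
  let Φ := c.trans Θ.symm
  have hyΦ : y ∈ Φ.source := by
    rw [OpenPartialHomeomorph.trans_source]
    exact ⟨hyc, hcy⟩
  have hΦy : Φ y = 0 := hΘy
  have hΦc : ContinuousAt Φ y := Φ.continuousAt hyΦ
  have hslice : ∀ v : Ed, Ψ (L₀ (v, 0)) = f v := fun v => by simp [Ψ]
  have hT : Tendsto (fun v : Ed => L₀ (v, (0 : R))) (𝓝 0) (𝓝 0) := by
    have : Continuous fun v : Ed => L₀ (v, (0 : R)) := by fun_prop
    exact this.tendsto' _ _ (by simp)
  have hU : ∀ᶠ v in 𝓝 (0 : Ed), ψ v ∈ c.source ∧ L₀ (v, (0 : R)) ∈ Θ.source :=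
    (hcont.eventually (c.open_source.mem_nhds hyc)).and
      (hT.eventually (Θ.open_source.mem_nhds hΘ0))
  have hpr : Tendsto (fun z => (L₀.symm (Φ z)).1) (𝓝 y) (𝓝 (0 : Ed)) := by
    have h1 : Continuous fun x : H => (L₀.symm x).1 := by fun_prop
    have h2 := (h1.tendsto (Φ y)).comp hΦc
    rw [hΦy, map_zero] at h2
    exact h2
  -- The chart is shrunk so that three things hold throughout: both it and its inverse are analytic;
  -- the slice is contained in `D`; and, by the `small` condition, `D` has no further points there.
  -- The last one makes `D` embedded and not merely immersed.
  have key : ∀ᶠ z in 𝓝 y, z ∈ Φ.source ∧ ContDiffAt ℂ ω Θ.symm (c z) ∧ ContDiffAt ℂ ω Ψ (Φ z) ∧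
      (z ∈ D ↔ (L₀.symm (Φ z)).2 = 0) ∧ (z ∈ D → ψ (L₀.symm (Φ z)).1 = z) := by
    filter_upwards [Φ.open_source.mem_nhds hyΦ,
      (c.continuousAt hyc).eventually (hinv.eventually (by simp)),
      hΦc.eventually ((hΦy ▸ hΨ0).eventually (by simp)),
      h.small _ hU, hpr.eventually (h.mem.and hU)] with z h1 h2 h3 h4 h5
    have hzc : z ∈ c.source ∧ c z ∈ Θ.target := by
      rwa [OpenPartialHomeomorph.trans_source] at h1
    have e1 : z ∈ D → L₀.symm (Φ z) = ((L₀.symm (Φ z)).1, 0) ∧ ψ (L₀.symm (Φ z)).1 = z := by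
      intro hz
      obtain ⟨v, ⟨hv1, hv2⟩, rfl⟩ := h4 hz
      have h6 : Φ (ψ v) = L₀ (v, 0) := by
        change Θ.symm (f v) = _
        rw [← hslice, ← hΘ, Θ.left_inv hv2]
      rw [h6]; simp
    refine ⟨h1, h2, h3, ⟨fun hz => by rw [(e1 hz).1], fun hz => ?_⟩, fun hz => (e1 hz).2⟩
    set v := (L₀.symm (Φ z)).1 with hv
    have h6 : Φ z = L₀ (v, 0) := by
      rw [← L₀.symm_apply_eq]
      exact Prod.ext rfl hz
    have h7 : c z = c (ψ v) := by
      have : Θ (Φ z) = c z := Θ.right_inv hzc.2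
      rw [← this, hΘ, h6, hslice]; rfl
    rw [c.injOn hzc.1 h5.2.1 h7]
    exact h5.1
  obtain ⟨O, hO, hOo, hyO⟩ := eventually_nhds_iff.1 key
  refine ⟨Φ.restrOpen O hOo, ?_, ⟨hyΦ, hyO⟩, hΦy, fun z hz => (hO z hz.2).2.2.2.1,
    fun z hz => (hO z hz.2).2.2.2.2⟩
  refine OpenPartialHomeomorph.mem_maximalAtlas_of_contMDiffOn _ ?_ ?_
  · intro z hz
    have h1 := hO z hz.2
    have hzc : z ∈ c.source := by
      have := h1.1; rw [OpenPartialHomeomorph.trans_source] at this; exact this.1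
    exact (h1.2.1.contMDiffAt.comp z (contMDiffAt_of_mem_maximalAtlas
      (IsManifold.chart_mem_maximalAtlas y) hzc)).contMDiffWithinAt
  · intro x hx
    have hx' := (Φ.restrOpen O hOo).map_target hx
    have hxT : x ∈ Φ.target := hx.1
    have h1 := hO _ hx'.2
    have h2 : Φ ((Φ.restrOpen O hOo).symm x) = x := (Φ.restrOpen O hOo).right_inv hx
    rw [h2] at h1
    rw [OpenPartialHomeomorph.trans_target] at hxT
    have h3 : Ψ x ∈ c.target := hxT.2
    exact ((contMDiffAt_symm_of_mem_maximalAtlas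
      (IsManifold.chart_mem_maximalAtlas y) h3).comp x h1.2.2.1.contMDiffAt).contMDiffWithinAt

end Submanifold

open Filter Topology

/-! ### Submanifold structure and tangent spaces from slices -/

section SliceChart

variable {H : Type} [NormedAddCommGroup H] [NormedSpace ℂ H] [FiniteDimensional ℂ H]
  {M : Type*} [TopologicalSpace M]
  {Ed : Type} [NormedAddCommGroup Ed] [NormedSpace ℂ Ed] [FiniteDimensional ℂ Ed]
  {R : Type} [NormedAddCommGroup R] [NormedSpace ℂ R] [FiniteDimensional ℂ R]

open Classical in
/-- The chart of a subset that is induced by a slice chart of the ambient space. -/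
def sliceChart {D : Set M} (y : D) (Φ : OpenPartialHomeomorph M H) (L₀ : (Ed × R) ≃L[ℂ] H)
    (hΦ : ∀ z ∈ Φ.source, z ∈ D ↔ (L₀.symm (Φ z)).2 = 0) : OpenPartialHomeomorph D Ed where
  toFun z := (L₀.symm (Φ z)).1
  -- The value `y` is a default taken only off the target.
  invFun v := if hv : Φ.symm (L₀ (v, 0)) ∈ D then ⟨_, hv⟩ else y
  source := Subtype.val ⁻¹' Φ.source
  target := {v | L₀ (v, 0) ∈ Φ.target}
  map_source' := by
    rintro ⟨z, hz⟩ hzΦ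
    have h1 : L₀ ((L₀.symm (Φ z)).1, 0) = Φ z := by
      rw [← (hΦ z hzΦ).1 hz]; simp
    change L₀ ((L₀.symm (Φ z)).1, 0) ∈ Φ.target
    rw [h1]
    exact Φ.map_source hzΦ
  map_target' := by
    intro v hv
    have h1 : Φ.symm (L₀ (v, 0)) ∈ Φ.source := Φ.map_target hv
    have h2 : Φ.symm (L₀ (v, 0)) ∈ D := (hΦ _ h1).2 (by rw [Φ.right_inv hv]; simp)
    rw [dif_pos h2]
    exact h1
  left_inv' := by
    rintro ⟨z, hz⟩ hzΦ
    have h1 : L₀ ((L₀.symm (Φ z)).1, 0) = Φ z := by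
      rw [← (hΦ z hzΦ).1 hz]; simp
    have h2 : Φ.symm (L₀ ((L₀.symm (Φ z)).1, 0)) = z := by
      rw [h1]; exact Φ.left_inv hzΦ
    have h3 : Φ.symm (L₀ ((L₀.symm (Φ z)).1, 0)) ∈ D := by rw [h2]; exact hz
    rw [dif_pos h3]
    exact Subtype.ext h2
  right_inv' := by
    intro v hv
    have h1 : Φ.symm (L₀ (v, 0)) ∈ Φ.source := Φ.map_target hv
    have h2 : Φ.symm (L₀ (v, 0)) ∈ D := (hΦ _ h1).2 (by rw [Φ.right_inv hv]; simp)
    rw [dif_pos h2]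
    change (L₀.symm (Φ (Φ.symm (L₀ (v, 0))))).1 = v
    rw [Φ.right_inv hv]; simp
  open_source := Φ.open_source.preimage continuous_subtype_val
  open_target := Φ.open_target.preimage (by fun_prop)
  continuousOn_toFun := by
    have h1 : Continuous fun x : H => (L₀.symm x).1 := by fun_prop
    exact h1.comp_continuousOn (Φ.continuousOn.comp continuous_subtype_val.continuousOn
      fun _ hz => hz)
  continuousOn_invFun := by
    rw [Topology.IsInducing.subtypeVal.continuousOn_iff]
    have h1 : ContinuousOn (fun v : Ed => Φ.symm (L₀ (v, 0))) {v | L₀ (v, 0) ∈ Φ.target} :=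
      Φ.symm.continuousOn.comp (by fun_prop) fun _ hv => hv
    refine h1.congr fun v hv => ?_
    have h1 : Φ.symm (L₀ (v, 0)) ∈ Φ.source := Φ.map_target hv
    have h2 : Φ.symm (L₀ (v, 0)) ∈ D := (hΦ _ h1).2 (by rw [Φ.right_inv hv]; simp)
    simp only [Function.comp]
    rw [dif_pos h2]

variable {D : Set M}

theorem sliceChart_apply (y : D) (Φ : OpenPartialHomeomorph M H) (L₀ : (Ed × R) ≃L[ℂ] H)
    (hΦ : ∀ z ∈ Φ.source, z ∈ D ↔ (L₀.symm (Φ z)).2 = 0) (z : D) :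
    sliceChart y Φ L₀ hΦ z = (L₀.symm (Φ z)).1 := rfl

theorem sliceChart_symm_apply (y : D) (Φ : OpenPartialHomeomorph M H) (L₀ : (Ed × R) ≃L[ℂ] H)
    (hΦ : ∀ z ∈ Φ.source, z ∈ D ↔ (L₀.symm (Φ z)).2 = 0) {v : Ed} (hv : L₀ (v, 0) ∈ Φ.target) :
    (((sliceChart y Φ L₀ hΦ).symm v : D) : M) = Φ.symm (L₀ (v, 0)) := by
  have h1 : Φ.symm (L₀ (v, 0)) ∈ Φ.source := Φ.map_target hv
  have h2 : Φ.symm (L₀ (v, 0)) ∈ D := (hΦ _ h1).2 (by rw [Φ.right_inv hv]; simp)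
  classical
  exact congrArg Subtype.val (dif_pos h2)

variable [ChartedSpace H M] [IsManifold 𝓘(ℂ, H) ω M]

/-- Near `y` the inclusion of `D` factors as `ψ ∘ w`, with `w` analytic because it is read off a
slice chart. Conversely `ψ` factors through `D` by a map `χ`, analytic because the inclusion is an
immersion. The chain rule gives the two containments, so the tangent space can be computed from any
parametrization. -/
theorem range_mfderiv_val [ChartedSpace Ed D] [IsManifold 𝓘(ℂ, Ed) ω D]
    (hval : Manifold.IsImmersion 𝓘(ℂ, Ed) 𝓘(ℂ, H) ω (Subtype.val : D → M))
    {Ed' : Type} [NormedAddCommGroup Ed'] [NormedSpace ℂ Ed'] [FiniteDimensional ℂ Ed']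
    {ψ : Ed' → M} (hψ : IsParam (H := H) D ψ) {y : D} (hy : ψ 0 = y) :
    Set.range (mfderiv 𝓘(ℂ, Ed) 𝓘(ℂ, H) (Subtype.val : D → M) y : Ed → H) =
      Set.range (mfderiv 𝓘(ℂ, Ed') 𝓘(ℂ, H) ψ 0 : Ed' → H) := by
  have hvald : ContMDiffAt 𝓘(ℂ, Ed) 𝓘(ℂ, H) ω (Subtype.val : D → M) y :=
    (hval.isImmersionAt y).contMDiffAt
  have hψd := hψ.smooth
  have hψ' := (hψd.mdifferentiableAt (by simp)).hasMFDerivAt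
  have hval' := (hvald.mdifferentiableAt (by simp)).hasMFDerivAt
  apply subset_antisymm
  · let A : Ed' →L[ℂ] H := mfderiv 𝓘(ℂ, Ed') 𝓘(ℂ, H) ψ 0
    have hA : Function.Injective A := hψ.inj
    have hle : Module.finrank ℂ Ed' ≤ Module.finrank ℂ H :=
      LinearMap.finrank_le_finrank_of_injective (f := (A : Ed' →ₗ[ℂ] H)) hA
    let L₀ : (Ed' × (Fin (Module.finrank ℂ H - Module.finrank ℂ Ed') → ℂ)) ≃L[ℂ] H :=
      ContinuousLinearEquiv.ofFinrankEq (by rw [Module.finrank_prod]; simp; omega)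
    obtain ⟨Φ, hΦ, hΦ0, hΦ00, -, hΦψ⟩ := hψ.exists_slice L₀
    let w : D → Ed' := fun z => (L₀.symm (Φ z)).1
    have hw : ContMDiffAt 𝓘(ℂ, Ed) 𝓘(ℂ, Ed') ω w y := by
      have h1 : ContMDiffAt 𝓘(ℂ, H) 𝓘(ℂ, H) ω Φ (y : M) :=
        contMDiffAt_of_mem_maximalAtlas hΦ (hy ▸ hΦ0)
      have h2 : ContMDiffAt 𝓘(ℂ, H) 𝓘(ℂ, Ed') ω (fun x : H => (L₀.symm x).1) (Φ y) :=
        (contDiff_fst.comp L₀.symm.contDiff).contMDiff.contMDiffAt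
      have h3 : ContMDiffAt 𝓘(ℂ, Ed) 𝓘(ℂ, H) ω (fun z : D => Φ z) y := h1.comp y hvald
      exact ContMDiffAt.comp (g := fun x : H => (L₀.symm x).1) y h2 h3
    have hev : (Subtype.val : D → M) =ᶠ[𝓝 y] ψ ∘ w := by
      have : ∀ᶠ z : D in 𝓝 y, (z : M) ∈ Φ.source :=
        continuous_subtype_val.continuousAt.eventually (Φ.open_source.mem_nhds (hy ▸ hΦ0))
      exact this.mono fun z hz => (hΦψ z hz z.2).symm
    have hwy : w y = 0 := by
      change (L₀.symm (Φ y)).1 = 0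
      rw [← hy, hΦ00]; simp
    have hw' := (hw.mdifferentiableAt (by simp)).hasMFDerivAt
    have h2 : HasMFDerivAt 𝓘(ℂ, Ed') 𝓘(ℂ, H) ψ (w y) A := by
      rw [hwy]; exact hψ'
    have h3 := (h2.comp y hw').congr_of_eventuallyEq hev
    have h4 := hasMFDerivAt_unique hval' h3
    rintro _ ⟨v, rfl⟩
    exact ⟨mfderiv 𝓘(ℂ, Ed) 𝓘(ℂ, Ed') w y v, (DFunLike.congr_fun h4 v).symm⟩
  · classical
    let χ : Ed' → D := fun v => if hv : ψ v ∈ D then ⟨ψ v, hv⟩ else y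
    have hχ : ∀ᶠ v in 𝓝 (0 : Ed'), ψ v = ((Subtype.val : D → M) ∘ χ) v :=
      hψ.mem.mono fun v hv => by simp [χ, hv]
    have hχ0 : χ 0 = y := Subtype.ext (hχ.self_of_nhds.symm.trans hy)
    have hχd : ContMDiffAt 𝓘(ℂ, Ed') 𝓘(ℂ, Ed) ω χ 0 := by
      have h1 : ContMDiffAt 𝓘(ℂ, Ed') 𝓘(ℂ, H) ω ((Subtype.val : D → M) ∘ χ) 0 :=
        hψd.congr_of_eventuallyEq (hχ.mono fun v hv => hv.symm)
      exact (ContMDiffAt.iff_comp_isImmersionAt (hval.isImmersionAt (χ 0))).2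
        ⟨Topology.IsInducing.subtypeVal.continuousAt_iff.2 h1.continuousAt, h1⟩
    have hχ' := (hχd.mdifferentiableAt (by simp)).hasMFDerivAt
    let B : Ed →L[ℂ] H := mfderiv 𝓘(ℂ, Ed) 𝓘(ℂ, H) (Subtype.val : D → M) y
    have h2 : HasMFDerivAt 𝓘(ℂ, Ed) 𝓘(ℂ, H) (Subtype.val : D → M) (χ 0) B := by
      rw [hχ0]; exact hval'
    have h3 := (h2.comp 0 hχ').congr_of_eventuallyEq hχ
    have h4 := hasMFDerivAt_unique hψ' h3
    rintro _ ⟨v, rfl⟩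
    exact ⟨mfderiv 𝓘(ℂ, Ed') 𝓘(ℂ, Ed) χ 0 v, (DFunLike.congr_fun h4 v).symm⟩

/-- A subset with a local parametrization, of constant dimension, at each of its points is an
embedded submanifold. -/
theorem exists_submanifold (L₀ : (Ed × R) ≃L[ℂ] H)
    (h : ∀ y : D, ∃ ψ : Ed → M, ψ 0 = y ∧ IsParam (H := H) D ψ) :
    ∃ _ : ChartedSpace Ed D, IsManifold 𝓘(ℂ, Ed) ω D ∧
      Manifold.IsSmoothEmbedding 𝓘(ℂ, Ed) 𝓘(ℂ, H) ω (Subtype.val : D → M) := by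
  have h' : ∀ y : D, ∃ Φ ∈ IsManifold.maximalAtlas 𝓘(ℂ, H) ω M, (y : M) ∈ Φ.source ∧
      ∀ z ∈ Φ.source, z ∈ D ↔ (L₀.symm (Φ z)).2 = 0 := fun y => by
    obtain ⟨ψ, hψy, hψ⟩ := h y
    obtain ⟨Φ, h1, h2, -, h3, -⟩ := hψ.exists_slice L₀
    exact ⟨Φ, h1, hψy ▸ h2, h3⟩
  choose Φ hΦ hyΦ hs using h'
  let ch : ChartedSpace Ed D :=
    { atlas := Set.range fun y => sliceChart y (Φ y) L₀ (hs y)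
      chartAt := fun y => sliceChart y (Φ y) L₀ (hs y)
      mem_chart_source := hyΦ
      chart_mem_atlas := fun y => ⟨y, rfl⟩ }
  have hman : IsManifold 𝓘(ℂ, Ed) ω D := by
    apply isManifold_of_contDiffOn
    rintro _ _ ⟨y, rfl⟩ ⟨y', rfl⟩
    simp only [modelWithCornersSelf_coe, modelWithCornersSelf_coe_symm, Set.range_id,
      Set.preimage_id, Set.inter_univ, Function.id_comp, Function.comp_id]
    have h1 : ContDiffOn ℂ ω ((Φ y).symm.trans (Φ y')) ((Φ y).symm.trans (Φ y')).source :=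
      contMDiffOn_iff_contDiffOn.1 (contMDiffOn_of_mem_contDiffGroupoid
        (IsManifold.compatible_of_mem_maximalAtlas (hΦ y) (hΦ y')))
    have h2 : ContDiffOn ℂ ω (fun v : Ed => (L₀.symm (((Φ y).symm.trans (Φ y')) (L₀ (v, 0)))).1)
        {v | L₀ (v, 0) ∈ ((Φ y).symm.trans (Φ y')).source} := by
      have h3 : ContDiff ℂ ω fun v : Ed => L₀ (v, (0 : R)) :=
        L₀.contDiff.comp (contDiff_id.prodMk contDiff_const)
      have h4 : ContDiff ℂ ω fun x : H => (L₀.symm x).1 := contDiff_fst.comp L₀.symm.contDiff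
      exact h4.comp_contDiffOn (h1.comp h3.contDiffOn fun v hv => hv)
    have h5 : ∀ v ∈ ((sliceChart y (Φ y) L₀ (hs y)).symm.trans
        (sliceChart y' (Φ y') L₀ (hs y'))).source, L₀ (v, 0) ∈ (Φ y).target ∧
        (((sliceChart y (Φ y) L₀ (hs y)).symm v : D) : M) = (Φ y).symm (L₀ (v, 0)) ∧
        L₀ (v, 0) ∈ ((Φ y).symm.trans (Φ y')).source := fun v hv => by
      rw [OpenPartialHomeomorph.trans_source] at hv
      have h6 : L₀ (v, 0) ∈ (Φ y).target := hv.1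
      have h7 := sliceChart_symm_apply y (Φ y) L₀ (hs y) h6
      refine ⟨h6, h7, ?_⟩
      rw [OpenPartialHomeomorph.trans_source]
      refine ⟨h6, ?_⟩
      change (Φ y).symm (L₀ (v, 0)) ∈ (Φ y').source
      rw [← h7]
      exact hv.2
    refine (h2.mono fun v hv => (h5 v hv).2.2).congr fun v hv => ?_
    rw [OpenPartialHomeomorph.coe_trans, Function.comp, sliceChart_apply, (h5 v hv).2.1]
    rfl
  refine ⟨ch, hman, ⟨?_, Topology.IsEmbedding.subtypeVal⟩⟩
  refine Manifold.IsImmersionOfComplement.isImmersion (F := R) fun y => ?_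
  refine Manifold.IsImmersionAtOfComplement.mk_of_charts L₀ (sliceChart y (Φ y) L₀ (hs y)) (Φ y)
    (hyΦ y) (hyΦ y) (IsManifold.subset_maximalAtlas ⟨y, rfl⟩) (hΦ y) (fun z hz => hz) ?_
  intro v hv
  simp only [mfld_simps] at hv
  have hv' : L₀ (v, 0) ∈ (Φ y).target := hv
  simp only [mfld_simps]
  rw [sliceChart_symm_apply y (Φ y) L₀ (hs y) hv', (Φ y).right_inv hv']

end SliceChart

open NormedSpace Filter Topology

/-! ### The linear group acting on products of Grassmannians -/

section GrassmannAction

variable {E : Type*} [NormedAddCommGroup E] [NormedSpace ℂ E] [FiniteDimensional ℂ E]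
  {ι : Type} {k : ι → ℕ}

attribute [local instance] endNormedRing endNormedAlgebra

/-- The first component, in the linear coordinates `e`, of an endomorphism restricted to the graph
of `T i`. -/
def actA (e : GrFrame E k) (T : GrModel E k) (i : ι) :
    Module.End ℂ E →L[ℂ] (Fin (k i) → ℂ) →L[ℂ] (Fin (k i) → ℂ) :=
  LinearMap.toContinuousLinearMap
    { toFun := fun A => LinearMap.toContinuousLinearMap
        (LinearMap.fst ℂ _ _ ∘ₗ (e i).toLinearMap ∘ₗ A ∘ₗ (e i).symm.toLinearMap ∘ₗ
          LinearMap.prod LinearMap.id (T i).toLinearMap)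
      map_add' := fun A B => by ext; simp
      map_smul' := fun c A => by ext; simp }

/-- The second component, in the linear coordinates `e`, of an endomorphism restricted to the graph
of `T i`. -/
def actB (e : GrFrame E k) (T : GrModel E k) (i : ι) :
    Module.End ℂ E →L[ℂ] (Fin (k i) → ℂ) →L[ℂ] (Fin (Module.finrank ℂ E - k i) → ℂ) :=
  LinearMap.toContinuousLinearMap
    { toFun := fun A => LinearMap.toContinuousLinearMap
        (LinearMap.snd ℂ _ _ ∘ₗ (e i).toLinearMap ∘ₗ A ∘ₗ (e i).symm.toLinearMap ∘ₗ
          LinearMap.prod LinearMap.id (T i).toLinearMap)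
      map_add' := fun A B => by ext; simp
      map_smul' := fun c A => by ext; simp }

theorem actA_apply (e : GrFrame E k) (T : GrModel E k) (i : ι) (A : Module.End ℂ E)
    (x : Fin (k i) → ℂ) : actA e T i A x = (e i (A ((e i).symm (x, T i x)))).1 := rfl

theorem actB_apply (e : GrFrame E k) (T : GrModel E k) (i : ι) (A : Module.End ℂ E)
    (x : Fin (k i) → ℂ) : actB e T i A x = (e i (A ((e i).symm (x, T i x)))).2 := rfl

theorem actA_one (e : GrFrame E k) (T : GrModel E k) (i : ι) : actA e T i 1 = 1 := by
  ext x : 1; simp [actA_apply]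

theorem actB_one (e : GrFrame E k) (T : GrModel E k) (i : ι) : actB e T i 1 = T i := by
  ext x : 1; simp [actB_apply]

/-- The action of an endomorphism in a chart of the product of Grassmannians. -/
def actChart (e : GrFrame E k) (T : GrModel E k) (A : Module.End ℂ E) : GrModel E k := fun i =>
  (actB e T i A).comp (Ring.inverse (actA e T i A))

theorem actChart_one (e : GrFrame E k) (T : GrModel E k) : actChart e T 1 = T := by
  funext i
  rw [actChart, actA_one, actB_one, Ring.inverse_one]
  exact ContinuousLinearMap.comp_id _

/-- Moving a subspace by `a` amounts to keeping its graph and changing the linear coordinates from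
`e` to `e ∘ a⁻¹`, so the formula for the change of graph charts applies. -/
theorem smul_graphParam (e : GrFrame E k) (T : GrModel E k)
    (a : LinearMap.GeneralLinearGroup ℂ E)
    (ha : ∀ i, IsUnit (actA e T i (a : Module.End ℂ E))) :
    (fun i => ((graphParam e T i).1.map (a : Module.End ℂ E))) =
      fun i => (graphParam e (actChart e T a) i).1 := by
  let e' : GrFrame E k := fun i =>
    (LinearMap.GeneralLinearGroup.toLinearEquiv a).symm.trans (e i)
  have hA : ∀ i, transA e' e i T = actA e T i (a : Module.End ℂ E) := fun i => by
    ext1 x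
    have h1 := congrArg Prod.fst (trans_apply e' e i T x)
    exact h1.symm
  have hB : ∀ i, transB e' e i T = actB e T i (a : Module.End ℂ E) := fun i => by
    ext1 x
    have h1 := congrArg Prod.snd (trans_apply e' e i T x)
    exact h1.symm
  have h1 := graphParam_eq_of_isUnit e' e T fun i => by rw [hA]; exact ha i
  have h2 : (fun i => (transB e' e i T).comp (Ring.inverse (transA e' e i T))) =
      actChart e T a := by
    funext i; rw [hA, hB]; rfl
  rw [h2] at h1
  funext i
  rw [← h1]
  ext w
  rw [mem_graphParam]
  constructor
  · rintro ⟨v, hv, rfl⟩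
    have h3 := (mem_graphParam e i T v).1 hv
    have h4 : (LinearMap.GeneralLinearGroup.toLinearEquiv a).symm ((a : Module.End ℂ E) v) = v :=
      (LinearMap.GeneralLinearGroup.toLinearEquiv a).symm_apply_apply v
    simpa [e', h4] using h3
  · intro hw
    exact ⟨(LinearMap.GeneralLinearGroup.toLinearEquiv a).symm w, (mem_graphParam e i T _).2 hw,
      (LinearMap.GeneralLinearGroup.toLinearEquiv a).apply_symm_apply w⟩

variable [Fintype ι]

theorem smul_graphParam' (e : GrFrame E k) (T : GrModel E k)
    (a : LinearMap.GeneralLinearGroup ℂ E)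
    (ha : ∀ i, IsUnit (actA e T i (a : Module.End ℂ E))) :
    a • graphParam e T = graphParam e (actChart e T a) := by
  funext i
  exact Subtype.ext (congrFun (smul_graphParam e T a ha) i)

theorem contDiffAt_actChart (e : GrFrame E k) (T : GrModel E k) :
    ContDiffAt ℂ ω (actChart e T) 1 := by
  rw [contDiffAt_pi]
  intro i
  have h1 : ContDiffAt ℂ ω (fun A => Ring.inverse (actA e T i A)) (1 : Module.End ℂ E) := by
    have h2 := contDiffAt_ringInverse ℂ (1 : ((Fin (k i) → ℂ) →L[ℂ] (Fin (k i) → ℂ))ˣ) (n := ω)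
    rw [Units.val_one, ← actA_one e T i] at h2
    exact h2.comp (1 : Module.End ℂ E) (actA e T i).contDiff.contDiffAt
  exact (actB e T i).contDiff.contDiffAt.clm_comp h1

/-- Differentiating the identity `actB = actChart ∘ actA` at `1` avoids the derivative of an
inverse. -/
theorem hasFDerivAt_actChart (e : GrFrame E k) (T : GrModel E k) (A : Module.End ℂ E) (i : ι) :
    fderiv ℂ (actChart e T) 1 A i = actB e T i A - (T i).comp (actA e T i A) := by
  have hd : DifferentiableAt ℂ (actChart e T) 1 :=
    (contDiffAt_actChart e T).differentiableAt (by simp)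
  have := end_completeSpace E
  have h1 : HasFDerivAt (fun A => actChart e T A i)
      ((ContinuousLinearMap.proj i).comp (fderiv ℂ (actChart e T) 1)) 1 :=
    hasFDerivAt_pi'.1 hd.hasFDerivAt i
  have h2 := h1.clm_comp (actA e T i).hasFDerivAt
  have h3 : ∀ᶠ B in 𝓝 (1 : Module.End ℂ E),
      actB e T i B = (actChart e T B i).comp (actA e T i B) := by
    have hu : ∀ᶠ B in 𝓝 (1 : Module.End ℂ E), IsUnit (actA e T i B) :=
      (actA e T i).continuous.continuousAt.eventually
        (Units.isOpen.mem_nhds (by rw [actA_one]; exact isUnit_one))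
    filter_upwards [hu] with B hB
    have h4 : (Ring.inverse (actA e T i B)).comp (actA e T i B) = 1 :=
      Ring.inverse_mul_cancel _ hB
    rw [actChart, ContinuousLinearMap.comp_assoc, h4]
    exact (ContinuousLinearMap.comp_id _).symm
  have h4 := DFunLike.congr_fun ((h2.congr_of_eventuallyEq h3).unique (actB e T i).hasFDerivAt) A
  rw [eq_sub_iff_add_eq, ← h4, actChart_one, actA_one]
  ext x : 1
  simp [add_comm]

/-- The infinitesimal action of an endomorphism vanishes only if it preserves all the subspaces. -/
theorem apply_mem_of_fderiv_eq_zero (e : GrFrame E k) (T : GrModel E k) {A : Module.End ℂ E}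
    (h : fderiv ℂ (actChart e T) 1 A = 0) (i : ι) {v : E} (hv : v ∈ (graphParam e T i).1) :
    A v ∈ (graphParam e T i).1 := by
  have h1 := congrFun h i
  rw [hasFDerivAt_actChart, Pi.zero_apply, sub_eq_zero] at h1
  have h2 := DFunLike.congr_fun h1 (e i v).1
  rw [mem_graphParam] at hv ⊢
  rw [ContinuousLinearMap.comp_apply, actA_apply, actB_apply, ← hv] at h2
  simpa using h2

open Classical in
/-- The orbit map at `x`, extended to all endomorphisms. -/
def orbitMap (x : GrProd E k) (A : Module.End ℂ E) : GrProd E k :=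
  if h : IsUnit A then h.unit • x else x

theorem orbitMap_unit (x : GrProd E k) (a : LinearMap.GeneralLinearGroup ℂ E) :
    orbitMap x (a : Module.End ℂ E) = a • x := by
  rw [orbitMap, dif_pos a.isUnit]
  congr 1
  exact Units.ext rfl

theorem one_smul' (x : GrProd E k) : (1 : LinearMap.GeneralLinearGroup ℂ E) • x = x := by
  funext i
  exact Subtype.ext (Submodule.map_id _)

theorem orbitMap_one (x : GrProd E k) : orbitMap x 1 = x := by
  have := orbitMap_unit x 1
  rwa [one_smul', Units.val_one] at this

theorem chartAt_eq (x : GrProd E k) : ∃ e : GrFrame E k, ∃ T : GrModel E k, graphParam e T = x ∧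
    (∀ T', T' ∈ (chartAt (GrModel E k) x).target) ∧
    (∀ T', (chartAt (GrModel E k) x).symm T' = graphParam e T') ∧
    ∀ T', chartAt (GrModel E k) x (graphParam e T') = T' :=
  ⟨(exists_mem_range_graphParam x).choose, (exists_mem_range_graphParam x).choose_spec.choose,
    (exists_mem_range_graphParam x).choose_spec.choose_spec, fun _ => Set.mem_univ _, fun _ => rfl,
    fun T' => Function.leftInverse_invFun (graphParam_injective _) T'⟩

theorem eventually_orbitMap (x : GrProd E k) {e : GrFrame E k} {T : GrModel E k}
    (hx : graphParam e T = x) :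
    ∀ᶠ A in 𝓝 (1 : Module.End ℂ E), orbitMap x A = graphParam e (actChart e T A) := by
  have := end_completeSpace E
  have h1 : ∀ᶠ A in 𝓝 (1 : Module.End ℂ E), ∀ i, IsUnit (actA e T i A) :=
    eventually_all.2 fun i => (actA e T i).continuous.continuousAt.eventually
      (Units.isOpen.mem_nhds (by rw [actA_one]; exact isUnit_one))
  filter_upwards [h1, Units.isOpen.mem_nhds (isUnit_one (M := Module.End ℂ E))] with A hA hu
  obtain ⟨a, rfl⟩ := hu
  rw [orbitMap_unit, ← hx, smul_graphParam' e T a hA]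

theorem contMDiffAt_orbitMap (x : GrProd E k) :
    ContMDiffAt 𝓘(ℂ, Module.End ℂ E) 𝓘(ℂ, GrModel E k) ω (orbitMap x) 1 := by
  obtain ⟨e, T, hx, ht, hs, hc⟩ := chartAt_eq x
  have h1 : ContMDiffAt 𝓘(ℂ, GrModel E k) 𝓘(ℂ, GrModel E k) ω (chartAt (GrModel E k) x).symm
      (actChart e T 1) :=
    contMDiffAt_symm_of_mem_maximalAtlas (IsManifold.chart_mem_maximalAtlas x) (ht _)
  refine (h1.comp (1 : Module.End ℂ E)
    (contDiffAt_actChart e T).contMDiffAt).congr_of_eventuallyEq ?_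
  filter_upwards [eventually_orbitMap x hx] with A hA
  rw [hA, Function.comp, hs]

theorem mfderiv_orbitMap (x : GrProd E k) : ∃ e : GrFrame E k, ∃ T : GrModel E k,
    graphParam e T = x ∧
    (mfderiv 𝓘(ℂ, Module.End ℂ E) 𝓘(ℂ, GrModel E k) (orbitMap x) 1 :
      Module.End ℂ E →L[ℂ] GrModel E k) = fderiv ℂ (actChart e T) 1 := by
  obtain ⟨e, T, hx, ht, hs, hc⟩ := chartAt_eq x
  refine ⟨e, T, hx, (mfderiv_eq_fderiv_chart
    ((contMDiffAt_orbitMap x).mdifferentiableAt (by simp))).trans ?_⟩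
  refine Filter.EventuallyEq.fderiv_eq ?_
  filter_upwards [eventually_orbitMap x hx] with A hA
  rw [Function.comp, hA, orbitMap_one, hc]

/-- The orbit map in exponential coordinates. -/
def orbitParam {Ed : Type} [NormedAddCommGroup Ed] [NormedSpace ℂ Ed] (x : GrProd E k)
    (J : Ed →L[ℂ] Module.End ℂ E) (v : Ed) : GrProd E k :=
  orbitMap x (exp (J v))

/-- The curve defining `infAct` is the orbit map along the line `1 + t • A`. By the chain rule the
infinitesimal action is the derivative of the orbit map at `1`, hence linear in `A`. -/
theorem infAct_eq (x : GrProd E k) (A : Module.End ℂ E) :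
    (infAct x A : GrModel E k) = (mfderiv 𝓘(ℂ, Module.End ℂ E) 𝓘(ℂ, GrModel E k) (orbitMap x) 1 :
      Module.End ℂ E →L[ℂ] GrModel E k) A := by
  let δ : Module.End ℂ E →L[ℂ] GrModel E k :=
    mfderiv 𝓘(ℂ, Module.End ℂ E) 𝓘(ℂ, GrModel E k) (orbitMap x) 1
  let c : ℂ → Module.End ℂ E := fun t => 1 + t • A
  have hc : HasFDerivAt c ((ContinuousLinearMap.id ℂ ℂ).smulRight A) 0 :=
    ((ContinuousLinearMap.id ℂ ℂ).smulRight A).hasFDerivAt.const_add 1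
  have h1 : HasMFDerivAt 𝓘(ℂ, Module.End ℂ E) 𝓘(ℂ, GrModel E k) (orbitMap x) (c 0) δ := by
    rw [show c 0 = 1 by simp [c]]
    exact ((contMDiffAt_orbitMap x).mdifferentiableAt (by simp)).hasMFDerivAt
  have h2 := (h1.comp (0 : ℂ) hc.hasMFDerivAt).mfderiv
  have h3 := DFunLike.congr_fun h2 (1 : ℂ)
  have h4 : (δ.comp ((ContinuousLinearMap.id ℂ ℂ).smulRight A)) (1 : ℂ) = δ A := by simp
  exact h3.trans h4

theorem apply_mem_of_infAct_eq_zero (x : GrProd E k) {A : Module.End ℂ E}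
    (h : (infAct x A : GrModel E k) = 0) (i : ι) {v : E} (hv : v ∈ (x i).1) : A v ∈ (x i).1 := by
  obtain ⟨e, T, rfl, hd⟩ := mfderiv_orbitMap x
  rw [infAct_eq, hd] at h
  exact apply_mem_of_fderiv_eq_zero e T h i hv

section Param

variable {Ed : Type} [NormedAddCommGroup Ed] [NormedSpace ℂ Ed] [FiniteDimensional ℂ Ed]
  (x : GrProd E k) (J : Ed →L[ℂ] Module.End ℂ E)

theorem orbitParam_zero : orbitParam x J 0 = x := by
  rw [orbitParam, map_zero, exp_zero, orbitMap_one]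

theorem contDiffAt_exp_comp : ContDiffAt ℂ ω (fun v => exp (J v)) 0 := by
  have := end_completeSpace E
  have h1 : ContDiffAt ℂ ω (exp : Module.End ℂ E → Module.End ℂ E) (J 0) :=
    (NormedSpace.exp_analytic (𝕂 := ℂ) (J 0)).contDiffAt
  exact h1.comp 0 J.contDiff.contDiffAt

theorem contMDiffAt_orbitParam :
    ContMDiffAt 𝓘(ℂ, Ed) 𝓘(ℂ, GrModel E k) ω (orbitParam x J) 0 := by
  have h1 : ContMDiffAt 𝓘(ℂ, Module.End ℂ E) 𝓘(ℂ, GrModel E k) ω (orbitMap x) (exp (J 0)) := by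
    rw [map_zero, exp_zero]; exact contMDiffAt_orbitMap x
  exact h1.comp 0 (contDiffAt_exp_comp J).contMDiffAt

theorem mfderiv_orbitParam (v : Ed) :
    (mfderiv 𝓘(ℂ, Ed) 𝓘(ℂ, GrModel E k) (orbitParam x J) 0 : Ed →L[ℂ] GrModel E k) v =
      (infAct x (J v) : GrModel E k) := by
  have := end_completeSpace E
  let δ : Module.End ℂ E →L[ℂ] GrModel E k :=
    mfderiv 𝓘(ℂ, Module.End ℂ E) 𝓘(ℂ, GrModel E k) (orbitMap x) 1
  have hc : HasFDerivAt (fun v => exp (J v)) J 0 := by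
    have h1 : HasFDerivAt (exp : Module.End ℂ E → Module.End ℂ E)
        (1 : Module.End ℂ E →L[ℂ] Module.End ℂ E) (J 0) := by
      rw [map_zero]; exact hasFDerivAt_exp_zero
    exact h1.comp 0 J.hasFDerivAt
  have h1 : HasMFDerivAt 𝓘(ℂ, Module.End ℂ E) 𝓘(ℂ, GrModel E k) (orbitMap x) (exp (J 0)) δ := by
    rw [map_zero, exp_zero]
    exact ((contMDiffAt_orbitMap x).mdifferentiableAt (by simp)).hasMFDerivAt
  have h2 := (h1.comp (0 : Ed) hc.hasMFDerivAt).mfderiv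
  rw [infAct_eq]
  exact DFunLike.congr_fun h2 v

end Param

end GrassmannAction

open NormedSpace Filter Topology

/-! ### Closedness and local parametrizations of the orbit among flags -/

section OrbitGeometry

variable {E : Type*} [NormedAddCommGroup E] [NormedSpace ℂ E] [FiniteDimensional ℂ E] {n : ℕ}
  {ι : Type} {k : ι → ℕ} {idx : ι → ℤ}

attribute [local instance] endNormedRing endNormedAlgebra

/-- The filtration with given members at the indices `idx`. -/
def filt (idx : ι → ℤ) (x : GrProd E k) (p : ℤ) : Submodule ℂ E :=
  ⨆ j : ι, ⨆ _ : p ≤ idx j, (x j).1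

variable [Fintype ι]

theorem smul_val (a : LinearMap.GeneralLinearGroup ℂ E) (x : GrProd E k) (j : ι) :
    ((a • x) j).1 = (x j).1.map (a : Module.End ℂ E) := rfl

theorem filt_smul (a : LinearMap.GeneralLinearGroup ℂ E) (x : GrProd E k) :
    filt idx (a • x) = mapF a (filt idx x) := by
  funext p
  simp only [filt, mapF, Submodule.map_iSup]
  rfl

theorem smul_eq_smul {x y : GrProd E k} (hx : ∀ j, filt idx x (idx j) = (x j).1)
    (hy : ∀ j, filt idx y (idx j) = (y j).1) {a c : LinearMap.GeneralLinearGroup ℂ E}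
    (h : mapF a (filt idx x) = mapF c (filt idx y)) : a • x = c • y := by
  funext j
  refine Subtype.ext ?_
  rw [smul_val, smul_val, ← hx, ← hy]
  exact congrFun h (idx j)

/-- In a graph chart at `y`, nearby subspaces are graphs over the same first factor, and the shear
by the difference of the two graph maps carries one to the other. -/
theorem exists_tendsto_map_member (y : GrProd E k) (i : ι) :
    ∃ θ : GrProd E k → Module.End ℂ E, Tendsto θ (𝓝 y) (𝓝 1) ∧
      ∀ᶠ z in 𝓝 y, (y i).1.map (θ z) = (z i).1 := by
  obtain ⟨e, T, hx, ht, hs, hc⟩ := chartAt_eq y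
  set c := chartAt (GrModel E k) y with hcdef
  let K : ((Fin (k i) → ℂ) →L[ℂ] (Fin (Module.finrank ℂ E - k i) → ℂ)) →ₗ[ℂ] Module.End ℂ E :=
    { toFun := fun Q => (e i).symm.toLinearMap ∘ₗ LinearMap.inr ℂ _ _ ∘ₗ Q.toLinearMap ∘ₗ
        LinearMap.fst ℂ _ _ ∘ₗ (e i).toLinearMap
      map_add' := fun A B => by
        ext v
        apply (e i).injective
        simp [Prod.ext_iff]
      map_smul' := fun r A => by
        ext v
        apply (e i).injective
        simp [Prod.ext_iff] }
  have hK : ∀ Q v, e i (v + K Q v) = ((e i v).1, (e i v).2 + Q (e i v).1) := fun Q v => by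
    rw [map_add]
    have : e i (K Q v) = (0, Q (e i v).1) := (e i).apply_symm_apply _
    rw [this]
    ext1 <;> simp
  have hyc : y ∈ c.source := mem_chart_source _ y
  have hcy : c y = T := by
    have := hc T
    rwa [hx] at this
  refine ⟨fun z => 1 + K (c z i - T i), ?_, ?_⟩
  · have h1 : Tendsto (fun z => c z i - T i) (𝓝 y) (𝓝 (c y i - T i)) :=
      (((continuous_apply i).tendsto _).comp (c.continuousAt hyc)).sub_const _
    have h2 := (K.continuous_of_finiteDimensional.tendsto _).comp h1
    rw [hcy, sub_self, map_zero] at h2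
    simpa using h2.const_add (1 : Module.End ℂ E)
  · filter_upwards [c.open_source.mem_nhds hyc] with z hz
    have hz' : graphParam e (c z) = z := by rw [← hs]; exact c.left_inv hz
    have h1 : ∀ v, v ∈ (y i).1 ↔ (e i v).2 = T i (e i v).1 := fun v => by
      rw [← hx]; exact mem_graphParam e i T v
    have h2 : ∀ v, v ∈ (z i).1 ↔ (e i v).2 = c z i (e i v).1 := fun v => by
      conv_lhs => rw [← hz']
      exact mem_graphParam e i (c z) v
    have h3 : ∀ v, e i ((1 + K (c z i - T i)) v) =
        ((e i v).1, (e i v).2 + (c z i - T i) (e i v).1) := fun v => hK _ v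
    ext w
    constructor
    · rintro ⟨v, hv, rfl⟩
      rw [h2, h3, (h1 v).1 hv]
      simp
    · intro hw
      refine ⟨(e i).symm ((e i w).1, T i (e i w).1), (h1 _).2 (by simp), (e i).injective ?_⟩
      rw [h3]
      have := (h2 w).1 hw
      ext1 <;> simp [this]

/-- The step of index `p` is the member at the smallest jump not less than `p`, or zero if there is
none. So the operators for single members suffice. -/
theorem exists_tendsto_map_filt {y : GrProd E k} (hy : ∀ j, filt idx y (idx j) = (y j).1) :
    ∃ θ : ℤ → GrProd E k → Module.End ℂ E, (∀ p, Tendsto (θ p) (𝓝 y) (𝓝 1)) ∧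
      ∀ p, ∀ᶠ z in 𝓝 y, (∀ j, filt idx z (idx j) = (z j).1) →
        (filt idx y p).map (θ p z) = filt idx z p := by
  have key : ∀ p, ∃ θ : GrProd E k → Module.End ℂ E, Tendsto θ (𝓝 y) (𝓝 1) ∧
      ∀ᶠ z in 𝓝 y, (∀ j, filt idx z (idx j) = (z j).1) →
        (filt idx y p).map (θ z) = filt idx z p := by
    intro p
    by_cases hp : ∃ j, p ≤ idx j
    · obtain ⟨j, hj, hmin⟩ := Finset.exists_min_image (Finset.univ.filter fun j => p ≤ idx j) idx
        (by obtain ⟨j, hj⟩ := hp; exact ⟨j, by simpa using hj⟩)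
      have hj' : p ≤ idx j := by simpa using hj
      have heq : ∀ z : GrProd E k, filt idx z p = filt idx z (idx j) := fun z => by
        simp only [filt]
        refine iSup_congr fun i => iSup_congr_Prop ⟨fun hi => ?_, fun hi => hj'.trans hi⟩ fun _ => rfl
        exact hmin i (by simpa using hi)
      obtain ⟨θ, hθ, hθ'⟩ := exists_tendsto_map_member y j
      refine ⟨θ, hθ, hθ'.mono fun z hz hzf => ?_⟩
      rw [heq, heq, hy, hzf, hz]
    · push Not at hp
      have heq : ∀ z : GrProd E k, filt idx z p = ⊥ := fun z => by
        simp only [filt]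
        refine iSup_eq_bot.2 fun i => iSup_eq_bot.2 fun hi => ?_
        exact absurd hi (not_le.2 (hp i))
      exact ⟨fun _ => 1, tendsto_const_nhds, Eventually.of_forall fun z _ => by
        rw [heq, heq, Submodule.map_bot]⟩
  choose θ h1 h2 using key
  exact ⟨θ, h1, h2⟩

namespace Sys

variable {S : Sys E} {b : Module.Basis (Fin n) ℂ E}
  {N : Subgroup (LinearMap.GeneralLinearGroup ℂ E)}

/-- A set of flags with the same Hodge numbers that define polarized mixed Hodge structures. -/
structure Dom (S : Sys E) (idx : ι → ℤ) (M : Set (GrProd E k)) : Prop where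
  fix : ∀ x ∈ M, ∀ j, filt idx x (idx j) = (x j).1
  pt : ∀ x ∈ M, S.Pt (filt idx x)
  dim : ∀ x ∈ M, ∀ y ∈ M, ∀ p m, Module.finrank ℂ (filt idx x p ⊓ S.W m : Submodule ℂ E) =
    Module.finrank ℂ (filt idx y p ⊓ S.W m : Submodule ℂ E)

variable {M D : Set (GrProd E k)} {x₀ : GrProd E k}

/-- The orbit of `x₀` under the group `H1`. -/
structure IsOrbit (S : Sys E) (b : Module.Basis (Fin n) ℂ E)
    (N : Subgroup (LinearMap.GeneralLinearGroup ℂ E)) (idx : ι → ℤ) (M D : Set (GrProd E k))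
    (x₀ : GrProd E k) : Prop where
  dom : S.Dom idx M
  subset : D ⊆ M
  base : S.Base b N (filt idx x₀)
  eq : D = {y | ∃ a ∈ H1 base.grp, y = a • x₀}

theorem IsOrbit.self_mem (h : S.IsOrbit b N idx M D x₀) : x₀ ∈ D := by
  rw [h.eq]
  exact ⟨1, one_mem _, (one_smul' x₀).symm⟩

theorem IsOrbit.exists_ultrafilter_data (h : S.IsOrbit b N idx M D x₀) {y : GrProd E k}
    (hy : y ∈ M) {l : Ultrafilter (GrProd E k)} (hly : (l : Filter (GrProd E k)) ≤ 𝓝 y)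
    (hlD : ∀ᶠ z in (l : Filter (GrProd E k)), z ∈ D) :
    ∃ g : GrProd E k → LinearMap.GeneralLinearGroup ℂ E, (∀ z, g z ∈ H1 h.base.grp) ∧
      (∀ z ∈ D, z = g z • x₀) ∧
      ∃ θ : ℤ → GrProd E k → Module.End ℂ E, (∀ p, Tendsto (θ p) l (𝓝 1)) ∧
        ∀ p, ∀ᶠ z in (l : Filter (GrProd E k)),
          (filt idx y p).map (θ p z) = mapF (g z) (filt idx x₀) p := by
  classical
  have hD : ∀ z, ∃ a ∈ H1 h.base.grp, z ∈ D → z = a • x₀ := fun z => by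
    by_cases hz : z ∈ D
    · rw [h.eq] at hz
      obtain ⟨a, ha, ha'⟩ := hz
      exact ⟨a, ha, fun _ => ha'⟩
    · exact ⟨1, one_mem _, fun hz' => absurd hz' hz⟩
  choose g hg hg' using hD
  obtain ⟨θ, h1, h2⟩ := exists_tendsto_map_filt (h.dom.fix y hy)
  refine ⟨g, hg, hg', θ, fun p => (h1 p).mono_left hly, fun p => ?_⟩
  filter_upwards [hlD, (h2 p).filter_mono hly] with z hz hz'
  rw [hz' (h.dom.fix z (h.subset hz)), ← filt_smul, ← hg' z hz]

/-- A point of the closure is the limit of an ultrafilter on `D`; if it is in `M`, it is polarized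
with the same dimensions, and `Base.mem_orbit_of_tendsto` places it in the orbit. -/
theorem IsOrbit.eq_inter_closure (h : S.IsOrbit b N idx M D x₀) : D = M ∩ closure D := by
  have := end_completeSpace E
  refine subset_antisymm (fun z hz => ⟨h.subset hz, subset_closure hz⟩) ?_
  rintro y ⟨hy, hyD⟩
  rw [mem_closure_iff_clusterPt] at hyD
  have hne : (𝓝 y ⊓ 𝓟 D).NeBot := hyD
  let l := Ultrafilter.of (𝓝 y ⊓ 𝓟 D)
  have hl : (l : Filter (GrProd E k)) ≤ 𝓝 y ⊓ 𝓟 D := Ultrafilter.of_le _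
  obtain ⟨g, hg, -, θ, hθ, hθ'⟩ := h.exists_ultrafilter_data hy (hl.trans inf_le_left)
    (le_principal_iff.1 (hl.trans inf_le_right))
  have hx₀ := h.subset h.self_mem
  obtain ⟨a, ha, haF⟩ := h.base.mem_orbit_of_tendsto (h.dom.pt y hy)
    (fun p m => h.dom.dim y hy x₀ hx₀ p m) hg hθ hθ'
  rw [h.eq]
  refine ⟨a, ha, ?_⟩
  have := smul_eq_smul (h.dom.fix y hy) (h.dom.fix x₀ hx₀) (a := 1) (c := a)
    (by rw [mapF_one, haF])
  rwa [one_smul'] at this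

/-- Injectivity of the derivative holds because an endomorphism with trivial infinitesimal action
preserves the filtration, and `C` meets the stabilizer trivially. The image is in `D` by the
openness statement `Base.eventually_expU_mem`. If points of `D` arbitrarily close to `y` were
missed, an ultrafilter on them would contradict `Base.eventually_mem_image`. -/
theorem IsOrbit.isParam (h : S.IsOrbit b N idx M D x₀) {y : GrProd E k} (hy : y ∈ D)
    {C : Submodule ℂ (Module.End ℂ E)} (hC : C ≤ lie b N)
    (hC' : lie b N ≤ C ⊔ FL b N (filt idx y) 0) (hC0 : ∀ X ∈ C, X ∈ FL b N (filt idx y) 0 → X = 0)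
    {Ed : Type} [NormedAddCommGroup Ed] [NormedSpace ℂ Ed] [FiniteDimensional ℂ Ed]
    {J : Ed →L[ℂ] Module.End ℂ E} (hJ : Function.Injective J)
    (hJC : LinearMap.range (J : Ed →ₗ[ℂ] Module.End ℂ E) = C) :
    IsParam (H := GrModel E k) D (orbitParam y J) := by
  have := end_completeSpace E
  have hJmem : ∀ v, J v ∈ C := fun v => hJC ▸ ⟨v, rfl⟩
  have hyM := h.subset hy
  have hx₀ := h.subset h.self_mem
  have hexp : ∀ v, orbitParam y J v = expU (J v) • y := fun v => orbitMap_unit y (expU (J v))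
  refine ⟨contMDiffAt_orbitParam y J, ?_, ?_, ?_⟩
  · let A : Ed →L[ℂ] GrModel E k := mfderiv 𝓘(ℂ, Ed) 𝓘(ℂ, GrModel E k) (orbitParam y J) 0
    have hA : Function.Injective A := by
      rw [injective_iff_map_eq_zero]
      intro v hv
      have h1 : (infAct y (J v) : GrModel E k) = 0 := (mfderiv_orbitParam y J v).symm.trans hv
      refine hJ ((hC0 _ (hJmem v) ⟨hC (hJmem v), fun p w hw => ?_⟩).trans (map_zero J).symm)
      rw [add_zero]
      have h2 : filt idx y p ≤ (filt idx y p).comap (J v) :=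
        iSup₂_le fun j hj w hw => Submodule.mem_comap.2
          (le_iSup₂_of_le (f := fun (j : ι) (_ : p ≤ idx j) => (y j).1) j hj le_rfl
            (apply_mem_of_infAct_eq_zero y h1 j hw))
      exact h2 hw
    exact hA
  · have hy' := hy
    rw [h.eq] at hy'
    obtain ⟨γ, hγ, rfl⟩ := hy'
    have h1 := h.base.eventually_expU_mem hγ (by rw [← filt_smul]; exact h.dom.pt _ hyM)
    have h2 : Tendsto J (𝓝 0) (𝓝 0) := J.continuous.tendsto' _ _ (map_zero J)
    filter_upwards [h2.eventually h1] with v hv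
    obtain ⟨a, ha, ha'⟩ := hv (hC (hJmem v))
    rw [h.eq]
    refine ⟨a, ha, ?_⟩
    rw [hexp]
    refine smul_eq_smul (h.dom.fix _ hyM) (h.dom.fix _ hx₀) ?_
    rw [filt_smul, ha']
  · intro U hU
    rw [orbitParam_zero]
    by_contra hcon
    have hfreq : ∃ᶠ z in 𝓝 y, z ∈ D ∧ z ∉ orbitParam y J '' U := by
      rw [Filter.not_eventually] at hcon
      exact hcon.mono fun z hz => by simpa only [Classical.not_imp] using hz
    have hne : (𝓝 y ⊓ 𝓟 {z | z ∈ D ∧ z ∉ orbitParam y J '' U}).NeBot :=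
      frequently_mem_iff_neBot.1 hfreq
    let l := Ultrafilter.of (𝓝 y ⊓ 𝓟 {z | z ∈ D ∧ z ∉ orbitParam y J '' U})
    have hl := Ultrafilter.of_le (𝓝 y ⊓ 𝓟 {z | z ∈ D ∧ z ∉ orbitParam y J '' U})
    have hlD : ∀ᶠ z in (l : Filter (GrProd E k)), z ∈ D ∧ z ∉ orbitParam y J '' U :=
      le_principal_iff.1 (hl.trans inf_le_right)
    obtain ⟨g, hg, hg', θ, hθ, hθ'⟩ := h.exists_ultrafilter_data hyM (hl.trans inf_le_left)
      (hlD.mono fun z hz => hz.1)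
    let ε : Ed ≃ₗ[ℂ] C := LinearEquiv.ofBijective
      (LinearMap.codRestrict C (J : Ed →ₗ[ℂ] Module.End ℂ E) hJmem)
      ⟨fun v w hvw => hJ (congrArg Subtype.val hvw), fun X => by
        have hX : (X : Module.End ℂ E) ∈ LinearMap.range (J : Ed →ₗ[ℂ] Module.End ℂ E) := by
          rw [hJC]; exact X.2
        obtain ⟨v, hv⟩ := hX
        exact ⟨v, Subtype.ext hv⟩⟩
    have hU' : ε.symm ⁻¹' U ∈ 𝓝 (0 : C) :=
      (ε.symm.toLinearMap.continuous_of_finiteDimensional).continuousAt.preimage_mem_nhds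
        (by rw [LinearEquiv.coe_coe, map_zero]; exact hU)
    have h1 := h.base.eventually_mem_image (h.dom.pt y hyM)
      (fun p m => h.dom.dim y hyM x₀ hx₀ p m) hg hθ hθ' hC hC' hU'
    obtain ⟨z, ⟨hzD, hzU⟩, X, hX, hzX⟩ := (hlD.and h1).exists
    refine hzU ⟨ε.symm X, hX, ?_⟩
    have h3 : J (ε.symm X) = X := congrArg Subtype.val (ε.apply_symm_apply X)
    rw [hexp, h3, hg' z hzD]
    exact (smul_eq_smul (h.dom.fix _ hx₀) (h.dom.fix _ hyM) hzX).symm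

end Sys

end OrbitGeometry

/-! ### The manifold structure of the orbit and its tangent space -/

section OrbitManifold

open NormedSpace Filter Topology

variable {E : Type*} [NormedAddCommGroup E] [NormedSpace ℂ E] [FiniteDimensional ℂ E] {n : ℕ}
  {ι : Type} {k : ι → ℕ} {idx : ι → ℤ}

attribute [local instance] endNormedRing endNormedAlgebra

theorem exists_range_eq {X : Type*} [NormedAddCommGroup X] [NormedSpace ℂ X]
    [FiniteDimensional ℂ X] (C : Submodule ℂ X) {d : ℕ} (hd : Module.finrank ℂ C = d) :
    ∃ J : EuclideanSpace ℂ (Fin d) →L[ℂ] X, Function.Injective J ∧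
      LinearMap.range (J : EuclideanSpace ℂ (Fin d) →ₗ[ℂ] X) = C := by
  let e : EuclideanSpace ℂ (Fin d) ≃ₗ[ℂ] C := LinearEquiv.ofFinrankEq _ _ (by rw [hd]; simp)
  refine ⟨LinearMap.toContinuousLinearMap (C.subtype ∘ₗ e.toLinearMap), ?_, ?_⟩
  · exact C.subtype_injective.comp e.injective
  · rw [LinearMap.coe_toContinuousLinearMap, LinearMap.range_comp, LinearEquiv.range,
      Submodule.map_top, Submodule.range_subtype]

namespace Sys

variable {S : Sys E} {b : Module.Basis (Fin n) ℂ E}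
  {N : Subgroup (LinearMap.GeneralLinearGroup ℂ E)}

theorem FL_le_lie (G : ℤ → Submodule ℂ E) (r : ℤ) : FL b N G r ≤ lie b N := fun _ hX => hX.1

theorem exists_compl_FL (G : ℤ → Submodule ℂ E) : ∃ C ≤ lie b N, lie b N ≤ C ⊔ FL b N G 0 ∧
    (∀ X ∈ C, X ∈ FL b N G 0 → X = 0) ∧
    Module.finrank ℂ C = Module.finrank ℂ (lie b N) - Module.finrank ℂ (FL b N G 0) := by
  obtain ⟨C', hC'⟩ := Submodule.exists_isCompl (FL b N G 0)
  have hsup : FL b N G 0 ⊔ C' ⊓ lie b N = lie b N := by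
    rw [← sup_inf_assoc_of_le C' (FL_le_lie G 0), hC'.sup_eq_top, top_inf_eq]
  have hinf : FL b N G 0 ⊓ (C' ⊓ lie b N) = ⊥ := by
    rw [← inf_assoc, hC'.inf_eq_bot, bot_inf_eq]
  refine ⟨C' ⊓ lie b N, inf_le_right, (hsup.symm.trans (sup_comm _ _)).le, fun X hX hX' => ?_, ?_⟩
  · have : X ∈ FL b N G 0 ⊓ (C' ⊓ lie b N) := ⟨hX', hX⟩
    rwa [hinf, Submodule.mem_bot] at this
  · have := Submodule.finrank_sup_add_finrank_inf_eq (FL b N G 0) (C' ⊓ lie b N)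
    rw [hsup, hinf, finrank_bot] at this
    omega

/-- The part of negative first degree in the Lie algebra. -/
def neg (S : Sys E) (b : Module.Basis (Fin n) ℂ E)
    (N : Subgroup (LinearMap.GeneralLinearGroup ℂ E)) (F : ℤ → Submodule ℂ E) :
    Submodule ℂ (Module.End ℂ E) :=
  ⨆ r : ℤ, ⨆ _ : r < 0, ⨆ s : ℤ, lie b N ⊓ S.adj F (r, s)

theorem neg_le_lie (F : ℤ → Submodule ℂ E) : S.neg b N F ≤ lie b N :=
  iSup_le fun _ => iSup_le fun _ => iSup_le fun _ => inf_le_left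

theorem Base.lie_le_neg_sup {F : ℤ → Submodule ℂ E} (h : S.Base b N F) :
    lie b N ≤ S.neg b N F ⊔ FL b N F 0 := by
  refine h.lie_le.trans (iSup_le fun m => iSup_le fun _ => ?_)
  rcases lt_or_ge m.1 0 with hm | hm
  · exact le_sup_of_le_left (le_iSup_of_le m.1 (le_iSup_of_le hm (le_iSup_of_le m.2 le_rfl)))
  · exact le_sup_of_le_right (h.adj_le_FL hm)

theorem neg_apply_mem {F : ℤ → Submodule ℂ E} {X : Module.End ℂ E} (hX : X ∈ S.neg b N F)
    (i : ℤ × ℤ) {v : E} (hv : v ∈ S.I F i) : X v ∈ ⨆ j : ℤ × ℤ, ⨆ _ : ¬ i.1 ≤ j.1, S.I F j := by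
  let T : Submodule ℂ (Module.End ℂ E) :=
    (⨆ j : ℤ × ℤ, ⨆ _ : ¬ i.1 ≤ j.1, S.I F j).comap (LinearMap.applyₗ v)
  have hT : S.neg b N F ≤ T := by
    refine iSup_le fun r => iSup_le fun hr => iSup_le fun s => ?_
    rintro A ⟨-, hA⟩
    exact Submodule.mem_iSup_of_mem (i + (r, s)) (Submodule.mem_iSup_of_mem
      (by simpa using hr) (hA i v hv))
  exact hT hX

/-- Elements of the negative part strictly lower the first degree, whereas preserving the filtration
forbids lowering it. -/
theorem Pt.eq_zero_of_mem_neg {F : ℤ → Submodule ℂ E} (h : S.Pt F) {X : Module.End ℂ E}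
    (hX : X ∈ S.neg b N F) (hF : ∀ p, ∀ v ∈ F p, X v ∈ F p) : X = 0 := by
  refine h.eq_of_forall_I fun i v hv => ?_
  refine h.eq_zero_of_mem_of_mem (fun j => i.1 ≤ j.1) ?_ (neg_apply_mem hX i hv)
  have := hF i.1 v (I_le_F i hv)
  rwa [h.F_eq] at this

variable [Fintype ι] {M D : Set (GrProd E k)} {x₀ : GrProd E k}

theorem IsOrbit.exists_submanifold (h : S.IsOrbit b N idx M D x₀) :
    ∃ (d : ℕ) (_ : ChartedSpace (EuclideanSpace ℂ (Fin d)) D),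
      IsManifold 𝓘(ℂ, EuclideanSpace ℂ (Fin d)) ω D ∧
      Manifold.IsSmoothEmbedding 𝓘(ℂ, EuclideanSpace ℂ (Fin d)) 𝓘(ℂ, GrModel E k) ω
        (Subtype.val : D → GrProd E k) := by
  set d := Module.finrank ℂ (lie b N) - Module.finrank ℂ (FL b N (filt idx x₀) 0) with hd
  have hparam : ∀ y : D, ∃ ψ : EuclideanSpace ℂ (Fin d) → GrProd E k, ψ 0 = y ∧
      IsParam (H := GrModel E k) D ψ := by
    rintro ⟨y, hy⟩
    obtain ⟨C, hC, hC', hC0, hCd⟩ := exists_compl_FL (b := b) (N := N) (filt idx y)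
    have hFL : Module.finrank ℂ (FL b N (filt idx y) 0) =
        -- The adjoint action of the element moving `x₀` to `y` identifies the stabilizers, so the
        -- local dimension is the same at every point of the orbit.
        Module.finrank ℂ (FL b N (filt idx x₀) 0) := by
      have hy' := hy
      rw [h.eq] at hy'
      obtain ⟨a, ha, rfl⟩ := hy'
      rw [filt_smul]
      exact (finrank_FL h.base.grp.alg (H1_le _ ha) 0).symm
    obtain ⟨J, hJ, hJC⟩ := exists_range_eq C (hCd.trans (by rw [hFL]))
    exact ⟨orbitParam y J, orbitParam_zero y J, h.isParam hy hC hC' hC0 hJ hJC⟩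
  have hle : d ≤ Module.finrank ℂ (GrModel E k) := by
    obtain ⟨ψ, -, hψ⟩ := hparam ⟨x₀, h.self_mem⟩
    let Ψ : EuclideanSpace ℂ (Fin d) →L[ℂ] GrModel E k :=
      mfderiv 𝓘(ℂ, EuclideanSpace ℂ (Fin d)) 𝓘(ℂ, GrModel E k) ψ 0
    have := LinearMap.finrank_le_finrank_of_injective (f := Ψ.toLinearMap) hψ.inj
    rwa [finrank_euclideanSpace_fin] at this
  let L₀ : (EuclideanSpace ℂ (Fin d) ×
      EuclideanSpace ℂ (Fin (Module.finrank ℂ (GrModel E k) - d))) ≃L[ℂ] GrModel E k :=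
    ContinuousLinearEquiv.ofFinrankEq (by
      rw [Module.finrank_prod, finrank_euclideanSpace_fin, finrank_euclideanSpace_fin]
      omega)
  obtain ⟨c, hc⟩ := MHS.exists_submanifold L₀ hparam
  exact ⟨d, c, hc⟩

theorem IsOrbit.injOn_infAct (h : S.IsOrbit b N idx M D x₀) :
    Set.InjOn (infAct x₀) (S.neg b N (filt idx x₀)) := by
  intro A hA B hB hAB
  have h1 : (infAct x₀ (A - B) : GrModel E k) = 0 := by
    let L : Module.End ℂ E →L[ℂ] GrModel E k :=
      mfderiv 𝓘(ℂ, Module.End ℂ E) 𝓘(ℂ, GrModel E k) (orbitMap x₀) 1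
    have h2 : L A = L B := (infAct_eq x₀ A).symm.trans (hAB.trans (infAct_eq x₀ B))
    refine (infAct_eq x₀ (A - B)).trans ?_
    change L (A - B) = 0
    rw [map_sub, h2, sub_self]
  refine sub_eq_zero.1 (h.base.pt.eq_zero_of_mem_neg (sub_mem hA hB) fun p v hv => ?_)
  have h3 : filt idx x₀ p ≤ (filt idx x₀ p).comap (A - B) := by
    refine iSup_le fun j => iSup_le fun hj => fun w hw => ?_
    exact Submodule.mem_iSup_of_mem j (Submodule.mem_iSup_of_mem hj
      (apply_mem_of_infAct_eq_zero x₀ h1 j hw))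
  exact h3 hv

/-- At the base point the negative part is itself a complement of the stabilizer in `Lie N`, so it
may serve as the parameter space; the derivative of its parametrization is the infinitesimal action.
-/
theorem IsOrbit.range_mfderiv_val (h : S.IsOrbit b N idx M D x₀) {Ed : Type}
    [NormedAddCommGroup Ed] [NormedSpace ℂ Ed] [FiniteDimensional ℂ Ed] [ChartedSpace Ed D]
    [IsManifold 𝓘(ℂ, Ed) ω D] (hval : Manifold.IsImmersion 𝓘(ℂ, Ed) 𝓘(ℂ, GrModel E k) ω
      (Subtype.val : D → GrProd E k)) {x : D} (hx : (x : GrProd E k) = x₀) :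
    Set.range (mfderiv 𝓘(ℂ, Ed) 𝓘(ℂ, GrModel E k) (Subtype.val : D → GrProd E k) x :
      Ed → GrModel E k) =
      (infAct x₀ : Module.End ℂ E → GrModel E k) '' (S.neg b N (filt idx x₀)) := by
  obtain ⟨J, hJ, hJC⟩ := exists_range_eq (S.neg b N (filt idx x₀)) rfl
  have hψ : IsParam (H := GrModel E k) D (orbitParam x₀ J) :=
    h.isParam h.self_mem (neg_le_lie _) h.base.lie_le_neg_sup
      (fun X hX hX' => h.base.pt.eq_zero_of_mem_neg hX fun p v hv => by simpa using hX'.2 p v hv)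
      hJ hJC
  rw [MHS.range_mfderiv_val hval hψ ((orbitParam_zero _ _).trans hx.symm)]
  ext t
  constructor
  · rintro ⟨v, rfl⟩
    exact ⟨J v, hJC.le ⟨v, rfl⟩, (mfderiv_orbitParam x₀ J v).symm⟩
  · rintro ⟨X, hX, rfl⟩
    obtain ⟨v, rfl⟩ := hJC.ge hX
    exact ⟨v, mfderiv_orbitParam x₀ J v⟩

end Sys

end OrbitManifold

/-! ### Polynomial conditions with rational coefficients -/

section Rational

variable {V : Type*} [AddCommGroup V] [Module ℚ V]

theorem exists_mem_baseChange_iff (T : Submodule ℚ V) :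
    ∃ ρ : V →ₗ[ℚ] V, ∀ y : ℂ ⊗[ℚ] V, y ∈ T.baseChange ℂ ↔ ρ.baseChange ℂ y = 0 := by
  obtain ⟨π, hπ⟩ := T.subtype.exists_leftInverse_of_injective
    (LinearMap.ker_eq_bot.2 T.subtype_injective)
  have hπT : ∀ u ∈ T, ((π u : T) : V) = u := fun u hu =>
    congrArg Subtype.val (LinearMap.congr_fun hπ ⟨u, hu⟩)
  refine ⟨LinearMap.id - T.subtype ∘ₗ π, fun y => ⟨fun hy => ?_, fun hy => ?_⟩⟩
  · have : T.baseChange ℂ ≤ LinearMap.ker ((LinearMap.id - T.subtype ∘ₗ π).baseChange ℂ) := by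
      refine baseChange_le fun u hu => ?_
      rw [LinearMap.mem_ker, LinearMap.baseChange_tmul]
      simp [hπT u hu]
    exact this hy
  · rw [LinearMap.baseChange_sub, LinearMap.sub_apply, sub_eq_zero, LinearMap.baseChange_id,
      LinearMap.id_apply] at hy
    rw [hy]
    clear hy
    induction y with
    | zero => simp
    | tmul a v => exact Submodule.tmul_mem_baseChange_of_mem a (π v).2
    | add x y hx hy => rw [map_add]; exact add_mem hx hy

variable [FiniteDimensional ℚ V]

/-- A polynomial function with rational coefficients on endomorphisms of `V_ℂ`. -/
def IsRatFun (P : Module.End ℂ (ℂ ⊗[ℚ] V) → ℂ) : Prop :=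
  ∃ f : MvPolynomial (Fin (Module.finrank ℚ V) × Fin (Module.finrank ℚ V)) ℚ,
    ∀ A, P A = MvPolynomial.aeval (entries A) f

theorem IsRatFun.const (q : ℚ) : IsRatFun (V := V) fun _ => (q : ℂ) :=
  ⟨MvPolynomial.C q, fun A => by simp⟩

theorem IsRatFun.add {P P' : Module.End ℂ (ℂ ⊗[ℚ] V) → ℂ} (h : IsRatFun P) (h' : IsRatFun P') :
    IsRatFun fun A => P A + P' A := by
  obtain ⟨f, hf⟩ := h
  obtain ⟨f', hf'⟩ := h'
  exact ⟨f + f', fun A => by simp only [hf, hf', map_add]⟩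

theorem IsRatFun.mul {P P' : Module.End ℂ (ℂ ⊗[ℚ] V) → ℂ} (h : IsRatFun P) (h' : IsRatFun P') :
    IsRatFun fun A => P A * P' A := by
  obtain ⟨f, hf⟩ := h
  obtain ⟨f', hf'⟩ := h'
  exact ⟨f * f', fun A => by simp only [hf, hf', map_mul]⟩

theorem IsRatFun.sub {P P' : Module.End ℂ (ℂ ⊗[ℚ] V) → ℂ} (h : IsRatFun P) (h' : IsRatFun P') :
    IsRatFun fun A => P A - P' A := by
  obtain ⟨f, hf⟩ := h
  obtain ⟨f', hf'⟩ := h'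
  exact ⟨f - f', fun A => by simp only [hf, hf', map_sub]⟩

theorem IsRatFun.sum {κ : Type*} (s : Finset κ) {P : κ → Module.End ℂ (ℂ ⊗[ℚ] V) → ℂ}
    (h : ∀ i, IsRatFun (P i)) : IsRatFun fun A => ∑ i ∈ s, P i A := by
  choose f hf using h
  exact ⟨∑ i ∈ s, f i, fun A => by rw [map_sum]; exact Finset.sum_congr rfl fun i _ => hf i A⟩

/-- A function to `U_ℂ` whose coordinates are polynomials with rational coefficients. -/
def IsRatVec {U : Type*} [AddCommGroup U] [Module ℚ U]
    (Φ : Module.End ℂ (ℂ ⊗[ℚ] V) → ℂ ⊗[ℚ] U) : Prop :=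
  ∃ (m : ℕ) (P : Fin m → Module.End ℂ (ℂ ⊗[ℚ] V) → ℂ) (u : Fin m → U),
    (∀ i, IsRatFun (P i)) ∧ ∀ A, Φ A = ∑ i, P i A ⊗ₜ[ℚ] u i

variable {U : Type*} [AddCommGroup U] [Module ℚ U] {U' : Type*} [AddCommGroup U'] [Module ℚ U']

theorem IsRatVec.map {Φ : Module.End ℂ (ℂ ⊗[ℚ] V) → ℂ ⊗[ℚ] U} (h : IsRatVec Φ)
    (f : U →ₗ[ℚ] U') : IsRatVec fun A => f.baseChange ℂ (Φ A) := by
  obtain ⟨m, P, u, hP, h⟩ := h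
  exact ⟨m, P, f ∘ u, hP, fun A => by simp [h]⟩

theorem isRatVec_const (u : U) : IsRatVec (V := V) fun _ => (1 : ℂ) ⊗ₜ[ℚ] u :=
  ⟨1, fun _ _ => ((1 : ℚ) : ℂ), fun _ => u, fun _ => IsRatFun.const 1, fun A => by simp⟩

theorem IsRatVec.sub {Φ Ψ : Module.End ℂ (ℂ ⊗[ℚ] V) → ℂ ⊗[ℚ] U} (h : IsRatVec Φ)
    (h' : IsRatVec Ψ) : IsRatVec fun A => Φ A - Ψ A := by
  obtain ⟨m, P, u, hP, h⟩ := h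
  obtain ⟨m', P', u', hP', h'⟩ := h'
  refine ⟨m + m', Fin.append P fun i A => ((-1 : ℚ) : ℂ) * P' i A, Fin.append u u', fun i => ?_,
    fun A => ?_⟩
  · refine Fin.addCases (fun i => ?_) (fun i => ?_) i
    · rw [Fin.append_left]; exact hP i
    · rw [Fin.append_right]; exact (IsRatFun.const (-1)).mul (hP' i)
  · simp only [Fin.sum_univ_add, h, h', sub_eq_add_neg, ← Finset.sum_neg_distrib]
    simp [TensorProduct.neg_tmul]

theorem IsRatVec.bilin {Φ : Module.End ℂ (ℂ ⊗[ℚ] V) → ℂ ⊗[ℚ] U}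
    {Ψ : Module.End ℂ (ℂ ⊗[ℚ] V) → ℂ ⊗[ℚ] U} (h : IsRatVec Φ) (h' : IsRatVec Ψ)
    (Q : LinearMap.BilinForm ℚ U) : IsRatFun fun A => Q.baseChange ℂ (Φ A) (Ψ A) := by
  obtain ⟨m, P, u, hP, h⟩ := h
  obtain ⟨m', P', u', hP', h'⟩ := h'
  have : (fun A => Q.baseChange ℂ (Φ A) (Ψ A)) =
      fun A => ∑ i, ∑ j, P i A * P' j A * ((Q (u i) (u' j) : ℚ) : ℂ) := by
    funext A
    rw [h, h']
    simp only [map_sum, LinearMap.sum_apply, LinearMap.BilinForm.baseChange_tmul]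
    rw [Finset.sum_comm]
    refine Finset.sum_congr rfl fun i _ => Finset.sum_congr rfl fun j _ => ?_
    simp [Rat.smul_def, mul_comm]
  rw [this]
  exact IsRatFun.sum _ fun i => IsRatFun.sum _ fun j =>
    ((hP i).mul (hP' j)).mul (IsRatFun.const _)

theorem IsRatVec.repr {Φ : Module.End ℂ (ℂ ⊗[ℚ] V) → ℂ ⊗[ℚ] U} (h : IsRatVec Φ) {κ : Type*}
    (b : Module.Basis κ ℚ U) (i : κ) : IsRatFun fun A => (b.baseChange ℂ).repr (Φ A) i := by
  obtain ⟨m, P, u, hP, h⟩ := h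
  have : (fun A => (b.baseChange ℂ).repr (Φ A) i) =
      fun A => ∑ j, P j A * ((b.repr (u j) i : ℚ) : ℂ) := by
    funext A
    rw [h, map_sum, Finsupp.finsetSum_apply]
    refine Finset.sum_congr rfl fun j _ => ?_
    rw [Module.Basis.baseChange_repr_tmul]
    simp [Rat.smul_def, mul_comm]
  rw [this]
  exact IsRatFun.sum _ fun j => (hP j).mul (IsRatFun.const _)

theorem isRatVec_apply (u : V) : IsRatVec fun A : Module.End ℂ (ℂ ⊗[ℚ] V) => A (1 ⊗ₜ u) := by
  let b := Module.finBasis ℚ V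
  refine ⟨Module.finrank ℚ V, fun i A => ∑ j, entries A (i, j) * ((b.repr u j : ℚ) : ℂ), b,
    fun i => ?_, fun A => ?_⟩
  · exact IsRatFun.sum Finset.univ fun j => IsRatFun.mul (P := fun A => entries A (i, j))
      ⟨MvPolynomial.X (i, j), fun A => by simp⟩ (IsRatFun.const _)
  · have hsum := (b.baseChange ℂ).sum_repr (A ((1 : ℂ) ⊗ₜ[ℚ] u))
    refine hsum.symm.trans (Finset.sum_congr rfl fun i _ => ?_)
    rw [Module.Basis.baseChange_apply, TensorProduct.smul_tmul', smul_eq_mul, mul_one]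
    congr 1
    have h := congrFun (LinearMap.toMatrix_mulVec_repr (b.baseChange ℂ) (b.baseChange ℂ) A
      (1 ⊗ₜ u)) i
    rw [← h, Matrix.mulVec, dotProduct]
    refine Finset.sum_congr rfl fun j _ => ?_
    rw [Module.Basis.baseChange_repr_tmul]
    simp [entries, b, Rat.smul_def]

theorem IsQAlgebraic.of_isRatFun {G N : Subgroup (LinearMap.GeneralLinearGroup ℂ (ℂ ⊗[ℚ] V))}
    (hN : IsQAlgebraic N) {κ : Type*} {P : κ → Module.End ℂ (ℂ ⊗[ℚ] V) → ℂ}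
    (hP : ∀ i, IsRatFun (P i)) (h : ∀ g, g ∈ G ↔ g ∈ N ∧ ∀ i, P i g = 0) : IsQAlgebraic G := by
  choose f hf using hP
  obtain ⟨S, hS⟩ := hN
  refine ⟨S ∪ Set.range f, fun g => ?_⟩
  rw [h, hS]
  constructor
  · rintro ⟨h1, h2⟩ _ (hf' | ⟨i, rfl⟩)
    · exact h1 _ hf'
    · rw [← hf]; exact h2 i
  · intro h1
    exact ⟨fun f' hf' => h1 f' (Or.inl hf'), fun i => by rw [hf]; exact h1 _ (Or.inr ⟨i, rfl⟩)⟩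

theorem isQAlgebraic_top :
    IsQAlgebraic (⊤ : Subgroup (LinearMap.GeneralLinearGroup ℂ (ℂ ⊗[ℚ] V))) :=
  ⟨∅, fun g => by simp⟩

/-- The condition that a rational vector function takes values in a rational subspace. -/
theorem IsRatVec.exists_mem_iff {Φ : Module.End ℂ (ℂ ⊗[ℚ] V) → ℂ ⊗[ℚ] V} (h : IsRatVec Φ)
    (T : Submodule ℚ V) : ∃ P : Fin (Module.finrank ℚ V) → Module.End ℂ (ℂ ⊗[ℚ] V) → ℂ,
      (∀ i, IsRatFun (P i)) ∧ ∀ A, Φ A ∈ T.baseChange ℂ ↔ ∀ i, P i A = 0 := by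
  obtain ⟨ρ, hρ⟩ := exists_mem_baseChange_iff T
  refine ⟨_, (h.map ρ).repr (Module.finBasis ℚ V), fun A => ?_⟩
  rw [hρ]
  constructor
  · intro h i; rw [h]; simp
  · intro h
    exact ((Module.finBasis ℚ V).baseChange ℂ).repr.map_eq_zero_iff.1 (Finsupp.ext h)

end Rational

/-! ### The Mumford--Tate group inside the group of similitudes -/

section Similitudes

variable {V : Type*} [AddCommGroup V] [Module ℚ V]

theorem bilin_eq_of_rational {T : Submodule ℚ V} {B B' : LinearMap.BilinForm ℂ (ℂ ⊗[ℚ] V)}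
    (h : ∀ u ∈ T, ∀ v ∈ T, B (1 ⊗ₜ u) (1 ⊗ₜ v) = B' (1 ⊗ₜ u) (1 ⊗ₜ v)) {x y : ℂ ⊗[ℚ] V}
    (hx : x ∈ T.baseChange ℂ) (hy : y ∈ T.baseChange ℂ) : B x y = B' x y := by
  have h1 : ∀ u ∈ T, B (1 ⊗ₜ u) y = B' (1 ⊗ₜ u) y := fun u hu => by
    have : T.baseChange ℂ ≤ LinearMap.eqLocus (B (1 ⊗ₜ u)) (B' (1 ⊗ₜ u)) :=
      baseChange_le fun v hv => h u hu v hv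
    exact this hy
  have : T.baseChange ℂ ≤ LinearMap.eqLocus (B.flip y) (B'.flip y) :=
    baseChange_le fun u hu => h1 u hu
  exact this hx

/-- Proportionality to `B` is expressed by the vanishing of two-by-two minors on rational vectors,
which are polynomial conditions without an unknown scalar. The minors carry no information when `B`
vanishes on `T`, and `h0` takes care of that case. -/
theorem exists_scale_of_rational {T : Submodule ℚ V} {B B' : LinearMap.BilinForm ℂ (ℂ ⊗[ℚ] V)}
    (h : ∀ u ∈ T, ∀ v ∈ T, ∀ u' ∈ T, ∀ v' ∈ T,
      B' (1 ⊗ₜ u) (1 ⊗ₜ v) * B (1 ⊗ₜ u') (1 ⊗ₜ v') = B' (1 ⊗ₜ u') (1 ⊗ₜ v') * B (1 ⊗ₜ u) (1 ⊗ₜ v))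
    (h0 : (∀ x ∈ T.baseChange ℂ, ∀ y ∈ T.baseChange ℂ, B x y = 0) →
      ∀ x ∈ T.baseChange ℂ, ∀ y ∈ T.baseChange ℂ, B' x y = 0) :
    ∃ c : ℂ, ∀ x ∈ T.baseChange ℂ, ∀ y ∈ T.baseChange ℂ, B' x y = c * B x y := by
  by_cases hz : ∃ u ∈ T, ∃ v ∈ T, B (1 ⊗ₜ u) (1 ⊗ₜ v) ≠ 0
  · obtain ⟨u₀, hu₀, v₀, hv₀, hne⟩ := hz
    obtain ⟨c, hc⟩ : ∃ c, B' (1 ⊗ₜ u₀) (1 ⊗ₜ v₀) = c * B (1 ⊗ₜ u₀) (1 ⊗ₜ v₀) :=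
      ⟨_, (div_mul_cancel₀ _ hne).symm⟩
    refine ⟨c, fun x hx y hy => bilin_eq_of_rational (B' := c • B) (fun u hu v hv => ?_) hx hy⟩
    have h1 := h u hu v hv u₀ hu₀ v₀ hv₀
    rw [hc] at h1
    rw [LinearMap.smul_apply, LinearMap.smul_apply, smul_eq_mul]
    exact mul_right_cancel₀ hne (by rw [h1]; ring)
  · push Not at hz
    have h1 : ∀ x ∈ T.baseChange ℂ, ∀ y ∈ T.baseChange ℂ, B x y = 0 := fun x hx y hy =>
      bilin_eq_of_rational (B' := 0) (fun u hu v hv => hz u hu v hv) hx hy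
    exact ⟨0, fun x hx y hy => by rw [h0 h1 x hx y hy, zero_mul]⟩

theorem isNilpotent_of_lowers {E : Type*} [AddCommGroup E] [Module ℂ E]
    {W : ℤ → Submodule ℂ E} (hW : Monotone W) (hb : ∃ a, W a = ⊥) (ht : ∃ a, W a = ⊤)
    {A : Module.End ℂ E} (hA : ∀ k, ∀ v ∈ W k, A v ∈ W (k - 1)) : IsNilpotent A := by
  obtain ⟨a, ha⟩ := hb
  obtain ⟨t, ht⟩ := ht
  have hpow : ∀ (m : ℕ) (k : ℤ), ∀ v ∈ W k, (A ^ m) v ∈ W (k - m) := by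
    intro m
    induction m with
    | zero => intro k v hv; simpa using hv
    | succ m ih =>
      intro k v hv
      rw [pow_succ', Module.End.mul_apply]
      have := hA _ _ (ih k v hv)
      rwa [sub_sub, ← Nat.cast_succ] at this
  refine ⟨(t - a).toNat, LinearMap.ext fun v => ?_⟩
  have h1 := hpow (t - a).toNat t v (ht ▸ Submodule.mem_top)
  have h2 := hW (show t - ((t - a).toNat : ℤ) ≤ a by omega) h1
  rwa [ha, Submodule.mem_bot] at h2

variable [FiniteDimensional ℚ V] (δ : Datum V)

theorem apply_mem_of_le {E : Type*} [AddCommGroup E] [Module ℂ E] [FiniteDimensional ℂ E]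
    {g : LinearMap.GeneralLinearGroup ℂ E} {T : Submodule ℂ E}
    (h : ∀ v ∈ T, (g : Module.End ℂ E) v ∈ T) {v : E} (hv : v ∈ T) :
    ((g⁻¹ : LinearMap.GeneralLinearGroup ℂ E) : Module.End ℂ E) v ∈ T := by
  have h1 : T.map (g : Module.End ℂ E) = T := by
    refine Submodule.eq_of_le_of_finrank_eq (Submodule.map_le_iff_le_comap.2 h) ?_
    exact LinearEquiv.finrank_map_eq (LinearMap.GeneralLinearGroup.toLinearEquiv g) T
  rw [← h1] at hv
  obtain ⟨w, hw, rfl⟩ := hv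
  have : ((g⁻¹ : LinearMap.GeneralLinearGroup ℂ E) : Module.End ℂ E) ((g : Module.End ℂ E) w) = w := by
    rw [← Module.End.mul_apply, Units.inv_mul, Module.End.one_apply]
  rwa [this]

/-- The group of automorphisms that preserve the weight filtration and preserve the forms on the
graded pieces up to scalars. -/
def Datum.simil : Subgroup (LinearMap.GeneralLinearGroup ℂ (ℂ ⊗[ℚ] V)) where
  carrier := {g | (∀ k, ∀ v ∈ Wc δ.W k, (g : Module.End ℂ (ℂ ⊗[ℚ] V)) v ∈ Wc δ.W k) ∧
    ∀ k, ∃ c : ℂ, ∀ u ∈ Wc δ.W k, ∀ v ∈ Wc δ.W k,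
      δ.β k ((g : Module.End ℂ (ℂ ⊗[ℚ] V)) u) ((g : Module.End ℂ (ℂ ⊗[ℚ] V)) v) = c * δ.β k u v}
  one_mem' := ⟨fun _ _ hv => hv, fun _ => ⟨1, fun _ _ _ _ => (one_mul _).symm⟩⟩
  mul_mem' := by
    rintro g h ⟨hg, hg'⟩ ⟨hh, hh'⟩
    refine ⟨fun k v hv => hg k _ (hh k v hv), fun k => ?_⟩
    obtain ⟨c, hc⟩ := hg' k
    obtain ⟨d, hd⟩ := hh' k
    refine ⟨c * d, fun u hu v hv => ?_⟩
    rw [Units.val_mul, Module.End.mul_apply, Module.End.mul_apply,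
      hc _ (hh k u hu) _ (hh k v hv), hd u hu v hv, mul_assoc]
  inv_mem' := by
    rintro g ⟨hg, hg'⟩
    have hi : ∀ k, ∀ v ∈ Wc δ.W k,
        ((g⁻¹ : LinearMap.GeneralLinearGroup ℂ (ℂ ⊗[ℚ] V)) : Module.End ℂ (ℂ ⊗[ℚ] V)) v ∈
          Wc δ.W k := fun k v hv => apply_mem_of_le (hg k) hv
    refine ⟨hi, fun k => ?_⟩
    obtain ⟨c, hc⟩ := hg' k
    have hgi : ∀ v, (g : Module.End ℂ (ℂ ⊗[ℚ] V))
        (((g⁻¹ : LinearMap.GeneralLinearGroup ℂ (ℂ ⊗[ℚ] V)) : Module.End ℂ (ℂ ⊗[ℚ] V)) v) = v :=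
      fun v => by rw [← Module.End.mul_apply, Units.mul_inv, Module.End.one_apply]
    have h1 : ∀ u ∈ Wc δ.W k, ∀ v ∈ Wc δ.W k, δ.β k u v = c * δ.β k
        (((g⁻¹ : LinearMap.GeneralLinearGroup ℂ (ℂ ⊗[ℚ] V)) : Module.End ℂ (ℂ ⊗[ℚ] V)) u)
        (((g⁻¹ : LinearMap.GeneralLinearGroup ℂ (ℂ ⊗[ℚ] V)) : Module.End ℂ (ℂ ⊗[ℚ] V)) v) :=
      fun u hu v hv => by rw [← hc _ (hi k u hu) _ (hi k v hv), hgi, hgi]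
    refine ⟨c⁻¹, fun u hu v hv => ?_⟩
    rcases eq_or_ne c 0 with h0 | h0
    · rw [h1 _ (hi k u hu) _ (hi k v hv), h0]; simp
    · rw [h1 u hu v hv, inv_mul_cancel_left₀ h0]

variable {δ}

theorem isRatFun_β {Φ Ψ : Module.End ℂ (ℂ ⊗[ℚ] V) → ℂ ⊗[ℚ] V} (h : IsRatVec Φ) (h' : IsRatVec Ψ)
    (k : ℤ) : IsRatFun fun A => δ.β k (Φ A) (Ψ A) :=
  (h.map (grProj δ.W k)).bilin (h'.map (grProj δ.W k)) (δ.Q k)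

-- The equations over the rationals are the preservation of each `W k`, tested on rational vectors,
-- and the minors expressing that the transformed form is proportional to `β k`.
variable (δ) in
theorem isQAlgebraic_simil : IsQAlgebraic δ.simil := by
  have hmem : ∀ i : Σ k : ℤ, δ.W k, ∃ P : Fin (Module.finrank ℚ V) →
      Module.End ℂ (ℂ ⊗[ℚ] V) → ℂ, (∀ j, IsRatFun (P j)) ∧
      ∀ A, A (1 ⊗ₜ (i.2 : V)) ∈ Wc δ.W i.1 ↔ ∀ j, P j A = 0 := fun i =>
    (isRatVec_apply (i.2 : V)).exists_mem_iff (δ.W i.1)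
  choose P hP hP' using hmem
  let R : (Σ k : ℤ, (δ.W k × δ.W k) × (δ.W k × δ.W k)) → Module.End ℂ (ℂ ⊗[ℚ] V) → ℂ :=
    fun i A => δ.β i.1 (A (1 ⊗ₜ (i.2.1.1 : V))) (A (1 ⊗ₜ (i.2.1.2 : V))) *
      δ.β i.1 (1 ⊗ₜ (i.2.2.1 : V)) (1 ⊗ₜ (i.2.2.2 : V)) -
      δ.β i.1 (A (1 ⊗ₜ (i.2.2.1 : V))) (A (1 ⊗ₜ (i.2.2.2 : V))) *
      δ.β i.1 (1 ⊗ₜ (i.2.1.1 : V)) (1 ⊗ₜ (i.2.1.2 : V))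
  have hR : ∀ i, IsRatFun (R i) := fun i =>
    ((isRatFun_β (isRatVec_apply _) (isRatVec_apply _) i.1).mul
      (isRatFun_β (isRatVec_const _) (isRatVec_const _) i.1)).sub
    ((isRatFun_β (isRatVec_apply _) (isRatVec_apply _) i.1).mul
      (isRatFun_β (isRatVec_const _) (isRatVec_const _) i.1))
  refine isQAlgebraic_top.of_isRatFun
    (P := Sum.elim (fun i : (Σ k : ℤ, δ.W k) × Fin (Module.finrank ℚ V) => P i.1 i.2) R)
    (Sum.rec (fun i => hP i.1 i.2) hR) fun g => ?_
  have hrat : ∀ {k} {u : V}, u ∈ δ.W k → (1 : ℂ) ⊗ₜ[ℚ] u ∈ Wc δ.W k := fun hu =>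
    Submodule.tmul_mem_baseChange_of_mem _ hu
  constructor
  · rintro ⟨h1, h2⟩
    refine ⟨Subgroup.mem_top _, ?_⟩
    rintro (⟨i, j⟩ | ⟨k, ⟨u, v⟩, ⟨u', v'⟩⟩)
    · exact (hP' i g).1 (h1 _ _ (hrat i.2.2)) j
    · obtain ⟨c, hc⟩ := h2 k
      simp only [Sum.elim_inr, R]
      rw [hc _ (hrat u.2) _ (hrat v.2), hc _ (hrat u'.2) _ (hrat v'.2)]
      ring
  · rintro ⟨-, h⟩
    have hW : ∀ k, ∀ v ∈ Wc δ.W k, (g : Module.End ℂ (ℂ ⊗[ℚ] V)) v ∈ Wc δ.W k := by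
      intro k
      have : Wc δ.W k ≤ (Wc δ.W k).comap (g : Module.End ℂ (ℂ ⊗[ℚ] V)) :=
        baseChange_le fun u hu => (hP' ⟨k, u, hu⟩ g).2 fun j => h (Sum.inl (⟨k, u, hu⟩, j))
      exact this
    refine ⟨hW, fun k => ?_⟩
    refine exists_scale_of_rational (T := δ.W k) (B := δ.β k)
      (B' := (δ.β k).compl₁₂ (g : Module.End ℂ (ℂ ⊗[ℚ] V)) (g : Module.End ℂ (ℂ ⊗[ℚ] V)))
      (fun a ha b hb a' ha' b' hb' => ?_) fun h1 u hu v hv => h1 _ (hW k u hu) _ (hW k v hv)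
    exact sub_eq_zero.1 (h (Sum.inr ⟨k, (⟨a, ha⟩, ⟨b, hb⟩), (⟨a', ha'⟩, ⟨b', hb'⟩)⟩))

/-- Trivial action on the graded pieces is tested on rational vectors. It makes `N1` algebraic over
the rationals, as the definition of the unipotent radical requires of its constituents. -/
theorem isQAlgebraic_of_unipotent_on_graded
    {U N : Subgroup (LinearMap.GeneralLinearGroup ℂ (ℂ ⊗[ℚ] V))} (hN : IsQAlgebraic N)
    {W : ℤ → Submodule ℚ V} (hU : ∀ g, g ∈ U ↔ g ∈ N ∧ ∀ k, ∀ v ∈ Wc W k,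
      (g : Module.End ℂ (ℂ ⊗[ℚ] V)) v - v ∈ Wc W (k - 1)) : IsQAlgebraic U := by
  have hmem : ∀ i : Σ k : ℤ, W k, ∃ P : Fin (Module.finrank ℚ V) →
      Module.End ℂ (ℂ ⊗[ℚ] V) → ℂ, (∀ j, IsRatFun (P j)) ∧
      ∀ A, A (1 ⊗ₜ (i.2 : V)) - 1 ⊗ₜ (i.2 : V) ∈ Wc W (i.1 - 1) ↔ ∀ j, P j A = 0 := fun i =>
    ((isRatVec_apply (i.2 : V)).sub (isRatVec_const _)).exists_mem_iff (W (i.1 - 1))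
  choose P hP hP' using hmem
  refine hN.of_isRatFun
    (P := fun i : (Σ k : ℤ, W k) × Fin (Module.finrank ℚ V) => P i.1 i.2)
    (fun i => hP i.1 i.2) fun g => ?_
  rw [hU]
  refine and_congr_right fun _ => ⟨fun h => ?_, fun h k => ?_⟩
  · rintro ⟨⟨k, u⟩, j⟩
    exact (hP' ⟨k, u⟩ g).1 (h k _ (Submodule.tmul_mem_baseChange_of_mem _ u.2)) j
  · have : Wc W k ≤ (Wc W (k - 1)).comap ((g : Module.End ℂ (ℂ ⊗[ℚ] V)) - 1) :=
      baseChange_le fun u hu => (hP' ⟨k, u, hu⟩ g).2 fun j => h (⟨k, u, hu⟩, j)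
    exact this

/-- In weight `k` the summand `I^(p,q)` pairs nontrivially only with `I^(q,p)`, by the bilinear
relations. On such pairs `h(z, w)` multiplies the form by `z ^ (-p - q) * w ^ (-q - p) = (z * w) ^
(-k)`. -/
theorem deligneTorus_subset_simil {F : ℤ → Submodule ℂ (ℂ ⊗[ℚ] V)} (hF : IsMHS δ.W F)
    (hQ : IsPolarized δ.W δ.Q F) : deligneTorus δ.W F ⊆ δ.simil := by
  rintro t ⟨z, w, ht⟩
  have hopp := hF.opposed δ.W_mono δ.W_bot δ.W_top
  have hWeq : ∀ k, Wc δ.W k = ⨆ i : ℤ × ℤ, ⨆ _ : i.1 + i.2 ≤ k, deligneI δ.W F i.1 i.2 :=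
    fun k => hopp.W_eq k
  have hlow : ∀ {k p q : ℤ} {u : ℂ ⊗[ℚ] V}, p + q < k → u ∈ deligneI δ.W F p q →
      u ∈ Wc δ.W (k - 1) := fun hpq hu =>
    Wc_mono δ.W_mono (by omega) (deligneI_le_W _ _ _ _ hu)
  have hz1 : ∀ {k : ℤ} {u v : ℂ ⊗[ℚ] V}, u ∈ Wc δ.W (k - 1) → δ.β k u v = 0 := fun {k u v} hu => by
    rw [Datum.β_congr (u' := 0) (v' := v) (by simpa using hu) (by simp)]; simp
  have hz2 : ∀ {k : ℤ} {u v : ℂ ⊗[ℚ] V}, v ∈ Wc δ.W (k - 1) → δ.β k u v = 0 := fun {k u v} hv => by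
    rw [Datum.β_congr (u' := u) (v' := 0) (by simp) (by simpa using hv)]; simp
  refine ⟨fun k => ?_, fun k => ⟨((z : ℂ) * w) ^ (-k), ?_⟩⟩
  · have : Wc δ.W k ≤ (Wc δ.W k).comap (t : Module.End ℂ (ℂ ⊗[ℚ] V)) := by
      conv_lhs => rw [hWeq k]
      refine iSup_le fun i => iSup_le fun hi => fun v hv => ?_
      rw [Submodule.mem_comap, ht _ _ v hv]
      exact Submodule.smul_mem _ _ (Wc_mono δ.W_mono hi (deligneI_le_W _ _ _ _ hv))
    exact this
  · have key : ∀ i j : ℤ × ℤ, i.1 + i.2 ≤ k → j.1 + j.2 ≤ k → ∀ u ∈ deligneI δ.W F i.1 i.2,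
        ∀ v ∈ deligneI δ.W F j.1 j.2, δ.β k ((t : Module.End ℂ (ℂ ⊗[ℚ] V)) u)
          ((t : Module.End ℂ (ℂ ⊗[ℚ] V)) v) = ((z : ℂ) * w) ^ (-k) * δ.β k u v := by
      intro i j hi hj u hu v hv
      rw [ht _ _ u hu, ht _ _ v hv, map_smul, map_smul, LinearMap.smul_apply, smul_eq_mul,
        smul_eq_mul]
      rcases hi.lt_or_eq with hi' | hi'
      · rw [hz1 (hlow hi' hu)]; simp
      rcases hj.lt_or_eq with hj' | hj'
      · rw [hz2 (hlow hj' hv)]; simp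
      rcases eq_or_ne j.1 i.2 with hij | hij
      · have h2 : j.2 = i.1 := by omega
        rw [hij, h2, ← hi', mul_zpow, neg_add, zpow_add₀ z.ne_zero, zpow_add₀ w.ne_zero]
        ring
      · rw [Datum.β_eq_zero_of_ne hF hQ hi' hj' hij hu hv]; simp
    intro u hu v hv
    let B : LinearMap.BilinForm ℂ (ℂ ⊗[ℚ] V) :=
      (δ.β k).compl₁₂ (t : Module.End ℂ (ℂ ⊗[ℚ] V)) (t : Module.End ℂ (ℂ ⊗[ℚ] V))
    let B' : LinearMap.BilinForm ℂ (ℂ ⊗[ℚ] V) := ((z : ℂ) * w) ^ (-k) • δ.β k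
    have h1 : ∀ i : ℤ × ℤ, i.1 + i.2 ≤ k → ∀ a ∈ deligneI δ.W F i.1 i.2, B a v = B' a v := by
      intro i hi a ha
      have : Wc δ.W k ≤ LinearMap.eqLocus (B a) (B' a) := by
        rw [hWeq k]
        exact iSup_le fun j => iSup_le fun hj => fun c hc => key i j hi hj a ha c hc
      exact this hv
    have : Wc δ.W k ≤ LinearMap.eqLocus (B.flip v) (B'.flip v) := by
      rw [hWeq k]
      exact iSup_le fun j => iSup_le fun hj => fun c hc => h1 j hj c hc
    exact this hu

theorem mumfordTate_le_simil {F : ℤ → Submodule ℂ (ℂ ⊗[ℚ] V)} (hF : IsMHS δ.W F)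
    (hQ : IsPolarized δ.W δ.Q F) : mumfordTate δ.W F ≤ δ.simil :=
  sInf_le ⟨isQAlgebraic_simil δ, deligneTorus_subset_simil hF hQ⟩

theorem deligneTorus_subset_mumfordTate (W : ℤ → Submodule ℚ V)
    (F : ℤ → Submodule ℂ (ℂ ⊗[ℚ] V)) : deligneTorus W F ⊆ mumfordTate W F := fun _ ht =>
  Subgroup.mem_sInf.2 fun _ hG => hG.2 ht

end Similitudes

/-! ### Hodge numbers determine the dimensions of `F^p ∩ W_k` -/

section HodgeNumbers

variable {V : Type*} [AddCommGroup V] [Module ℚ V] [FiniteDimensional ℚ V]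
  {W : ℤ → Submodule ℚ V} {F F' : ℤ → Submodule ℂ (ℂ ⊗[ℚ] V)}

theorem finrank_submoduleOf {E : Type*} [AddCommGroup E] [Module ℂ E] {S T : Submodule ℂ E}
    (h : S ≤ T) : Module.finrank ℂ (S.submoduleOf T) = Module.finrank ℂ S :=
  (Submodule.submoduleOfEquivOfLe h).finrank_eq

theorem grFil_anti (hF : Antitone F) (k : ℤ) : Antitone (grFil W F k) := fun _ _ h => by
  rw [grFil_eq, grFil_eq]
  exact Submodule.map_mono (inf_le_inf_right _ (hF h))

theorem finrank_grFil_succ (hF : Antitone F) (p q : ℤ) :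
    Module.finrank ℂ (grFil W F (p + q) p) =
      hodgeNumber W F p q + Module.finrank ℂ (grFil W F (p + q) (p + 1)) := by
  rw [← finrank_submoduleOf (grFil_anti hF (p + q) (by omega : p ≤ p + 1)), hodgeNumber,
    Submodule.finrank_quotient_add_finrank]

theorem finrank_grFil_eq (hF : IsMHS W F) (hF' : IsMHS W F')
    (h : ∀ p q, hodgeNumber W F p q = hodgeNumber W F' p q) (k p : ℤ) :
    Module.finrank ℂ (grFil W F k p) = Module.finrank ℂ (grFil W F' k p) := by
  obtain ⟨b, hb⟩ := hF.exists_bot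
  obtain ⟨b', hb'⟩ := hF'.exists_bot
  have key : ∀ m : ℕ, ∀ p, max b b' ≤ p + m →
      Module.finrank ℂ (grFil W F k p) = Module.finrank ℂ (grFil W F' k p) := by
    intro m
    induction m with
    | zero =>
      intro p hp
      have h1 : F p = ⊥ := le_bot_iff.1 (hb ▸ hF.anti (by simp at hp; exact hp.1))
      have h2 : F' p = ⊥ := le_bot_iff.1 (hb' ▸ hF'.anti (by simp at hp; exact hp.2))
      rw [grFil_eq, grFil_eq, h1, h2]
    | succ m ih =>
      intro p hp
      obtain ⟨q, rfl⟩ : ∃ q, k = p + q := ⟨k - p, by omega⟩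
      rw [finrank_grFil_succ hF.anti, finrank_grFil_succ hF'.anti, h,
        ih (p + 1) (by push_cast at hp; omega)]
  exact key (max b b' - p).toNat p (by omega)

theorem finrank_inf_Wc (hW : Monotone W) (k p : ℤ) :
    Module.finrank ℂ (F p ⊓ Wc W k : Submodule ℂ (ℂ ⊗[ℚ] V)) =
      Module.finrank ℂ (grFil W F k p) +
        Module.finrank ℂ (F p ⊓ Wc W (k - 1) : Submodule ℂ (ℂ ⊗[ℚ] V)) := by
  have h1 := LinearMap.finrank_range_add_finrank_ker ((gp W k).domRestrict (F p ⊓ Wc W k))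
  have h2 : LinearMap.ker ((gp W k).domRestrict (F p ⊓ Wc W k)) =
      (F p ⊓ Wc W (k - 1)).submoduleOf (F p ⊓ Wc W k) := by
    ext ⟨u, hu⟩
    rw [LinearMap.mem_ker, LinearMap.domRestrict_apply, gp_eq_zero_iff hW hu.2]
    exact ⟨fun h => ⟨hu.1, h⟩, fun h => h.2⟩
  rw [h2, finrank_submoduleOf (inf_le_inf_left _ (Wc_mono hW (by omega))),
    LinearMap.range_domRestrict, ← grFil_eq] at h1
  exact h1.symm

/-- The Hodge numbers give the dimensions of the filtration induced on each graded piece, by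
descending induction on `p`; summing over the weights up to `k` gives the intersections with `W k`.
-/
theorem finrank_inf_Wc_eq (hW : Monotone W) (hb : ∃ a, W a = ⊥) (hF : IsMHS W F)
    (hF' : IsMHS W F') (h : ∀ p q, hodgeNumber W F p q = hodgeNumber W F' p q) (k p : ℤ) :
    Module.finrank ℂ (F p ⊓ Wc W k : Submodule ℂ (ℂ ⊗[ℚ] V)) =
      Module.finrank ℂ (F' p ⊓ Wc W k : Submodule ℂ (ℂ ⊗[ℚ] V)) := by
  obtain ⟨a, ha⟩ := hb
  have key : ∀ m : ℕ, ∀ k, k ≤ a + m →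
      Module.finrank ℂ (F p ⊓ Wc W k : Submodule ℂ (ℂ ⊗[ℚ] V)) =
        Module.finrank ℂ (F' p ⊓ Wc W k : Submodule ℂ (ℂ ⊗[ℚ] V)) := by
    intro m
    induction m with
    | zero =>
      intro k hk
      have h1 : Wc W k = ⊥ := le_bot_iff.1
        ((Wc_mono hW (show k ≤ a by simpa using hk)).trans (by simp [Wc, ha]))
      rw [h1, inf_bot_eq, inf_bot_eq]
    | succ m ih =>
      intro k hk
      rw [finrank_inf_Wc hW, finrank_inf_Wc (F := F') hW, finrank_grFil_eq hF hF' h,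
        ih (k - 1) (by push_cast at hk; omega)]
  exact key (k - a).toNat k (by omega)

end HodgeNumbers

/-! ### Weak Mumford--Tate domains as orbits in the abstract setting -/

section Domains

open NormedSpace Filter Topology

variable {V : Type*} [AddCommGroup V] [Module ℚ V] [FiniteDimensional ℚ V]

variable (V) in
/-- The supremum norm with respect to a rational basis. -/
abbrev tensorNormedAddCommGroup : NormedAddCommGroup (ℂ ⊗[ℚ] V) :=
  NormedAddCommGroup.induced (ℂ ⊗[ℚ] V) (Fin (Module.finrank ℚ V) → ℂ)
    ((Module.finBasis ℚ V).baseChange ℂ).equivFun.toLinearMap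
    ((Module.finBasis ℚ V).baseChange ℂ).equivFun.injective

attribute [local instance] tensorNormedAddCommGroup

variable (V) in
abbrev tensorNormedSpace : NormedSpace ℂ (ℂ ⊗[ℚ] V) :=
  NormedSpace.induced ℂ (ℂ ⊗[ℚ] V) (Fin (Module.finrank ℚ V) → ℂ)
    ((Module.finBasis ℚ V).baseChange ℂ).equivFun.toLinearMap

attribute [local instance] tensorNormedSpace endNormedRing endNormedAlgebra

variable {δ : Datum V}

/-- The linear algebra data underlying a classifying space that has a point. -/
def Datum.sys (δ : Datum V) (hQ : ∃ F, IsPolarized δ.W δ.Q F) : Sys (ℂ ⊗[ℚ] V) where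
  σ := conj V
  invol := conj_conj
  W := Wc δ.W
  mono := Wc_mono δ.W_mono
  bot := δ.W_bot.imp fun a ha => by simp [Wc, ha]
  top := δ.W_top.imp fun a ha => by simp [Wc, ha]
  W_conj := conj_mem_baseChange
  β := δ.β
  β_congr := Datum.β_congr
  β_nondeg := fun hu h => by
    obtain ⟨F, hF⟩ := hQ
    exact Datum.β_nondegenerate' hF hu h

theorem Datum.sys_pt (hQ : ∃ F, IsPolarized δ.W δ.Q F) {F : ℤ → Submodule ℂ (ℂ ⊗[ℚ] V)}
    (hF : IsMHS δ.W F) (hF' : IsPolarized δ.W δ.Q F) : (δ.sys hQ).Pt F where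
  opp := hF.opposed δ.W_mono δ.W_bot δ.W_top
  pos := fun hpq hu hv huv h0 => Datum.β_pos hF' hpq hu hv huv h0

theorem Datum.sys_dom (hQ : ∃ F, IsPolarized δ.W δ.Q F) :
    (δ.sys hQ).Dom (Subtype.val : δ.Jump → ℤ) δ.classifyingSpace where
  fix := fun _ hx => hx.1
  pt := fun _ hx => Datum.sys_pt hQ hx.2.1 hx.2.2.2
  dim := fun _ hx _ hy p m => finrank_inf_Wc_eq δ.W_mono δ.W_bot hx.2.1 hy.2.1
    (fun p q => (hx.2.2.1 p q).trans (hy.2.2.1 p q).symm) m p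

variable {x : δ.Flags} {N : Subgroup (LinearMap.GeneralLinearGroup ℂ (ℂ ⊗[ℚ] V))}
  {D : Set δ.Flags}

/-- The Deligne torus lies in the Mumford--Tate group, in which `N` is normal; this is the only
place where normality enters. The weight filtration and the forms are controlled by the inclusion
into the similitudes. -/
theorem Datum.IsOrbitOfNormal.base (h : Datum.IsOrbitOfNormal D x N)
    (hQ : ∃ F, IsPolarized δ.W δ.Q F) (hx : x ∈ δ.classifyingSpace) :
    (δ.sys hQ).Base ((Module.finBasis ℚ V).baseChange ℂ) N (filt Subtype.val x) where
  grp :=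
    { alg := h.algebraic
      real := fun i => by
        rw [Module.Basis.baseChange_apply]
        exact (conj_tmul _ _).trans (by simp)
      map_W := fun g hg => (mumfordTate_le_simil hx.2.1 hx.2.2.2 (h.le hg)).1
      scale := fun g hg => (mumfordTate_le_simil hx.2.1 hx.2.2.2 (h.le hg)).2 }
  pt := Datum.sys_pt hQ hx.2.1 hx.2.2.2
  torus := fun z w t ht g hg => by
    have h1 : t ∈ mumfordTate δ.W (Datum.fil x) :=
      deligneTorus_subset_mumfordTate _ _ ⟨z, w, ht⟩
    exact h.normal.conj_mem ⟨g, h.le hg⟩ hg ⟨t, h1⟩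

theorem realIdentityComponent_eq (hQ : ∃ F, IsPolarized δ.W δ.Q F) :
    realIdentityComponent N = (δ.sys hQ).realComp N := by
  unfold realIdentityComponent
  rw [← end_topology_eq (E := ℂ ⊗[ℚ] V)]
  rfl

/-- `N1` is algebraic, normal in `N`, and unipotent because it lowers weights, so it is one of the
groups whose supremum is the radical. -/
theorem N1_le_unipotentRadical {S : Sys (ℂ ⊗[ℚ] V)} {W : ℤ → Submodule ℚ V} (hW : S.W = Wc W)
    (hN : S.Grp ((Module.finBasis ℚ V).baseChange ℂ) N) : Sys.N1 hN ≤ unipotentRadical N := by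
  refine le_sSup ⟨isQAlgebraic_of_unipotent_on_graded (W := W) hN.alg fun g => ?_,
    fun g hg => hg.1, ?_, fun u hu => ?_⟩
  · rw [← hW]; rfl
  · exact ⟨fun u hu g => Sys.N1_conj hN g.2 hu⟩
  · exact isNilpotent_of_lowers S.mono S.bot S.top fun k v hv => hu.2 k v hv

/-- One inclusion is `exists_H1`, for which all points of the orbit must be polarized; this holds as
`D` is contained in the classifying space. The other holds since `K1` is contained in the identity
component and `N1` in the unipotent radical. -/
theorem Datum.IsOrbitOfNormal.isOrbit (h : Datum.IsOrbitOfNormal D x N)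
    (hQ : ∃ F, IsPolarized δ.W δ.Q F) (hD : D ⊆ δ.classifyingSpace)
    (hx : x ∈ δ.classifyingSpace) : (δ.sys hQ).IsOrbit ((Module.finBasis ℚ V).baseChange ℂ) N
      (Subtype.val : δ.Jump → ℤ) δ.classifyingSpace D x where
  dom := Datum.sys_dom hQ
  subset := hD
  base := h.base hQ hx
  eq := by
    have := end_completeSpace (ℂ ⊗[ℚ] V)
    have hB := h.base hQ hx
    have hmem : ∀ g ∈ (δ.sys hQ).realComp N, ∀ u ∈ Sys.uniRad ((Module.finBasis ℚ V).baseChange ℂ) N,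
        (g * u) • x ∈ D := fun g hg u hu => by
      rw [h.eq_orbit]
      exact ⟨g, (realIdentityComponent_eq hQ).symm ▸ hg, u, hu, rfl⟩
    have hM : ∀ g ∈ (δ.sys hQ).realComp N, ∀ u ∈ Sys.uniRad ((Module.finBasis ℚ V).baseChange ℂ) N,
        (δ.sys hQ).Pt (mapF (g * u) (filt Subtype.val x)) := fun g hg u hu => by
      rw [← filt_smul]
      exact (Datum.sys_dom hQ).pt _ (hD (hmem g hg u hu))
    ext y
    constructor
    · intro hy
      rw [h.eq_orbit] at hy
      obtain ⟨g, hg, u, hu, rfl⟩ := hy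
      rw [realIdentityComponent_eq hQ] at hg
      obtain ⟨a, ha, hga⟩ := hB.exists_H1 hM hg hu
      exact ⟨a, ha, smul_eq_smul hx.1 hx.1 hga⟩
    · rintro ⟨_, ⟨g, hg, u, hu, rfl⟩, rfl⟩
      exact hmem g hg.1 u (N1_le_unipotentRadical rfl hB.grp hu)

end Domains

end MHS
end
theorem mainTheorem8 {V : Type*} [AddCommGroup V] [Module ℚ V] [FiniteDimensional ℚ V]
    (δ : MHS.Datum V) (D : Set δ.Flags) (hD : MHS.Datum.IsWeakMTDomain D) :
    (∃ Z : Set δ.Flags, IsClosed Z ∧ D = δ.classifyingSpace ∩ Z) ∧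
    ∃ (d : ℕ) (_ : ChartedSpace (EuclideanSpace ℂ (Fin d)) D),
      IsManifold 𝓘(ℂ, EuclideanSpace ℂ (Fin d)) ω D ∧
      Manifold.IsSmoothEmbedding 𝓘(ℂ, EuclideanSpace ℂ (Fin d))
        𝓘(ℂ, MHS.GrModel (ℂ ⊗[ℚ] V) δ.dimF) ω (Subtype.val : D → δ.Flags) ∧
      ∀ (x : D) (N : Subgroup (LinearMap.GeneralLinearGroup ℂ (ℂ ⊗[ℚ] V))),
        MHS.Datum.IsOrbitOfNormal D x.1 N →
          Set.InjOn (MHS.infAct x.1) (MHS.Datum.negativePart x.1 N) ∧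
          Set.range (mfderiv 𝓘(ℂ, EuclideanSpace ℂ (Fin d))
              𝓘(ℂ, MHS.GrModel (ℂ ⊗[ℚ] V) δ.dimF) (Subtype.val : D → δ.Flags) x) =
            MHS.infAct x.1 '' (MHS.Datum.negativePart x.1 N) := by
  obtain ⟨hDM, x₀, hx₀, N₀, h₀⟩ := hD
  have hQ : ∃ F, MHS.IsPolarized δ.W δ.Q F := ⟨_, (hDM hx₀).2.2.2⟩
  let := MHS.tensorNormedAddCommGroup V
  let := MHS.tensorNormedSpace V
  have horb := h₀.isOrbit hQ hDM (hDM hx₀)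
  refine ⟨⟨closure D, isClosed_closure, horb.eq_inter_closure⟩, ?_⟩
  obtain ⟨d, c, hman, hemb⟩ := horb.exists_submanifold
  refine ⟨d, c, hman, hemb, fun x N h => ?_⟩
  -- The manifold structure was built from one presentation `(x₀, N₀)` of `D`. The tangent space
  -- computation uses only that the inclusion is an immersion, so it applies to any other
  -- presentation `(x, N)` of the same set.
  have horb' := h.isOrbit hQ hDM (hDM x.2)
  have hneg : MHS.Datum.negativePart x.1 N = (δ.sys hQ).neg
      ((Module.finBasis ℚ V).baseChange ℂ) N (MHS.filt Subtype.val x.1) := by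
    refine iSup_congr fun r => iSup_congr fun _ => iSup_congr fun s => ?_
    refine congrArg (MHS.lieAlg N ⊓ ·) (Submodule.ext fun A => ?_)
    exact ⟨fun h i v hv => h i.1 i.2 v hv, fun h p q v hv => h (p, q) v hv⟩
  rw [hneg]
  exact ⟨horb'.injOn_infAct, horb'.range_mfderiv_val hemb.isImmersion rfl⟩
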